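/- Consider linearized gravity on 4-dimensional Minkowski spacetime $(G=c=1$, signature $-+++$), with inertial coordinates $(t,x)$, $r=|x|$, $u=t-r$, $n=x/r\in S^2$, and let $\bar h_{ab}=h_{ab}-\frac12 h\,\eta_{ab}$. Let $\mathcal D$, $\epsilon$ be the covariant derivative and area form of the unit sphere. Let $0<v<1$, $\gamma=(1-v^2)^{-1/2}$, let $u^a=\gamma(\partial_t+v\,\partial_r)^a$, let $\alpha$ be a smooth function on $S^2$, and let $l_{ab}=l_{ab}(n)$ be given, in a Cartesian basis, by $$l_{\mu\nu}=-\epsilon_{(\mu}{}^{\lambda}\bigl[u_{\nu)}(\mathcal D^2+1)-\gamma v\,\mathcal D_{\nu)}\bigr]\mathcal D_\lambda\alpha .$$ Call a symmetric tensor field $\tau_{ab}(n)$ of vector type (magnetic parity) if $\tau_{tt}=\tau_{tr}=\tau_{rr}=0$, $\tau_{tA}$ and $\tau_{rA}$ are smooth divergence-free covector fields on the sphere, and $\tau_{AB}=\mathcal D_{(A}S_{B)}$ for a smooth divergence-free $S_A$. For $\rho>0$ and $m\ge0$ let $T_{ab}$ be the distributional stress-energy of a static point laboratory at $r=0$, of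 mass $m+4\pi\rho\gamma^2$ for $t<0$ and $m$ for $t>0$, which at $t=r=0$ launches the shell $$\frac1{r^2}\bigl[\rho\,u_au_b+l_{ab}\bigr]\,\delta(r-vt)\qquad(t>0).$$ Then the following hold. 1. $l_{ab}$ is of vector type, and $r^{-2}l_{ab}\,\delta(r-vt)$ (for $t>0$) is conserved by itself, as a distribution on all of spacetime. 2. There is $\rho_0>0$, depending only on $v$ and $\alpha$, such that $T_{ab}$ satisfies the dominant energy condition for all $\rho\ge\rho_0$ and all $m\ge 0$. 3. For all $\rho>0$, $m\ge0$: $\partial^aT_{ab}=0$, and the coefficient $T^{(2)}_{ab}$ of $1/r^2$ at future null infinity vanishes (no stress-energy flux, so there is no null memory and all memory is ordinary memory). 4. For all $\rho>0$, $m\ge0$: the retarded solution $\bar h_{ab}$ of $\Box\bar h_{ab}=-16\pi T_{ab}$ (the convolution of $16\pi T_{ab}$ with the retarded Green's function) is represented by a locally integrable function, continuous away from $r=0$, $u=0$ and $r=vt$, and satisfies the Lorenz gauge condition $\partial^b\bar h_{ab}=0$ and the linearized Einstein equation $\Box\bar h_{ab}-2\partial_{(a}\partial^c\bar h_{b)c}+\eta_{ab}\partial^c\partial^d\bar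 h_{cd}=-16\pi T_{ab}$. Its radiative order $\bar h^{(1)}_{ab}(u,n)=\lim_{r\to\infty}r\,\bar h_{ab}$ (at fixed $u$, $n$) exists for $u\ne0$; it is $4(m+4\pi\rho\gamma^2)(dt)_a(dt)_b$ for $u<0$, and for $u>0$ it is $$4m\,(dt)_a(dt)_b+4\rho\int_{S^2}\frac{u_au_b(n')}{1-v\,n\cdot n'}\,d\Omega'+4\int_{S^2}\frac{l_{ab}(n')}{1-v\,n\cdot n'}\,d\Omega' .$$ The last term, the contribution of $l_{ab}$, is of vector type. 5. The memory tensor at order $1/r$, $\Delta^{(1)}_{\mu\nu}=-\int_{-\infty}^{\infty}du'\int_{-\infty}^{u'}du''\,C^{(1)}_{u\nu u\mu}$, exists, where $C^{(1)}$ is the coefficient of $1/r$ at null infinity of the linearized Weyl tensor of $h_{ab}$ and the integrals over $u$ are taken in the sense of distributions. Only its components $\Delta^{(1)}_{AB}$ are nonzero; these are half the difference of $h^{(1)}_{AB}$ at $u>0$ and at $u<0$. It is purely of vector type. If $\alpha$ contains a multipole with $\ell>1$, i.e. is not a sum of spherical harmonics with $\ell\le1$, then $\Delta^{(1)}_{AB}\ne0$: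 there is a nonzero vector (magnetic-parity) ordinary memory at order $1/r$. -/

import Mathlib

open Set Filter Topology MeasureTheory
open scoped Manifold ContDiff

noncomputable section

namespace ShellMemory

/-! ### Minkowski spacetime -/

/-- Euclidean 3-space. -/
abbrev E3 : Type := EuclideanSpace ℝ (Fin 3)

/-- The unit sphere of directions. -/
abbrev S2 : Type := Metric.sphere (0 : E3) 1

/-- Spacetime in global inertial coordinates `(t, x¹, x², x³)`; index `0` is time. -/
abbrev Spacetime : Type := Fin 4 → ℝ

/-- The event at time `t` and position `x`. -/
def event (t : ℝ) (x : E3) : Spacetime := Fin.cons t (fun i => x i)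

/-- The position of an event. -/
def space (p : Spacetime) : E3 := WithLp.toLp 2 (fun i : Fin 3 => p i.succ)

/-- The Minkowski metric `diag(-1, 1, 1, 1)`; it is its own inverse. -/
def eta (a b : Fin 4) : ℝ := if a = b then (if a = 0 then -1 else 1) else 0

/-- The surface measure of the unit sphere (of total mass `4π`). -/
def area : Measure S2 := (volume : Measure E3).toSphere

/-! ### Tensor calculus on the unit sphere

Tensor fields on the sphere are given by their Cartesian components. Each component is extended
to `ℝ³ ∖ {0}` as a function homogeneous of degree zero; the covariant derivative is the Cartesian
derivative with all indices projected to the sphere. -/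

/-- Radial projection to the sphere (with an arbitrary value at the origin). -/
def toS2 (x : E3) : S2 :=
  if h : x = 0 then ⟨EuclideanSpace.single 0 1, by simp⟩
  else ⟨‖x‖⁻¹ • x, by simp [norm_smul, h]⟩

/-- Smooth functions on the sphere. -/
def SmoothS2 (f : S2 → ℝ) : Prop := ContMDiff (𝓡 2) 𝓘(ℝ, ℝ) ∞ f

/-- `∂ᵢ` of the degree-zero extension of `f`, on the sphere: the Cartesian components of the
gradient `𝒟ᵢ f` of a function on the sphere. -/
def grad (f : S2 → ℝ) (n : S2) (i : Fin 3) : ℝ :=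
  fderiv ℝ (fun x : E3 => f (toS2 x)) (n : E3) (EuclideanSpace.single i 1)

/-- The projector `δᵢⱼ - nᵢ nⱼ` to the tangent plane; it is also the metric of the sphere. -/
def proj (n : S2) (i j : Fin 3) : ℝ := (if i = j then 1 else 0) - (n : E3) i * (n : E3) j

/-- The area form `εᵢⱼ = det(eᵢ, eⱼ, n)` of the sphere. -/
def epsS (n : S2) (i j : Fin 3) : ℝ :=
  Matrix.det ![Pi.single i 1, Pi.single j 1, fun k => (n : E3) k]

/-- `𝒟ⱼ Wᵢ` for a tangent covector field `W`. -/
def cov (W : S2 → Fin 3 → ℝ) (n : S2) (j i : Fin 3) : ℝ :=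
  ∑ k, proj n i k * grad (fun m => W m k) n j

/-- `𝒟ₖ Xⱼᵢ` for a tangent tensor field `X`. -/
def cov2 (X : S2 → Fin 3 → Fin 3 → ℝ) (n : S2) (k j i : Fin 3) : ℝ :=
  ∑ a, ∑ b, proj n j a * proj n i b * grad (fun m => X m a b) n k

/-- `𝒟² Wᵢ = 𝒟ᵏ 𝒟ₖ Wᵢ` for a tangent covector field `W`. -/
def lapl (W : S2 → Fin 3 → ℝ) (n : S2) (i : Fin 3) : ℝ := ∑ k, cov2 (cov W) n k k i

/-- Smooth tangent covector fields with vanishing divergence. -/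
def IsSolenoidal (W : S2 → Fin 3 → ℝ) : Prop :=
  (∀ i, SmoothS2 (fun n => W n i)) ∧ (∀ n : S2, ∑ i, (n : E3) i * W n i = 0) ∧
    ∀ n, ∑ i, cov W n i i = 0

/-- A symmetric spacetime tensor, depending on the direction only, is purely of vector type (that
is, in four dimensions, of magnetic parity): its `tt`, `tr` and `rr` components vanish, its `tA`
and `rA` components are divergence-free covector fields on the sphere, and its `AB` components
are `𝒟_(A S_B)` with `S` divergence-free. -/
def IsVectorType (τ : S2 → Fin 4 → Fin 4 → ℝ) : Prop :=
  ∃ P Q S : S2 → Fin 3 → ℝ, IsSolenoidal P ∧ IsSolenoidal Q ∧ IsSolenoidal S ∧ ∀ n : S2,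
    τ n 0 0 = 0 ∧ (∀ i : Fin 3, τ n 0 i.succ = P n i ∧ τ n i.succ 0 = P n i) ∧
    ∀ i j : Fin 3, τ n i.succ j.succ =
      (n : E3) i * Q n j + Q n i * (n : E3) j + (cov S n i j + cov S n j i) / 2

/-- `α` has no multipoles with `ℓ > 1`, i.e. it is a sum of spherical harmonics with `ℓ ≤ 1`. -/
def OnlyLowMultipoles (α : S2 → ℝ) : Prop :=
  ∃ (c : ℝ) (b : E3), ∀ n : S2, α n = c + inner ℝ b (n : E3)

/-! ### Distributions on spacetime -/

/-- Test functions. -/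
def IsTest {E : Type*} [NormedAddCommGroup E] [NormedSpace ℝ E] (φ : E → ℝ) : Prop :=
  ContDiff ℝ ∞ φ ∧ HasCompactSupport φ

/-- Distributions on spacetime, as functionals; only their values on test functions matter. -/
abbrev Dist : Type := (Spacetime → ℝ) → ℝ

/-- Tensor distributions with two lower indices, by Cartesian components. -/
abbrev Tensor2 : Type := Fin 4 → Fin 4 → Dist

/-- The partial derivative `∂ₐ φ` of a function. -/
def pd (a : Fin 4) (φ : Spacetime → ℝ) (p : Spacetime) : ℝ := fderiv ℝ φ p (Pi.single a 1)

/-- The distributional partial derivative `∂ₐ F`. -/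
def dD (a : Fin 4) (F : Dist) : Dist := fun φ => - F (pd a φ)

/-- The distribution given by a locally integrable function. -/
def ofFun (f : Spacetime → ℝ) : Dist := fun φ => ∫ p, f p * φ p

/-- The wave operator `□ = η^{ab} ∂ₐ ∂_b`. -/
def box (F : Dist) : Dist := ∑ a, eta a a • dD a (dD a F)

/-- The divergence `∂^c T_{ac}`. -/
def divT (T : Tensor2) (a : Fin 4) : Dist := ∑ c, eta c c • dD c (T a c)

/-- `∂^a T_{ab} = 0`. -/
def Conserved (T : Tensor2) : Prop := ∀ a φ, IsTest φ → divT T a φ = 0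

/-- Future-directed causal vectors (including zero). -/
def FutureCausal (k : Fin 4 → ℝ) : Prop := 0 ≤ k 0 ∧ ∑ a, eta a a * k a * k a ≤ 0

/-- The dominant energy condition: for each future-directed causal `k`, the energy current
`-T^a_b k^b` is future-directed causal. A distribution is tested on nonnegative test functions. -/
def DominantEnergy (T : Tensor2) : Prop :=
  ∀ φ, IsTest φ → (∀ p, 0 ≤ φ p) → ∀ k, FutureCausal k →
    FutureCausal (fun a => - (eta a a * ∑ b, T a b φ * k b))

/-! ### Linearized gravity -/

/-- The trace reversal `h_{ab} - ½ η_{ab} η^{cd} h_{cd}`; in four dimensions it is an involution. -/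
def traceRev {V : Type*} [AddCommGroup V] [Module ℝ V] (h : Fin 4 → Fin 4 → V) (a b : Fin 4) : V :=
  h a b - (eta a b / 2) • ∑ c, eta c c • h c c

/-- `-2 δG_{ab} = □ h̄_{ab} - 2 ∂_(a ∂^c h̄_{b)c} + η_{ab} ∂^c ∂^d h̄_{cd}`. -/
def einsteinOp (hb : Tensor2) (a b : Fin 4) : Dist :=
  box (hb a b) - dD a (divT hb b) - dD b (divT hb a)
    + eta a b • ∑ c, eta c c • dD c (divT hb c)

/-- The linearized Riemann tensor `R_{abcd}`. -/
def riemann (h : Tensor2) (a b c d : Fin 4) : Dist :=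
  (1 / 2 : ℝ) • (dD b (dD c (h a d)) + dD a (dD d (h b c))
    - dD a (dD c (h b d)) - dD b (dD d (h a c)))

/-- The linearized Ricci tensor `R_{ac} = η^{bd} R_{abcd}`. -/
def ricci (h : Tensor2) (a c : Fin 4) : Dist := ∑ b, eta b b • riemann h a b c b

/-- The linearized scalar curvature. -/
def scalarCurv (h : Tensor2) : Dist := ∑ a, eta a a • ricci h a a

/-- The linearized Weyl tensor `C_{abcd}` in four dimensions. -/
def weyl (h : Tensor2) (a b c d : Fin 4) : Dist :=
  riemann h a b c d
    - (1 / 2 : ℝ) • (eta a c • ricci h d b - eta a d • ricci h c b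
        - eta b c • ricci h d a + eta b d • ricci h c a)
    + ((eta a c * eta d b - eta a d * eta c b) / 6) • scalarCurv h

/-- The advanced potential `(t, x) ↦ ∫ φ(t + |z|, x + z) / (4π |z|) dz`, the transpose of the
retarded Green's operator of `-□`. -/
def advanced (φ : Spacetime → ℝ) (p : Spacetime) : ℝ :=
  ∫ z : E3, φ (event (p 0 + ‖z‖) (space p + z)) / (4 * Real.pi * ‖z‖)

/-- `h̄` is the retarded solution of `□ h̄_{ab} = -16π T_{ab}`, i.e. the convolution of `16π T_{ab}`
with the retarded Green's function. -/
def IsRetardedSolution (T : Tensor2) (hb : Fin 4 → Fin 4 → Spacetime → ℝ) : Prop :=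
  ∀ a b, LocallyIntegrable (hb a b) ∧
    ∀ φ, IsTest φ → ofFun (hb a b) φ = 16 * Real.pi * T a b (advanced φ)

/-! ### Null infinity and memory -/

/-- The function `r^{k-2} ψ(t - r, x / r) η(r - R)`: integrating `F` against it (the volume
element is `r² du dr dΩ`) averages `r^k F` against `ψ(u, n)` near the radius `R`. -/
def scriTest (k : ℕ) (ψ : ℝ × E3 → ℝ) (χ : ℝ → ℝ) (R : ℝ) (p : Spacetime) : ℝ :=
  ‖space p‖ ^ ((k : ℤ) - 2) * ψ (p 0 - ‖space p‖, ‖space p‖⁻¹ • space p) * χ (‖space p‖ - R)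

/-- The distribution `F` falls off as `1/r^k` at null infinity (`r → ∞` at fixed `u = t - r` and
direction), and the coefficient `F^{(k)}` of `1/r^k`, a distribution in `u` and the direction, is
`f`. -/
def LeadingAtScri (k : ℕ) (F : Dist) (f : (ℝ × E3 → ℝ) → ℝ) : Prop :=
  ∀ (ψ : ℝ × E3 → ℝ) (χ : ℝ → ℝ), IsTest ψ → IsTest χ → ∫ s, χ s = 1 →
    Tendsto (fun R => F (scriTest k ψ χ R)) atTop (𝓝 (f ψ))

/-- `Δ` is the memory tensor at order `1/r` of the metric perturbation `h`,
`Δ_{μν} = - ∫_{-∞}^{∞} du' ∫_{-∞}^{u'} du'' C^{(1)}_{uνuμ}`, where `∂/∂u = ∂/∂t`. The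
coefficient `C^{(1)}` is a distribution in `u`, so the double integral is taken in the sense of
distributions: `∂²_u D_{μν} = - C^{(1)}_{uνuμ}`, `D → 0` at early and `D → Δ` at late retarded
times. -/
def HasMemoryTensor (h : Tensor2) (Δ : S2 → Fin 4 → Fin 4 → ℝ) : Prop :=
  ∃ D : ℝ → S2 → Fin 4 → Fin 4 → ℝ, ∀ μ ν : Fin 4,
    (∀ b : ℝ, IntegrableOn (fun q : ℝ × S2 => D q.1 q.2 μ ν) (Icc (-b) b ×ˢ univ)
      ((volume : Measure ℝ).prod area)) ∧
    LeadingAtScri 1 (weyl h 0 ν 0 μ) (fun ψ =>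
      - ∫ u : ℝ, ∫ n : S2, D u n μ ν * iteratedDeriv 2 (fun s => ψ (s, (n : E3))) u ∂area) ∧
    ∀ n : S2, Tendsto (fun u => D u n μ ν) atBot (𝓝 0) ∧
      Tendsto (fun u => D u n μ ν) atTop (𝓝 (Δ n μ ν))

/-! ### The shell -/

/-- `γ = (1 - v²)^{-1/2}`. -/
def gam (v : ℝ) : ℝ := (Real.sqrt (1 - v ^ 2))⁻¹

/-- The covector `u_a` of the radially outward 4-velocity with speed `v`. -/
def vel (v : ℝ) (n : S2) : Fin 4 → ℝ := Fin.cons (-gam v) (fun i => gam v * v * (n : E3) i)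

/-- `u_a u_b`. -/
def dust (v : ℝ) (n : S2) (a b : Fin 4) : ℝ := vel v n a * vel v n b

/-- `ε_i^λ [u_ν (𝒟² + 1) - γ v 𝒟_ν] 𝒟_λ α`, for `ν` temporal (first case) or spatial. -/
def lAux (v : ℝ) (α : S2 → ℝ) (n : S2) (i : Fin 3) (ν : Fin 4) : ℝ :=
  ∑ k, epsS n i k * (vel v n ν * (lapl (grad α) n k + grad α n k)
    - gam v * v * (Fin.cons 0 (fun j => cov (grad α) n j k) : Fin 4 → ℝ) ν)

/-- `l_{μν} = - ε_(μ^λ [u_ν) (𝒟² + 1) - γ v 𝒟_ν)] 𝒟_λ α`, where tensors on the sphere have no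
time components. -/
def lStress (v : ℝ) (α : S2 → ℝ) (n : S2) (μ ν : Fin 4) : ℝ :=
  - (((Fin.cons 0 (fun i => lAux v α n i ν) : Fin 4 → ℝ) μ
    + (Fin.cons 0 (fun i => lAux v α n i μ) : Fin 4 → ℝ) ν) / 2)

/-- `r^{-2} τ_{ab}(x / r) δ(r - v t)` for `t > 0`. The factor `r^{-2}` cancels against the volume
element `r² dr dΩ`, so that the integral over space is the integral over the sphere of
directions, at `x = v t n`. -/
def shell (v : ℝ) (τ : S2 → Fin 4 → Fin 4 → ℝ) : Tensor2 := fun a b φ =>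
  ∫ t in Ioi (0 : ℝ), ∫ n : S2, τ n a b * φ (event t ((v * t) • (n : E3))) ∂area

/-- The components of `dt ⊗ dt`, i.e. of `u_a u_b` for matter at rest. -/
def rest (a b : Fin 4) : ℝ := if a = 0 ∧ b = 0 then 1 else 0

/-- A laboratory at rest at the origin, of mass `m₀` for `t < 0` and `m₁` for `t > 0`. -/
def laboratory (m₀ m₁ : ℝ) : Tensor2 := fun a b φ =>
  rest a b * (m₀ * (∫ t in Iio (0 : ℝ), φ (event t 0)) + m₁ * ∫ t in Ioi (0 : ℝ), φ (event t 0))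

/-- The total energy `4πργ²` of the shell. -/
def shellEnergy (v ρ : ℝ) : ℝ := 4 * Real.pi * ρ * gam v ^ 2

/-- The total stress-energy: a static laboratory launches, at the event `t = r = 0`, the shell
`r^{-2} [ρ u_a u_b + l_{ab}] δ(r - v t)` and is left with the mass `m`. -/
def source (v ρ m : ℝ) (α : S2 → ℝ) : Tensor2 :=
  laboratory (m + shellEnergy v ρ) m
    + shell v (fun n a b => ρ * dust v n a b + lStress v α n a b)

/-- The integral `4 ∫ τ_{ab}(n') / (1 - v n·n') dΩ'`. -/
def radiative (v : ℝ) (τ : S2 → Fin 4 → Fin 4 → ℝ) (n : S2) (a b : Fin 4) : ℝ :=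
  4 * ∫ m : S2, τ m a b / (1 - v * inner ℝ (n : E3) (m : E3)) ∂area

/-- The spherical (`AB`) part of a tensor: both indices projected to the tangent plane. -/
def angular (H : Fin 4 → Fin 4 → ℝ) (n : S2) : Fin 4 → Fin 4 → ℝ :=
  Fin.cons 0 (fun i => Fin.cons 0 (fun j => ∑ k, ∑ l, proj n i k * proj n j l * H k.succ l.succ))

end ShellMemory

end

noncomputable section

namespace ShellMemory

/-! ### Calculus on the unit sphere -/

/-! Put `S = ε𝒟α` and `β = (𝒟² + 2)α`. The Ricci tensor of the unit sphere is its metric, so `(𝒟² +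
1)𝒟α = 𝒟β`, and `l` is built from the rotated gradients `ε𝒟β` and `ε𝒟α` alone (`rot` in the code).
These are divergence-free, so `l` is of vector type.

A shell that expands with speed `v` is conserved away from its tip if its radial flux is `v` times
its density and its flux along the sphere is divergence-free (`IsFreeShell`). For `l` the second
condition amounts to `𝒟^i (𝒟_i S_j + 𝒟_j S_i) = ε_j^k 𝒟_k β`, once more the curvature identity. Only
a point source at the launch event is left (`divT_shell`), the total momentum of the shell. It
vanishes for `l`, and for the dust it is the mass that the laboratory loses. For the energy
condition, the dust is bounded below by a multiple of `ρ k⁰ q⁰` on causal vectors, so it dominates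
the bounded tensor `l` when `ρ` is large.

The retarded solution is defined by transposition: the field tested on `φ` is the source tested on
the advanced potential of `φ`. That potential no longer has compact support, but it vanishes at
early and late times on every cone `|x| < w|t|` with `w < 1`, which is all that conservation needs;
hence the gauge condition and the Einstein equation. Changing variables from emission to arrival
turns the field into an integral of Liénard–Wiechert kernels. The shell contribution is homogeneous
of degree `-1`, so `r` times it depends on `u / r` only, and `r → ∞` produces the denominators `1 -
v n·n'`.

At order `1/r` each derivative acts as `∂_a u ∂_u` (`HasScriLimit.dD`), so the Weyl coefficient is
the second `u`-derivative of an algebraic expression in the step function `h^{(1)}`. The jump of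
`h̄^{(1)}` is annihilated by the null vector `∂^a u`; this removes the Ricci part and leaves minus
half of the angular part of the jump of `h^{(1)}` (`weylSymbol_traceRev`). The angular part of the
dust is pure trace and cancels the jump due to the lost mass (`angular_radiative_dust`). The memory
is thus due to `l` alone and equals half of `𝒟_(A S'_B)`, where `S'` is the rotated gradient of
`memoryPotential`.

If it vanishes, `S'` is a Killing field and `memoryPotential` has only `ℓ ≤ 1`
(`onlyLowMultipoles_of_killing`). This potential is a constant times a zonal integral operator
applied to `α`, and up to an additive constant its kernel is a power series in `n·n'` with positive
coefficients (`hasSum_memoryProfile`). On functions of mean zero the quadratic form is therefore a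
positive combination of squares of moments, hence definite. Applied to the part of `α` orthogonal to
`ℓ ≤ 1`, this shows that `α` has only `ℓ ≤ 1` as well. -/

instance fact_finrank_E3 : Fact (Module.finrank ℝ E3 = 2 + 1) := ⟨by simp⟩

lemma S2.norm_coe (n : S2) : ‖(n : E3)‖ = 1 := norm_eq_of_mem_sphere n

lemma S2.coe_ne_zero (n : S2) : (n : E3) ≠ 0 := ne_zero_of_mem_unit_sphere n

lemma S2.sum_sq (n : S2) : (1 : ℝ) = (n : E3) 0 * (n : E3) 0 + (n : E3) 1 * (n : E3) 1
    + (n : E3) 2 * (n : E3) 2 := by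
  have h := EuclideanSpace.norm_sq_eq (n : E3)
  rw [S2.norm_coe, Fin.sum_univ_three] at h
  simp only [Real.norm_eq_abs, sq_abs] at h
  nlinarith [h]

lemma toS2_coe (n : S2) : toS2 (n : E3) = n := by
  unfold toS2
  rw [dif_neg n.coe_ne_zero]
  ext1
  simp

lemma coe_toS2 {x : E3} (hx : x ≠ 0) : (toS2 x : E3) = ‖x‖⁻¹ • x := by
  unfold toS2
  rw [dif_neg hx]

lemma toS2_smul {r : ℝ} (hr : 0 < r) (x : E3) : toS2 (r • x) = toS2 x := by
  by_cases hx : x = 0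
  · simp [hx]
  · ext1
    rw [coe_toS2 hx, coe_toS2 (smul_ne_zero hr.ne' hx), norm_smul, Real.norm_of_nonneg hr.le,
      smul_smul]
    congr 1
    field_simp

/-- Off the origin the extension is `f` composed with the smooth normalisation map. The punctured
space enters as an open submanifold because the codomain restriction to the sphere asks for a
globally smooth map. -/
lemma contDiffAt_extend {f : S2 → ℝ} (hf : SmoothS2 f) {x : E3} (hx : x ≠ 0) :
    ContDiffAt ℝ ∞ (fun x : E3 => f (toS2 x)) x := by
  let U : TopologicalSpace.Opens E3 := ⟨{0}ᶜ, isOpen_compl_singleton⟩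
  have h1 : ContMDiff 𝓘(ℝ, E3) 𝓘(ℝ, E3) ∞ (fun y : U => ‖(y : E3)‖⁻¹ • (y : E3)) := by
    intro y
    suffices h : ContMDiffAt 𝓘(ℝ, E3) 𝓘(ℝ, E3) ∞ (fun y : E3 => ‖y‖⁻¹ • y) (y : E3) from
      contMDiffAt_subtype_iff.2 h
    have hy : (y : E3) ≠ 0 := y.2
    exact (((contDiffAt_norm ℝ hy).inv (by simpa using hy)).smul contDiffAt_id).contMDiffAt
  have hm : ∀ y : U, ‖(y : E3)‖⁻¹ • (y : E3) ∈ Metric.sphere (0 : E3) 1 := by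
    intro y
    have hy : (y : E3) ≠ 0 := y.2
    simp [norm_smul, hy]
  have h2 := ContMDiff.codRestrict_sphere (n := 2) h1 hm
  have h3 := ContMDiff.comp hf h2
  have h4 : ContMDiffAt 𝓘(ℝ, E3) 𝓘(ℝ, ℝ) ∞ (fun y : U => f (toS2 y)) ⟨x, hx⟩ := by
    refine (h3 ⟨x, hx⟩).congr_of_eventuallyEq (Eventually.of_forall fun y => ?_)
    change f _ = f _
    congr 1
    ext1
    exact coe_toS2 y.2
  have h5 : ContMDiffAt 𝓘(ℝ, E3) 𝓘(ℝ, ℝ) ∞ (fun y : E3 => f (toS2 y)) x :=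
    contMDiffAt_subtype_iff (U := U) (x := ⟨x, hx⟩).1 h4
  exact h5.contDiffAt

lemma SmoothS2.of_contDiffAt {F : E3 → ℝ} (hF : ∀ n : S2, ContDiffAt ℝ ∞ F n) :
    SmoothS2 (fun n => F n) := by
  intro n
  exact ContMDiffAt.comp (I' := 𝓘(ℝ, E3)) n (hF n).contMDiffAt
    ((contMDiff_coe_sphere (E := E3) (n := 2)) n)

-- Closure properties of smooth functions on the sphere.

attribute [fun_prop] SmoothS2

lemma SmoothS2.comp_real {g : ℝ → ℝ} {f : S2 → ℝ} (hf : SmoothS2 f)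
    (hg : ∀ n, ContDiffAt ℝ ∞ g (f n)) : SmoothS2 (fun n => g (f n)) := by
  intro n
  exact ContMDiffAt.comp (I' := 𝓘(ℝ, ℝ)) n (hg n).contMDiffAt (hf n)

@[fun_prop]
lemma SmoothS2.const (c : ℝ) : SmoothS2 (fun _ => c) := contMDiff_const

@[fun_prop]
lemma SmoothS2.coord (i : Fin 3) : SmoothS2 (fun n => (n : E3) i) :=
  .of_contDiffAt (F := fun x => x i) fun n => by fun_prop

@[fun_prop]
lemma SmoothS2.add {f g : S2 → ℝ} (hf : SmoothS2 f) (hg : SmoothS2 g) :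
    SmoothS2 (fun n => f n + g n) := ContMDiff.add hf hg

@[fun_prop]
lemma SmoothS2.mul {f g : S2 → ℝ} (hf : SmoothS2 f) (hg : SmoothS2 g) :
    SmoothS2 (fun n => f n * g n) := fun n =>
  ContMDiffAt.comp (I' := 𝓘(ℝ, ℝ × ℝ)) n
    (g := fun p : ℝ × ℝ => p.1 * p.2) (contDiff_mul.contDiffAt.contMDiffAt)
    ((hf n).prodMk_space (hg n))

@[fun_prop]
lemma SmoothS2.neg {f : S2 → ℝ} (hf : SmoothS2 f) : SmoothS2 (fun n => - f n) :=
  hf.comp_real (g := fun x => -x) fun _ => contDiff_neg.contDiffAt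

@[fun_prop]
lemma SmoothS2.sub {f g : S2 → ℝ} (hf : SmoothS2 f) (hg : SmoothS2 g) :
    SmoothS2 (fun n => f n - g n) := by
  simp only [sub_eq_add_neg]; fun_prop

@[fun_prop]
lemma SmoothS2.div_const {f : S2 → ℝ} (hf : SmoothS2 f) (c : ℝ) : SmoothS2 (fun n => f n / c) := by
  simp only [div_eq_mul_inv]; fun_prop

@[fun_prop]
lemma SmoothS2.sum {ι : Type*} {s : Finset ι} {f : ι → S2 → ℝ} (hf : ∀ i, SmoothS2 (f i)) :
    SmoothS2 (fun n => ∑ i ∈ s, f i n) := by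
  classical
  induction s using Finset.induction_on with
  | empty => simpa using SmoothS2.const 0
  | insert a s ha ih => simp only [Finset.sum_insert ha]; fun_prop

@[fun_prop]
lemma SmoothS2.continuous {f : S2 → ℝ} (hf : SmoothS2 f) : Continuous f := ContMDiff.continuous hf

lemma differentiableAt_extend {f : S2 → ℝ} (hf : SmoothS2 f) {x : E3} (hx : x ≠ 0) :
    DifferentiableAt ℝ (fun x : E3 => f (toS2 x)) x :=
  (contDiffAt_extend hf hx).differentiableAt (by simp)

@[fun_prop]
lemma SmoothS2.proj (i j : Fin 3) : SmoothS2 (fun n => proj n i j) := by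
  unfold ShellMemory.proj; fun_prop

lemma epsS_eq (n : S2) (i j : Fin 3) : epsS n i j =
    ![![0, (n : E3) 2, -(n : E3) 1], ![-(n : E3) 2, 0, (n : E3) 0],
      ![(n : E3) 1, -(n : E3) 0, 0]] i j := by
  have h : epsS n i j = _ := Matrix.det_fin_three _
  rw [h]
  fin_cases i <;> fin_cases j <;> simp

@[fun_prop]
lemma SmoothS2.epsS (i j : Fin 3) : SmoothS2 (fun n => epsS n i j) := by
  simp only [epsS_eq]
  fin_cases i <;> fin_cases j <;> simp <;> fun_prop

/-! ### Rules for the gradient of degree-zero extensions. -/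

lemma hasFDerivAt_norm_sphere (n : S2) :
    HasFDerivAt (fun x : E3 => ‖x‖) (innerSL ℝ (n : E3)) (n : E3) := by
  have h := (hasStrictFDerivAt_norm_sq (n : E3)).hasFDerivAt.sqrt (by simp)
  simp only [Real.sqrt_sq (norm_nonneg _)] at h
  refine h.congr_fderiv ?_
  ext y
  simp

/-- The derivative at a point of the sphere of a function on space pulled back by the radial
projection. -/
lemma hasFDerivAt_normalize (n : S2) : HasFDerivAt (fun x : E3 => ‖x‖⁻¹ • x)
    (ContinuousLinearMap.id ℝ E3 - (innerSL ℝ (n : E3)).smulRight (n : E3)) (n : E3) := by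
  have h1 := (hasDerivAt_inv (x := ‖(n : E3)‖) (by simp)).comp_hasFDerivAt (n : E3)
    (hasFDerivAt_norm_sphere n)
  have h2 := h1.smul (hasFDerivAt_id (n : E3))
  refine h2.congr_fderiv ?_
  ext y
  simp [sub_eq_add_neg]

/-- Chain rule through normalisation, whose derivative at a unit vector is the tangential projector.
-/
lemma grad_comp_coe {F : E3 → ℝ} (n : S2) (hF : DifferentiableAt ℝ F n) (i : Fin 3) :
    grad (fun m => F m) n i =
      ∑ k, proj n i k * fderiv ℝ F n (EuclideanSpace.single k 1) := by
  have h1 : (fun x : E3 => F (toS2 x)) =ᶠ[𝓝 (n : E3)] fun x => F (‖x‖⁻¹ • x) := by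
    filter_upwards [isOpen_compl_singleton.mem_nhds n.coe_ne_zero] with x hx
    rw [coe_toS2 hx]
  have h2 : HasFDerivAt (fun x : E3 => F (‖x‖⁻¹ • x)) _ (n : E3) :=
    HasFDerivAt.comp (n : E3) (f := fun x : E3 => ‖x‖⁻¹ • x)
      (by simpa using hF.hasFDerivAt) (hasFDerivAt_normalize n)
  unfold grad
  rw [h1.fderiv_eq, h2.fderiv]
  have h3 : (n : E3) = ∑ k, (n : E3) k • EuclideanSpace.single k (1 : ℝ) := by
    ext j; fin_cases j <;> simp [Fin.sum_univ_three]
  simp only [ContinuousLinearMap.coe_comp, Function.comp_apply, sub_apply,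
    ContinuousLinearMap.id_apply, ContinuousLinearMap.smulRight_apply, innerSL_apply_apply,
    map_sub, map_smul, proj, sub_mul, Finset.sum_sub_distrib, ite_mul, one_mul, zero_mul,
    Finset.sum_ite_eq, Finset.mem_univ, if_true, smul_eq_mul]
  congr 1
  nth_rw 3 [h3]
  rw [map_sum, Finset.mul_sum]
  refine Finset.sum_congr rfl fun k _ => ?_
  simp [EuclideanSpace.inner_single_right, mul_assoc]

lemma grad_coord (n : S2) (i j : Fin 3) : grad (fun m => (m : E3) j) n i = proj n i j := by
  rw [grad_comp_coe (F := fun x => x j) n (by fun_prop)]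
  have : ∀ k, fderiv ℝ (fun x : E3 => x j) (n : E3) (EuclideanSpace.single k 1)
      = if k = j then 1 else 0 := by
    intro k
    have : (fun x : E3 => x j) = EuclideanSpace.proj (𝕜 := ℝ) j := rfl
    rw [this, ContinuousLinearMap.fderiv]
    simp [eq_comm]
  simp [this]

lemma grad_const (c : ℝ) (n : S2) (i : Fin 3) : grad (fun _ => c) n i = 0 := by
  simp [grad]

lemma grad_add {f g : S2 → ℝ} (hf : SmoothS2 f) (hg : SmoothS2 g) (n : S2) (i : Fin 3) :
    grad (fun m => f m + g m) n i = grad f n i + grad g n i := by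
  unfold grad
  rw [fderiv_fun_add (differentiableAt_extend hf n.coe_ne_zero)
    (differentiableAt_extend hg n.coe_ne_zero)]
  rfl

lemma grad_sub {f g : S2 → ℝ} (hf : SmoothS2 f) (hg : SmoothS2 g) (n : S2) (i : Fin 3) :
    grad (fun m => f m - g m) n i = grad f n i - grad g n i := by
  unfold grad
  rw [fderiv_fun_sub (differentiableAt_extend hf n.coe_ne_zero)
    (differentiableAt_extend hg n.coe_ne_zero)]
  rfl

lemma grad_neg (f : S2 → ℝ) (n : S2) (i : Fin 3) :
    grad (fun m => - f m) n i = - grad f n i := by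
  unfold grad
  rw [fderiv_fun_neg]
  rfl

lemma grad_mul {f g : S2 → ℝ} (hf : SmoothS2 f) (hg : SmoothS2 g) (n : S2) (i : Fin 3) :
    grad (fun m => f m * g m) n i = grad f n i * g n + f n * grad g n i := by
  unfold grad
  rw [fderiv_fun_mul (differentiableAt_extend hf n.coe_ne_zero)
    (differentiableAt_extend hg n.coe_ne_zero)]
  simp [toS2_coe]
  ring

lemma grad_comp_real {g : ℝ → ℝ} {f : S2 → ℝ} (hf : SmoothS2 f) (n : S2) {g' : ℝ}
    (hg : HasDerivAt g g' (f n)) (i : Fin 3) :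
    grad (fun m => g (f m)) n i = g' * grad f n i := by
  unfold grad
  have h := (differentiableAt_extend hf n.coe_ne_zero).hasFDerivAt
  have h2 := HasDerivAt.comp_hasFDerivAt (n : E3) (f := fun x : E3 => f (toS2 x))
    (h₂ := g) (by simpa [toS2_coe] using hg) h
  have h3 : fderiv ℝ (fun x : E3 => g (f (toS2 x))) (n : E3) = _ := h2.fderiv
  rw [h3]
  simp

lemma grad_sum {ι : Type*} (s : Finset ι) {f : ι → S2 → ℝ} (hf : ∀ i, SmoothS2 (f i)) (n : S2)
    (j : Fin 3) : grad (fun m => ∑ i ∈ s, f i m) n j = ∑ i ∈ s, grad (f i) n j := by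
  classical
  induction s using Finset.induction_on with
  | empty => simp [grad_const]
  | insert a s ha ih =>
    simp only [Finset.sum_insert ha]
    rw [grad_add (hf a) (by fun_prop), ih]

lemma grad_const_mul (c : ℝ) {f : S2 → ℝ} (hf : SmoothS2 f) (n : S2) (i : Fin 3) :
    grad (fun m => c * f m) n i = c * grad f n i := by
  rw [grad_mul (by fun_prop) hf, grad_const]; ring

lemma grad_div_const (c : ℝ) {f : S2 → ℝ} (hf : SmoothS2 f) (n : S2) (i : Fin 3) :
    grad (fun m => f m / c) n i = grad f n i / c := by
  simp only [div_eq_mul_inv]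
  rw [grad_mul hf (by fun_prop), grad_const]; ring

/-- The derivative of a degree-zero extension away from the sphere. -/
lemma fderiv_extend_smul (f : S2 → ℝ) {x : E3} (hx : x ≠ 0) :
    fderiv ℝ (fun y : E3 => f (toS2 y)) (toS2 x : E3)
      = ‖x‖ • fderiv ℝ (fun y : E3 => f (toS2 y)) x := by
  have hx' : (0 : ℝ) < ‖x‖ := norm_pos_iff.2 hx
  have h := fderiv_comp_smul (f := fun y : E3 => f (toS2 y)) (x := (toS2 x : E3)) ‖x‖
  have h1 : (fun y : E3 => f (toS2 y)) = fun y => f (toS2 (‖x‖ • y)) := by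
    ext y; rw [toS2_smul hx']
  rw [← h1] at h
  rw [h, coe_toS2 hx, smul_smul, mul_inv_cancel₀ hx'.ne', one_smul]

/-- The derivative of a function of degree zero has degree `-1`; the factor `‖x‖` brings it back to
degree zero. This expresses the extension of `grad f` by Euclidean derivatives, so that the gradient
can be differentiated again. -/
lemma grad_toS2 (f : S2 → ℝ) {x : E3} (hx : x ≠ 0) (i : Fin 3) : grad f (toS2 x) i
    = ‖x‖ * fderiv ℝ (fun y : E3 => f (toS2 y)) x (EuclideanSpace.single i 1) := by
  unfold grad
  rw [fderiv_extend_smul f hx]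
  rfl

@[fun_prop]
lemma SmoothS2.grad {f : S2 → ℝ} (hf : SmoothS2 f) (i : Fin 3) : SmoothS2 (fun n => grad f n i) := by
  refine .of_contDiffAt (F := fun x =>
    fderiv ℝ (fun y : E3 => f (toS2 y)) x (EuclideanSpace.single i 1)) fun n => ?_
  exact ((contDiffAt_extend hf n.coe_ne_zero).fderiv_right (by simp)).clm_apply contDiffAt_const

/-- Tangency is read off from `grad_comp_coe`, applied to the extension of `f` itself. -/
lemma grad_normal {f : S2 → ℝ} (hf : SmoothS2 f) (n : S2) :
    ∑ i, (n : E3) i * grad f n i = 0 := by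
  have h := grad_comp_coe (F := fun x => f (toS2 x)) n (differentiableAt_extend hf n.coe_ne_zero)
  simp only [toS2_coe] at h
  have h' : ∀ i, ShellMemory.grad f n i = ∑ k, ShellMemory.proj n i k *
      fderiv ℝ (fun x => f (toS2 x)) (n : E3) (EuclideanSpace.single k 1) := h
  simp only [h', Fin.sum_univ_three, ShellMemory.proj]
  have := n.sum_sq
  simp
  set a := fderiv ℝ (fun x => f (toS2 x)) (n : E3) (EuclideanSpace.single 0 1)
  set b := fderiv ℝ (fun x => f (toS2 x)) (n : E3) (EuclideanSpace.single 1 1)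
  set c := fderiv ℝ (fun x => f (toS2 x)) (n : E3) (EuclideanSpace.single 2 1)
  linear_combination ((n : E3) 0 * a + (n : E3) 1 * b + (n : E3) 2 * c) * this

/-- By `grad_toS2` the extension of `grad f` is `‖x‖` times the Euclidean gradient; the derivative
of `‖x‖` is the source of the first, non-symmetric term. -/
lemma grad_grad {f : S2 → ℝ} (hf : SmoothS2 f) (n : S2) (i j : Fin 3) :
    grad (fun m => grad f m i) n j = (n : E3) j * grad f n i +
      fderiv ℝ (fderiv ℝ (fun y : E3 => f (toS2 y))) n (EuclideanSpace.single j 1)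
        (EuclideanSpace.single i 1) := by
  have h1 : (fun x : E3 => grad f (toS2 x) i) =ᶠ[𝓝 (n : E3)] fun x =>
      ‖x‖ * fderiv ℝ (fun y : E3 => f (toS2 y)) x (EuclideanSpace.single i 1) := by
    filter_upwards [isOpen_compl_singleton.mem_nhds n.coe_ne_zero] with x hx
    exact grad_toS2 f hx i
  have h2 : HasFDerivAt (fderiv ℝ (fun y : E3 => f (toS2 y)))
      (fderiv ℝ (fderiv ℝ (fun y : E3 => f (toS2 y))) n) (n : E3) :=
    (((contDiffAt_extend hf n.coe_ne_zero).fderiv_right (m := ∞)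
      (by simp)).differentiableAt (by simp)).hasFDerivAt
  have h3 := (hasFDerivAt_norm_sphere n).mul (h2.clm_apply (hasFDerivAt_const (EuclideanSpace.single i (1 : ℝ)) (n : E3)))
  conv_lhs => unfold grad
  change fderiv ℝ (fun x : E3 => grad f (toS2 x) i) n _ = _
  rw [h1.fderiv_eq]
  have h4 : fderiv ℝ (fun x : E3 => ‖x‖ * fderiv ℝ (fun y : E3 => f (toS2 y)) x
    (EuclideanSpace.single i 1)) (n : E3) = _ := h3.fderiv
  rw [h4]
  simp [grad]
  rw [EuclideanSpace.inner_single_right]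
  simp
  ring

/-- The commutator of the tangential derivatives. -/
lemma grad_comm {f : S2 → ℝ} (hf : SmoothS2 f) (n : S2) (i j : Fin 3) :
    grad (fun m => grad f m i) n j = grad (fun m => grad f m j) n i
      + (n : E3) j * grad f n i - (n : E3) i * grad f n j := by
  rw [grad_grad hf, grad_grad hf]
  have h := (contDiffAt_extend hf n.coe_ne_zero).isSymmSndFDerivAt
    (by simpa using (WithTop.coe_le_coe.2 le_top : ((2 : ℕ∞) : WithTop ℕ∞) ≤ ∞))
  rw [h.eq]
  ring

/-! ### Integration over the unit sphere -/

instance : IsFiniteMeasure area := by unfold area; infer_instance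

instance : area.IsOpenPosMeasure := by unfold area; infer_instance

lemma integrable_area {f : S2 → ℝ} (hf : Continuous f) : Integrable f area :=
  hf.integrable_of_hasCompactSupport (HasCompactSupport.of_compactSpace f)

lemma area_real_univ : area.real univ = 4 * Real.pi := by
  unfold area
  rw [Measure.toSphere_real_apply_univ, measureReal_def, EuclideanSpace.volume_ball_fin_three]
  have : (0 : ℝ) ≤ Real.pi * (4 / 3) := by positivity
  simp [mul_div_assoc, ENNReal.toReal_ofReal this]
  ring

/-- The measure `r² dr dΩ`. -/
def polarMeasure : Measure (ℝ × S2) :=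
  ((volume.restrict (Ioi (0 : ℝ))).prod area).withDensity fun q => ENNReal.ofReal (q.1 ^ 2)

/-- The origin is a null set, and the punctured space is the product of sphere and half-line, with
radial density `r ^ (dim - 1) = r ^ 2`. -/
lemma lintegral_polar_aux {f : E3 → ENNReal} (hf : Measurable f) :
    ∫⁻ x, f x = ∫⁻ q, f (q.1 • (q.2 : E3)) ∂polarMeasure := by
  have h1 : ∫⁻ x, f x =
      ∫⁻ x : ({(0)}ᶜ : Set E3), f (x : E3) ∂((volume : Measure E3).comap Subtype.val) := by
    rw [lintegral_subtype_comap (measurableSet_singleton _).compl, restrict_compl_singleton]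
  have h2 := (volume : Measure E3).measurePreserving_homeomorphUnitSphereProd
  have hd : Module.finrank ℝ E3 - 1 = 2 := by simp
  rw [hd] at h2
  have h3 := h2.lintegral_comp_emb (Homeomorph.measurableEmbedding _)
    (fun q => f ((q.2 : ℝ) • (q.1 : E3)))
  have h4 : ∀ x : ({(0)}ᶜ : Set E3), f (((homeomorphUnitSphereProd E3 x).2 : ℝ) •
      ((homeomorphUnitSphereProd E3 x).1 : E3)) = f x := by
    intro x
    rw [← homeomorphUnitSphereProd_symm_apply_coe, Homeomorph.symm_apply_apply]
  simp only [h4] at h3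
  rw [h1, h3]
  have hm : Measurable fun r : Ioi (0 : ℝ) => ∫⁻ n : S2, f ((r : ℝ) • (n : E3)) ∂area :=
    Measurable.lintegral_prod_right'
      (f := fun q : Ioi (0 : ℝ) × S2 => f ((q.1 : ℝ) • (q.2 : E3))) (by fun_prop)
  have h5 := lintegral_withDensity_eq_lintegral_mul
    (Measure.comap (Subtype.val : Ioi (0 : ℝ) → ℝ) volume)
    (f := fun r => ENNReal.ofReal ((r : ℝ) ^ 2)) (by fun_prop) hm
  have h6 := lintegral_subtype_comap (μ := (volume : Measure ℝ))
      (measurableSet_Ioi (a := (0 : ℝ)))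
      (fun r : ℝ => ENNReal.ofReal (r ^ 2) * ∫⁻ n : S2, f (r • (n : E3)) ∂area)
  unfold polarMeasure
  rw [lintegral_withDensity_eq_lintegral_mul _ (by fun_prop) (by fun_prop),
    lintegral_prod_symm _ (by fun_prop), lintegral_prod _ (by fun_prop)]
  refine (h5.trans h6).trans (lintegral_congr fun r => ?_)
  simp only [Pi.mul_apply]
  rw [lintegral_const_mul _ (by fun_prop)]

lemma measurePreserving_polar :
    MeasurePreserving (fun q : ℝ × S2 => q.1 • (q.2 : E3)) polarMeasure volume := by
  refine ⟨by fun_prop, ?_⟩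
  refine Measure.ext_of_lintegral _ fun f hf => ?_
  rw [lintegral_map hf (by fun_prop), lintegral_polar_aux hf]

lemma integrable_polar {f : E3 → ℝ} (hf : Integrable f) :
    Integrable (fun q : ℝ × S2 => q.1 ^ 2 * f (q.1 • (q.2 : E3)))
      ((volume.restrict (Ioi (0 : ℝ))).prod area) := by
  have h := measurePreserving_polar.integrable_comp_of_integrable hf
  unfold polarMeasure at h
  rw [integrable_withDensity_iff_integrable_smul' (by fun_prop) (by simp)] at h
  refine h.congr (Eventually.of_forall fun q => ?_)
  simp [ENNReal.toReal_ofReal (sq_nonneg q.1)]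

lemma integral_polar {f : E3 → ℝ} (hf : Integrable f) :
    ∫ x, f x = ∫ r in Ioi (0 : ℝ), ∫ n, r ^ 2 * f (r • (n : E3)) ∂area := by
  have h := integral_map (μ := polarMeasure) (φ := fun q : ℝ × S2 => q.1 • (q.2 : E3))
    (by fun_prop) (f := f) (by rw [measurePreserving_polar.map_eq]; exact hf.1)
  rw [measurePreserving_polar.map_eq] at h
  rw [h, ← integral_prod _ (integrable_polar hf), polarMeasure,
    integral_withDensity_eq_integral_toReal_smul (by fun_prop) (by simp)]
  refine integral_congr_ae (Eventually.of_forall fun q => ?_)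
  simp [ENNReal.toReal_ofReal (sq_nonneg q.1)]

/-- The divergence theorem on the sphere. -/
lemma integral_grad {f : S2 → ℝ} (hf : SmoothS2 f) (i : Fin 3) :
    ∫ n, grad f n i ∂area = 2 * ∫ n, (n : E3) i * f n ∂area := by
  -- With this cutoff, supported in `1 ≤ r ≤ 3`, the function `η(|x|) f(x / |x|)` is a test function
  -- on space. Its derivative integrates to zero, which in polar coordinates reads `A ∫ 𝒟ᵢ f + B ∫
  -- nᵢ f = 0` with `A = ∫ r η` and `B = ∫ r² η'`.
  let η : ContDiffBump (2 : ℝ) := ⟨1 / 2, 1, by norm_num, by norm_num⟩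
  have hη : ContDiff ℝ ∞ η := η.contDiff
  have hη0 : ∀ r : ℝ, r ≤ 1 → η r = 0 := fun r hr => η.zero_of_le_dist (by
    rw [Real.dist_eq, abs_of_nonpos (by linarith)]; change (1 : ℝ) ≤ _; linarith)
  have hη1 : ∀ r : ℝ, 3 ≤ r → η r = 0 := fun r hr => η.zero_of_le_dist (by
    rw [Real.dist_eq, abs_of_nonneg (by linarith)]; change (1 : ℝ) ≤ _; linarith)
  set e := EuclideanSpace.single i (1 : ℝ)
  let G : E3 → ℝ := fun x => η ‖x‖ * f (toS2 x)
  have hG0 : ∀ x : E3, ‖x‖ < 1 → G =ᶠ[𝓝 x] 0 := by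
    intro x hx
    filter_upwards [(isOpen_lt continuous_norm continuous_const).mem_nhds hx] with y hy
    simp [G, hη0 _ (le_of_lt hy)]
  have hG : ContDiff ℝ ∞ G := by
    rw [contDiff_iff_contDiffAt]
    intro x
    by_cases hx : x = 0
    · exact contDiffAt_const.congr_of_eventuallyEq (hG0 x (by simp [hx]))
    · exact (hη.contDiffAt.comp x (contDiffAt_norm ℝ hx)).mul (contDiffAt_extend hf hx)
  have hGc : HasCompactSupport G := by
    refine HasCompactSupport.of_support_subset_isCompact (isCompact_closedBall (0 : E3) 3) ?_
    intro x hx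
    by_contra h
    simp only [Metric.mem_closedBall, dist_zero_right, not_le] at h
    exact hx (by simp [G, hη1 _ h.le])
  have hG' : Continuous (fun x => fderiv ℝ G x e) :=
    (hG.continuous_fderiv (by simp)).clm_apply continuous_const
  have hGi : Integrable (fun x => fderiv ℝ G x e) :=
    hG'.integrable_of_hasCompactSupport (hGc.fderiv_apply (𝕜 := ℝ) e)
  have h0 : ∫ x, fderiv ℝ G x e = 0 := by
    have h := integral_mul_fderiv_eq_neg_fderiv_mul_of_integrable (μ := (volume : Measure E3))
      (f := fun _ => (1 : ℝ)) (g := G) (v := e) (by simp) (by simpa using hGi)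
      (by simpa using hG.continuous.integrable_of_hasCompactSupport hGc)
      (fun x _ => by fun_prop) (fun x _ => (hG.differentiable (by simp)).differentiableAt)
    simpa using h
  have hpt : ∀ r : ℝ, 0 < r → ∀ n : S2, r ^ 2 * fderiv ℝ G (r • (n : E3)) e =
      (r * η r) * grad f n i + (r ^ 2 * deriv η r) * ((n : E3) i * f n) := by
    intro r hr n
    have hx : r • (n : E3) ≠ 0 := smul_ne_zero hr.ne' n.coe_ne_zero
    have hnx : ‖r • (n : E3)‖ = r := by rw [norm_smul, S2.norm_coe, mul_one, Real.norm_of_nonneg hr.le]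
    have h1 : HasFDerivAt (fun x : E3 => ‖x‖) (innerSL ℝ (n : E3)) (r • (n : E3)) := by
      have h := (hasStrictFDerivAt_norm_sq (r • (n : E3))).hasFDerivAt.sqrt
        (by simpa using ⟨hr.ne', n.coe_ne_zero⟩)
      simp only [Real.sqrt_sq (norm_nonneg _)] at h
      refine h.congr_fderiv ?_
      rw [hnx]
      ext y
      simp
      field_simp
    have h2 := ((hη.differentiable (by simp)).differentiableAt (x := ‖r • (n : E3)‖)).hasDerivAt.comp_hasFDerivAt
      _ h1
    have h3 : fderiv ℝ G (r • (n : E3)) = _ :=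
      (h2.mul (differentiableAt_extend hf hx).hasFDerivAt).fderiv
    have h4 := grad_toS2 f hx i
    rw [toS2_smul hr, toS2_coe, hnx] at h4
    rw [h3, h4]
    simp [hnx, toS2_smul hr, toS2_coe, e, EuclideanSpace.inner_single_right]
    ring
  rw [integral_polar hGi] at h0
  have hg1 := integrable_area (f := fun n => grad f n i) (by fun_prop)
  have hg2 := integrable_area (f := fun n => (n : E3) i * f n) (by fun_prop)
  have h1 : ∀ r ∈ Ioi (0 : ℝ), ∫ n : S2, r ^ 2 * fderiv ℝ G (r • (n : E3)) e ∂area =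
      (r * η r) * ∫ n, grad f n i ∂area +
        (r ^ 2 * deriv η r) * ∫ n, (n : E3) i * f n ∂area := by
    intro r hr
    simp only [hpt r hr]
    rw [integral_add (hg1.const_mul _) (hg2.const_mul _), integral_const_mul, integral_const_mul]
  rw [setIntegral_congr_fun measurableSet_Ioi h1] at h0
  have hc1 : Continuous fun r : ℝ => r * η r := continuous_id.mul hη.continuous
  have hs1 : HasCompactSupport fun r : ℝ => r * η r := η.hasCompactSupport.mul_left
  have hc2 : Continuous fun r : ℝ => r ^ 2 * deriv η r :=
    (continuous_id.pow 2).mul (hη.continuous_deriv (by simp))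
  have hs2 : HasCompactSupport fun r : ℝ => r ^ 2 * deriv η r :=
    (HasCompactSupport.deriv (𝕜 := ℝ) η.hasCompactSupport).mul_left
  have hi1 : Integrable fun r : ℝ => r * η r := hc1.integrable_of_hasCompactSupport hs1
  have hi2 : Integrable fun r : ℝ => r ^ 2 * deriv η r := hc2.integrable_of_hasCompactSupport hs2
  rw [integral_add (hi1.integrableOn.mul_const _) (hi2.integrableOn.mul_const _),
    integral_mul_const, integral_mul_const] at h0
  -- The integrand is the derivative of `r² η`, so `B = -2 A`.
  have hB : ∫ r in Ioi (0 : ℝ), (2 * (r * η r) + r ^ 2 * deriv η r) = 0 := by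
    have hd : ContDiff ℝ 1 fun r : ℝ => r ^ 2 * η r :=
      (contDiff_id.pow 2).mul (hη.of_le (by simp))
    have hs : HasCompactSupport fun r : ℝ => r ^ 2 * η r := η.hasCompactSupport.mul_left
    have h := hs.integral_Ioi_deriv_eq hd 0
    simp only [ne_eq, OfNat.ofNat_ne_zero, not_false_eq_true, zero_pow, zero_mul, neg_zero] at h
    refine Eq.trans (integral_congr_ae (Eventually.of_forall fun r => ?_)) h
    have h5 := ((hasDerivAt_pow (𝕜 := ℝ) 2 r).fun_mul
      ((hη.differentiable (by simp) : Differentiable ℝ (η : ℝ → ℝ)).differentiableAt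
        (x := r)).hasDerivAt).deriv
    rw [h5]
    simp
    ring
  rw [integral_add (hi1.integrableOn.const_mul _) hi2.integrableOn, integral_const_mul] at hB
  -- Positivity allows the radial factor to be cancelled; `η = 1` on an interval around `2`.
  have hA : 0 < ∫ r in Ioi (0 : ℝ), r * η r := by
    rw [setIntegral_pos_iff_support_of_nonneg_ae _ hi1.integrableOn]
    · have : Ioo (3 / 2 : ℝ) (5 / 2) ⊆ Function.support (fun r : ℝ => r * η r) ∩ Ioi 0 := by
        intro r hr
        have h1 : η r = 1 := η.one_of_mem_closedBall (by
          rw [Metric.mem_closedBall, Real.dist_eq, abs_le]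
          change -(1 / 2 : ℝ) ≤ _ ∧ _ ≤ (1 / 2 : ℝ)
          constructor <;> linarith [hr.1, hr.2])
        have h2 : 0 < r := by linarith [hr.1]
        exact ⟨by simp [h1, h2.ne'], h2⟩
      refine lt_of_lt_of_le ?_ (measure_mono this)
      rw [Real.volume_Ioo]
      norm_num
    · filter_upwards [ae_restrict_mem measurableSet_Ioi] with r hr
      exact mul_nonneg (le_of_lt hr) η.nonneg
  have : (∫ r in Ioi (0 : ℝ), r * η r) *
      ((∫ n, grad f n i ∂area) - 2 * ∫ n, (n : E3) i * f n ∂area) = 0 := by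
    linear_combination h0 - (∫ n, (n : E3) i * f n ∂area) * hB
  rcases mul_eq_zero.1 this with h | h
  · exact absurd h hA.ne'
  · linarith

/-! ### Rotations and the Laplacian -/

/-- The derivatives `εᵢₖ 𝒟ₖ f` along the rotations. -/
def rot (f : S2 → ℝ) (n : S2) (i : Fin 3) : ℝ := ∑ k, epsS n i k * grad f n k

/-- The Laplacian of a function on the sphere. -/
def lap (f : S2 → ℝ) (n : S2) : ℝ := ∑ a, grad (fun m => grad f m a) n a

@[fun_prop]
lemma SmoothS2.rot {f : S2 → ℝ} (hf : SmoothS2 f) (i : Fin 3) : SmoothS2 (fun n => rot f n i) := by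
  unfold ShellMemory.rot; fun_prop

@[fun_prop]
lemma SmoothS2.lap {f : S2 → ℝ} (hf : SmoothS2 f) : SmoothS2 (fun n => lap f n) := by
  unfold ShellMemory.lap; fun_prop

@[fun_prop]
lemma SmoothS2.lap' {f : S2 → ℝ} (hf : SmoothS2 f) : SmoothS2 (ShellMemory.lap f) := hf.lap

lemma rot_zero (f : S2 → ℝ) (n : S2) :
    rot f n 0 = (n : E3) 2 * grad f n 1 - (n : E3) 1 * grad f n 2 := by
  simp [rot, epsS_eq, Fin.sum_univ_three]; ring

lemma rot_one (f : S2 → ℝ) (n : S2) :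
    rot f n 1 = (n : E3) 0 * grad f n 2 - (n : E3) 2 * grad f n 0 := by
  simp [rot, epsS_eq, Fin.sum_univ_three]; ring

lemma rot_two (f : S2 → ℝ) (n : S2) :
    rot f n 2 = (n : E3) 1 * grad f n 0 - (n : E3) 0 * grad f n 1 := by
  simp [rot, epsS_eq, Fin.sum_univ_three]; ring

lemma grad_normal' {f : S2 → ℝ} (hf : SmoothS2 f) (n : S2) : (n : E3) 0 * grad f n 0
    + (n : E3) 1 * grad f n 1 + (n : E3) 2 * grad f n 2 = 0 := by
  simpa [Fin.sum_univ_three] using grad_normal hf n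

lemma sum_proj_mul (n : S2) (i : Fin 3) (W : Fin 3 → ℝ) :
    ∑ k, proj n i k * W k = W i - (n : E3) i * ∑ k, (n : E3) k * W k := by
  simp only [proj, sub_mul, Finset.sum_sub_distrib, ite_mul, one_mul, zero_mul,
    Finset.sum_ite_eq, Finset.mem_univ, if_true, mul_assoc, ← Finset.mul_sum]

lemma proj_comm (n : S2) (i j : Fin 3) : proj n i j = proj n j i := by
  simp only [proj, eq_comm, mul_comm]

/-- Obtained by differentiating `n · W = 0`. -/
lemma normal_grad_tangent {W : S2 → Fin 3 → ℝ} (hW : ∀ i, SmoothS2 (fun n => W n i))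
    (ht : ∀ n : S2, ∑ i, (n : E3) i * W n i = 0) (n : S2) (j : Fin 3) :
    ∑ k, (n : E3) k * grad (fun m => W m k) n j = - W n j := by
  have h : (fun m : S2 => ∑ i, (m : E3) i * W m i) = fun _ => 0 := funext ht
  have h1 : grad (fun m : S2 => ∑ i, (m : E3) i * W m i) n j = 0 := by rw [h, grad_const]
  rw [grad_sum _ (fun i => by fun_prop)] at h1
  simp (disch := fun_prop) only [grad_mul, grad_coord, Finset.sum_add_distrib] at h1
  have h2 : ∑ i, proj n j i * W n i = W n j := by rw [sum_proj_mul, ht]; ring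
  linarith

/-- For tangent fields the projection in `cov` only adds a normal term, so covariant derivatives
reduce to derivatives of Cartesian components. -/
lemma cov_tangent {W : S2 → Fin 3 → ℝ} (hW : ∀ i, SmoothS2 (fun n => W n i))
    (ht : ∀ n : S2, ∑ i, (n : E3) i * W n i = 0) (n : S2) (j i : Fin 3) :
    cov W n j i = grad (fun m => W m i) n j + (n : E3) i * W n j := by
  have h := normal_grad_tangent hW ht n j
  rw [cov, sum_proj_mul, h]
  ring

lemma normal_grad_grad {f : S2 → ℝ} (hf : SmoothS2 f) (n : S2) (j : Fin 3) :
    ∑ k, (n : E3) k * grad (fun m => grad f m k) n j = - grad f n j :=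
  normal_grad_tangent (W := fun m k => grad f m k) (fun _ => by fun_prop)
    (fun m => grad_normal hf m) n j

/-- The index `b` is moved past both contracted derivatives by `grad_comm`. Since `grad f k b` is
only a Cartesian component, the result has a part along `n`. -/
lemma sum_grad_grad_grad {f : S2 → ℝ} (hf : SmoothS2 f) (n : S2) (b : Fin 3) :
    ∑ a, grad (fun m => grad (fun k => grad f k b) m a) n a
      = grad (lap f) n b - 2 * (n : E3) b * lap f n := by
  have h1 : ∀ a, grad (fun m => grad (fun k => grad f k b) m a) n a =
      grad (fun m => grad (fun k => grad f k a) m a) n b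
      + (n : E3) a * grad (fun k => grad f k a) n b - (n : E3) b * grad (fun k => grad f k a) n a
      + proj n a a * grad f n b + (n : E3) a * grad (fun k => grad f k b) n a
      - proj n a b * grad f n a - (n : E3) b * grad (fun k => grad f k a) n a := by
    intro a
    have h2 : (fun m => grad (fun k => grad f k b) m a) = fun m =>
      grad (fun k => grad f k a) m b + (m : E3) a * grad f m b - (m : E3) b * grad f m a :=
      funext fun m => grad_comm hf m b a
    rw [h2]
    simp (disch := fun_prop) only [grad_sub, grad_add, grad_mul, grad_coord]
    rw [grad_comm (f := fun k => grad f k a) (by fun_prop) n b a]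
    ring
  have h3 : grad (lap f) n b = ∑ a, grad (fun m => grad (fun k => grad f k a) m a) n b :=
    grad_sum _ (fun a => by fun_prop) n b
  have h4 := normal_grad_grad hf n b
  have h5 := grad_normal (f := fun k => grad f k b) (by fun_prop) n
  have h6 := grad_normal hf n
  have h7 := n.sum_sq
  simp only [h1, h3, lap, Fin.sum_univ_three, proj] at *
  fin_cases b <;> simp at *
  · linear_combination h4 + h5 + grad f n 0 * h7 + (n : E3) 0 * h6
  · linear_combination h4 + h5 + grad f n 1 * h7 + (n : E3) 1 * h6
  · linear_combination h4 + h5 + grad f n 2 * h7 + (n : E3) 2 * h6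

/-- Bochner's formula: the Ricci tensor of the unit sphere equals its metric, which gives the extra
gradient. The final projection removes the normal part of the preceding identity. -/
lemma lapl_grad {f : S2 → ℝ} (hf : SmoothS2 f) (n : S2) (i : Fin 3) :
    lapl (grad f) n i = grad (lap f) n i + grad f n i := by
  have hc : ∀ a b, (fun m => cov (grad f) m a b) =
      fun m => grad (fun k => grad f k b) m a + (m : E3) b * grad f m a := fun a b =>
    funext fun m => cov_tangent (W := grad f) (fun _ => by fun_prop) (fun m => grad_normal hf m) m a b
  have h1 : ∀ a b k, grad (fun m => cov (grad f) m a b) n k =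
      grad (fun m => grad (fun k => grad f k b) m a) n k + proj n k b * grad f n a
        + (n : E3) b * grad (fun m => grad f m a) n k := by
    intro a b k
    rw [hc]
    simp (disch := fun_prop) only [grad_add, grad_mul, grad_coord]
    ring
  have h2 : ∀ a b, ∑ k, (n : E3) k * grad (fun m => cov (grad f) m a b) n k = 0 := fun a b =>
    grad_normal (f := fun m => cov (grad f) m a b) (by rw [hc]; fun_prop) n
  have h3 : lapl (grad f) n i =
      ∑ b, proj n i b * ∑ a, grad (fun m => cov (grad f) m a b) n a := by
    have h4 : ∀ a b, ∑ k, proj n a k * grad (fun m => cov (grad f) m a b) n k =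
        grad (fun m => cov (grad f) m a b) n a := fun a b => by
      rw [sum_proj_mul, h2]; ring
    simp only [lapl, cov2, Finset.mul_sum, ← h4]
    rw [Finset.sum_comm, Finset.sum_congr rfl fun a _ => Finset.sum_comm, Finset.sum_comm]
    refine Finset.sum_congr rfl fun b _ => Finset.sum_congr rfl fun a _ =>
      Finset.sum_congr rfl fun k _ => ?_
    rw [proj_comm n k a]
    ring
  have h5 : ∀ b, ∑ a, grad (fun m => cov (grad f) m a b) n a =
      grad (lap f) n b - (n : E3) b * lap f n + grad f n b := by
    intro b
    have h6 : ∑ a, proj n a b * grad f n a = grad f n b := by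
      simp only [proj_comm n _ b]
      rw [sum_proj_mul, grad_normal hf]
      ring
    simp only [h1, Finset.sum_add_distrib, sum_grad_grad_grad hf, h6, ← Finset.mul_sum]
    rw [lap]
    ring
  rw [h3, sum_proj_mul]
  have h6 : ∑ b, (n : E3) b * (grad (lap f) n b - (n : E3) b * lap f n + grad f n b) = - lap f n := by
    have h7 := grad_normal hf n
    have h8 := grad_normal (f := lap f) (by fun_prop) n
    have h9 := n.sum_sq
    simp only [Fin.sum_univ_three] at *
    linear_combination h7 + h8 + lap f n * h9
  simp only [h5, h6]
  ring

lemma grad_epsS (n : S2) (i k j : Fin 3) : grad (fun m => epsS m i k) n j =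
    ![![0, proj n j 2, -proj n j 1], ![-proj n j 2, 0, proj n j 0],
      ![proj n j 1, -proj n j 0, 0]] i k := by
  simp only [epsS_eq]
  fin_cases i <;> fin_cases k <;> simp (disch := fun_prop) [grad_const, grad_neg, grad_coord]

lemma rot_tangent (f : S2 → ℝ) (n : S2) : ∑ i, (n : E3) i * rot f n i = 0 := by
  simp only [Fin.sum_univ_three, rot_zero, rot_one, rot_two]
  ring

lemma grad_rot {f : S2 → ℝ} (hf : SmoothS2 f) (n : S2) (i j : Fin 3) :
    grad (fun m => rot f m i) n j =
      ∑ k, (grad (fun m => epsS m i k) n j * grad f n k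
        + epsS n i k * grad (fun m => grad f m k) n j) := by
  unfold rot
  rw [grad_sum _ (fun k => by fun_prop)]
  exact Finset.sum_congr rfl fun k _ => grad_mul (by fun_prop) (by fun_prop) n j

/-- The area form is parallel. Its Cartesian components do have nonzero derivatives, but against
tangent vectors these are normal and drop out under projection. -/
lemma cov_rot {f : S2 → ℝ} (hf : SmoothS2 f) (n : S2) (j i : Fin 3) :
    cov (rot f) n j i = ∑ k, epsS n i k * cov (grad f) n j k := by
  have h1 := grad_normal hf n
  have h2 := normal_grad_grad hf n j
  have h3 := n.sum_sq
  rw [cov_tangent (W := rot f) (fun _ => by fun_prop) (rot_tangent f)]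
  simp only [cov_tangent (W := grad f) (fun _ => by fun_prop) (fun m => grad_normal hf m),
    grad_rot hf, grad_epsS, Fin.sum_univ_three] at *
  simp only [epsS_eq]
  fin_cases i <;> fin_cases j <;> simp [proj, rot_zero, rot_one, rot_two] at * <;> generalize (n : E3) 0 = x at * <;>
    generalize (n : E3) 1 = y at * <;> generalize (n : E3) 2 = z at * <;>
    beta_reduce at * <;> grobner

/-- The antisymmetric `ε` is contracted with a Hessian that `grad_comm` shows to be symmetric up to
normal terms. -/
lemma div_rot {f : S2 → ℝ} (hf : SmoothS2 f) (n : S2) :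
    ∑ i, grad (fun m => rot f m i) n i = 0 := by
  have h1 := grad_normal hf n
  have h2 := grad_comm hf n 0 1
  have h3 := grad_comm hf n 0 2
  have h4 := grad_comm hf n 1 2
  have h5 := n.sum_sq
  simp only [grad_rot hf, grad_epsS, Fin.sum_univ_three] at *
  simp [proj, epsS_eq]
  linear_combination -(n : E3) 2 * h2 + (n : E3) 1 * h3 - (n : E3) 0 * h4

lemma div_eq_sum_cov {W : S2 → Fin 3 → ℝ} (hW : ∀ i, SmoothS2 (fun n => W n i))
    (ht : ∀ n : S2, ∑ i, (n : E3) i * W n i = 0) (n : S2) :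
    ∑ i, cov W n i i = ∑ i, grad (fun m => W m i) n i := by
  simp only [cov_tangent hW ht, Finset.sum_add_distrib, ht n, add_zero]

lemma isSolenoidal_rot {f : S2 → ℝ} (hf : SmoothS2 f) : IsSolenoidal (rot f) :=
  ⟨fun i => by fun_prop, rot_tangent f, fun n => by
    rw [div_eq_sum_cov (fun i => by fun_prop) (rot_tangent f), div_rot hf]⟩

lemma IsSolenoidal.const_mul {W : S2 → Fin 3 → ℝ} (hW : IsSolenoidal W) (c : ℝ) :
    IsSolenoidal (fun n i => c * W n i) := by
  obtain ⟨h1, h2, h3⟩ := hW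
  refine ⟨fun i => by have := h1 i; fun_prop, fun n => ?_, fun n => ?_⟩
  · rw [← mul_zero c, ← h2 n, Finset.mul_sum]
    exact Finset.sum_congr rfl fun i _ => by ring
  · rw [← mul_zero c, ← h3 n, Finset.mul_sum]
    refine Finset.sum_congr rfl fun i _ => ?_
    simp only [cov, Finset.mul_sum]
    refine Finset.sum_congr rfl fun k _ => ?_
    rw [grad_const_mul c (h1 k)]
    ring

lemma cov_const_mul {W : S2 → Fin 3 → ℝ} (hW : ∀ i, SmoothS2 (fun n => W n i)) (c : ℝ) (n : S2)
    (j i : Fin 3) : cov (fun n i => c * W n i) n j i = c * cov W n j i := by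
  simp only [cov, Finset.mul_sum]
  refine Finset.sum_congr rfl fun k _ => ?_
  rw [grad_const_mul c (hW k)]
  ring

/-- The rotations commute with the Laplacian. -/
lemma lap_rot {f : S2 → ℝ} (hf : SmoothS2 f) (n : S2) (i : Fin 3) :
    lap (fun m => rot f m i) n = rot (lap f) n i := by
  have h0 : ∀ a, grad (fun m => grad (fun m => rot f m i) m a) n a =
      ∑ k, (grad (fun m => grad (fun m => epsS m i k) m a) n a * grad f n k
        + 2 * grad (fun m => epsS m i k) n a * grad (fun m => grad f m k) n a
        + epsS n i k * grad (fun m => grad (fun k' => grad f k' k) m a) n a) := by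
    intro a
    simp only [grad_rot hf]
    rw [grad_sum _ (fun k => by fun_prop)]
    refine Finset.sum_congr rfl fun k _ => ?_
    simp (disch := fun_prop) only [grad_add, grad_mul]
    ring
  have hp : ∀ a b c, grad (fun m => proj m a b) n c = -(proj n c a * (n : E3) b)
      - (n : E3) a * proj n c b := by
    intro a b c
    unfold proj
    simp (disch := fun_prop) only [grad_sub, grad_mul, grad_coord, grad_const]
    unfold proj
    ring
  have h1 := grad_normal hf n
  have h5 := n.sum_sq
  have h6 := sum_grad_grad_grad hf n
  have h7 := fun b => grad_normal (f := fun k => grad f k b) (by fun_prop) n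
  have h8 := grad_comm hf n 0 1
  have h9 := grad_comm hf n 0 2
  have h10 := grad_comm hf n 1 2
  have h11 := h6 0
  have h12 := h6 1
  have h13 := h6 2
  have h14 := h7 0
  have h15 := h7 1
  have h16 := h7 2
  change ∑ a, grad (fun m => grad (fun m => rot f m i) m a) n a = _
  simp only [h0, grad_epsS]
  clear h6 h7 h0
  fin_cases i <;> simp (disch := fun_prop) [Fin.sum_univ_three, grad_const, grad_neg, hp, epsS_eq,
    rot_zero, rot_one, rot_two] at * <;> simp [proj]
  · linear_combination (n : E3) 2 * h12 - (n : E3) 1 * h13 - 2 * (n : E3) 2 * h15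
      + 2 * (n : E3) 1 * h16 + 2 * h10
      + (-2 * (n : E3) 2 * grad f n 1 + 2 * (n : E3) 1 * grad f n 2) * h5
  · linear_combination (n : E3) 0 * h13 - (n : E3) 2 * h11 - 2 * (n : E3) 0 * h16
      + 2 * (n : E3) 2 * h14 - 2 * h9
      + (-2 * (n : E3) 0 * grad f n 2 + 2 * (n : E3) 2 * grad f n 0) * h5
  · linear_combination (n : E3) 1 * h11 - (n : E3) 0 * h12 - 2 * (n : E3) 1 * h14
      + 2 * (n : E3) 0 * h15 + 2 * h8
      + (-2 * (n : E3) 1 * grad f n 0 + 2 * (n : E3) 0 * grad f n 1) * h5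

/-- For symmetric `M` the hypothesis `h` says that `M` commutes with the generator of rotations
about `n`, so its block on the tangent plane is a multiple of the identity, fixed by the trace. It
serves for the Hessian of a Killing potential and for the second moments of a zonal kernel. -/
lemma isotropic_of_commute (n : S2) (M : Fin 3 → Fin 3 → ℝ) (hs : ∀ i j, M i j = M j i)
    (h : ∀ i j, ∑ k, (epsS n i k * M k j + epsS n j k * M k i) = 0) (i j : Fin 3) :
    ∑ k, ∑ l, proj n i k * proj n j l * M k l =
      (∑ k, M k k - ∑ k, ∑ l, (n : E3) k * (n : E3) l * M k l) / 2 * proj n i j := by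
  have h00 := h 0 0
  have h01 := h 0 1
  have h02 := h 0 2
  have h11 := h 1 1
  have h12 := h 1 2
  have h22 := h 2 2
  have h5 := n.sum_sq
  have s1 := hs 1 0
  have s2 := hs 2 0
  have s3 := hs 2 1
  simp only [Fin.sum_univ_three, epsS_eq, s1, s2, s3] at *
  clear h hs
  fin_cases i <;> fin_cases j <;> simp [proj] at * <;>
    generalize (n : E3) 0 = x at * <;>
    generalize (n : E3) 1 = y at * <;> generalize (n : E3) 2 = z at * <;>
    generalize M 0 0 = m00 at * <;> generalize M 0 1 = m01 at * <;> generalize M 0 2 = m02 at * <;>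
    generalize M 1 1 = m11 at * <;> generalize M 1 2 = m12 at * <;> generalize M 2 2 = m22 at * <;>
    beta_reduce at * <;> grobner

/-- Integration by parts: the mean-curvature term `2 n · X f` of `integral_grad` is absent for
tangent fields. -/
lemma integral_tangent_mul_grad {X : S2 → Fin 3 → ℝ} (hX : ∀ i, SmoothS2 (fun n => X n i))
    (ht : ∀ n : S2, ∑ i, (n : E3) i * X n i = 0) {f : S2 → ℝ} (hf : SmoothS2 f) :
    ∫ n, ∑ i, X n i * grad f n i ∂area = - ∫ n, (∑ i, grad (fun m => X m i) n i) * f n ∂area := by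
  have h1 : ∀ i, ∫ n, grad (fun m => X m i * f m) n i ∂area =
      2 * ∫ n, (n : E3) i * (X n i * f n) ∂area := fun i =>
    integral_grad (by have := hX i; fun_prop) i
  have h2 : ∫ n, ∑ i, grad (fun m => X m i * f m) n i ∂area = 0 := by
    rw [integral_finsetSum _ fun i _ => integrable_area (by have := hX i; fun_prop)]
    simp only [h1]
    rw [← Finset.mul_sum, ← integral_finsetSum _ fun i _ => integrable_area
      (by have := hX i; fun_prop)]
    have : ∀ n : S2, ∑ i, (n : E3) i * (X n i * f n) = 0 := fun n => by
      simp only [← mul_assoc, ← Finset.sum_mul, ht n, zero_mul]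
    simp [this]
  have h3 : ∀ n, ∑ i, grad (fun m => X m i * f m) n i =
      (∑ i, grad (fun m => X m i) n i) * f n + ∑ i, X n i * grad f n i := fun n => by
    simp only [grad_mul (hX _) hf, Finset.sum_add_distrib, Finset.sum_mul]
  simp only [h3] at h2
  rw [integral_add (integrable_area (by fun_prop)) (integrable_area (by fun_prop))] at h2
  linarith

lemma rot_mul {f g : S2 → ℝ} (hf : SmoothS2 f) (hg : SmoothS2 g) (n : S2) (i : Fin 3) :
    rot (fun m => f m * g m) n i = rot f n i * g n + f n * rot g n i := by
  simp only [rot, grad_mul hf hg, Finset.sum_mul, Finset.mul_sum, ← Finset.sum_add_distrib]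
  exact Finset.sum_congr rfl fun k _ => by ring

/-- The rotation fields are tangent and divergence-free. -/
lemma integral_rot {f : S2 → ℝ} (hf : SmoothS2 f) (i : Fin 3) : ∫ n, rot f n i ∂area = 0 := by
  unfold rot
  rw [integral_tangent_mul_grad (X := fun n k => epsS n i k) (fun k => by fun_prop) _ hf]
  · have : ∀ n, ∑ k, grad (fun m => epsS m i k) n k = 0 := fun n => by
      simp only [grad_epsS, Fin.sum_univ_three]
      fin_cases i <;> simp [proj] <;> ring
    simp [this]
  · intro n
    simp only [epsS_eq, Fin.sum_univ_three]
    fin_cases i <;> simp <;> ring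

lemma integral_mul_rot {f g : S2 → ℝ} (hf : SmoothS2 f) (hg : SmoothS2 g) (i : Fin 3) :
    ∫ n, f n * rot g n i ∂area = - ∫ n, rot f n i * g n ∂area := by
  have h := integral_rot (f := fun m => f m * g m) (by fun_prop) i
  simp only [rot_mul hf hg] at h
  rw [integral_add (integrable_area (by fun_prop)) (integrable_area (by fun_prop))] at h
  linarith

/-- Green's identity. -/
lemma integral_lap_mul {f g : S2 → ℝ} (hf : SmoothS2 f) (hg : SmoothS2 g) :
    ∫ n, lap f n * g n ∂area = ∫ n, f n * lap g n ∂area := by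
  have h1 := integral_tangent_mul_grad (X := grad f) (fun k => by fun_prop)
    (fun n => grad_normal hf n) hg
  have h2 := integral_tangent_mul_grad (X := grad g) (fun k => by fun_prop)
    (fun n => grad_normal hg n) hf
  have h3 : ∀ n, ∑ i, grad f n i * grad g n i = ∑ i, grad g n i * grad f n i := fun n =>
    Finset.sum_congr rfl fun k _ => mul_comm _ _
  simp only [h3] at h1
  rw [h1] at h2
  simp only [mul_comm (f _)]
  exact neg_injective h2

/-- The degree-zero extension has zero derivative on the punctured space, which is connected. -/
lemma eq_const_of_grad_eq_zero {f : S2 → ℝ} (hf : SmoothS2 f) (h : ∀ n i, grad f n i = 0)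
    (n m : S2) : f n = f m := by
  have hc : IsPreconnected ({0}ᶜ : Set E3) :=
    (isConnected_compl_singleton_of_one_lt_rank (by
      rw [← Module.finrank_eq_rank]; simp) 0).isPreconnected
  have hz : ∀ x : E3, x ≠ 0 → fderiv ℝ (fun y : E3 => f (toS2 y)) x = 0 := by
    intro x hx
    ext v
    have hv : v = ∑ k, v k • EuclideanSpace.single k (1 : ℝ) := by
      ext j; fin_cases j <;> simp [Fin.sum_univ_three]
    rw [hv, map_sum]
    simp only [map_smul, zero_apply]
    refine Finset.sum_eq_zero fun k _ => ?_
    have h1 := grad_toS2 f hx k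
    rw [h, eq_comm, mul_eq_zero] at h1
    rcases h1 with h1 | h1
    · exact absurd h1 (norm_ne_zero_iff.2 hx)
    · rw [h1, smul_zero]
  have h1 := isOpen_compl_singleton.is_const_of_fderiv_eq_zero (𝕜 := ℝ) hc
    (f := fun y : E3 => f (toS2 y))
    (fun x hx => (differentiableAt_extend hf hx).differentiableWithinAt) (fun x hx => hz x hx)
    n.coe_ne_zero m.coe_ne_zero
  simpa [toS2_coe] using h1

/-! ### The stress term -/

/-- The potential `(𝒟² + 2) α` of the radial components of the stress. -/
def radialPotential (α : S2 → ℝ) (n : S2) : ℝ := lap α n + 2 * α n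

@[fun_prop]
lemma SmoothS2.radialPotential {α : S2 → ℝ} (hα : SmoothS2 α) :
    SmoothS2 (fun n => radialPotential α n) := by
  unfold ShellMemory.radialPotential; fun_prop

@[fun_prop]
lemma SmoothS2.radialPotential' {α : S2 → ℝ} (hα : SmoothS2 α) :
    SmoothS2 (ShellMemory.radialPotential α) := hα.radialPotential

/-- The operator `𝒟² + 1` on covectors becomes `𝒟² + 2` on the potential: one unit comes from
curvature (`lapl_grad`), one is explicit. -/
lemma lapl_grad_add_grad {α : S2 → ℝ} (hα : SmoothS2 α) (n : S2) (k : Fin 3) :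
    lapl (grad α) n k + grad α n k = grad (radialPotential α) n k := by
  have h : grad (radialPotential α) n k = grad (fun n => lap α n + 2 * α n) n k := rfl
  rw [lapl_grad hα, h, grad_add (by fun_prop) (by fun_prop), grad_const_mul _ hα]
  change _ = grad (lap α) n k + _
  ring

lemma lAux_zero (v : ℝ) {α : S2 → ℝ} (hα : SmoothS2 α) (n : S2) (i : Fin 3) :
    lAux v α n i 0 = - gam v * rot (radialPotential α) n i := by
  simp only [lAux, lapl_grad_add_grad hα, rot, Finset.mul_sum, vel, Fin.cons_zero]
  exact Finset.sum_congr rfl fun k _ => by ring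

lemma lAux_succ (v : ℝ) {α : S2 → ℝ} (hα : SmoothS2 α) (n : S2) (i j : Fin 3) :
    lAux v α n i j.succ = gam v * v * ((n : E3) j * rot (radialPotential α) n i
      - cov (rot α) n j i) := by
  simp only [lAux, lapl_grad_add_grad hα, rot, cov_rot hα, vel, Fin.cons_succ]
  rw [Finset.mul_sum, ← Finset.sum_sub_distrib, Finset.mul_sum]
  exact Finset.sum_congr rfl fun k _ => by ring

lemma lStress_zero_zero (v : ℝ) (α : S2 → ℝ) (n : S2) : lStress v α n 0 0 = 0 := by
  simp [lStress]

lemma lStress_zero_succ (v : ℝ) {α : S2 → ℝ} (hα : SmoothS2 α) (n : S2) (i : Fin 3) :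
    lStress v α n 0 i.succ = gam v / 2 * rot (radialPotential α) n i := by
  simp only [lStress, Fin.cons_zero, Fin.cons_succ, lAux_zero v hα]
  ring

lemma lStress_succ_zero (v : ℝ) {α : S2 → ℝ} (hα : SmoothS2 α) (n : S2) (i : Fin 3) :
    lStress v α n i.succ 0 = gam v / 2 * rot (radialPotential α) n i := by
  simp only [lStress, Fin.cons_zero, Fin.cons_succ, lAux_zero v hα]
  ring

lemma lStress_succ_succ (v : ℝ) {α : S2 → ℝ} (hα : SmoothS2 α) (n : S2) (i j : Fin 3) :
    lStress v α n i.succ j.succ = gam v * v / 2 * (cov (rot α) n i j + cov (rot α) n j i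
      - (n : E3) i * rot (radialPotential α) n j - (n : E3) j * rot (radialPotential α) n i) := by
  simp only [lStress, Fin.cons_succ, lAux_succ v hα]
  ring

lemma lStress_symm (v : ℝ) (α : S2 → ℝ) (n : S2) (a b : Fin 4) :
    lStress v α n a b = lStress v α n b a := by
  simp only [lStress, add_comm]

@[fun_prop]
lemma SmoothS2.cov {W : S2 → Fin 3 → ℝ} (hW : ∀ i, SmoothS2 (fun n => W n i)) (i j : Fin 3) :
    SmoothS2 (fun n => cov W n i j) := by
  unfold ShellMemory.cov
  fun_prop

@[fun_prop]
lemma SmoothS2.lStress (v : ℝ) {α : S2 → ℝ} (hα : SmoothS2 α) (a b : Fin 4) :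
    SmoothS2 (fun n => lStress v α n a b) := by
  refine Fin.cases ?_ (fun i => ?_) a <;> refine Fin.cases ?_ (fun j => ?_) b
  · simp only [lStress_zero_zero]; fun_prop
  · simp only [lStress_zero_succ v hα]; fun_prop
  · simp only [lStress_succ_zero v hα]; fun_prop
  · simp only [lStress_succ_succ v hα]
    have := fun i j => SmoothS2.cov (W := ShellMemory.rot α) (fun i => by fun_prop) i j
    fun_prop

theorem isVectorType_lStress (v : ℝ) {α : S2 → ℝ} (hα : SmoothS2 α) :
    IsVectorType (lStress v α) := by
  have hr := isSolenoidal_rot (f := radialPotential α) (by fun_prop)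
  refine ⟨_, _, _, hr.const_mul (gam v / 2), hr.const_mul (-(gam v * v / 2)),
    (isSolenoidal_rot hα).const_mul (gam v * v), fun n => ⟨lStress_zero_zero v α n, fun i =>
      ⟨lStress_zero_succ v hα n i, lStress_succ_zero v hα n i⟩, fun i j => ?_⟩⟩
  rw [lStress_succ_succ v hα, cov_const_mul fun i => by fun_prop, cov_const_mul fun i => by fun_prop]
  ring

/-- The divergence of the spatial stress along the sphere. -/
lemma sum_grad_lStress (v : ℝ) {α : S2 → ℝ} (hα : SmoothS2 α) (n : S2) (j : Fin 3) :
    ∑ i : Fin 3, grad (fun m => lStress v α m i.succ j.succ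
      + gam v * v / 2 * ((m : E3) i * rot (radialPotential α) m j)) n i = 0 := by
  have hS := cov_tangent (W := rot α) (fun i => by fun_prop) (rot_tangent α)
  -- The added term cancels the component of the stress along `n` in the index `i`. What remains is
  -- tangent in `i`, so the sum of Cartesian derivatives is its divergence.
  have h1 : ∀ i, (fun m : S2 => lStress v α m i.succ j.succ
      + gam v * v / 2 * ((m : E3) i * rot (radialPotential α) m j)) =
      fun m => gam v * v / 2 * (grad (fun m => rot α m j) m i + (m : E3) j * rot α m i
        + (grad (fun m => rot α m i) m j + (m : E3) i * rot α m j)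
        - (m : E3) j * rot (radialPotential α) m i) := fun i => funext fun m => by
    rw [lStress_succ_succ v hα, hS, hS]
    ring
  -- The derivatives are commuted so that the divergence of `rot α`, which is zero, appears.
  have h2 : ∀ i, grad (fun m => grad (fun m => rot α m i) m j) n i =
      grad (fun m => grad (fun m => rot α m i) m i) n j
        + (n : E3) i * grad (fun m => rot α m i) n j
        - (n : E3) j * grad (fun m => rot α m i) n i := fun i => grad_comm (by fun_prop) n j i
  have h3 : ∑ i, grad (fun m => grad (fun m => rot α m i) m i) n j = 0 := by
    rw [← grad_sum _ (fun i => by fun_prop)]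
    simp only [div_rot hα, grad_const]
  have h4 := normal_grad_tangent (W := rot α) (fun i => by fun_prop) (rot_tangent α) n j
  have h5 := lap_rot hα n j
  have h6 := div_rot hα n
  have h7 := div_rot (f := radialPotential α) (by fun_prop) n
  have h8 := grad_normal (f := fun m => rot α m j) (by fun_prop) n
  have h9 : ∀ f : S2 → ℝ, ∑ i, proj n i j * rot f n i = rot f n j := fun f => by
    simp only [proj_comm n _ j]
    rw [sum_proj_mul, rot_tangent]
    ring
  have h10 : ∑ i, proj n i i = 2 := by
    have := n.sum_sq
    simp only [proj, Fin.sum_univ_three]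
    simp
    linear_combination this
  -- The choice `β = (𝒟² + 2)α` enters here: together with `lap_rot` it makes the radial part of the
  -- stress cancel the divergence of the shear.
  have h11 : rot (radialPotential α) n j = rot (lap α) n j + 2 * rot α n j := by
    have : ∀ k, grad (radialPotential α) n k = grad (lap α) n k + 2 * grad α n k := fun k => by
      have h : grad (radialPotential α) n k = grad (fun n => lap α n + 2 * α n) n k := rfl
      rw [h, grad_add (by fun_prop) (by fun_prop), grad_const_mul _ hα]
    simp only [rot, this, mul_add, Finset.sum_add_distrib, Finset.mul_sum]
    congr 1
    exact Finset.sum_congr rfl fun k _ => by ring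
  simp only [h1]
  simp (disch := fun_prop) only [grad_const_mul, grad_sub, grad_add, grad_mul, grad_coord, h2]
  rw [← Finset.mul_sum]
  simp only [Finset.sum_add_distrib, Finset.sum_sub_distrib, h9, ← Finset.mul_sum,
    ← Finset.sum_mul, h3, h4, h6, h7, h8, h10]
  change _ * (lap (fun m => rot α m j) n + _ + _ - _) = 0
  rw [h5, h11]
  ring

/-- The stress term is conserved: weak form over the sphere. -/
lemma integral_lStress_mul_grad (v : ℝ) {α : S2 → ℝ} (hα : SmoothS2 α) {f : S2 → ℝ}
    (hf : SmoothS2 f) (j : Fin 3) :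
    ∫ n, ∑ i : Fin 3, lStress v α n i.succ j.succ * grad f n i ∂area = 0 := by
  have h := integral_tangent_mul_grad (X := fun n i => lStress v α n i.succ j.succ
      + gam v * v / 2 * ((n : E3) i * rot (radialPotential α) n j)) (fun i => by fun_prop)
      (fun n => ?_) hf
  · simp only [sum_grad_lStress v hα, zero_mul, integral_zero, neg_zero] at h
    rw [← h]
    congr 1
    funext n
    have h1 := grad_normal hf n
    have h2 : ∑ i : Fin 3, gam v * v / 2 * ((n : E3) i * rot (radialPotential α) n j) * grad f n i
        = 0 := by
      rw [← mul_zero (gam v * v / 2 * rot (radialPotential α) n j), ← h1, Finset.mul_sum]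
      exact Finset.sum_congr rfl fun k _ => by ring
    simp only [add_mul, Finset.sum_add_distrib, h2, add_zero]
  · have hS := cov_tangent (W := rot α) (fun i => by fun_prop) (rot_tangent α)
    have h1 := normal_grad_tangent (W := rot α) (fun i => by fun_prop) (rot_tangent α) n j
    have h2 := grad_normal (f := fun m => rot α m j) (by fun_prop) n
    have h3 := rot_tangent α n
    have h4 := rot_tangent (radialPotential α) n
    have h5 := n.sum_sq
    simp only [lStress_succ_succ v hα, hS, Fin.sum_univ_three] at *
    linear_combination gam v * v / 2 * (h1 + h2 + (n : E3) j * h3 - (n : E3) j * h4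
      - rot α n j * h5)

/-! ### Killing potentials -/

/-- If `𝒟_(i S_j)` vanishes for `S = ε 𝒟 f`, then `f` has no multipoles above the dipole. -/
lemma onlyLowMultipoles_of_killing {f : S2 → ℝ} (hf : SmoothS2 f)
    (h : ∀ n i j, cov (rot f) n i j + cov (rot f) n j i = 0) : OnlyLowMultipoles f := by
  have hG := cov_tangent (W := grad f) (fun i => by fun_prop) (fun n => grad_normal hf n)
  -- For `S = ε𝒟f` the Killing equation says that the Hessian of `f` commutes with `ε`, so the
  -- Hessian is pure trace.
  have h1 : ∀ n j k, grad (fun m => grad f m k) n j + (n : E3) k * grad f n j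
      = lap f n / 2 * proj n j k := by
    intro n j k
    have hs : ∀ i j, cov (grad f) n i j = cov (grad f) n j i := fun i j => by
      rw [hG, hG, grad_comm hf n j i]; ring
    have hi := isotropic_of_commute n (cov (grad f) n) hs (fun i j => by
      have := h n j i
      rw [cov_rot hf, cov_rot hf, ← Finset.sum_add_distrib] at this
      rw [← this]
      exact Finset.sum_congr rfl fun k _ => by rw [hs k j, hs k i]) j k
    have ht1 : ∀ j, ∑ k, (n : E3) k * cov (grad f) n j k = 0 := fun j => by
      simp only [hG, mul_add, Finset.sum_add_distrib, normal_grad_grad hf]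
      have := n.sum_sq
      simp only [Fin.sum_univ_three]
      linear_combination -(grad f n j) * this
    have ht2 : ∀ k, ∑ j, (n : E3) j * cov (grad f) n j k = 0 := fun k => by
      simp only [hs _ k, ht1]
    have h3 : ∑ a, ∑ b, proj n j a * proj n k b * cov (grad f) n a b = cov (grad f) n j k := by
      have : ∀ a, ∑ b, proj n j a * proj n k b * cov (grad f) n a b =
          proj n j a * cov (grad f) n a k := fun a => by
        simp only [mul_assoc, ← Finset.mul_sum]
        rw [sum_proj_mul, ht1]
        ring
      simp only [this]
      rw [sum_proj_mul, ht2]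
      ring
    have h4 : ∑ a, ∑ b, (n : E3) a * (n : E3) b * cov (grad f) n a b = 0 := by
      simp only [mul_assoc, ← Finset.mul_sum, ht1, mul_zero, Finset.sum_const_zero]
    have h5 : ∑ a, cov (grad f) n a a = lap f n := by
      simp only [hG, Finset.sum_add_distrib, grad_normal hf, add_zero, lap]
    rw [h3, h4, h5, hG, sub_zero] at hi
    exact hi
  have hpr : ∀ n (j k : Fin 3), proj n j k = proj n k j := fun n j k => proj_comm n j k
  -- The divergence of the pure-trace identity, combined with `sum_grad_grad_grad`, makes `lap f + 2
  -- f` constant.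
  have h2 : ∀ n k, grad (fun m => lap f m + 2 * f m) n k = 0 := by
    intro n k
    have h3 : ∀ j, grad (fun m => grad (fun m => grad f m k) m j + (m : E3) k * grad f m j) n j
        = grad (fun m => lap f m / 2 * ((if j = k then 1 else 0) - (m : E3) j * (m : E3) k)) n j :=
      fun j => by simp only [h1]; rfl
    have h4 := Finset.sum_congr (s₁ := Finset.univ) rfl fun j (_ : j ∈ Finset.univ) => h3 j
    simp (disch := fun_prop) only [grad_add, grad_mul, grad_sub, grad_coord, grad_const,
      grad_div_const, Finset.sum_add_distrib] at h4
    rw [sum_grad_grad_grad hf] at h4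
    have h5 := grad_normal hf n
    have h6 := grad_normal (f := lap f) (by fun_prop) n
    have h7 := n.sum_sq
    have hl : lap f n = grad (fun m => grad f m 0) n 0 + grad (fun m => grad f m 1) n 1
      + grad (fun m => grad f m 2) n 2 := by simp [lap, Fin.sum_univ_three]
    rw [grad_add (by fun_prop) (by fun_prop), grad_const_mul _ hf]
    change grad (lap f) n k + _ = 0
    simp only [Fin.sum_univ_three, proj] at *
    fin_cases k <;> simp at * <;>
    generalize (n : E3) 0 = x at * <;>
    generalize (n : E3) 1 = y at * <;> generalize (n : E3) 2 = z at * <;>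
    beta_reduce at * <;> grobner
  have h3 := eq_const_of_grad_eq_zero (f := fun m => lap f m + 2 * f m) (by fun_prop) h2
  let p : S2 := toS2 0
  set c := lap f p + 2 * f p with hc
  have h4 : ∀ n, lap f n = c - 2 * f n := fun n => by
    have := h3 n p
    linarith
  -- The Euclidean vector `𝒟f + n (f - c / 2)` has zero derivative by `h1`, hence is a constant `b`.
  -- Its inner product with `n` gives `f = c / 2 + b · n`.
  have h5 : ∀ k n m, grad f n k + (n : E3) k * (f n - c / 2) =
      grad f m k + (m : E3) k * (f m - c / 2) := fun k =>
    eq_const_of_grad_eq_zero (f := fun n => grad f n k + (n : E3) k * (f n - c / 2)) (by fun_prop)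
      fun n j => by
        simp (disch := fun_prop) only [grad_add, grad_mul, grad_coord, grad_sub, grad_const]
        have := h1 n j k
        rw [h4] at this
        linear_combination this
  refine ⟨c / 2, WithLp.toLp 2 fun k => grad f p k + (p : E3) k * (f p - c / 2), fun n => ?_⟩
  have h6 := grad_normal hf n
  have h7 := n.sum_sq
  simp only [PiLp.inner_apply, ← h5 _ n p, Fin.sum_univ_three] at *
  simp
  linear_combination (f n - c / 2) * h7 - h6

/-! ### Integral operators on the sphere -/

/-- Functions on the square of the sphere that extend smoothly to all of space. -/
@[fun_prop]
def SmoothKernel (k : S2 × S2 → ℝ) : Prop :=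
  ∃ G : E3 × E3 → ℝ, ContDiff ℝ ∞ G ∧ ∀ p, k p = G (p.1, p.2)

namespace SmoothKernel

@[fun_prop]
lemma inner : SmoothKernel (fun p => inner ℝ (p.1 : E3) (p.2 : E3)) :=
  ⟨fun q => Inner.inner ℝ q.1 q.2, contDiff_fst.inner ℝ contDiff_snd, fun _ => rfl⟩

lemma fst {k : S2 × S2 → ℝ} (hk : SmoothKernel k) (m : S2) : SmoothS2 (fun n => k (n, m)) := by
  obtain ⟨G, hG, h⟩ := hk
  simp only [h]
  exact .of_contDiffAt (F := fun x => G (x, m)) fun n =>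
    (hG.comp (contDiff_id.prodMk contDiff_const)).contDiffAt

lemma snd {k : S2 × S2 → ℝ} (hk : SmoothKernel k) (n : S2) : SmoothS2 (fun m => k (n, m)) := by
  obtain ⟨G, hG, h⟩ := hk
  simp only [h]
  exact .of_contDiffAt (F := fun x => G (n, x)) fun m =>
    (hG.comp (contDiff_const.prodMk contDiff_id)).contDiffAt

lemma continuous {k : S2 × S2 → ℝ} (hk : SmoothKernel k) : Continuous k := by
  obtain ⟨G, hG, h⟩ := hk
  have : k = fun p => G (p.1, p.2) := funext h
  rw [this]
  exact hG.continuous.comp (by fun_prop)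

end SmoothKernel

/-- The integral is a convolution evaluated at `0`, against the area measure pushed forward to
space, with `x` as a parameter. The cutoff `χ` is `1` on the sphere and supplies the compact support
that the theorem on convolutions with parameters requires. -/
lemma contDiff_integral_area {G : E3 × E3 → ℝ} (hG : ContDiff ℝ ∞ G) {f : S2 → ℝ}
    (hf : Continuous f) : ContDiff ℝ ∞ (fun x : E3 => ∫ m : S2, f m * G (x, m) ∂area) := by
  let χ : ContDiffBump (0 : E3) := ⟨1, 2, by norm_num, by norm_num⟩
  have he : MeasurableEmbedding (Subtype.val : S2 → E3) :=
    MeasurableEmbedding.subtype_coe Metric.isClosed_sphere.measurableSet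
  let ν : Measure E3 := area.map Subtype.val
  let F : E3 → ℝ := fun y => f (toS2 y)
  have hF : LocallyIntegrable F ν := by
    refine Integrable.locallyIntegrable ?_
    rw [he.integrable_map_iff]
    have : F ∘ Subtype.val = f := funext fun m => by simp [F, toS2_coe]
    rw [this]
    exact integrable_area hf
  have h := contDiffOn_convolution_right_with_param_comp (μ := ν) (n := ⊤)
    (ContinuousLinearMap.mul ℝ ℝ) (s := (univ : Set E3)) (v := fun _ => (0 : E3))
    contDiffOn_const (f := F) (g := fun x y => χ y * G (x, -y)) (k := Metric.closedBall 0 2)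
    isOpen_univ (isCompact_closedBall _ _) (fun x y _ hy => by
      have : χ y = 0 := χ.zero_of_le_dist (by
        simp only [Metric.mem_closedBall, not_le] at hy; exact hy.le)
      simp [this]) hF
    (((χ.contDiff.comp contDiff_snd).mul
      (hG.comp (contDiff_fst.prodMk contDiff_snd.neg))).contDiffOn)
  rw [contDiffOn_univ] at h
  convert h using 2 with x
  simp only [convolution, ContinuousLinearMap.mul_apply', zero_sub, neg_neg]
  rw [he.integral_map]
  refine integral_congr_ae (Eventually.of_forall fun m => ?_)
  have : χ (-(m : E3)) = 1 := χ.one_of_mem_closedBall (by simp [χ])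
  simp [F, toS2_coe, this]

lemma hasFDerivAt_integral_area {G : E3 × E3 → ℝ} (hG : ContDiff ℝ ∞ G) {f : S2 → ℝ}
    (hf : Continuous f) (x : E3) : HasFDerivAt (fun x : E3 => ∫ m : S2, f m * G (x, m) ∂area)
      (∫ m : S2, f m • (fderiv ℝ G (x, m)).comp (ContinuousLinearMap.inl ℝ E3 E3) ∂area) x := by
  have hd : Continuous (fderiv ℝ G) := hG.continuous_fderiv (by simp)
  have hc : Continuous fun q : E3 × S2 =>
      f q.2 • (fderiv ℝ G (q.1, q.2)).comp (ContinuousLinearMap.inl ℝ E3 E3) :=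
    (hf.comp continuous_snd).smul
      ((hd.comp (by fun_prop)).clm_comp continuous_const)
  obtain ⟨C, hC⟩ := ((isCompact_closedBall x 1).prod
    (isCompact_univ : IsCompact (univ : Set S2))).exists_bound_of_continuousOn hc.continuousOn
  refine hasFDerivAt_integral_of_dominated_of_fderiv_le (𝕜 := ℝ) (s := Metric.closedBall x 1)
    (F := fun x (m : S2) => f m * G (x, m))
    (F' := fun x (m : S2) => f m • (fderiv ℝ G (x, m)).comp (ContinuousLinearMap.inl ℝ E3 E3))
    (bound := fun _ => C) (Metric.closedBall_mem_nhds x one_pos) ?_ ?_ ?_ ?_ ?_ ?_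
  · refine Eventually.of_forall fun y => ?_
    exact (hf.mul (hG.continuous.comp (by fun_prop))).aestronglyMeasurable
  · exact integrable_area (hf.mul (hG.continuous.comp (by fun_prop)))
  · exact (hc.comp (by fun_prop : Continuous fun m : S2 => (x, m))).aestronglyMeasurable
  · exact Eventually.of_forall fun m y hy => hC (y, m) ⟨hy, mem_univ _⟩
  · exact integrable_const C
  · refine Eventually.of_forall fun m y _ => ?_
    have h := (hG.differentiable (by simp)).differentiableAt (x := (y, (m : E3)))
    exact (h.hasFDerivAt.comp y (hasFDerivAt_prodMk_left y (m : E3))).const_mul (f m)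

lemma SmoothS2.integral {k : S2 × S2 → ℝ} (hk : SmoothKernel k) {f : S2 → ℝ} (hf : Continuous f) :
    SmoothS2 (fun n => ∫ m, f m * k (n, m) ∂area) := by
  obtain ⟨G, hG, h⟩ := hk
  simp only [h]
  exact .of_contDiffAt (F := fun x => ∫ m : S2, f m * G (x, m) ∂area) fun n =>
    (contDiff_integral_area hG hf).contDiffAt

lemma grad_integral {k : S2 × S2 → ℝ} (hk : SmoothKernel k) {f : S2 → ℝ} (hf : Continuous f)
    (n : S2) (i : Fin 3) : grad (fun n => ∫ m, f m * k (n, m) ∂area) n i =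
      ∫ m, f m * grad (fun n => k (n, m)) n i ∂area := by
  obtain ⟨G, hG, h⟩ := hk
  simp only [h]
  have h1 := hasFDerivAt_integral_area hG hf (n : E3)
  rw [grad_comp_coe (F := fun x => ∫ m : S2, f m * G (x, m) ∂area) n h1.differentiableAt]
  have h2 : ∀ m : S2, ∀ k, fderiv ℝ (fun x => G (x, (m : E3))) (n : E3) (EuclideanSpace.single k 1)
      = fderiv ℝ G (n, m) (ContinuousLinearMap.inl ℝ E3 E3 (EuclideanSpace.single k 1)) := by
    intro m k
    have h := (hG.differentiable (by simp)).differentiableAt (x := ((n : E3), (m : E3)))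
    have h' := HasFDerivAt.comp (g := G) (f := fun x : E3 => (x, (m : E3))) (n : E3) h.hasFDerivAt
      (hasFDerivAt_prodMk_left (n : E3) (m : E3))
    change fderiv ℝ (G ∘ fun x => (x, (m : E3))) _ _ = _
    rw [h'.fderiv]
    rfl
  have h3 : ∀ m : S2, grad (fun n : S2 => G (n, m)) n i = ∑ k, proj n i k *
      fderiv ℝ G (n, m) (ContinuousLinearMap.inl ℝ E3 E3 (EuclideanSpace.single k 1)) := by
    intro m
    rw [grad_comp_coe (F := fun x => G (x, m)) n
      ((hG.differentiable (by simp)).comp (by fun_prop)).differentiableAt]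
    simp only [h2]
  have hd : Continuous (fderiv ℝ G) := hG.continuous_fderiv (by simp)
  have hc : Continuous fun m : S2 =>
      f m • (fderiv ℝ G (n, m)).comp (ContinuousLinearMap.inl ℝ E3 E3) :=
    hf.smul ((hd.comp (by fun_prop)).clm_comp continuous_const)
  have hi : Integrable (fun m : S2 =>
      f m • (fderiv ℝ G (n, m)).comp (ContinuousLinearMap.inl ℝ E3 E3)) area :=
    hc.integrable_of_hasCompactSupport (HasCompactSupport.of_compactSpace _)
  simp only [h1.fderiv, h3, ContinuousLinearMap.integral_apply hi, Finset.mul_sum]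
  rw [integral_finsetSum]
  · refine Finset.sum_congr rfl fun k _ => ?_
    rw [← integral_const_mul]
    refine integral_congr_ae (Eventually.of_forall fun m => ?_)
    simp
    ring
  · intro k _
    refine integrable_area ?_
    exact hf.mul (continuous_const.mul ((hd.comp (by fun_prop)).clm_apply continuous_const))

/-! ### Zonal integral operators -/

/-- Functions that are smooth on a neighbourhood of `(-∞, 1]`. -/
@[fun_prop]
def IsProfile (k : ℝ → ℝ) : Prop := ∀ s ≤ 1, ContDiffAt ℝ ∞ k s

namespace IsProfile

@[fun_prop]
lemma const (c : ℝ) : IsProfile (fun _ => c) := fun _ _ => contDiffAt_const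

@[fun_prop]
lemma id : IsProfile (fun s => s) := fun _ _ => contDiffAt_id

@[fun_prop]
lemma add {f g : ℝ → ℝ} (hf : IsProfile f) (hg : IsProfile g) : IsProfile (fun s => f s + g s) :=
  fun s hs => (hf s hs).add (hg s hs)

@[fun_prop]
lemma mul {f g : ℝ → ℝ} (hf : IsProfile f) (hg : IsProfile g) : IsProfile (fun s => f s * g s) :=
  fun s hs => (hf s hs).mul (hg s hs)

@[fun_prop]
lemma sub {f g : ℝ → ℝ} (hf : IsProfile f) (hg : IsProfile g) : IsProfile (fun s => f s - g s) :=
  fun s hs => (hf s hs).sub (hg s hs)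

@[fun_prop]
lemma pow {f : ℝ → ℝ} (hf : IsProfile f) (n : ℕ) : IsProfile (fun s => f s ^ n) :=
  fun s hs => (hf s hs).pow n

lemma smoothKernel {k : ℝ → ℝ} (hk : IsProfile k) :
    SmoothKernel (fun p => k (inner ℝ (p.1 : E3) (p.2 : E3))) := by
  -- On pairs of unit vectors this argument is the inner product, and on all of space it is at most
  -- `1`, where the profile is smooth.
  refine ⟨fun q => k (1 - ‖q.1 - q.2‖ ^ 2 / 2), ?_, fun p => ?_⟩
  · rw [contDiff_iff_contDiffAt]
    intro q
    have h : ContDiffAt ℝ ∞ (fun q : E3 × E3 => 1 - ‖q.1 - q.2‖ ^ 2 / 2) q :=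
      contDiffAt_const.sub (((contDiffAt_fst.sub contDiffAt_snd).norm_sq ℝ).div_const 2)
    exact (hk (1 - ‖q.1 - q.2‖ ^ 2 / 2) (by have := sq_nonneg ‖q.1 - q.2‖; linarith)).comp q h
  · beta_reduce
    rw [norm_sub_sq_real, S2.norm_coe, S2.norm_coe]
    congr 1
    ring

end IsProfile

lemma inner_eq_sum (x y : E3) : inner ℝ x y = ∑ i, x i * y i := by
  simp [PiLp.inner_apply, mul_comm]

lemma inner_sphere_le_one (n m : S2) : inner ℝ (n : E3) (m : E3) ≤ 1 := by
  simpa [S2.norm_coe] using real_inner_le_norm (n : E3) (m : E3)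

lemma abs_inner_sphere_le_one (n m : S2) : |inner ℝ (n : E3) (m : E3)| ≤ 1 := by
  simpa [S2.norm_coe] using abs_real_inner_le_norm (n : E3) (m : E3)

lemma SmoothS2.inner_left (m : S2) : SmoothS2 (fun n => inner ℝ (n : E3) (m : E3)) :=
  SmoothKernel.inner.fst m

lemma SmoothS2.inner_right (n : S2) : SmoothS2 (fun m => inner ℝ (n : E3) (m : E3)) :=
  SmoothKernel.inner.snd n

lemma grad_inner_left (n m : S2) (i : Fin 3) :
    grad (fun n => inner ℝ (n : E3) (m : E3)) n i =
      (m : E3) i - inner ℝ (n : E3) (m : E3) * (n : E3) i := by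
  have h : (fun n : S2 => inner ℝ (n : E3) (m : E3)) = fun n : S2 => ∑ k, (m : E3) k * (n : E3) k := by
    funext n
    simp only [inner_eq_sum, mul_comm]
  rw [h, grad_sum _ (fun k => by fun_prop)]
  simp only [grad_const_mul _ (SmoothS2.coord _), grad_coord]
  have := sum_proj_mul n i (fun k => (m : E3) k)
  simp only [inner_eq_sum]
  rw [Finset.sum_congr rfl fun k _ => mul_comm ((m : E3) k) _, this, mul_comm]

lemma grad_inner_right (n m : S2) (i : Fin 3) :
    grad (fun m => inner ℝ (n : E3) (m : E3)) m i =
      (n : E3) i - inner ℝ (n : E3) (m : E3) * (m : E3) i := by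
  simp only [real_inner_comm _ (n : E3)]
  exact grad_inner_left m n i

lemma grad_profile_left {k : ℝ → ℝ} {k' : ℝ} (n m : S2)
    (hk : HasDerivAt k k' (inner ℝ (n : E3) (m : E3))) (i : Fin 3) :
    grad (fun n => k (inner ℝ (n : E3) (m : E3))) n i =
      k' * ((m : E3) i - inner ℝ (n : E3) (m : E3) * (n : E3) i) := by
  rw [grad_comp_real (SmoothS2.inner_left m) n hk, grad_inner_left]

lemma grad_profile_right {k : ℝ → ℝ} {k' : ℝ} (n m : S2)
    (hk : HasDerivAt k k' (inner ℝ (n : E3) (m : E3))) (i : Fin 3) :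
    grad (fun m => k (inner ℝ (n : E3) (m : E3))) m i =
      k' * ((n : E3) i - inner ℝ (n : E3) (m : E3) * (m : E3) i) := by
  rw [grad_comp_real (SmoothS2.inner_right n) m hk, grad_inner_right]

/-- The integral operator with kernel `k (n · m)`. -/
def zonalOp (k : ℝ → ℝ) (f : S2 → ℝ) (n : S2) : ℝ :=
  ∫ m, f m * k (inner ℝ (n : E3) (m : E3)) ∂area

lemma SmoothS2.zonalOp {k : ℝ → ℝ} (hk : IsProfile k) {f : S2 → ℝ} (hf : Continuous f) :
    SmoothS2 (fun n => zonalOp k f n) := SmoothS2.integral hk.smoothKernel hf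

lemma IsProfile.continuous_right {k : ℝ → ℝ} (hk : IsProfile k) (n : S2) :
    Continuous fun m : S2 => k (inner ℝ (n : E3) (m : E3)) := (hk.smoothKernel.snd n).continuous

lemma grad_zonalOp {k k' : ℝ → ℝ} (hk : IsProfile k) (hd : ∀ s ≤ 1, HasDerivAt k (k' s) s)
    {f : S2 → ℝ} (hf : Continuous f) (n : S2) (i : Fin 3) : grad (fun n => zonalOp k f n) n i =
      ∫ m, f m * (k' (inner ℝ (n : E3) (m : E3)) *
        ((m : E3) i - inner ℝ (n : E3) (m : E3) * (n : E3) i)) ∂area := by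
  refine (grad_integral hk.smoothKernel hf n i).trans ?_
  refine integral_congr_ae (Eventually.of_forall fun m => ?_)
  simp only
  rw [grad_profile_left n m (hd _ (inner_sphere_le_one n m))]

lemma sum_epsS_mul (n : S2) (i : Fin 3) (W : Fin 3 → ℝ) :
    ∑ k, epsS n i k * W k = ![(n : E3) 2 * W 1 - (n : E3) 1 * W 2,
      (n : E3) 0 * W 2 - (n : E3) 2 * W 0, (n : E3) 1 * W 0 - (n : E3) 0 * W 1] i := by
  fin_cases i <;> simp [epsS_eq, Fin.sum_univ_three] <;> ring

lemma IsProfile.hasDerivAt {k : ℝ → ℝ} (hk : IsProfile k) (s : ℝ) (hs : s ≤ 1) :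
    HasDerivAt k (deriv k s) s := ((hk s hs).differentiableAt (by simp)).hasDerivAt

lemma IsProfile.deriv {k : ℝ → ℝ} (hk : IsProfile k) : IsProfile (deriv k) := fun s hs =>
  ((hk s hs).fderiv_right (m := ∞) (by simp)).clm_apply contDiffAt_const

/-- The kernel is invariant under simultaneous rotation of `n` and `m`, so rotating `n` is minus
rotating `m`; integration by parts moves the rotation to `f`. -/
lemma rot_zonalOp {k : ℝ → ℝ} (hk : IsProfile k) {f : S2 → ℝ} (hf : SmoothS2 f) (n : S2)
    (i : Fin 3) : rot (fun n => zonalOp k f n) n i = zonalOp k (fun m => rot f m i) n := by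
  have h := integral_mul_rot hf (hk.smoothKernel.snd n) i
  have h' : zonalOp k (fun m => rot f m i) n =
      - ∫ m, f m * rot (fun m => k (inner ℝ (n : E3) (m : E3))) m i ∂area := by
    rw [h, neg_neg]; rfl
  rw [h', rot]
  simp only [grad_zonalOp hk hk.hasDerivAt hf.continuous]
  simp only [← integral_const_mul]
  have hc : ∀ j, Continuous fun m : S2 => epsS n i j * (f m *
      (_root_.deriv k (inner ℝ (n : E3) (m : E3)) *
        ((m : E3) j - inner ℝ (n : E3) (m : E3) * (n : E3) j))) := by
    intro j
    have := hk.deriv.continuous_right n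
    have := hf.continuous
    fun_prop
  rw [← integral_finsetSum _ fun j _ => integrable_area (hc j), ← integral_neg]
  refine integral_congr_ae (Eventually.of_forall fun m => ?_)
  simp only [rot, grad_profile_right n m (hk.hasDerivAt _ (inner_sphere_le_one n m))]
  generalize _root_.deriv k (inner ℝ (n : E3) (m : E3)) = d
  generalize inner ℝ (n : E3) (m : E3) = μ
  fin_cases i <;> simp [Fin.sum_univ_three, epsS_eq] <;> ring

/-! ### The radiative order of the stress term -/

/-- The profile `1 / (1 - v s)`. -/
def kap (v s : ℝ) : ℝ := (1 - v * s)⁻¹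

/-- The profile `- log (1 - v s) / v`, an antiderivative of `kap`. -/
def logKap (v s : ℝ) : ℝ := - Real.log (1 - v * s) / v

lemma one_sub_mul_pos {v s : ℝ} (hv0 : 0 < v) (hv1 : v < 1) (hs : s ≤ 1) : 0 < 1 - v * s := by
  nlinarith

lemma one_sub_mul_inner_pos {v : ℝ} (hv0 : 0 < v) (hv1 : v < 1) (n m : S2) :
    0 < 1 - v * inner ℝ (n : E3) (m : E3) := one_sub_mul_pos hv0 hv1 (inner_sphere_le_one n m)

lemma isProfile_kap {v : ℝ} (hv0 : 0 < v) (hv1 : v < 1) : IsProfile (kap v) := fun s hs =>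
  ContDiffAt.inv (f := fun s => 1 - v * s) (by fun_prop) (one_sub_mul_pos hv0 hv1 hs).ne'

lemma isProfile_logKap {v : ℝ} (hv0 : 0 < v) (hv1 : v < 1) : IsProfile (logKap v) := fun s hs =>
  ((ContDiffAt.log (f := fun s => 1 - v * s) (by fun_prop) (one_sub_mul_pos hv0 hv1 hs).ne').neg).div_const v

lemma hasDerivAt_kap {v s : ℝ} (hv0 : 0 < v) (hv1 : v < 1) (hs : s ≤ 1) :
    HasDerivAt (kap v) (v * kap v s ^ 2) s := by
  have h := (one_sub_mul_pos hv0 hv1 hs).ne'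
  have h1 : HasDerivAt (fun s => 1 - v * s) (-v) s := by
    simpa using ((hasDerivAt_id s).const_mul v).const_sub 1
  refine (h1.fun_inv h).congr_deriv ?_
  unfold kap
  field_simp

lemma hasDerivAt_logKap {v s : ℝ} (hv0 : 0 < v) (hv1 : v < 1) (hs : s ≤ 1) :
    HasDerivAt (logKap v) (kap v s) s := by
  have h := (one_sub_mul_pos hv0 hv1 hs).ne'
  have h1 : HasDerivAt (fun s => 1 - v * s) (-v) s := by
    simpa using ((hasDerivAt_id s).const_mul v).const_sub 1
  refine (((h1.log h).neg).div_const v).congr_deriv ?_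
  unfold kap
  field_simp

/-- Contraction with `n` multiplies the kernel by `v n·m`; by this identity that reproduces the
kernel up to a constant, whence the null conditions for dust and stress. -/
lemma mul_kap {v s : ℝ} (hv0 : 0 < v) (hv1 : v < 1) (hs : s ≤ 1) :
    v * s * kap v s = kap v s - 1 := by
  have h := (one_sub_mul_pos hv0 hv1 hs).ne'
  unfold kap
  field_simp
  ring

lemma radiative_eq (v : ℝ) (τ : S2 → Fin 4 → Fin 4 → ℝ) (n : S2) (a b : Fin 4) :
    radiative v τ n a b = 4 * zonalOp (kap v) (fun m => τ m a b) n := by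
  simp only [radiative, zonalOp, kap, div_eq_mul_inv]

lemma zonalOp_const_mul (k : ℝ → ℝ) (c : ℝ) (f : S2 → ℝ) (n : S2) :
    zonalOp k (fun m => c * f m) n = c * zonalOp k f n := by
  simp only [zonalOp, mul_assoc]
  exact integral_const_mul _ _

lemma radiative_lStress_zero_zero (v : ℝ) (α : S2 → ℝ) (n : S2) :
    radiative v (lStress v α) n 0 0 = 0 := by
  simp [radiative, lStress_zero_zero]

lemma radiative_symm (v : ℝ) {τ : S2 → Fin 4 → Fin 4 → ℝ} (hτ : ∀ n a b, τ n a b = τ n b a) (n : S2)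
    (a b : Fin 4) : radiative v τ n a b = radiative v τ n b a := by
  simp only [radiative, hτ _ a b]

lemma radiative_lStress_zero_succ {v : ℝ} (hv0 : 0 < v) (hv1 : v < 1) {α : S2 → ℝ}
    (hα : SmoothS2 α) (n : S2) (i : Fin 3) : radiative v (lStress v α) n 0 i.succ =
      2 * gam v * rot (fun n => zonalOp (kap v) (radialPotential α) n) n i := by
  rw [radiative_eq, rot_zonalOp (isProfile_kap hv0 hv1) hα.radialPotential]
  simp only [lStress_zero_succ v hα, zonalOp_const_mul]
  ring

/-- The radial flux of momentum is its density carried along with speed `v`. The sign comes from the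
lowered time index. -/
lemma sum_mul_lStress (v : ℝ) {α : S2 → ℝ} (hα : SmoothS2 α) (m : S2) (j : Fin 3) :
    ∑ i : Fin 3, (m : E3) i * lStress v α m i.succ j.succ = - v * lStress v α m 0 j.succ := by
  have hS := (isSolenoidal_rot hα)
  have h1 := rot_tangent α m
  have h2 := normal_grad_tangent hS.1 hS.2.1 m j
  have h3 : ∑ i, (m : E3) i * grad (fun m => rot α m j) m i = 0 := grad_normal (hα.rot j) m
  have h4 := rot_tangent (radialPotential α) m
  have h5 := m.sum_sq
  simp only [lStress_succ_succ v hα, lStress_zero_succ v hα, cov_tangent hS.1 hS.2.1]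
  simp only [Fin.sum_univ_three] at *
  linear_combination gam v * v / 2 * (h2 + h3 - h4 * (m : E3) j + 2 * h1 * (m : E3) j
    - h1 * (m : E3) j) - gam v * v / 2 * (rot α m j - rot (radialPotential α) m j) * h5

/-- The radiative order of the stress term satisfies the Lorenz gauge condition. -/
lemma sum_mul_radiative_lStress {v : ℝ} (hv0 : 0 < v) (hv1 : v < 1) {α : S2 → ℝ}
    (hα : SmoothS2 α) (n : S2) (j : Fin 3) :
    ∑ i : Fin 3, (n : E3) i * radiative v (lStress v α) n i.succ j.succ =
      - radiative v (lStress v α) n 0 j.succ := by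
  have hK := isProfile_kap hv0 hv1
  have hc := hK.continuous_right n
  -- Conservation is tested on `logKap v (n · m)`, whose gradient in `m` is `kap` times the
  -- tangential part of `n`. The radial part of `n` is handled by `mul_kap`, at the price of a
  -- constant times the integral of `rot β`, which is zero.
  have h := integral_lStress_mul_grad v hα ((isProfile_logKap hv0 hv1).smoothKernel.snd n) j
  have hR : ∫ m, rot (radialPotential α) m j ∂area = 0 := integral_rot hα.radialPotential j
  have hl : ∀ i : Fin 3, Continuous fun m => lStress v α m i.succ j.succ :=
    fun i => (SmoothS2.lStress v hα i.succ j.succ).continuous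
  have hl0 : Continuous fun m => lStress v α m 0 j.succ := (SmoothS2.lStress v hα 0 j.succ).continuous
  have hRc : Continuous fun m => rot (radialPotential α) m j :=
    (SmoothS2.rot hα.radialPotential j).continuous
  have hn := fun m => sum_mul_lStress v hα m j
  have h6 : ∑ i : Fin 3, (n : E3) i * radiative v (lStress v α) n i.succ j.succ
      + radiative v (lStress v α) n 0 j.succ =
      4 * (∫ m, ∑ i : Fin 3, lStress v α m i.succ j.succ *
        grad (fun m => logKap v (inner ℝ (n : E3) (m : E3))) m i ∂area
      + gam v / 2 * ∫ m, rot (radialPotential α) m j ∂area) := by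
    simp only [radiative_eq, zonalOp, mul_left_comm _ (4 : ℝ), ← Finset.mul_sum, ← mul_add,
      ← integral_const_mul ((n : E3) _)]
    congr 1
    rw [← integral_finsetSum, ← integral_add, ← integral_const_mul, ← integral_add]
    · refine integral_congr_ae (Eventually.of_forall fun m => ?_)
      have h7 := hn m
      have h8 := mul_kap hv0 hv1 (inner_sphere_le_one n m)
      simp only [grad_profile_right n m (hasDerivAt_logKap hv0 hv1 (inner_sphere_le_one n m))]
      rw [lStress_zero_succ v hα] at *
      generalize kap v (inner ℝ (n : E3) (m : E3)) = k at *
      generalize inner ℝ (n : E3) (m : E3) = μ at *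
      simp only [Fin.sum_univ_three] at *
      linear_combination k * μ * h7 - gam v / 2 * rot (radialPotential α) m j * h8
    · refine integrable_area (continuous_finsetSum _ fun i _ => (hl i).mul ?_)
      exact (((isProfile_logKap hv0 hv1).smoothKernel.snd n).grad i).continuous
    · exact integrable_area (continuous_const.mul hRc)
    · exact integrable_area (continuous_finsetSum _ fun i _ =>
        continuous_const.mul ((hl i).mul hc))
    · exact integrable_area (hl0.mul hc)
    · exact fun i _ => integrable_area (continuous_const.mul ((hl i).mul hc))
  rw [h, hR] at h6
  linarith


/-- The potential of the angular part of the radiative order of the stress term. -/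
def memoryPotential (v : ℝ) (α : S2 → ℝ) (n : S2) : ℝ :=
  -(4 * gam v * v) * (zonalOp (logKap v) (radialPotential α) n
    - zonalOp (fun s => 2 * logKap v s + s * kap v s) α n)

lemma SmoothS2.memoryPotential {v : ℝ} (hv0 : 0 < v) (hv1 : v < 1) {α : S2 → ℝ}
    (hα : SmoothS2 α) : SmoothS2 (memoryPotential v α) := by
  have h1 := isProfile_kap hv0 hv1
  have h2 := isProfile_logKap hv0 hv1
  have h3 := SmoothS2.zonalOp h2 hα.radialPotential.continuous
  have h4 := SmoothS2.zonalOp (k := fun s => 2 * logKap v s + s * kap v s) (by fun_prop)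
    hα.continuous
  unfold ShellMemory.memoryPotential
  fun_prop

lemma rot_const_mul (c : ℝ) {f : S2 → ℝ} (hf : SmoothS2 f) (n : S2) (i : Fin 3) :
    rot (fun n => c * f n) n i = c * rot f n i := by
  simp only [rot, grad_const_mul c hf, Finset.mul_sum, mul_left_comm c]

lemma rot_sub {f g : S2 → ℝ} (hf : SmoothS2 f) (hg : SmoothS2 g) (n : S2) (i : Fin 3) :
    rot (fun n => f n - g n) n i = rot f n i - rot g n i := by
  simp only [rot, grad_sub hf hg, mul_sub, Finset.sum_sub_distrib]

lemma rot_memoryPotential {v : ℝ} (hv0 : 0 < v) (hv1 : v < 1) {α : S2 → ℝ} (hα : SmoothS2 α)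
    (n : S2) (i : Fin 3) : rot (memoryPotential v α) n i = -(4 * gam v * v) *
      (zonalOp (logKap v) (fun m => rot (radialPotential α) m i) n
        - zonalOp (fun s => 2 * logKap v s + s * kap v s) (fun m => rot α m i) n) := by
  have h1 := isProfile_kap hv0 hv1
  have h2 := isProfile_logKap hv0 hv1
  have h5 : IsProfile (fun s => 2 * logKap v s + s * kap v s) := by fun_prop
  have h3 := SmoothS2.zonalOp h2 hα.radialPotential.continuous
  have h4 := SmoothS2.zonalOp h5 hα.continuous
  unfold memoryPotential
  rw [rot_const_mul _ (h3.sub h4), rot_sub h3 h4, rot_zonalOp h2 hα.radialPotential,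
    rot_zonalOp h5 hα]

/-- The weight `(3 k + v μ k²) rot α - k rot β` with `β` the radial potential and `k = kap v μ`. -/
def memoryWeight (v : ℝ) (α : S2 → ℝ) (n m : S2) (i : Fin 3) : ℝ :=
  rot α m i * (3 * kap v (inner ℝ (n : E3) (m : E3))
    + v * inner ℝ (n : E3) (m : E3) * kap v (inner ℝ (n : E3) (m : E3)) ^ 2)
  - rot (radialPotential α) m i * kap v (inner ℝ (n : E3) (m : E3))

lemma continuous_memoryWeight {v : ℝ} (hv0 : 0 < v) (hv1 : v < 1) {α : S2 → ℝ} (hα : SmoothS2 α)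
    (n : S2) (i : Fin 3) : Continuous fun m => memoryWeight v α n m i := by
  have h1 := (isProfile_kap hv0 hv1).continuous_right n
  have h2 := IsProfile.id.continuous_right n
  have h3 := (hα.rot i).continuous
  have h4 := (hα.radialPotential.rot i).continuous
  unfold memoryWeight
  fun_prop

/-- The profiles in `memoryPotential` are antiderivatives, chosen so that one differentiation gives
the kernels of `memoryWeight`: `kap` for `logKap`, and `3 kap + v s kap²` for `2 logKap + s kap`. -/
lemma grad_rot_memoryPotential {v : ℝ} (hv0 : 0 < v) (hv1 : v < 1) {α : S2 → ℝ} (hα : SmoothS2 α)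
    (n : S2) (i j : Fin 3) : grad (fun n => rot (memoryPotential v α) n i) n j =
      4 * gam v * v * ∫ m, memoryWeight v α n m i *
        ((m : E3) j - inner ℝ (n : E3) (m : E3) * (n : E3) j) ∂area := by
  have h1 := isProfile_kap hv0 hv1
  have h2 := isProfile_logKap hv0 hv1
  have h5 : IsProfile (fun s => 2 * logKap v s + s * kap v s) := by fun_prop
  have hR := (hα.radialPotential.rot i).continuous
  have hS := (hα.rot i).continuous
  have h3 := SmoothS2.zonalOp h2 hR
  have h4 := SmoothS2.zonalOp h5 hS
  have hd : ∀ s ≤ 1, HasDerivAt (fun s => 2 * logKap v s + s * kap v s)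
      (3 * kap v s + v * s * kap v s ^ 2) s := by
    intro s hs
    refine (((hasDerivAt_logKap hv0 hv1 hs).const_mul 2).add
      ((hasDerivAt_id s).mul (hasDerivAt_kap hv0 hv1 hs))).congr_deriv ?_
    simp only [id]
    ring
  have h6 := h1.continuous_right n
  have h7 := IsProfile.id.continuous_right n
  simp only [rot_memoryPotential hv0 hv1 hα]
  rw [grad_const_mul _ (h3.sub h4), grad_sub h3 h4,
    grad_zonalOp h2 (fun s hs => hasDerivAt_logKap hv0 hv1 hs) hR, grad_zonalOp h5 hd hS,
    ← integral_sub, neg_mul, ← mul_neg, ← integral_neg]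
  · congr 1
    refine integral_congr_ae (Eventually.of_forall fun m => ?_)
    simp only [memoryWeight]
    ring
  · exact integrable_area (by fun_prop)
  · exact integrable_area (by fun_prop)

lemma radiative_lStress_succ_succ {v : ℝ} (hv0 : 0 < v) (hv1 : v < 1) {α : S2 → ℝ}
    (hα : SmoothS2 α) (n : S2) (i j : Fin 3) : radiative v (lStress v α) n i.succ j.succ =
      2 * gam v * v * (∫ m, memoryWeight v α n m j * (m : E3) i ∂area
        + ∫ m, memoryWeight v α n m i * (m : E3) j ∂area
        - (n : E3) i * ∫ m, v * kap v (inner ℝ (n : E3) (m : E3)) ^ 2 * rot α m j ∂area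
        - (n : E3) j * ∫ m, v * kap v (inner ℝ (n : E3) (m : E3)) ^ 2 * rot α m i ∂area) := by
  have hK := isProfile_kap hv0 hv1
  have hKs : SmoothS2 fun m : S2 => kap v (inner ℝ (n : E3) (m : E3)) := hK.smoothKernel.snd n
  have hKc := hKs.continuous
  have hS := isSolenoidal_rot hα
  have hSc : ∀ i, Continuous fun m => rot α m i := fun i => (hS.1 i).continuous
  have hY := continuous_memoryWeight hv0 hv1 hα n
  have hl : Continuous fun m => lStress v α m i.succ j.succ :=
    (SmoothS2.lStress v hα i.succ j.succ).continuous
  -- The divergence theorem for `kap · rot α`. Adding two such zeros trades the derivatives of `rot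
  -- α` in the stress for derivatives of the kernel.
  have hg : ∀ i j : Fin 3, ∫ m, (grad (fun m => kap v (inner ℝ (n : E3) (m : E3)) * rot α m j) m i
      - 2 * ((m : E3) i * (kap v (inner ℝ (n : E3) (m : E3)) * rot α m j))) ∂area = 0 := by
    intro i j
    rw [integral_sub, integral_grad (hKs.mul (hS.1 j)), integral_const_mul, sub_self]
    · exact integrable_area ((hKs.mul (hS.1 j)).grad i).continuous
    · exact integrable_area (by fun_prop)
  have hgi : ∀ i j : Fin 3, Integrable (fun m =>
      (grad (fun m => kap v (inner ℝ (n : E3) (m : E3)) * rot α m j) m i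
      - 2 * ((m : E3) i * (kap v (inner ℝ (n : E3) (m : E3)) * rot α m j)))) area := by
    intro i j
    have := ((hKs.mul (hS.1 j)).grad i).continuous
    exact integrable_area (by fun_prop)
  rw [← add_zero (radiative _ _ _ _ _), ← mul_zero (-(2 * gam v * v)), ← add_zero (0 : ℝ)]
  nth_rw 2 [← hg i j]
  rw [← hg j i, radiative_eq, zonalOp]
  rw [← integral_add (hgi j i) (hgi i j), ← integral_const_mul, ← integral_const_mul,
    ← integral_add, ← integral_const_mul ((n : E3) i), ← integral_const_mul ((n : E3) j),
    ← integral_add, ← integral_sub, ← integral_sub, ← integral_const_mul]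
  · refine integral_congr_ae (Eventually.of_forall fun m => ?_)
    simp only [memoryWeight, lStress_succ_succ v hα, cov_tangent hS.1 hS.2.1,
      grad_mul hKs (hS.1 _),
      grad_profile_right n m (hasDerivAt_kap hv0 hv1 (inner_sphere_le_one n m))]
    ring
  all_goals first
    | exact ((hgi j i).add (hgi i j)).const_mul _
    | exact integrable_area (by fun_prop)

lemma cov_rot_memoryPotential {v : ℝ} (hv0 : 0 < v) (hv1 : v < 1) {α : S2 → ℝ} (hα : SmoothS2 α)
    (n : S2) (i j : Fin 3) : cov (rot (memoryPotential v α)) n j i = 4 * gam v * v *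
      (∫ m, memoryWeight v α n m i * (m : E3) j ∂area
        - (n : E3) j * ∑ k, (n : E3) k * ∫ m, memoryWeight v α n m i * (m : E3) k ∂area
        - (n : E3) i * ∑ k, (n : E3) k * (∫ m, memoryWeight v α n m k * (m : E3) j ∂area
        - (n : E3) j * ∑ l, (n : E3) l * ∫ m, memoryWeight v α n m k * (m : E3) l ∂area)) := by
  have h : ∀ i, grad (fun n => rot (memoryPotential v α) n i) n j = 4 * gam v * v *
      (∫ m, memoryWeight v α n m i * (m : E3) j ∂area
        - (n : E3) j * ∑ k, (n : E3) k * ∫ m, memoryWeight v α n m i * (m : E3) k ∂area) := by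
    intro i
    have hY := continuous_memoryWeight hv0 hv1 hα n i
    rw [grad_rot_memoryPotential hv0 hv1 hα]
    simp only [← integral_const_mul ((n : E3) _)]
    rw [← integral_finsetSum, ← integral_const_mul ((n : E3) _), ← integral_sub]
    · congr 2
      funext m
      simp only [inner_eq_sum, Fin.sum_univ_three]
      ring
    · exact integrable_area (by fun_prop)
    · exact integrable_area (by fun_prop)
    · exact fun k _ => integrable_area (by fun_prop)
  rw [cov, sum_proj_mul]
  simp only [h, Fin.sum_univ_three]
  ring

/-- The decomposition of the spatial components of the radiative order of the stress term. -/
lemma radiative_lStress_decomp {v : ℝ} (hv0 : 0 < v) (hv1 : v < 1) {α : S2 → ℝ}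
    (hα : SmoothS2 α) (n : S2) (i j : Fin 3) : radiative v (lStress v α) n i.succ j.succ =
      -((n : E3) i * radiative v (lStress v α) n 0 j.succ)
      - radiative v (lStress v α) n 0 i.succ * (n : E3) j
      + (cov (rot (memoryPotential v α)) n i j + cov (rot (memoryPotential v α)) n j i) / 2 := by
  have hQ := sum_mul_radiative_lStress hv0 hv1 hα n
  have hP : ∑ j, (n : E3) j * radiative v (lStress v α) n 0 j.succ = 0 := by
    simp only [radiative_lStress_zero_succ hv0 hv1 hα]
    simp only [mul_left_comm _ (2 * gam v), ← Finset.mul_sum, rot_tangent, mul_zero]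
  have hR := radiative_lStress_succ_succ hv0 hv1 hα n
  have hC := cov_rot_memoryPotential hv0 hv1 hα n
  have h5 := n.sum_sq
  rw [hC, hC]
  have hi := hQ i
  have hj := hQ j
  -- The `rr` component vanishes: the gauge condition turns it into the radial part of a tangent
  -- covector.
  have hPP : ∑ j, (n : E3) j * ∑ i, (n : E3) i * radiative v (lStress v α) n i.succ j.succ = 0 := by
    simp only [hQ, mul_neg, Finset.sum_neg_distrib, hP, neg_zero]
  rw [← neg_eq_iff_eq_neg] at hi hj
  rw [← hi, ← hj]
  simp only [hR] at hPP ⊢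
  -- All the integrals are now entries of a vector `B` and a matrix `A`, and the claim is algebra:
  -- both sides have the same symmetrised tangential block of `A`, while the terms in `B` are
  -- proportional to `n`.
  obtain ⟨B, hB⟩ : ∃ B : Fin 3 → ℝ, ∀ j,
    ∫ m, v * kap v (inner ℝ (n : E3) (m : E3)) ^ 2 * rot α m j ∂area = B j := ⟨_, fun _ => rfl⟩
  obtain ⟨A, hA⟩ : ∃ A : Fin 3 → Fin 3 → ℝ, ∀ j k,
    ∫ m, memoryWeight v α n m j * (m : E3) k ∂area = A j k := ⟨_, fun _ _ => rfl⟩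
  simp only [hA, hB, Fin.sum_univ_three] at hPP ⊢
  linear_combination -((n : E3) i * (n : E3) j) * hPP + 2 * gam v * v *
    (-((n : E3) i * B j + (n : E3) j * B i) + 2 * (n : E3) i * (n : E3) j *
      ((n : E3) 0 * B 0 + (n : E3) 1 * B 1 + (n : E3) 2 * B 2)) * h5


theorem isVectorType_radiative_lStress {v : ℝ} (hv0 : 0 < v) (hv1 : v < 1) {α : S2 → ℝ}
    (hα : SmoothS2 α) : IsVectorType (radiative v (lStress v α)) := by
  have hP : IsSolenoidal (fun n i => radiative v (lStress v α) n 0 (Fin.succ i)) := by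
    simp only [radiative_lStress_zero_succ hv0 hv1 hα]
    exact (isSolenoidal_rot (SmoothS2.zonalOp (isProfile_kap hv0 hv1)
      hα.radialPotential.continuous)).const_mul _
  -- The Lorenz gauge makes the `rA` part minus the `tA` part.
  refine ⟨_, _, _, hP, hP.const_mul (-1), isSolenoidal_rot (SmoothS2.memoryPotential hv0 hv1 hα),
    fun n => ⟨radiative_lStress_zero_zero v α n,
      fun i => ⟨rfl, radiative_symm v (lStress_symm v α) n _ _⟩, fun i j => ?_⟩⟩
  rw [radiative_lStress_decomp hv0 hv1 hα]
  ring

/-! ### The radiative order of the dust -/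

lemma integral_coord (i : Fin 3) : ∫ n : S2, (n : E3) i ∂area = 0 := by
  have h := integral_grad (SmoothS2.const 1) i
  simp only [grad_const, integral_zero, mul_one] at h
  linarith

lemma gam_sq {v : ℝ} (hv0 : 0 < v) (hv1 : v < 1) : gam v ^ 2 * (1 - v ^ 2) = 1 := by
  have h : 0 < 1 - v ^ 2 := by nlinarith
  rw [gam, inv_pow, Real.sq_sqrt h.le, inv_mul_cancel₀ h.ne']

lemma gam_pos {v : ℝ} (hv0 : 0 < v) (hv1 : v < 1) : 0 < gam v :=
  inv_pos.2 (Real.sqrt_pos.2 (by nlinarith))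

lemma SmoothS2.vel (v : ℝ) (a : Fin 4) : SmoothS2 (fun n => vel v n a) := by
  refine Fin.cases ?_ (fun i => ?_) a
  · exact SmoothS2.const _
  · exact SmoothS2.mul (SmoothS2.const _) (SmoothS2.coord i)

lemma SmoothS2.dust (v : ℝ) (a b : Fin 4) : SmoothS2 (fun n => dust v n a b) :=
  (SmoothS2.vel v a).mul (SmoothS2.vel v b)

lemma dust_symm (v : ℝ) (n : S2) (a b : Fin 4) : dust v n a b = dust v n b a := mul_comm _ _

lemma integral_vel (v : ℝ) (a : Fin 4) :
    ∫ n, vel v n a ∂area = -(4 * Real.pi * gam v) * (if a = 0 then 1 else 0) := by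
  refine Fin.cases ?_ (fun i => ?_) a
  · simp [vel, area_real_univ]
  · simp [vel, integral_const_mul, integral_coord]

/-- The divergence of the radiative order of the dust. -/
lemma radiative_dust_null {v : ℝ} (hv0 : 0 < v) (hv1 : v < 1) (n : S2) (a : Fin 4) :
    radiative v (dust v) n a 0 + ∑ i : Fin 3, (n : E3) i * radiative v (dust v) n a i.succ =
      4 * shellEnergy v 1 * (if a = 0 then 1 else 0) := by
  have hK := (isProfile_kap hv0 hv1).continuous_right n
  have hd : ∀ a b, Continuous fun m => dust v m a b := fun a b => (SmoothS2.dust v a b).continuous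
  simp only [radiative_eq, zonalOp, mul_left_comm _ (4 : ℝ), ← Finset.mul_sum, ← mul_add,
    ← integral_const_mul ((n : E3) _)]
  rw [← integral_finsetSum _ fun i _ => integrable_area (by have := hd a i.succ; fun_prop),
    ← integral_add (integrable_area (by have := hd a 0; fun_prop)) (integrable_area
      (continuous_finsetSum _ fun i _ => by have := hd a i.succ; fun_prop))]
  -- The contraction produces the factor `1 - v n·m`, which cancels the kernel and leaves the
  -- momentum density of the dust.
  have h : ∀ m : S2, dust v m a 0 * kap v (inner ℝ (n : E3) (m : E3)) + ∑ i : Fin 3, (n : E3) i *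
      (dust v m a i.succ * kap v (inner ℝ (n : E3) (m : E3))) = - gam v * vel v m a := by
    intro m
    have h8 := mul_kap hv0 hv1 (inner_sphere_le_one n m)
    rw [inner_eq_sum] at *
    simp only [Fin.sum_univ_three] at *
    simp only [dust]
    generalize vel v m a = w
    simp only [vel, Fin.cons_zero, Fin.cons_succ]
    linear_combination gam v * w * h8
  simp only [h, integral_const_mul, integral_vel, shellEnergy]
  ring

lemma SmoothS2.kap_right {v : ℝ} (hv0 : 0 < v) (hv1 : v < 1) (n : S2) :
    SmoothS2 fun m : S2 => kap v (inner ℝ (n : E3) (m : E3)) :=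
  (isProfile_kap hv0 hv1).smoothKernel.snd n

/-- The second moments of the kernel are isotropic about `n`. -/
lemma proj_integral_kap {v : ℝ} (hv0 : 0 < v) (hv1 : v < 1) (n : S2) (i j : Fin 3) :
    ∑ k, ∑ l, proj n i k * proj n j l *
        ∫ m, (m : E3) k * (m : E3) l * kap v (inner ℝ (n : E3) (m : E3)) ∂area =
      (∫ m, (1 - inner ℝ (n : E3) (m : E3) ^ 2) * kap v (inner ℝ (n : E3) (m : E3)) ∂area) / 2
        * proj n i j := by
  have hK := (isProfile_kap hv0 hv1).continuous_right n
  have hG := (isProfile_logKap hv0 hv1).smoothKernel.snd n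
  have hGc := hG.continuous
  -- The kernel times `m`, turned about `n`, is minus the rotation derivative of `logKap`. By parts
  -- it falls on the coordinate and gives an antisymmetric matrix, so the symmetrisation required by
  -- `isotropic_of_commute` vanishes.
  have hM : ∀ i j, ∑ k, epsS n i k * ∫ m, (m : E3) k * (m : E3) j *
      kap v (inner ℝ (n : E3) (m : E3)) ∂area =
      ∫ m, epsS m i j * logKap v (inner ℝ (n : E3) (m : E3)) ∂area := by
    intro i j
    have h := integral_mul_rot (SmoothS2.coord j) hG i
    simp only [← integral_const_mul (epsS n i _)]
    rw [← integral_finsetSum _ fun k _ => integrable_area (by fun_prop)]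
    calc _ = - ∫ m, (m : E3) j * rot (fun m => logKap v (inner ℝ (n : E3) (m : E3))) m i ∂area := by
          rw [← integral_neg]
          refine integral_congr_ae (Eventually.of_forall fun m => ?_)
          simp only [rot,
            grad_profile_right n m (hasDerivAt_logKap hv0 hv1 (inner_sphere_le_one n m))]
          generalize kap v (inner ℝ (n : E3) (m : E3)) = k
          generalize inner ℝ (n : E3) (m : E3) = μ
          fin_cases i <;> simp [Fin.sum_univ_three, epsS_eq] <;> ring
      _ = _ := by
          rw [h, neg_neg]
          refine integral_congr_ae (Eventually.of_forall fun m => ?_)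
          simp only [rot, grad_coord]
          congr 1
          have := sum_epsS_mul m i (fun k => proj m k j)
          rw [this]
          have h5 := m.sum_sq
          fin_cases i <;> fin_cases j <;> simp [proj, epsS_eq] <;> ring
  rw [isotropic_of_commute n _ (fun i j => by simp only [mul_comm ((_ : E3) i)])]
  · congr 2
    simp only [← integral_const_mul ((n : E3) _ * _)]
    have hc : ∀ k l, Continuous fun m : S2 => (n : E3) k * (n : E3) l * ((m : E3) k * (m : E3) l *
        kap v (inner ℝ (n : E3) (m : E3))) := fun k l => by fun_prop
    have hs : ∀ k, ∑ l, ∫ m : S2, (n : E3) k * (n : E3) l * ((m : E3) k * (m : E3) l *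
        kap v (inner ℝ (n : E3) (m : E3))) ∂area = ∫ m : S2, ∑ l, (n : E3) k * (n : E3) l *
          ((m : E3) k * (m : E3) l * kap v (inner ℝ (n : E3) (m : E3))) ∂area :=
      fun k => (integral_finsetSum _ fun l _ => integrable_area (hc k l)).symm
    simp only [hs]
    rw [← integral_finsetSum _ fun k _ => integrable_area (by fun_prop),
      ← integral_finsetSum _ fun k _ => integrable_area
        (continuous_finsetSum _ fun l _ => hc k l),
      ← integral_sub (integrable_area (by fun_prop)) (integrable_area
        (continuous_finsetSum _ fun k _ => continuous_finsetSum _ fun l _ => hc k l))]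
    refine integral_congr_ae (Eventually.of_forall fun m => ?_)
    have h5 := m.sum_sq
    simp only [inner_eq_sum]
    generalize kap v _ = q
    simp only [Fin.sum_univ_three]
    linear_combination -q * h5
  · intro i j
    rw [Finset.sum_add_distrib, hM, hM, ← integral_add]
    · refine integral_eq_zero_of_ae (Eventually.of_forall fun m => ?_)
      fin_cases i <;> fin_cases j <;> simp [epsS_eq]
    · exact integrable_area (((SmoothS2.epsS i j).continuous).mul hGc)
    · exact integrable_area (((SmoothS2.epsS j i).continuous).mul hGc)


/-! ### Trace reversal and the angular projection. -/

lemma eta_succ_succ (i j : Fin 3) : eta i.succ j.succ = if i = j then 1 else 0 := by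
  simp [eta, Fin.succ_ne_zero]

lemma eta_zero_succ (i : Fin 3) : eta 0 i.succ = 0 := by simp [eta, (Fin.succ_ne_zero i).symm]

lemma eta_succ_zero (i : Fin 3) : eta i.succ 0 = 0 := by simp [eta, Fin.succ_ne_zero i]

lemma eta_zero_zero : eta 0 0 = -1 := by simp [eta]

lemma sum_proj_proj_mul (n : S2) (i j : Fin 3) : ∑ k, ∑ l, proj n i k * proj n j l *
    (if k = l then (1 : ℝ) else 0) = proj n i j := by
  have h5 := n.sum_sq
  simp only [mul_ite, mul_one, mul_zero, Finset.sum_ite_eq, Finset.mem_univ, if_true, proj]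
  fin_cases i <;> fin_cases j <;> simp [Fin.sum_univ_three] <;>
    generalize (n : E3) 0 = x at * <;> generalize (n : E3) 1 = y at * <;>
    generalize (n : E3) 2 = z at * <;> beta_reduce at * <;> grobner

lemma angular_zero_left (H : Fin 4 → Fin 4 → ℝ) (n : S2) (b : Fin 4) : angular H n 0 b = 0 := rfl

lemma angular_zero_right (H : Fin 4 → Fin 4 → ℝ) (n : S2) (a : Fin 4) : angular H n a 0 = 0 := by
  refine Fin.cases rfl (fun i => rfl) a

lemma angular_succ_succ (H : Fin 4 → Fin 4 → ℝ) (n : S2) (i j : Fin 3) :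
    angular H n i.succ j.succ = ∑ k, ∑ l, proj n i k * proj n j l * H k.succ l.succ := rfl

lemma sum_eta_smul {V : Type*} [AddCommGroup V] [Module ℝ V] (H : Fin 4 → V) :
    ∑ c, eta c c • H c = ∑ k : Fin 3, H k.succ - H 0 := by
  rw [Fin.sum_univ_succ]
  simp only [eta_zero_zero, eta_succ_succ, if_true, one_smul, neg_smul]
  abel

lemma angular_traceRev (H : Fin 4 → Fin 4 → ℝ) (n : S2) (i j : Fin 3) :
    angular (traceRev H) n i.succ j.succ = ∑ k, ∑ l, proj n i k * proj n j l * H k.succ l.succ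
      - proj n i j / 2 * (∑ k : Fin 3, H k.succ k.succ - H 0 0) := by
  have h := sum_proj_proj_mul n i j
  rw [angular_succ_succ]
  simp only [traceRev, sum_eta_smul, eta_succ_succ]
  generalize ∑ k : Fin 3, H k.succ k.succ - H 0 0 = t
  rw [← h]
  simp only [smul_eq_mul, Finset.sum_mul, Finset.sum_div, ← Finset.sum_sub_distrib]
  refine Finset.sum_congr rfl fun k _ => Finset.sum_congr rfl fun l _ => ?_
  ring

/-- Uses only the normalisation `u_a u^a = -1`. -/
lemma trace_radiative_dust {v : ℝ} (hv0 : 0 < v) (hv1 : v < 1) (n : S2) :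
    ∑ k : Fin 3, radiative v (dust v) n k.succ k.succ - radiative v (dust v) n 0 0 =
      - 4 * ∫ m, kap v (inner ℝ (n : E3) (m : E3)) ∂area := by
  have hK := (isProfile_kap hv0 hv1).continuous_right n
  have hd : ∀ a b, Continuous fun m => dust v m a b := fun a b => (SmoothS2.dust v a b).continuous
  simp only [radiative_eq, zonalOp, ← Finset.mul_sum]
  rw [← integral_finsetSum _ fun k _ => integrable_area ((hd k.succ k.succ).mul hK), ← mul_sub,
    ← integral_sub (integrable_area (by have := fun k : Fin 3 => hd k.succ k.succ; fun_prop))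
      (integrable_area (by have := hd 0 0; fun_prop)), neg_mul, ← mul_neg, ← integral_neg]
  congr 2
  funext m
  have h5 := m.sum_sq
  have hg := gam_sq hv0 hv1
  generalize kap v _ = q
  simp only [dust, vel, Fin.cons_zero, Fin.cons_succ, Fin.sum_univ_three]
  linear_combination -q * hg - gam v ^ 2 * v ^ 2 * q * h5

/-- A spherical dust shell yields a pure trace, equal to that of a static mass of the same energy.
The dust and the mass lost by the laboratory therefore leave no memory together. -/
lemma angular_radiative_dust {v : ℝ} (hv0 : 0 < v) (hv1 : v < 1) (n : S2) (i j : Fin 3) :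
    angular (traceRev (radiative v (dust v) n)) n i.succ j.succ =
      2 * shellEnergy v 1 * proj n i j := by
  have hK := (isProfile_kap hv0 hv1).continuous_right n
  have hI := IsProfile.id.continuous_right n
  have hg := gam_sq hv0 hv1
  rw [angular_traceRev, trace_radiative_dust hv0 hv1]
  have h : ∀ k l : Fin 3, radiative v (dust v) n k.succ l.succ = 4 * (gam v * v) ^ 2 *
      ∫ m, (m : E3) k * (m : E3) l * kap v (inner ℝ (n : E3) (m : E3)) ∂area := by
    intro k l
    rw [radiative_eq, zonalOp, ← integral_const_mul, ← integral_const_mul]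
    congr 1
    funext m
    simp only [dust, vel, Fin.cons_succ]
    ring
  simp only [h, mul_left_comm _ (4 * (gam v * v) ^ 2), ← Finset.mul_sum]
  rw [proj_integral_kap hv0 hv1]
  -- With `γ²(1 - v²) = 1` the combined numerator is `γ²(1 - vμ)(1 + vμ)`; the kernel cancels one
  -- factor, and the odd remainder integrates to zero.
  have h1 : gam v ^ 2 * v ^ 2 * (∫ m, (1 - inner ℝ (n : E3) (m : E3) ^ 2) *
      kap v (inner ℝ (n : E3) (m : E3)) ∂area) + ∫ m, kap v (inner ℝ (n : E3) (m : E3)) ∂area =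
      gam v ^ 2 * (4 * Real.pi) := by
    have h2 : gam v ^ 2 * (4 * Real.pi) =
        ∫ m : S2, gam v ^ 2 * (1 + v * ∑ i, (n : E3) i * (m : E3) i) ∂area := by
      rw [integral_const_mul, integral_add, integral_const_mul, integral_finsetSum]
      · simp [integral_const_mul, integral_coord, area_real_univ]
      · exact fun i _ => integrable_area (by fun_prop)
      · exact integrable_area (by fun_prop)
      · exact integrable_area (by fun_prop)
    rw [h2, ← integral_const_mul, ← integral_add (integrable_area (by fun_prop))
      (integrable_area hK)]
    congr 1
    funext m
    have h8 := mul_kap hv0 hv1 (inner_sphere_le_one n m)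
    rw [← inner_eq_sum]
    generalize kap v (inner ℝ (n : E3) (m : E3)) = q at *
    generalize inner ℝ (n : E3) (m : E3) = μ at *
    linear_combination -q * hg - gam v ^ 2 * (1 + v * μ) * h8
  rw [shellEnergy]
  linear_combination 2 * proj n i j * h1

/-- The memory tensor at order `1/r`. -/
def memoryTensor (v : ℝ) (α : S2 → ℝ) (n : S2) (a b : Fin 4) : ℝ :=
  1 / 2 * angular (radiative v (lStress v α) n) n a b

/-! ### The memory tensor: vector type, and comparison with the jump of the field. -/

lemma angular_radiative_lStress {v : ℝ} (hv0 : 0 < v) (hv1 : v < 1) {α : S2 → ℝ}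
    (hα : SmoothS2 α) (n : S2) (i j : Fin 3) :
    angular (radiative v (lStress v α) n) n i.succ j.succ =
      (cov (rot (memoryPotential v α)) n i j + cov (rot (memoryPotential v α)) n j i) / 2 := by
  have hs := SmoothS2.memoryPotential hv0 hv1 hα
  have hS := isSolenoidal_rot hs
  have hP : ∑ j, (n : E3) j * radiative v (lStress v α) n 0 j.succ = 0 := by
    simp only [radiative_lStress_zero_succ hv0 hv1 hα]
    simp only [mul_left_comm _ (2 * gam v), ← Finset.mul_sum, rot_tangent, mul_zero]
  have h1 := normal_grad_tangent hS.1 hS.2.1 n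
  have h2 : ∀ i, ∑ k, (n : E3) k * grad (fun m => rot (memoryPotential v α) m i) n k = 0 :=
    fun i => grad_normal (hS.1 i) n
  have h3 := rot_tangent (memoryPotential v α) n
  have h4 := n.sum_sq
  have hX1 : ∀ i, ∑ k, (n : E3) k * cov (rot (memoryPotential v α)) n k i = 0 := by
    intro i
    simp only [cov_tangent hS.1 hS.2.1, mul_add, Finset.sum_add_distrib, h2,
      mul_left_comm _ ((n : E3) i), ← Finset.mul_sum, h3, mul_zero, add_zero]
  have hX2 : ∀ i, ∑ k, (n : E3) k * cov (rot (memoryPotential v α)) n i k = 0 := by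
    intro i
    have h5 := h1 i
    simp only [cov_tangent hS.1 hS.2.1, Fin.sum_univ_three] at h5 ⊢
    linear_combination h5 - rot (memoryPotential v α) n i * h4
  have hT := radiative_lStress_decomp hv0 hv1 hα n
  rw [angular_succ_succ]
  have hl : ∀ k, ∑ l, proj n j l * radiative v (lStress v α) n k.succ l.succ =
      - ((n : E3) k * radiative v (lStress v α) n 0 j.succ) +
        (cov (rot (memoryPotential v α)) n k j + cov (rot (memoryPotential v α)) n j k) / 2 := by
    intro k
    have h5 := hX1 k
    have h6 := hX2 k
    rw [sum_proj_mul]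
    simp only [hT, Fin.sum_univ_three] at *
    linear_combination (n : E3) j * (n : E3) k * hP - (n : E3) j / 2 * (h5 + h6) -
      radiative v (lStress v α) n 0 k.succ * (n : E3) j * h4
  simp only [mul_assoc, ← Finset.mul_sum, hl]
  rw [sum_proj_mul]
  have h5 := hX1 j
  have h6 := hX2 j
  simp only [Fin.sum_univ_three] at *
  linear_combination - (n : E3) i / 2 * (h5 + h6) -
    radiative v (lStress v α) n 0 j.succ * (n : E3) i * h4

lemma memoryTensor_zero_left (v : ℝ) (α : S2 → ℝ) (n : S2) (b : Fin 4) :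
    memoryTensor v α n 0 b = 0 := by
  simp [memoryTensor, angular_zero_left]

lemma memoryTensor_zero_right (v : ℝ) (α : S2 → ℝ) (n : S2) (a : Fin 4) :
    memoryTensor v α n a 0 = 0 := by
  simp [memoryTensor, angular_zero_right]

theorem isVectorType_memoryTensor {v : ℝ} (hv0 : 0 < v) (hv1 : v < 1) {α : S2 → ℝ}
    (hα : SmoothS2 α) : IsVectorType (memoryTensor v α) := by
  have hS := isSolenoidal_rot (SmoothS2.memoryPotential hv0 hv1 hα)
  refine ⟨_, _, _, hS.const_mul 0, hS.const_mul 0, hS.const_mul (1 / 2), fun n => ⟨rfl.trans ?_,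
    fun i => ⟨?_, ?_⟩, fun i j => ?_⟩⟩
  · exact memoryTensor_zero_left v α n 0
  · rw [memoryTensor_zero_left, zero_mul]
  · rw [memoryTensor_zero_right, zero_mul]
  · rw [memoryTensor, angular_radiative_lStress hv0 hv1 hα, cov_const_mul hS.1, cov_const_mul hS.1]
    ring

lemma trace_radiative_lStress {v : ℝ} (hv0 : 0 < v) (hv1 : v < 1) {α : S2 → ℝ}
    (hα : SmoothS2 α) (n : S2) :
    ∑ k : Fin 3, radiative v (lStress v α) n k.succ k.succ = 0 := by
  have hs := SmoothS2.memoryPotential hv0 hv1 hα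
  have hS := isSolenoidal_rot hs
  have hP : ∑ j, (n : E3) j * radiative v (lStress v α) n 0 j.succ = 0 := by
    simp only [radiative_lStress_zero_succ hv0 hv1 hα]
    simp only [mul_left_comm _ (2 * gam v), ← Finset.mul_sum, rot_tangent, mul_zero]
  have h := hS.2.2 n
  simp only [radiative_lStress_decomp hv0 hv1 hα, Fin.sum_univ_three] at *
  linear_combination h - 2 * hP

/-- The stress term is trace-free, so trace reversal leaves it alone. The mass terms enter the
angular part only through trace reversal, and their difference is cancelled by the dust. -/
theorem memoryTensor_eq {v : ℝ} (hv0 : 0 < v) (hv1 : v < 1) {α : S2 → ℝ} (hα : SmoothS2 α)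
    (ρ m : ℝ) (n : S2) : memoryTensor v α n = (1 / 2 : ℝ) •
      (angular (traceRev (fun a b => 4 * m * rest a b + ρ * radiative v (dust v) n a b
          + radiative v (lStress v α) n a b)) n
        - angular (traceRev (fun a b => 4 * (m + shellEnergy v ρ) * rest a b)) n) := by
  funext a b
  refine Fin.cases ?_ (fun i => ?_) a
  · simp [memoryTensor, angular_zero_left]
  refine Fin.cases ?_ (fun j => ?_) b
  · simp [memoryTensor, angular_zero_right]
  have h1 := angular_radiative_dust hv0 hv1 n i j
  have h2 := trace_radiative_lStress hv0 hv1 hα n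
  simp only [memoryTensor, Pi.smul_apply, Pi.sub_apply, smul_eq_mul]
  congr 1
  rw [angular_traceRev] at h1
  rw [angular_traceRev, angular_traceRev, angular_succ_succ]
  have h0 := radiative_lStress_zero_zero v α n
  have hr : ∀ k l : Fin 3, rest k.succ l.succ = 0 := fun k l => by simp [rest, Fin.succ_ne_zero]
  have hr0 : rest 0 0 = 1 := by simp [rest]
  have hE : shellEnergy v ρ = ρ * shellEnergy v 1 := by simp [shellEnergy]; ring
  simp only [hr, hr0, h0, hE, mul_zero, zero_add, add_zero, mul_add, Finset.sum_add_distrib, h2,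
    mul_left_comm _ ρ, ← Finset.mul_sum, Finset.sum_const_zero]
  linear_combination -ρ * h1

/-- The memory tensor vanishes only if its potential is a sum of spherical harmonics with
`ℓ ≤ 1`. -/
lemma onlyLowMultipoles_memoryPotential {v : ℝ} (hv0 : 0 < v) (hv1 : v < 1) {α : S2 → ℝ}
    (hα : SmoothS2 α) (h : ∀ n a b, memoryTensor v α n a b = 0) :
    OnlyLowMultipoles (memoryPotential v α) := by
  refine onlyLowMultipoles_of_killing (SmoothS2.memoryPotential hv0 hv1 hα) fun n i j => ?_
  have h1 := h n i.succ j.succ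
  rw [memoryTensor, angular_radiative_lStress hv0 hv1 hα] at h1
  linarith

/-! ### Injectivity of the memory on the multipoles with `ℓ > 1` -/

/-- The profile of the operator that takes `α` to the potential of its memory. -/
def memoryProfile (v s : ℝ) : ℝ := 3 * s * kap v s - v * (1 - s ^ 2) * kap v s ^ 2

lemma isProfile_memoryProfile {v : ℝ} (hv0 : 0 < v) (hv1 : v < 1) : IsProfile (memoryProfile v) := by
  have h := isProfile_kap hv0 hv1
  unfold memoryProfile
  fun_prop

lemma lap_logKap {v : ℝ} (hv0 : 0 < v) (hv1 : v < 1) (n m : S2) :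
    lap (fun m => logKap v (inner ℝ (n : E3) (m : E3))) m =
      v * kap v (inner ℝ (n : E3) (m : E3)) ^ 2 * (1 - inner ℝ (n : E3) (m : E3) ^ 2)
      - 2 * inner ℝ (n : E3) (m : E3) * kap v (inner ℝ (n : E3) (m : E3)) := by
  have hK := SmoothS2.kap_right hv0 hv1 n
  have hI := SmoothS2.inner_right n
  have h1 := m.sum_sq
  have h2 := n.sum_sq
  simp only [lap, grad_profile_right n _ (hasDerivAt_logKap hv0 hv1 (inner_sphere_le_one n _))]
  have h : ∀ a, grad (fun m : S2 => kap v (inner ℝ (n : E3) (m : E3)) *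
      ((n : E3) a - inner ℝ (n : E3) (m : E3) * (m : E3) a)) m a =
      v * kap v (inner ℝ (n : E3) (m : E3)) ^ 2 *
        ((n : E3) a - inner ℝ (n : E3) (m : E3) * (m : E3) a) *
        ((n : E3) a - inner ℝ (n : E3) (m : E3) * (m : E3) a) +
      kap v (inner ℝ (n : E3) (m : E3)) *
        (0 - (((n : E3) a - inner ℝ (n : E3) (m : E3) * (m : E3) a) * (m : E3) a
          + inner ℝ (n : E3) (m : E3) * proj m a a)) := by
    intro a
    rw [grad_mul hK ((SmoothS2.const _).sub (hI.mul (SmoothS2.coord a))),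
      grad_sub (SmoothS2.const _) (hI.mul (SmoothS2.coord a)), grad_mul hI (SmoothS2.coord a),
      grad_const, grad_inner_right, grad_coord,
      grad_profile_right n m (hasDerivAt_kap hv0 hv1 (inner_sphere_le_one n m))]
  simp only [h]
  have h3 := inner_eq_sum (n : E3) (m : E3)
  generalize kap v (inner ℝ (n : E3) (m : E3)) = k at *
  generalize inner ℝ (n : E3) (m : E3) = μ at *
  simp only [Fin.sum_univ_three, proj, if_true] at *
  subst h3
  generalize (m : E3) 0 = x at *
  generalize (m : E3) 1 = y at *
  generalize (m : E3) 2 = z at *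
  generalize (n : E3) 0 = a at *
  generalize (n : E3) 1 = b at *
  generalize (n : E3) 2 = c at *
  linear_combination -(2 * (a * x + b * y + c * z) * k + v * k ^ 2 * (a * x + b * y + c * z) ^ 2) * h1 -
    v * k ^ 2 * h2

/-- Green's identity moves `𝒟² + 2` from `α` to the kernel `logKap`; with the value from
`lap_logKap` the logarithms cancel, and a rational kernel acting on `α` itself is left. -/
lemma memoryPotential_eq {v : ℝ} (hv0 : 0 < v) (hv1 : v < 1) {α : S2 → ℝ} (hα : SmoothS2 α)
    (n : S2) : memoryPotential v α n = 4 * gam v * v * zonalOp (memoryProfile v) α n := by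
  have hK := isProfile_kap hv0 hv1
  have hL := isProfile_logKap hv0 hv1
  have hLs := hL.smoothKernel.snd n
  have h := integral_lap_mul hα hLs
  have hKc := hK.continuous_right n
  have hLc := hLs.continuous
  have hIc := (SmoothS2.inner_right n).continuous
  have hc := hα.continuous
  have hlc := hα.lap.continuous
  have h1 : zonalOp (logKap v) (radialPotential α) n =
      ∫ m, α m * lap (fun m => logKap v (inner ℝ (n : E3) (m : E3))) m ∂area +
      ∫ m, 2 * α m * logKap v (inner ℝ (n : E3) (m : E3)) ∂area := by
    rw [← h, ← integral_add (integrable_area (by fun_prop)) (integrable_area (by fun_prop))]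
    simp only [zonalOp, radialPotential, add_mul]
  simp only [lap_logKap hv0 hv1] at h1
  rw [memoryPotential, h1, zonalOp, zonalOp, ← integral_add (integrable_area (by fun_prop))
    (integrable_area (by fun_prop)), ← integral_sub (integrable_area (by fun_prop))
    (integrable_area (by fun_prop)), neg_mul, ← mul_neg, ← integral_neg]
  congr 2
  funext m
  simp only [memoryProfile]
  ring

/-! ### Zonal operators preserve the harmonics with `ℓ = 0` and `ℓ = 1`. -/

lemma grad_eq_zero_of_rot_eq_zero {f : S2 → ℝ} (hf : SmoothS2 f) (n : S2)
    (h : ∀ i, rot f n i = 0) (i : Fin 3) : grad f n i = 0 := by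
  have h0 := h 0
  have h1 := h 1
  have h2 := h 2
  rw [rot_zero] at h0
  rw [rot_one] at h1
  rw [rot_two] at h2
  have h3 := grad_normal' hf n
  have h4 := n.sum_sq
  fin_cases i
  · show grad f n 0 = 0
    linear_combination (n : E3) 1 * h2 - (n : E3) 2 * h1 + (n : E3) 0 * h3 + grad f n 0 * h4
  · show grad f n 1 = 0
    linear_combination (n : E3) 2 * h0 - (n : E3) 0 * h2 + (n : E3) 1 * h3 + grad f n 1 * h4
  · show grad f n 2 = 0
    linear_combination (n : E3) 0 * h1 - (n : E3) 1 * h0 + (n : E3) 2 * h3 + grad f n 2 * h4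

lemma exists_const_of_rot_eq_zero {f : S2 → ℝ} (hf : SmoothS2 f) (h : ∀ n i, rot f n i = 0) :
    ∃ c, ∀ n, f n = c :=
  ⟨f (toS2 0), fun n => eq_const_of_grad_eq_zero hf
    (fun n => grad_eq_zero_of_rot_eq_zero hf n (h n)) n _⟩

lemma exists_zonalOp_const {k : ℝ → ℝ} (hk : IsProfile k) :
    ∃ c, ∀ n, zonalOp k (fun _ => 1) n = c := by
  refine exists_const_of_rot_eq_zero (SmoothS2.zonalOp hk continuous_const) fun n i => ?_
  rw [rot_zonalOp hk (SmoothS2.const 1)]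
  simp [rot, grad_const, zonalOp]

lemma rot_coord (n : S2) (i j : Fin 3) : rot (fun n => (n : E3) j) n i = epsS n i j := by
  simp only [rot, grad_coord, sum_epsS_mul]
  fin_cases i <;> fin_cases j <;> simp [proj, epsS_eq] <;> ring

lemma zonalOp_neg (k : ℝ → ℝ) (f : S2 → ℝ) (n : S2) :
    zonalOp k (fun m => - f m) n = - zonalOp k f n := by
  simp only [zonalOp, neg_mul, integral_neg]

/-- Schur's lemma for `ℓ = 1`: the images `V` of the coordinates transform under `rot` as the
coordinates do, which forces `V = g n` with `g` constant. -/
lemma exists_zonalOp_coord {k : ℝ → ℝ} (hk : IsProfile k) :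
    ∃ c, ∀ n i, zonalOp k (fun m => (m : E3) i) n = c * (n : E3) i := by
  have hg : ∀ i, SmoothS2 fun n => zonalOp k (fun m => (m : E3) i) n :=
    fun i => SmoothS2.zonalOp hk (SmoothS2.coord i).continuous
  have hr : ∀ n i j, rot (fun n => zonalOp k (fun m => (m : E3) j) n) n i =
      ![![0, zonalOp k (fun m => (m : E3) 2) n, - zonalOp k (fun m => (m : E3) 1) n],
        ![- zonalOp k (fun m => (m : E3) 2) n, 0, zonalOp k (fun m => (m : E3) 0) n],
        ![zonalOp k (fun m => (m : E3) 1) n, - zonalOp k (fun m => (m : E3) 0) n, 0]] i j := by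
    intro n i j
    rw [rot_zonalOp hk (SmoothS2.coord j)]
    simp only [rot_coord, epsS_eq]
    fin_cases i <;> fin_cases j <;> simp [zonalOp_neg] <;> simp [zonalOp]
  -- `rot` is tangent; contracted with `n`, the rotation law `hr` says that the cross product of `n`
  -- and `V` vanishes.
  have hn : ∀ n i, zonalOp k (fun m => (m : E3) i) n =
      (∑ j, (n : E3) j * zonalOp k (fun m => (m : E3) j) n) * (n : E3) i := by
    intro n i
    have h0 := rot_tangent (fun n => zonalOp k (fun m => (m : E3) 0) n) n
    have h1 := rot_tangent (fun n => zonalOp k (fun m => (m : E3) 1) n) n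
    have h2 := rot_tangent (fun n => zonalOp k (fun m => (m : E3) 2) n) n
    have h4 := n.sum_sq
    simp only [hr, Fin.sum_univ_three] at *
    simp only [Matrix.cons_val] at *
    fin_cases i
    · show zonalOp k (fun m => (m : E3) 0) n = _
      simp only [Fin.zero_eta, Fin.isValue]
      linear_combination zonalOp k (fun m => (m : E3) 0) n * h4 + (n : E3) 1 * h2 - (n : E3) 2 * h1
    · show zonalOp k (fun m => (m : E3) 1) n = _
      simp only [Fin.mk_one, Fin.isValue]
      linear_combination zonalOp k (fun m => (m : E3) 1) n * h4 + (n : E3) 2 * h0 - (n : E3) 0 * h2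
    · show zonalOp k (fun m => (m : E3) 2) n = _
      simp only [Fin.reduceFinMk, Fin.isValue]
      linear_combination zonalOp k (fun m => (m : E3) 2) n * h4 + (n : E3) 0 * h1 - (n : E3) 1 * h0
  have hs : SmoothS2 fun n => ∑ j, (n : E3) j * zonalOp k (fun m => (m : E3) j) n := by
    fun_prop
  -- In `V = g n` both `V` and `n` obey the same rotation law, so the product rule leaves `(rot g)
  -- nⱼ = 0` for every `j`.
  obtain ⟨c, hc⟩ := exists_const_of_rot_eq_zero hs (fun n i => by
    have h5 : ∀ j, rot (fun n => ∑ j, (n : E3) j * zonalOp k (fun m => (m : E3) j) n) n i *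
        (n : E3) j = 0 := by
      intro j
      have h6 := rot_mul hs (SmoothS2.coord j) n i
      simp only [← hn] at h6
      rw [rot_coord] at h6
      rw [hr] at h6
      have h7 : ∀ i, (∑ j, (n : E3) j * zonalOp k (fun m => (m : E3) j) n) * (n : E3) i =
        zonalOp k (fun m => (m : E3) i) n := fun i => (hn n i).symm
      have h8 : (∑ j, (n : E3) j * zonalOp k (fun m => (m : E3) j) n) * epsS n i j =
        ![![0, zonalOp k (fun m => (m : E3) 2) n, - zonalOp k (fun m => (m : E3) 1) n],
        ![- zonalOp k (fun m => (m : E3) 2) n, 0, zonalOp k (fun m => (m : E3) 0) n],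
        ![zonalOp k (fun m => (m : E3) 1) n, - zonalOp k (fun m => (m : E3) 0) n, 0]] i j := by
        rw [epsS_eq]
        fin_cases i <;> fin_cases j <;> simp [h7]
      linarith
    have h4 := n.sum_sq
    have h0 := h5 0
    have h1 := h5 1
    have h2 := h5 2
    generalize rot _ n i = w at *
    linear_combination w * h4 + (n : E3) 0 * h0 + (n : E3) 1 * h1 + (n : E3) 2 * h2)
  exact ⟨c, fun n i => by rw [hn, hc]⟩

/-! ### Moments, and positivity of the memory operator. -/

lemma integral_coord_mul_coord (i j : Fin 3) :
    ∫ n : S2, (n : E3) i * (n : E3) j ∂area = (if i = j then 1 else 0) * (4 * Real.pi / 3) := by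
  have h := integral_grad (SmoothS2.coord j) i
  simp only [grad_coord, proj] at h
  rw [integral_sub (integrable_const _) (integrable_area (by fun_prop))] at h
  simp [area_real_univ] at h
  split_ifs at h ⊢ <;> linarith

/-- Functions all of whose moments vanish are zero. -/
lemma eq_zero_of_moments {f : S2 → ℝ} (hf : Continuous f)
    (h : ∀ (k : ℕ) (w : Fin k → Fin 3), ∫ n, f n * ∏ i, (n : E3) (w i) ∂area = 0) (n : S2) :
    f n = 0 := by
  -- Stone–Weierstrass: the coordinates generate a dense algebra, on which the continuous functional
  -- `φ` vanishes; it is then evaluated at `f` itself.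
  let x : Fin 3 → C(S2, ℝ) := fun i => ⟨fun n => (n : E3) i, by fun_prop⟩
  let A : Subalgebra ℝ C(S2, ℝ) := Algebra.adjoin ℝ (range x)
  let φ : C(S2, ℝ) →ₗ[ℝ] ℝ :=
    { toFun := fun g => ∫ n, f n * g n ∂area
      map_add' := fun g g' => by
        simp only [ContinuousMap.add_apply, mul_add]
        exact integral_add (integrable_area (by fun_prop)) (integrable_area (by fun_prop))
      map_smul' := fun c g => by
        simp only [ContinuousMap.smul_apply, smul_eq_mul, RingHom.id_apply, mul_left_comm (f _)]
        exact integral_const_mul _ _ }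
  have hφc : Continuous φ := by
    obtain ⟨C, hC⟩ := (isCompact_univ (X := S2)).exists_bound_of_continuousOn hf.continuousOn
    refine AddMonoidHomClass.continuous_of_bound φ (C * area.real univ) fun g => ?_
    have h1 := norm_integral_le_of_norm_le_const (μ := area) (f := fun n => f n * g n)
      (C := C * ‖g‖) (Eventually.of_forall fun n => by
        rw [norm_mul]
        exact mul_le_mul (hC n trivial) (g.norm_coe_le_norm n) (norm_nonneg _)
          ((norm_nonneg _).trans (hC n trivial)))
    refine h1.trans_eq ?_
    ring
  have hA : ∀ g ∈ A, φ g = 0 := by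
    intro g hg
    rw [← Subalgebra.mem_toSubmodule, Algebra.adjoin_eq_span] at hg
    refine (Submodule.span_le (p := LinearMap.ker φ)).2 (fun g hg => ?_) hg
    have : ∃ (k : ℕ) (w : Fin k → Fin 3), g = ∏ i, x (w i) := by
      obtain ⟨l, hl, rfl⟩ := Submonoid.exists_list_of_mem_closure hg
      choose w hw using fun i : Fin l.length => hl _ (l.get_mem i)
      refine ⟨l.length, w, ?_⟩
      simp only [hw]
      conv_lhs => rw [← List.ofFn_get l, List.prod_ofFn]
    obtain ⟨k, w, rfl⟩ := this
    change ∫ n, f n * (∏ i, x (w i)) n ∂area = 0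
    rw [← h k w]
    simp [x]
  have hsep : A.SeparatesPoints := by
    intro p q hpq
    have : ∃ i, (p : E3) i ≠ (q : E3) i := by
      by_contra! hc
      exact hpq (Subtype.ext (PiLp.ext hc))
    obtain ⟨i, hi⟩ := this
    exact ⟨x i, ⟨x i, Algebra.subset_adjoin ⟨i, rfl⟩, rfl⟩, hi⟩
  have htop := ContinuousMap.subalgebra_topologicalClosure_eq_top_of_separatesPoints A hsep
  have hall : ∀ g : C(S2, ℝ), φ g = 0 := by
    intro g
    have hg : g ∈ closure (A : Set C(S2, ℝ)) := by
      rw [← Subalgebra.topologicalClosure_coe, htop]; trivial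
    exact closure_minimal (fun g hg => hA g hg) (isClosed_singleton.preimage hφc) hg
  have h1 : ∫ n, f n * f n ∂area = 0 := hall ⟨f, hf⟩
  rw [integral_eq_zero_iff_of_nonneg (fun n => mul_self_nonneg _) (integrable_area (hf.mul hf))]
    at h1
  exact mul_self_eq_zero.1 (congrFun (((hf.mul hf).ae_eq_iff_eq area continuous_const).1 h1) n)

/-- The quadratic form of a positive power of `n · m` is a sum of squares of moments. -/
lemma integral_inner_pow {f : S2 → ℝ} (hf : Continuous f) (k : ℕ) :
    ∫ p : S2 × S2, f p.1 * f p.2 * inner ℝ (p.1 : E3) (p.2 : E3) ^ k ∂(area.prod area) =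
      ∑ w : Fin k → Fin 3, (∫ n, f n * ∏ i, (n : E3) (w i) ∂area) ^ 2 := by
  have h : ∀ p : S2 × S2, f p.1 * f p.2 * inner ℝ (p.1 : E3) (p.2 : E3) ^ k =
      ∑ w : Fin k → Fin 3, (f p.1 * ∏ i, (p.1 : E3) (w i)) * (f p.2 * ∏ i, (p.2 : E3) (w i)) := by
    intro p
    rw [inner_eq_sum, Fintype.sum_pow, Finset.mul_sum]
    refine Finset.sum_congr rfl fun w _ => ?_
    rw [Finset.prod_mul_distrib]
    ring
  simp only [h]
  have hc : ∀ w : Fin k → Fin 3, Continuous fun n : S2 => f n * ∏ i, (n : E3) (w i) :=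
    fun w => hf.mul (continuous_finsetProd _ fun i _ => by fun_prop)
  rw [integral_finsetSum]
  · refine Finset.sum_congr rfl fun w _ => ?_
    rw [sq]
    exact integral_prod_mul (fun n => f n * ∏ i, (n : E3) (w i))
      (fun n => f n * ∏ i, (n : E3) (w i))
  · exact fun w _ => (integrable_area (hc w)).mul_prod (integrable_area (hc w))

/-- The profile has the negative value `-v` at `s = 0`. The added `2` makes every coefficient
positive and is invisible to functions of mean zero. -/
lemma hasSum_memoryProfile {v s : ℝ} (hv0 : 0 < v) (hv1 : v < 1) (hs : |s| ≤ 1) :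
    HasSum (fun k : ℕ => (k * (1 - v ^ 2) + (2 - v ^ 2)) * v ^ k * s ^ k)
      (v * memoryProfile v s + 2) := by
  have h : ‖v * s‖ < 1 := by
    rw [norm_mul, Real.norm_eq_abs, Real.norm_eq_abs, abs_of_pos hv0]
    nlinarith [abs_nonneg s]
  have h1 := (hasSum_coe_mul_geometric_of_norm_lt_one h).mul_left (1 - v ^ 2)
  have h2 := (hasSum_geometric_of_norm_lt_one h).mul_left (2 - v ^ 2)
  have h0 := (one_sub_mul_pos hv0 hv1 ((le_abs_self s).trans hs)).ne'
  have hf : (fun k : ℕ => (k * (1 - v ^ 2) + (2 - v ^ 2)) * v ^ k * s ^ k) =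
      fun k : ℕ => (1 - v ^ 2) * (k * (v * s) ^ k) + (2 - v ^ 2) * (v * s) ^ k := by
    funext k
    rw [mul_pow]
    ring
  have hs : v * memoryProfile v s + 2 =
      (1 - v ^ 2) * (v * s / (1 - v * s) ^ 2) + (2 - v ^ 2) * (1 - v * s)⁻¹ := by
    unfold memoryProfile kap
    field_simp
    ring
  rw [hf, hs]
  exact h1.add h2

/-- Expanded in powers of `n · m`, the quadratic form is a sum of squared moments with positive
weights, so its vanishing annihilates every moment. -/
lemma eq_zero_of_quadratic_form {v : ℝ} (hv0 : 0 < v) (hv1 : v < 1) {f : S2 → ℝ}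
    (hf : Continuous f) (h0 : ∫ n, f n ∂area = 0)
    (h : ∫ n, f n * zonalOp (memoryProfile v) f n ∂area = 0) (n : S2) : f n = 0 := by
  have hN := isProfile_memoryProfile hv0 hv1
  have hNc := hN.smoothKernel.continuous
  have hIc := SmoothKernel.inner.continuous
  have hint : ∀ g : S2 × S2 → ℝ, Continuous g → Integrable g (area.prod area) := fun g hg =>
    hg.integrable_of_hasCompactSupport (HasCompactSupport.of_compactSpace _)
  have htot : ∫ p : S2 × S2, f p.1 * f p.2 *
      (v * memoryProfile v (inner ℝ (p.1 : E3) (p.2 : E3)) + 2) ∂(area.prod area) = 0 := by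
    have h1 : ∫ p : S2 × S2, f p.1 * f p.2 * memoryProfile v (inner ℝ (p.1 : E3) (p.2 : E3))
        ∂(area.prod area) = 0 := by
      rw [integral_prod _ (hint _ (by fun_prop)), ← h]
      simp only [zonalOp, ← integral_const_mul, mul_assoc]
    have h2 : ∫ p : S2 × S2, f p.1 * f p.2 ∂(area.prod area) = 0 := by
      rw [integral_prod_mul, h0, zero_mul]
    calc _ = ∫ p : S2 × S2, (v * (f p.1 * f p.2 *
          memoryProfile v (inner ℝ (p.1 : E3) (p.2 : E3))) + 2 * (f p.1 * f p.2))
          ∂(area.prod area) := by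
          congr 1; funext p; ring
      _ = 0 := by
          rw [integral_add (hint _ (by fun_prop)) (hint _ (by fun_prop)), integral_const_mul,
            integral_const_mul, h1, h2]
          simp
  obtain ⟨C, hC⟩ := (isCompact_univ (X := S2)).exists_bound_of_continuousOn hf.continuousOn
  let d : ℕ → ℝ := fun k => (k * (1 - v ^ 2) + (2 - v ^ 2)) * v ^ k
  have hv2 : 0 < 1 - v ^ 2 := by nlinarith
  have hd : ∀ k, 0 < d k := fun k => by
    have : (0 : ℝ) ≤ k := k.cast_nonneg
    have : 0 < 2 - v ^ 2 := by linarith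
    positivity
  -- The case `s = 1` of the expansion gives the dominating series, since `|n · m| ≤ 1`.
  have hds : Summable d := by
    have := (hasSum_memoryProfile hv0 hv1 (s := 1) (by simp)).summable
    simpa [d] using this
  have hsum := hasSum_integral_of_dominated_convergence (μ := area.prod area)
    (F := fun k (p : S2 × S2) => f p.1 * f p.2 * (d k * inner ℝ (p.1 : E3) (p.2 : E3) ^ k))
    (bound := fun k _ => C * C * d k)
    (f := fun p => f p.1 * f p.2 * (v * memoryProfile v (inner ℝ (p.1 : E3) (p.2 : E3)) + 2))
    (fun k => (Continuous.aestronglyMeasurable (by fun_prop)))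
    (fun k => Eventually.of_forall fun p => by
      have h1 := hC p.1 trivial
      have h2 := hC p.2 trivial
      have h3 : ‖inner ℝ (p.1 : E3) (p.2 : E3) ^ k‖ ≤ 1 := by
        rw [norm_pow]
        exact pow_le_one₀ (norm_nonneg _) (abs_inner_sphere_le_one _ _)
      rw [norm_mul, norm_mul, norm_mul, Real.norm_of_nonneg (hd k).le]
      have h4 : 0 ≤ C := (norm_nonneg _).trans h1
      have h5 : d k * ‖inner ℝ (p.1 : E3) (p.2 : E3) ^ k‖ ≤ d k :=
        mul_le_of_le_one_right (hd k).le h3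
      exact mul_le_mul (mul_le_mul h1 h2 (norm_nonneg _) h4) h5
        (mul_nonneg (hd k).le (norm_nonneg _)) (mul_nonneg h4 h4))
    (Eventually.of_forall fun p => hds.mul_left _)
    (integrable_const _)
    (Eventually.of_forall fun p =>
      (hasSum_memoryProfile hv0 hv1 (abs_inner_sphere_le_one p.1 p.2)).mul_left _)
  rw [htot] at hsum
  have hq : ∀ k, ∫ p : S2 × S2, f p.1 * f p.2 * (d k * inner ℝ (p.1 : E3) (p.2 : E3) ^ k)
      ∂(area.prod area) = d k * ∑ w : Fin k → Fin 3, (∫ n, f n * ∏ i, (n : E3) (w i) ∂area) ^ 2 := by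
    intro k
    rw [← integral_inner_pow hf, ← integral_const_mul]
    congr 1
    funext p
    ring
  simp only [hq] at hsum
  have hz := (hasSum_zero_iff_of_nonneg fun k => mul_nonneg (hd k).le
    (Finset.sum_nonneg fun w _ => sq_nonneg _)).1 hsum
  refine eq_zero_of_moments hf (fun k w => ?_) n
  have h1 := (mul_eq_zero.1 (congrFun hz k)).resolve_left (hd k).ne'
  rw [Finset.sum_eq_zero_iff_of_nonneg fun w _ => sq_nonneg _] at h1
  simpa using h1 w (Finset.mem_univ _)


theorem onlyLowMultipoles_of_memoryPotential {v : ℝ} (hv0 : 0 < v) (hv1 : v < 1) {α : S2 → ℝ}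
    (hα : SmoothS2 α) (h : OnlyLowMultipoles (memoryPotential v α)) : OnlyLowMultipoles α := by
  have hN := isProfile_memoryProfile hv0 hv1
  obtain ⟨c₀, hc₀⟩ := exists_zonalOp_const hN
  obtain ⟨c₁, hc₁⟩ := exists_zonalOp_coord hN
  obtain ⟨c, b, hcb⟩ := h
  have hαc := hα.continuous
  -- `a` and `q` are the coefficients of the orthogonal projection to `ℓ ≤ 1`; the factor `3` comes
  -- from `∫ nᵢ nⱼ = (4π / 3) δᵢⱼ`.
  let a : ℝ := (4 * Real.pi)⁻¹ * ∫ n, α n ∂area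
  let q : Fin 3 → ℝ := fun i => 3 * (4 * Real.pi)⁻¹ * ∫ n, α n * (n : E3) i ∂area
  let f : S2 → ℝ := fun n => α n - (a + ∑ i, q i * (n : E3) i)
  have hfc : Continuous f := by
    have : Continuous fun n : S2 => ∑ i, q i * (n : E3) i := by fun_prop
    fun_prop
  have hf0 : ∫ n, f n ∂area = 0 := by
    simp only [f]
    rw [integral_sub (integrable_area hαc) (integrable_area (by fun_prop)),
      integral_add (integrable_const _) (integrable_area (by fun_prop)),
      integral_finsetSum _ (fun i _ => integrable_area (by fun_prop))]
    simp only [integral_const_mul, integral_coord, mul_zero, Finset.sum_const_zero, add_zero,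
      integral_const, area_real_univ, smul_eq_mul, a]
    have := Real.pi_pos
    field_simp
    ring
  have hf1 : ∀ j, ∫ n, f n * (n : E3) j ∂area = 0 := by
    intro j
    simp only [f, sub_mul, add_mul, Finset.sum_mul]
    rw [integral_sub (integrable_area (by fun_prop)) (integrable_area (by fun_prop)),
      integral_add (integrable_area (by fun_prop)) (integrable_area (by fun_prop)),
      integral_finsetSum _ (fun i _ => integrable_area (by fun_prop))]
    simp only [mul_assoc, integral_const_mul, integral_coord, mul_zero, zero_add,
      integral_coord_mul_coord, ite_mul, one_mul, zero_mul, mul_ite, Finset.sum_ite_eq',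
      Finset.mem_univ, if_true, q]
    have := Real.pi_pos
    field_simp
    ring
  -- The image of `α` is in `ℓ ≤ 1` by hypothesis and that of its low part by Schur's lemma, so the
  -- image of `f` is in `ℓ ≤ 1`, to which `f` is orthogonal.
  have hNf : ∀ n, zonalOp (memoryProfile v) f n = (4 * gam v * v)⁻¹ * (c + inner ℝ b (n : E3))
      - (a * c₀ + ∑ i, q i * (c₁ * (n : E3) i)) := by
    intro n
    have hNn := hN.continuous_right n
    have h4 : 4 * gam v * v ≠ 0 := by
      have := gam_pos hv0 hv1
      positivity
    rw [← hcb, memoryPotential_eq hv0 hv1 hα, inv_mul_cancel_left₀ h4, ← hc₀ n]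
    simp only [← hc₁]
    simp only [zonalOp, f, sub_mul, add_mul, Finset.sum_mul, mul_assoc, one_mul]
    rw [integral_sub (integrable_area (by fun_prop)) (integrable_area (by fun_prop)),
      integral_add (integrable_area (by fun_prop)) (integrable_area (by fun_prop)),
      integral_finsetSum _ (fun i _ => integrable_area (by fun_prop))]
    simp only [integral_const_mul]
  have hquad : ∫ n, f n * zonalOp (memoryProfile v) f n ∂area = 0 := by
    have h1 : ∀ n, f n * zonalOp (memoryProfile v) f n =
        ((4 * gam v * v)⁻¹ * c - a * c₀) * f n +
          ∑ i, ((4 * gam v * v)⁻¹ * b i - c₁ * q i) * (f n * (n : E3) i) := by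
      intro n
      rw [hNf, inner_eq_sum]
      simp only [Fin.sum_univ_three]
      ring
    simp only [h1]
    rw [integral_add (integrable_area (by fun_prop)) (integrable_area (by fun_prop)),
      integral_finsetSum _ (fun i _ => integrable_area (by fun_prop))]
    simp only [integral_const_mul, hf0, hf1, mul_zero, Finset.sum_const_zero, add_zero]
  refine ⟨a, WithLp.toLp 2 q, fun n => ?_⟩
  have h1 := eq_zero_of_quadratic_form hv0 hv1 hfc hf0 hquad n
  rw [inner_eq_sum]
  simp only [f] at h1
  linarith

/-! ### Calculus on spacetime -/

@[simp] lemma event_zero (t : ℝ) (x : E3) : event t x 0 = t := rfl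

@[simp] lemma event_succ (t : ℝ) (x : E3) (i : Fin 3) : event t x i.succ = x i := rfl

@[simp] lemma space_event (t : ℝ) (x : E3) : space (event t x) = x := rfl

@[simp] lemma event_space (p : Spacetime) : event (p 0) (space p) = p := by
  funext a
  refine Fin.cases rfl (fun i => rfl) a

/-- `event` as a linear equivalence. -/
def eventL : (ℝ × E3) ≃L[ℝ] Spacetime :=
  LinearEquiv.toContinuousLinearEquiv
    { toFun := fun q => event q.1 q.2
      invFun := fun p => (p 0, space p)
      map_add' := fun q q' => by
        funext a
        refine Fin.cases rfl (fun i => rfl) a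
      map_smul' := fun c q => by
        funext a
        refine Fin.cases rfl (fun i => rfl) a
      left_inv := fun q => rfl
      right_inv := fun p => event_space p }

@[fun_prop]
lemma contDiff_event {E : Type*} [NormedAddCommGroup E] [NormedSpace ℝ E] {n : WithTop ℕ∞}
    {f : E → ℝ} {g : E → E3} (hf : ContDiff ℝ n f) (hg : ContDiff ℝ n g) :
    ContDiff ℝ n (fun x => event (f x) (g x)) :=
  eventL.contDiff.comp (hf.prodMk hg)

@[fun_prop]
lemma continuous_event {X : Type*} [TopologicalSpace X] {f : X → ℝ} {g : X → E3}
    (hf : Continuous f) (hg : Continuous g) : Continuous (fun x => event (f x) (g x)) :=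
  eventL.continuous.comp (hf.prodMk hg)

@[fun_prop]
lemma continuous_space : Continuous space :=
  (continuous_snd.comp eventL.symm.continuous : Continuous fun p => (eventL.symm p).2)

@[fun_prop]
lemma contDiff_space {n : WithTop ℕ∞} : ContDiff ℝ n space :=
  (contDiff_snd.comp eventL.symm.contDiff : ContDiff ℝ n fun p => (eventL.symm p).2)

lemma fderiv_eq_sum_pd (φ : Spacetime → ℝ) (p w : Spacetime) :
    fderiv ℝ φ p w = ∑ a, w a * pd a φ p := by
  conv_lhs => rw [← Finset.univ_sum_single w]
  rw [map_sum]
  refine Finset.sum_congr rfl fun a _ => ?_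
  have : (Pi.single a (w a) : Spacetime) = w a • Pi.single a 1 := by
    rw [← Pi.single_smul, smul_eq_mul, mul_one]
  rw [this, map_smul, smul_eq_mul, pd]

lemma contDiff_pd {φ : Spacetime → ℝ} (hφ : ContDiff ℝ ∞ φ) (a : Fin 4) :
    ContDiff ℝ ∞ (pd a φ) :=
  (hφ.fderiv_right (m := ∞) (by simp)).clm_apply contDiff_const

lemma pd_comm {φ : Spacetime → ℝ} (hφ : ContDiff ℝ ∞ φ) (a b : Fin 4) :
    pd a (pd b φ) = pd b (pd a φ) := by
  funext p
  have hd : DifferentiableAt ℝ (fderiv ℝ φ) p :=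
    ((hφ.fderiv_right (m := ∞) (by simp)).differentiable (by simp)).differentiableAt
  have h : ∀ a b, pd a (pd b φ) p = fderiv ℝ (fderiv ℝ φ) p (Pi.single a 1) (Pi.single b 1) := by
    intro a b
    unfold ShellMemory.pd
    rw [fderiv_clm_apply hd (differentiableAt_const _)]
    simp
  have hs : IsSymmSndFDerivAt ℝ φ p := hφ.contDiffAt.isSymmSndFDerivAt
    (by simpa using (WithTop.coe_le_coe.2 le_top : ((2 : ℕ∞) : WithTop ℕ∞) ≤ ∞))
  rw [h, h, hs]

lemma hasDerivAt_comp_curve {φ : Spacetime → ℝ} (hφ : ContDiff ℝ ∞ φ) {c : ℝ → Spacetime}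
    {c' : Spacetime} {r : ℝ} (hc : HasDerivAt c c' r) :
    HasDerivAt (fun r => φ (c r)) (∑ a, c' a * pd a φ (c r)) r := by
  have h := (hφ.differentiable (by simp)).differentiableAt.hasFDerivAt.comp_hasDerivAt r hc
  rwa [fderiv_eq_sum_pd] at h

lemma hasDerivAt_event_line (t : ℝ) (x y : E3) (c r : ℝ) :
    HasDerivAt (fun r => event (t + r * c) (x + r • y)) (event c y) r := by
  have h1 : HasDerivAt (fun r : ℝ => t + r * c) c r := by
    simpa using ((hasDerivAt_id r).mul_const c).const_add t
  have h2 : HasDerivAt (fun r : ℝ => x + r • y) y r := by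
    simpa using ((hasDerivAt_id r).smul_const y).const_add x
  exact eventL.hasFDerivAt.comp_hasDerivAt r (h1.prodMk h2)

lemma hasDerivAt_comp_event_line {φ : Spacetime → ℝ} (hφ : ContDiff ℝ ∞ φ) (t : ℝ) (x y : E3)
    (c r : ℝ) : HasDerivAt (fun r => φ (event (t + r * c) (x + r • y)))
      (c * pd 0 φ (event (t + r * c) (x + r • y))
        + ∑ i : Fin 3, y i * pd i.succ φ (event (t + r * c) (x + r • y))) r := by
  have h := hasDerivAt_comp_curve hφ (hasDerivAt_event_line t x y c r)
  rwa [Fin.sum_univ_succ] at h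

lemma SmoothS2.comp_event {φ : Spacetime → ℝ} (hφ : ContDiff ℝ ∞ φ) (t r : ℝ) (x : E3) :
    SmoothS2 (fun n => φ (event t (x + r • (n : E3)))) :=
  .of_contDiffAt (F := fun y : E3 => φ (event t (x + r • y))) fun n =>
    (hφ.comp (by fun_prop)).contDiffAt

lemma grad_comp_event {φ : Spacetime → ℝ} (hφ : ContDiff ℝ ∞ φ) (t r : ℝ) (x : E3) (n : S2)
    (i : Fin 3) : grad (fun n => φ (event t (x + r • (n : E3)))) n i =
      r * ∑ k : Fin 3, proj n i k * pd k.succ φ (event t (x + r • (n : E3))) := by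
  have hd : ContDiff ℝ ∞ fun y : E3 => φ (event t (x + r • y)) := hφ.comp (by fun_prop)
  rw [grad_comp_coe (F := fun y : E3 => φ (event t (x + r • y))) n
    (hd.differentiable (by simp)).differentiableAt, Finset.mul_sum]
  refine Finset.sum_congr rfl fun k _ => ?_
  have h1 : HasDerivAt (fun s : ℝ => φ (event t (x + r • ((n : E3) + s • EuclideanSpace.single k 1))))
      (fderiv ℝ (fun y : E3 => φ (event t (x + r • y))) n (EuclideanSpace.single k 1)) 0 := by
    have h2 : HasDerivAt (fun s : ℝ => (n : E3) + s • EuclideanSpace.single k (1 : ℝ))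
        (EuclideanSpace.single k (1 : ℝ)) 0 := by
      simpa using ((hasDerivAt_id (0 : ℝ)).smul_const
        (EuclideanSpace.single k (1 : ℝ) : E3)).const_add (n : E3)
    have h3 := (hd.differentiable (by simp)).differentiableAt (x := (n : E3)) |>.hasFDerivAt
    have h4 : HasFDerivAt (fun y : E3 => φ (event t (x + r • y)))
      (fderiv ℝ (fun y : E3 => φ (event t (x + r • y))) n)
      ((n : E3) + (0 : ℝ) • EuclideanSpace.single k (1 : ℝ)) := by simpa using h3
    exact h4.comp_hasDerivAt (0 : ℝ) h2
  have h5 := hasDerivAt_comp_event_line hφ t (x + r • (n : E3))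
    (r • EuclideanSpace.single k (1 : ℝ)) 0 0
  have h6 : (fun s : ℝ => φ (event t (x + r • ((n : E3) + s • EuclideanSpace.single k 1)))) =
      fun s => φ (event (t + s * 0) (x + r • (n : E3) + s • r • EuclideanSpace.single k (1 : ℝ))) := by
    funext s
    rw [mul_zero, add_zero, smul_add, add_assoc, smul_comm]
  rw [h6] at h1
  have h7 := h1.unique h5
  rw [h7]
  simp
  ring

/-! ### Conservation -/

/-- Smooth functions that vanish at early and late times on the cone `|x| < w |t|`. -/
def Admissible (w : ℝ) (φ : Spacetime → ℝ) : Prop :=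
  ContDiff ℝ ∞ φ ∧ ∃ A, 0 < A ∧ ∀ p : Spacetime, A < |p 0| → ‖space p‖ < w * |p 0| → φ p = 0

lemma Admissible.pd {w : ℝ} {φ : Spacetime → ℝ} (hφ : Admissible w φ) (a : Fin 4) :
    Admissible w (pd a φ) := by
  obtain ⟨h, A, hA, hz⟩ := hφ
  refine ⟨contDiff_pd h a, A, hA, fun p h1 h2 => ?_⟩
  have ho : IsOpen {p : Spacetime | A < |p 0| ∧ ‖space p‖ < w * |p 0|} :=
    (isOpen_lt (f := fun _ => A) (g := fun p : Spacetime => |p 0|) (by fun_prop)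
      (by fun_prop)).inter (isOpen_lt (f := fun p => ‖space p‖)
        (g := fun p : Spacetime => w * |p 0|) (by fun_prop) (by fun_prop))
  have he : φ =ᶠ[𝓝 p] fun _ => 0 := by
    filter_upwards [ho.mem_nhds ⟨h1, h2⟩] with q hq using hz q hq.1 hq.2
  rw [ShellMemory.pd, he.fderiv_eq]
  simp

lemma IsTest.admissible {φ : Spacetime → ℝ} (hφ : IsTest φ) (w : ℝ) : Admissible w φ := by
  obtain ⟨R, hR⟩ := hφ.2.isCompact.isBounded.exists_norm_le
  refine ⟨hφ.1, max R 1, by positivity, fun p h1 _ => ?_⟩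
  by_contra h
  have h2 := hR p (subset_tsupport _ h)
  have h3 := norm_le_pi_norm p 0
  rw [Real.norm_eq_abs] at h3
  have := le_max_left R 1
  linarith

/-- The conditions for a shell to be conserved up to the momentum that it carries. -/
structure IsFreeShell (v : ℝ) (τ : S2 → Fin 4 → Fin 4 → ℝ) : Prop where
  continuous : ∀ a b, Continuous fun n => τ n a b
  normal : ∀ (n : S2) a, ∑ i : Fin 3, (n : E3) i * τ n a i.succ = - v * τ n a 0
  tangential : ∀ f, SmoothS2 f → ∀ a, ∫ n, ∑ i : Fin 3, τ n a i.succ * grad f n i ∂area = 0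

lemma integrable_shell {A : ℝ} {F : ℝ × S2 → ℝ} (hF : Continuous F)
    (hA : ∀ t, A < t → ∀ n, F (t, n) = 0) :
    Integrable F ((volume.restrict (Ioi (0 : ℝ))).prod area) := by
  have h1 : IntegrableOn F (Icc 0 A ×ˢ univ) (volume.prod area) :=
    hF.continuousOn.integrableOn_compact (isCompact_Icc.prod isCompact_univ)
  have h2 : IntegrableOn F (Ioi 0 ×ˢ univ) (volume.prod area) := by
    refine h1.of_forall_sdiff_eq_zero (measurableSet_Ioi.prod MeasurableSet.univ) fun q hq => ?_
    refine hA q.1 ?_ q.2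
    by_contra! h
    exact hq.2 ⟨⟨(mem_Ioi.1 hq.1.1).le, h⟩, trivial⟩
  rwa [IntegrableOn, ← Measure.prod_restrict, Measure.restrict_univ] at h2


lemma continuous_integral_area {X : Type*} [TopologicalSpace X] [FirstCountableTopology X]
    [LocallyCompactSpace X] {F : X × S2 → ℝ} (hF : Continuous F) :
    Continuous fun x => ∫ n, F (x, n) ∂area := by
  have h := continuous_parametric_integral_of_continuous (μ := area)
    (f := fun x n => F (x, n)) hF (isCompact_univ (X := S2))
  simpa using h

/-- A continuous function of `(t, n)` that vanishes at late times. -/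
lemma integral_shell_eq {F G : ℝ × S2 → ℝ} (hF : Continuous F) (hG : Continuous G) {A : ℝ}
    (hA : ∀ t, A < t → ∀ n, G (t, n) = 0) (hd : ∀ t, 0 < t → ∀ n, HasDerivAt (fun t => G (t, n)) (F (t, n)) t)
    (hA' : ∀ t, A < t → ∀ n, F (t, n) = 0) :
    ∫ t in Ioi (0 : ℝ), ∫ n, F (t, n) ∂area = - ∫ n, G (0, n) ∂area := by
  have hi := integrable_shell hF hA'
  rw [integral_integral_swap (f := fun t n => F (t, n)) hi, ← integral_neg]
  refine integral_congr_ae ?_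
  filter_upwards [hi.prod_left_ae] with n hn
  have h := integral_Ioi_of_hasDerivAt_of_tendsto (a := (0 : ℝ)) (f := fun t => G (t, n))
    (f' := fun t => F (t, n)) (m := 0)
    (hG.comp (by fun_prop : Continuous fun t : ℝ => (t, n))).continuousWithinAt
    (fun t ht => hd t ht n) hn (tendsto_const_nhds.congr' (by
      filter_upwards [eventually_gt_atTop A] with t ht using (hA t ht n).symm))
  simpa using h

lemma dD_apply (a : Fin 4) (F : Dist) (φ : Spacetime → ℝ) : dD a F φ = - F (pd a φ) := rfl

lemma divT_apply (T : Tensor2) (a : Fin 4) (φ : Spacetime → ℝ) :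
    divT T a φ = T a 0 (pd 0 φ) - ∑ i : Fin 3, T a i.succ (pd i.succ φ) := by
  simp only [divT, Finset.sum_apply, Pi.smul_apply, dD_apply, sum_eta_smul,
    Finset.sum_neg_distrib]
  ring

lemma event_zero_zero : event 0 0 = 0 := by
  funext a
  refine Fin.cases rfl (fun i => rfl) a

/-- The divergence of a shell is its momentum at the event at which it is launched. -/
theorem divT_shell {v w : ℝ} (hv0 : 0 < v) (hvw : v < w) {τ : S2 → Fin 4 → Fin 4 → ℝ}
    (hτ : IsFreeShell v τ) {φ : Spacetime → ℝ} (hφ : Admissible w φ) (a : Fin 4) :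
    divT (shell v τ) a φ = - φ 0 * ∫ n, τ n a 0 ∂area := by
  have hz : ∀ ψ, Admissible w ψ → ∃ A, 0 < A ∧ ∀ t, A < t → ∀ n : S2,
      ψ (event t ((v * t) • (n : E3))) = 0 := by
    rintro ψ ⟨-, A, hA, h⟩
    refine ⟨A, hA, fun t ht n => h _ ?_ ?_⟩
    · exact ht.trans_le (le_abs_self t)
    · have : 0 < t := hA.trans ht
      rw [space_event, norm_smul, S2.norm_coe, mul_one, Real.norm_of_nonneg (by positivity),
        event_zero, abs_of_pos this]
      gcongr
  have hc := hφ.1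
  have hpc : ∀ b, Continuous fun q : ℝ × S2 => pd b φ (event q.1 ((v * q.1) • (q.2 : E3))) :=
    fun b => (contDiff_pd hc b).continuous.comp (by fun_prop)
  have hτc : ∀ a b, Continuous fun q : ℝ × S2 => τ q.2 a b :=
    fun a b => (hτ.continuous a b).comp continuous_snd
  have hφc : Continuous fun q : ℝ × S2 => φ (event q.1 ((v * q.1) • (q.2 : E3))) :=
    hc.continuous.comp (by fun_prop)
  choose A hA0 hA using fun b => hz _ (hφ.pd b)
  obtain ⟨A', hA0', hA'⟩ := hz φ hφ
  have hI : ∀ b, Integrable (fun q : ℝ × S2 => τ q.2 a b * pd b φ (event q.1 ((v * q.1) • (q.2 : E3))))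
      ((volume.restrict (Ioi (0 : ℝ))).prod area) := fun b =>
    integrable_shell ((hτc a b).mul (hpc b)) (A := A b)
      fun t ht n => by simp only [hA b t ht n, mul_zero]
  let B := A' + ∑ b, A b
  have hAB : ∀ b, A b ≤ B := fun b => by
    have := Finset.single_le_sum (fun b _ => (hA0 b).le) (Finset.mem_univ b)
    simp only [B]; linarith
  have hAB' : A' ≤ B := by
    have := Finset.sum_nonneg (s := Finset.univ) (fun b _ => (hA0 b).le)
    simp only [B]; linarith
  -- The derivative of `φ` along the radial world lines integrates to minus its value at the launch.
  have h1 := integral_shell_eq (A := B)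
    (F := fun q => τ q.2 a 0 * (pd 0 φ (event q.1 ((v * q.1) • (q.2 : E3))) + ∑ i : Fin 3,
      (v * (q.2 : E3) i) * pd i.succ φ (event q.1 ((v * q.1) • (q.2 : E3)))))
    (G := fun q => τ q.2 a 0 * φ (event q.1 ((v * q.1) • (q.2 : E3))))
    ((hτc a 0).mul ((hpc 0).add (continuous_finsetSum _ fun i _ =>
      Continuous.mul (by fun_prop) (hpc i.succ))))
    ((hτc a 0).mul hφc)
    (fun t ht n => by simp only [hA' t (hAB'.trans_lt ht) n, mul_zero])
    (fun t _ n => by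
      have h := (hasDerivAt_comp_event_line hc 0 0 (v • (n : E3)) 1 t).const_mul (τ n a 0)
      have e : ∀ s : ℝ, (v * s) • (n : E3) = s • v • (n : E3) := fun s => by
        rw [smul_smul, mul_comm]
      simp only [e]
      simpa using h)
    (fun t ht n => by simp [hA _ t ((hAB _).trans_lt ht) n])
  -- At fixed time the spatial gradient splits into a radial part, which `normal` turns into
  -- transport with speed `v`, and a tangential part, which integrates to zero by `tangential`.
  have h2 : ∀ t : ℝ, 0 < t → ∫ n, (τ n a 0 * pd 0 φ (event t ((v * t) • (n : E3)))
      - ∑ i : Fin 3, τ n a i.succ * pd i.succ φ (event t ((v * t) • (n : E3)))) ∂area =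
      ∫ n, τ n a 0 * (pd 0 φ (event t ((v * t) • (n : E3))) + ∑ i : Fin 3,
        (v * (n : E3) i) * pd i.succ φ (event t ((v * t) • (n : E3)))) ∂area := by
    intro t ht
    have hg := grad_comp_event hc t (v * t) 0
    have h3 := hτ.tangential _ (SmoothS2.comp_event hc t (v * t) 0) a
    simp only [zero_add] at hg h3
    simp only [hg, mul_left_comm _ (v * t), ← Finset.mul_sum] at h3
    rw [integral_const_mul, mul_eq_zero, or_iff_right (by positivity)] at h3
    have hpt : ∀ b, Continuous fun n : S2 => pd b φ (event t ((v * t) • (n : E3))) :=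
      fun b => (contDiff_pd hc b).continuous.comp (by fun_prop)
    have hτt := hτ.continuous a
    rw [← sub_eq_zero, ← integral_sub, ← neg_eq_zero, ← integral_neg, ← h3]
    · congr 1
      funext n
      have h5 := hτ.normal n a
      simp only [sum_proj_mul]
      simp only [Fin.sum_univ_three] at h5 ⊢
      linear_combination ((n : E3) 0 * pd (Fin.succ 0) φ (event t ((v * t) • (n : E3))) +
        (n : E3) 1 * pd (Fin.succ 1) φ (event t ((v * t) • (n : E3))) +
        (n : E3) 2 * pd (Fin.succ 2) φ (event t ((v * t) • (n : E3)))) * h5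
    · exact integrable_area (((hτt 0).mul (hpt 0)).sub (continuous_finsetSum _ fun i _ =>
        (hτt i.succ).mul (hpt i.succ)))
    · exact integrable_area ((hτt 0).mul ((hpt 0).add (continuous_finsetSum _ fun i _ =>
        Continuous.mul (by fun_prop) (hpt i.succ))))
  have h0 : - ∫ n : S2, τ n a 0 * φ (event 0 ((v * 0) • (n : E3))) ∂area =
      - φ 0 * ∫ n, τ n a 0 ∂area := by
    simp only [mul_zero, zero_smul, event_zero_zero, integral_mul_const]
    ring
  rw [divT_apply, ← h0, ← h1]
  simp only [shell]
  rw [← integral_finsetSum _ (fun i _ => (hI _).integral_prod_left),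
    ← integral_sub (hI 0).integral_prod_left
      (integrable_finsetSum _ fun i _ => (hI _).integral_prod_left)]
  refine setIntegral_congr_fun measurableSet_Ioi fun t ht => ?_
  simp only
  rw [← h2 t ht]
  have hpt : ∀ b, Continuous fun n : S2 => pd b φ (event t ((v * t) • (n : E3))) :=
    fun b => (contDiff_pd hc b).continuous.comp (by fun_prop)
  have hτt := hτ.continuous a
  have hi : ∀ b, Integrable (fun n => τ n a b * pd b φ (event t ((v * t) • (n : E3)))) area :=
    fun b => integrable_area ((hτt b).mul (hpt b))
  rw [integral_sub (hi 0) (integrable_finsetSum _ fun i _ => hi i.succ),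
    integral_finsetSum _ fun i _ => hi i.succ]

lemma IsFreeShell.add {v : ℝ} {σ τ : S2 → Fin 4 → Fin 4 → ℝ} (hσ : IsFreeShell v σ)
    (hτ : IsFreeShell v τ) : IsFreeShell v (fun n a b => σ n a b + τ n a b) where
  continuous a b := (hσ.continuous a b).add (hτ.continuous a b)
  normal n a := by
    simp only [mul_add, Finset.sum_add_distrib, hσ.normal, hτ.normal]
  tangential f hf a := by
    simp only [add_mul, Finset.sum_add_distrib]
    rw [integral_add, hσ.tangential f hf, hτ.tangential f hf, add_zero]
    · exact integrable_area (continuous_finsetSum _ fun i _ =>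
        (hσ.continuous a i.succ).mul (hf.grad i).continuous)
    · exact integrable_area (continuous_finsetSum _ fun i _ =>
        (hτ.continuous a i.succ).mul (hf.grad i).continuous)

lemma IsFreeShell.const_mul {v : ℝ} {τ : S2 → Fin 4 → Fin 4 → ℝ} (hτ : IsFreeShell v τ) (c : ℝ) :
    IsFreeShell v (fun n a b => c * τ n a b) where
  continuous a b := continuous_const.mul (hτ.continuous a b)
  normal n a := by
    simp only [mul_left_comm _ c, ← Finset.mul_sum, hτ.normal]
  tangential f hf a := by
    simp only [mul_assoc, ← Finset.mul_sum]
    rw [integral_const_mul, hτ.tangential f hf, mul_zero]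

lemma isFreeShell_dust (v : ℝ) : IsFreeShell v (dust v) where
  continuous a b := (SmoothS2.dust v a b).continuous
  normal n a := by
    have h := n.sum_sq
    simp only [dust]
    generalize vel v n a = c
    simp only [vel, Fin.cons_succ, Fin.cons_zero, Fin.sum_univ_three]
    linear_combination - gam v * v * c * h
  tangential f hf a := by
    have h : ∀ n, ∑ i : Fin 3, dust v n a i.succ * grad f n i = 0 := by
      intro n
      have h := grad_normal hf n
      simp only [dust]
      generalize vel v n a = c
      simp only [vel, Fin.cons_succ, Fin.sum_univ_three] at *
      linear_combination gam v * v * c * h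
    simp only [h, integral_zero]

lemma isFreeShell_lStress (v : ℝ) {α : S2 → ℝ} (hα : SmoothS2 α) :
    IsFreeShell v (lStress v α) where
  continuous a b := (SmoothS2.lStress v hα a b).continuous
  normal n a := by
    refine Fin.cases ?_ (fun j => ?_) a
    · have h := rot_tangent (radialPotential α) n
      simp only [lStress_zero_succ v hα, lStress_zero_zero, mul_left_comm _ (gam v / 2),
        ← Finset.mul_sum, h, mul_zero]
    · simp only [lStress_symm v α n j.succ]
      exact sum_mul_lStress v hα n j
  tangential f hf a := by
    refine Fin.cases ?_ (fun j => ?_) a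
    · have hβ := hα.radialPotential'
      have h := integral_tangent_mul_grad hβ.rot (rot_tangent (radialPotential α)) hf
      simp only [div_rot hβ, zero_mul, integral_zero, neg_zero] at h
      simp only [lStress_zero_succ v hα, mul_assoc, ← Finset.mul_sum]
      rw [integral_const_mul, h, mul_zero]
    · simp only [lStress_symm v α _ j.succ]
      exact integral_lStress_mul_grad v hα hf j

lemma integral_lStress_zero (v : ℝ) {α : S2 → ℝ} (hα : SmoothS2 α) (a : Fin 4) :
    ∫ n, lStress v α n a 0 ∂area = 0 := by
  refine Fin.cases ?_ (fun j => ?_) a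
  · simp [lStress_zero_zero]
  · simp only [lStress_succ_zero v hα, integral_const_mul, integral_rot hα.radialPotential',
      mul_zero]

lemma integral_dust_zero (v : ℝ) (a : Fin 4) :
    ∫ n, dust v n a 0 ∂area = shellEnergy v 1 * rest a 0 := by
  simp only [dust, vel, Fin.cons_zero]
  rw [integral_mul_const]
  have := integral_vel v a
  simp only [vel] at this
  rw [this, shellEnergy, rest]
  simp only [and_true]
  ring

/-- The stress tensor of the shell, including its dust. -/
def shellStress (v ρ : ℝ) (α : S2 → ℝ) (n : S2) (a b : Fin 4) : ℝ :=
  ρ * dust v n a b + lStress v α n a b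

lemma source_eq (v ρ m : ℝ) (α : S2 → ℝ) : source v ρ m α =
    laboratory (m + shellEnergy v ρ) m + shell v (shellStress v ρ α) := rfl

lemma isFreeShell_shellStress (v ρ : ℝ) {α : S2 → ℝ} (hα : SmoothS2 α) :
    IsFreeShell v (shellStress v ρ α) :=
  ((isFreeShell_dust v).const_mul ρ).add (isFreeShell_lStress v hα)

lemma integral_shellStress_zero (v ρ : ℝ) {α : S2 → ℝ} (hα : SmoothS2 α) (a : Fin 4) :
    ∫ n, shellStress v ρ α n a 0 ∂area = shellEnergy v ρ * rest a 0 := by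
  simp only [shellStress]
  have hd : Continuous fun n => ρ * dust v n a 0 :=
    continuous_const.mul ((isFreeShell_dust v).continuous a 0)
  rw [integral_add (integrable_area hd)
    (integrable_area ((isFreeShell_lStress v hα).continuous a 0)), integral_const_mul,
    integral_dust_zero, integral_lStress_zero v hα]
  simp only [shellEnergy]
  ring

lemma rest_succ_right (a : Fin 4) (i : Fin 3) : rest a i.succ = 0 := by
  simp [rest, Fin.succ_ne_zero]

lemma divT_laboratory {w : ℝ} (hw : 0 < w) (m₀ m₁ : ℝ) {φ : Spacetime → ℝ}
    (hφ : Admissible w φ) (a : Fin 4) :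
    divT (laboratory m₀ m₁) a φ = rest a 0 * (m₀ - m₁) * φ 0 := by
  have hz : ∀ ψ, Admissible w ψ → ∃ A, 0 < A ∧ ∀ t, A < |t| → ψ (event t 0) = 0 := by
    rintro ψ ⟨-, A, hA, h⟩
    exact ⟨A, hA, fun t ht => h _ ht (by simpa using mul_pos hw (hA.trans ht))⟩
  have hc := hφ.1
  obtain ⟨A, hA0, hA⟩ := hz _ hφ
  obtain ⟨B, hB0, hB⟩ := hz _ (hφ.pd 0)
  have hd : ∀ t, HasDerivAt (fun t => φ (event t 0)) (pd 0 φ (event t 0)) t := by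
    intro t
    simpa using hasDerivAt_comp_event_line hc 0 0 0 1 t
  have hg : Continuous fun t => φ (event t 0) := hc.continuous.comp (by fun_prop)
  have hg' : Continuous fun t => pd 0 φ (event t 0) := (contDiff_pd hc 0).continuous.comp (by fun_prop)
  have hi : Integrable fun t => pd 0 φ (event t 0) := by
    refine hg'.integrable_of_hasCompactSupport (HasCompactSupport.intro (isCompact_Icc (a := -B)
      (b := B)) fun t ht => hB t ?_)
    contrapose! ht
    exact abs_le.1 ht
  have h1 := integral_Ioi_of_hasDerivAt_of_tendsto (a := (0 : ℝ)) (m := 0) hg.continuousWithinAt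
    (fun t _ => hd t) hi.integrableOn (tendsto_const_nhds.congr' (by
      filter_upwards [eventually_gt_atTop A] with t ht using
        (hA t (ht.trans_le (le_abs_self t))).symm))
  have h2 := integral_Iic_of_hasDerivAt_of_tendsto (a := (0 : ℝ)) (m := 0) hg.continuousWithinAt
    (fun t _ => hd t) hi.integrableOn (tendsto_const_nhds.congr' (by
      filter_upwards [eventually_lt_atBot (-A)] with t ht using
        (hA t (by have := neg_le_abs t; linarith)).symm))
  rw [integral_Iic_eq_integral_Iio] at h2
  rw [divT_apply]
  simp only [laboratory, rest_succ_right, h1, h2, zero_mul, Finset.sum_const_zero,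
    event_zero_zero]
  ring

lemma divT_add (T U : Tensor2) (a : Fin 4) (φ : Spacetime → ℝ) :
    divT (T + U) a φ = divT T a φ + divT U a φ := by
  simp only [divT_apply, Pi.add_apply, Finset.sum_add_distrib]
  ring

/-- The point sources at the launch cancel: the shell has no total spatial momentum, and its energy
is the mass lost by the laboratory. The class `Admissible` is kept so that advanced potentials are
allowed as test functions. -/
theorem divT_source {v w : ℝ} (hv0 : 0 < v) (hvw : v < w) {α : S2 → ℝ} (hα : SmoothS2 α)
    (ρ m : ℝ) {φ : Spacetime → ℝ} (hφ : Admissible w φ) (a : Fin 4) :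
    divT (source v ρ m α) a φ = 0 := by
  rw [source_eq, divT_add, divT_laboratory (hv0.trans hvw) _ _ hφ,
    divT_shell hv0 hvw (isFreeShell_shellStress v ρ hα) hφ, integral_shellStress_zero v ρ hα]
  ring

theorem conserved_source {v : ℝ} (hv0 : 0 < v) {α : S2 → ℝ} (hα : SmoothS2 α)
    (ρ m : ℝ) : Conserved (source v ρ m α) := fun a _ hφ =>
  divT_source hv0 (lt_add_one v) hα ρ m (hφ.admissible _) a

theorem conserved_shell_lStress {v : ℝ} (hv0 : 0 < v) {α : S2 → ℝ} (hα : SmoothS2 α) :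
    Conserved (shell v (lStress v α)) := fun a φ hφ => by
  rw [divT_shell hv0 (lt_add_one v) (isFreeShell_lStress v hα) (hφ.admissible _),
    integral_lStress_zero v hα, mul_zero]

/-! ### The dominant energy condition -/

lemma sum_eta_mul_mul (k : Fin 4 → ℝ) :
    ∑ a, eta a a * k a * k a = ∑ i : Fin 3, k i.succ * k i.succ - k 0 * k 0 := by
  rw [Fin.sum_univ_succ]
  simp only [eta_zero_zero, eta_succ_succ, if_true]
  ring_nf

lemma FutureCausal.abs_le {k : Fin 4 → ℝ} (hk : FutureCausal k) (a : Fin 4) : |k a| ≤ k 0 := by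
  obtain ⟨h0, h⟩ := hk
  rw [sum_eta_mul_mul] at h
  refine Fin.cases ?_ (fun i => ?_) a
  · rw [abs_of_nonneg h0]
  · refine abs_le_of_sq_le_sq ?_ h0
    have := Finset.single_le_sum (f := fun i : Fin 3 => k i.succ * k i.succ)
      (fun i _ => mul_self_nonneg _) (Finset.mem_univ i)
    nlinarith

/-- Cauchy–Schwarz bounds the radial component of `k` by `k⁰`. The bound is uniform in the
direction, which lets the dust absorb `l`. -/
lemma vel_mul_le {v : ℝ} (hv0 : 0 < v) (hv1 : v < 1) (n : S2) {k : Fin 4 → ℝ}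
    (hk : FutureCausal k) : ∑ a, vel v n a * k a ≤ - (gam v * (1 - v)) * k 0 := by
  have hg := gam_pos hv0 hv1
  obtain ⟨h0, h⟩ := hk
  rw [sum_eta_mul_mul] at h
  have h1 : ∑ i : Fin 3, (n : E3) i * k i.succ ≤ k 0 := by
    have h2 := Finset.sum_mul_sq_le_sq_mul_sq Finset.univ (fun i => (n : E3) i)
      (fun i : Fin 3 => k i.succ)
    have h3 : ∑ i, (n : E3) i ^ 2 = 1 := by
      have := n.sum_sq
      simp only [Fin.sum_univ_three]
      linarith
    rw [h3, one_mul] at h2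
    refine abs_le_of_sq_le_sq' ?_ h0 |>.2
    refine h2.trans ?_
    simp only [sq]
    linarith
  rw [Fin.sum_univ_succ]
  simp only [vel, Fin.cons_zero, Fin.cons_succ, mul_assoc, ← Finset.mul_sum]
  have h4 := mul_le_mul_of_nonneg_left h1 (mul_pos hg hv0).le
  nlinarith

/-- A symmetric tensor that is nonnegative on future causal vectors satisfies the dominant energy
condition. -/
lemma futureCausal_of_nonneg {w : Fin 4 → ℝ}
    (h : ∀ q, FutureCausal q → 0 ≤ ∑ a, w a * q a) :
    FutureCausal (fun a => - (eta a a * w a)) := by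
  -- Self-duality of the light cone: testing on this null vector and on the time direction suffices.
  have h1 := h (Fin.cons (Real.sqrt (∑ i : Fin 3, w i.succ ^ 2)) (fun i => - w i.succ)) (by
    refine ⟨Real.sqrt_nonneg _, ?_⟩
    rw [sum_eta_mul_mul]
    simp only [Fin.cons_zero, Fin.cons_succ]
    rw [Real.mul_self_sqrt (Finset.sum_nonneg fun i _ => sq_nonneg _)]
    simp [sq])
  have h2 := h (Fin.cons 1 0) ⟨zero_le_one, by rw [sum_eta_mul_mul]; simp⟩
  have hs := Real.sq_sqrt (Finset.sum_nonneg fun (i : Fin 3) (_ : i ∈ Finset.univ) =>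
    sq_nonneg (w i.succ))
  have hs0 := Real.sqrt_nonneg (∑ i : Fin 3, w i.succ ^ 2)
  set s := Real.sqrt (∑ i : Fin 3, w i.succ ^ 2)
  rw [Fin.sum_univ_succ] at h1 h2
  simp only [Fin.cons_zero, Fin.cons_succ, Pi.zero_apply, mul_zero, Finset.sum_const_zero,
    mul_one, add_zero, mul_neg, Finset.sum_neg_distrib, ← sq, ← hs] at h1 h2
  refine ⟨by simpa [eta_zero_zero] using h2, ?_⟩
  rw [sum_eta_mul_mul]
  simp only [eta_zero_zero, eta_succ_succ, if_true, one_mul, neg_mul, neg_neg, ← sq, neg_sq]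
  rw [← hs]
  rcases hs0.eq_or_lt with h3 | h3
  · rw [← h3]
    nlinarith
  · have : s ≤ w 0 := by nlinarith
    nlinarith


lemma exists_bound_of_continuous {τ : S2 → Fin 4 → Fin 4 → ℝ}
    (hτ : ∀ a b, Continuous fun n => τ n a b) : ∃ L, 0 ≤ L ∧ ∀ n a b, |τ n a b| ≤ L := by
  choose C hC using fun a b => (isCompact_univ (X := S2)).exists_bound_of_continuousOn
    (hτ a b).continuousOn
  have h0 : ∀ a b, 0 ≤ C a b := fun a b => (norm_nonneg _).trans (hC a b (toS2 0) trivial)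
  refine ⟨∑ a, ∑ b, C a b, Finset.sum_nonneg fun a _ => Finset.sum_nonneg fun b _ => h0 a b,
    fun n a b => (hC a b n trivial).trans ?_⟩
  exact (Finset.single_le_sum (fun b _ => h0 a b) (Finset.mem_univ b)).trans
    (Finset.single_le_sum (f := fun a => ∑ b, C a b)
      (fun a _ => Finset.sum_nonneg fun b _ => h0 a b) (Finset.mem_univ a))

/-- The dust contributes at least `ρ (γ(1 - v))² k⁰ q⁰`, and the sixteen components of `l` at most
`16 L k⁰ q⁰` in absolute value. -/
lemma shellStress_nonneg {v : ℝ} (hv0 : 0 < v) (hv1 : v < 1) {α : S2 → ℝ} {L ρ : ℝ}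
    (hL : ∀ n a b, |lStress v α n a b| ≤ L)
    (hρ : 16 * L ≤ ρ * (gam v * (1 - v)) ^ 2) (hρ0 : 0 ≤ ρ) (n : S2) {k q : Fin 4 → ℝ}
    (hk : FutureCausal k) (hq : FutureCausal q) :
    0 ≤ ∑ a, ∑ b, shellStress v ρ α n a b * k b * q a := by
  have h1 := vel_mul_le hv0 hv1 n hk
  have h2 := vel_mul_le hv0 hv1 n hq
  set c := gam v * (1 - v)
  have hc : 0 < c := mul_pos (gam_pos hv0 hv1) (by linarith)
  have h3 : ∑ a, ∑ b, shellStress v ρ α n a b * k b * q a =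
      ρ * ((∑ a, vel v n a * q a) * (∑ b, vel v n b * k b)) +
        ∑ a, ∑ b, lStress v α n a b * k b * q a := by
    rw [Finset.sum_mul_sum, Finset.mul_sum, ← Finset.sum_add_distrib]
    refine Finset.sum_congr rfl fun a _ => ?_
    rw [Finset.mul_sum, ← Finset.sum_add_distrib]
    refine Finset.sum_congr rfl fun b _ => ?_
    simp only [shellStress, dust]
    ring
  have hkq : 0 ≤ k 0 * q 0 := mul_nonneg hk.1 hq.1
  have h4 : |∑ a, ∑ b, lStress v α n a b * k b * q a| ≤ 16 * L * (k 0 * q 0) := by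
    calc _ ≤ ∑ a : Fin 4, ∑ b : Fin 4, L * (k 0 * q 0) := by
          refine (Finset.abs_sum_le_sum_abs _ _).trans (Finset.sum_le_sum fun a _ =>
            (Finset.abs_sum_le_sum_abs _ _).trans (Finset.sum_le_sum fun b _ => ?_))
          rw [abs_mul, abs_mul, mul_assoc]
          exact mul_le_mul (hL n a b) (mul_le_mul (hk.abs_le b) (hq.abs_le a) (abs_nonneg _) hk.1)
            (by positivity) ((abs_nonneg _).trans (hL n a b))
      _ = _ := by simp; ring
  have h5 : c ^ 2 * (k 0 * q 0) ≤ (∑ a, vel v n a * q a) * (∑ b, vel v n b * k b) := by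
    have h6 := mul_nonneg hc.le hk.1
    have h7 := mul_nonneg hc.le hq.1
    nlinarith
  have h6 := mul_le_mul_of_nonneg_left h5 hρ0
  have h7 := neg_abs_le (∑ a, ∑ b, lStress v α n a b * k b * q a)
  have h8 := mul_le_mul_of_nonneg_right hρ hkq
  rw [h3]
  nlinarith

lemma continuous_shell_integrand {φ : Spacetime → ℝ} (hφ : Continuous φ) (v : ℝ) {f : S2 → ℝ}
    (hf : Continuous f) :
    Continuous fun q : ℝ × S2 => f q.2 * φ (event q.1 ((v * q.1) • (q.2 : E3))) :=
  (hf.comp continuous_snd).mul (hφ.comp (by fun_prop))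

theorem dominantEnergy_source {v : ℝ} (hv0 : 0 < v) (hv1 : v < 1) {α : S2 → ℝ} (hα : SmoothS2 α) :
    ∃ ρ₀ : ℝ, 0 < ρ₀ ∧ ∀ ρ : ℝ, ρ₀ ≤ ρ → ∀ m : ℝ, 0 ≤ m → DominantEnergy (source v ρ m α) := by
  obtain ⟨L, hL0, hL⟩ := exists_bound_of_continuous (isFreeShell_lStress v hα).continuous
  have hc : 0 < gam v * (1 - v) := mul_pos (gam_pos hv0 hv1) (by linarith)
  -- The summand `1` keeps the threshold positive when `L = 0`.
  refine ⟨16 * L / (gam v * (1 - v)) ^ 2 + 1, by positivity, fun ρ hρ m hm φ hφ hφ0 k hk => ?_⟩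
  have hρ1 : 16 * L ≤ ρ * (gam v * (1 - v)) ^ 2 := by
    rw [← div_le_iff₀ (by positivity)]
    linarith
  have hρ0 : 0 ≤ ρ := by
    have : 0 ≤ 16 * L / (gam v * (1 - v)) ^ 2 := by positivity
    linarith
  refine futureCausal_of_nonneg fun q hq => ?_
  have hτ := (isFreeShell_shellStress v ρ hα).continuous
  obtain ⟨-, A, -, hA⟩ := hφ.admissible (v + 1)
  have hz : ∀ t, A < t → 0 < t → ∀ n : S2, φ (event t ((v * t) • (n : E3))) = 0 := by
    intro t ht h0 n
    refine hA _ (ht.trans_le (le_abs_self t)) ?_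
    rw [space_event, norm_smul, S2.norm_coe, mul_one, Real.norm_of_nonneg (by positivity),
        event_zero, abs_of_pos h0]
    gcongr
    linarith
  have hi : ∀ a b, Integrable (fun p : ℝ × S2 => shellStress v ρ α p.2 a b *
      φ (event p.1 ((v * p.1) • (p.2 : E3)))) ((volume.restrict (Ioi (0 : ℝ))).prod area) :=
    fun a b => integrable_shell (A := max A 0) (continuous_shell_integrand hφ.1.continuous v (hτ a b))
      fun t ht n => by
        rw [hz t ((le_max_left _ _).trans_lt ht) ((le_max_right _ _).trans_lt ht), mul_zero]
  have h1 : ∀ a b, source v ρ m α a b φ = laboratory (m + shellEnergy v ρ) m a b φ +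
      ∫ p : ℝ × S2, shellStress v ρ α p.2 a b * φ (event p.1 ((v * p.1) • (p.2 : E3)))
        ∂((volume.restrict (Ioi (0 : ℝ))).prod area) := by
    intro a b
    rw [integral_prod _ (hi a b)]
    rfl
  have h2 : ∑ a, (∑ b, source v ρ m α a b φ * k b) * q a =
      ∑ a, (∑ b, laboratory (m + shellEnergy v ρ) m a b φ * k b) * q a +
      ∫ p : ℝ × S2, (∑ a, ∑ b, shellStress v ρ α p.2 a b * k b * q a) *
        φ (event p.1 ((v * p.1) • (p.2 : E3))) ∂((volume.restrict (Ioi (0 : ℝ))).prod area) := by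
    simp only [h1, add_mul, Finset.sum_add_distrib, Finset.sum_mul]
    congr 1
    simp only [← integral_mul_const]
    rw [integral_finsetSum]
    · refine Finset.sum_congr rfl fun a _ => ?_
      rw [integral_finsetSum]
      · refine Finset.sum_congr rfl fun b _ => ?_
        congr 1
        funext p
        ring
      · exact fun b _ => (((hi a b).mul_const (k b)).mul_const (q a)).congr
          (Eventually.of_forall fun p => by simp only; ring)
    · exact fun a _ => integrable_finsetSum _ fun b _ =>
        (((hi a b).mul_const (k b)).mul_const (q a)).congr
          (Eventually.of_forall fun p => by simp only; ring)
  rw [h2]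
  refine add_nonneg ?_ (integral_nonneg fun p => mul_nonneg
    (shellStress_nonneg hv0 hv1 hL hρ1 hρ0 p.2 hk hq) (hφ0 _))
  have hE : 0 ≤ shellEnergy v ρ := by unfold shellEnergy; positivity
  have h3 : ∑ a, (∑ b, laboratory (m + shellEnergy v ρ) m a b φ * k b) * q a =
      laboratory (m + shellEnergy v ρ) m 0 0 φ * k 0 * q 0 := by
    simp [Fin.sum_univ_succ, laboratory, rest]
  rw [h3]
  refine mul_nonneg (mul_nonneg (mul_nonneg (by simp [rest]) (add_nonneg
    (mul_nonneg (by positivity) (integral_nonneg fun _ => hφ0 _))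
    (mul_nonneg hm (integral_nonneg fun _ => hφ0 _)))) hk.1) hq.1

/-! ### No flux to null infinity -/

lemma exists_bound_of_isTest {E : Type*} [NormedAddCommGroup E] [NormedSpace ℝ E] {φ : E → ℝ}
    (hφ : IsTest φ) : ∃ R, 0 < R ∧ ∀ p, R < ‖p‖ → φ p = 0 := by
  obtain ⟨R, hR⟩ := hφ.2.isCompact.isBounded.exists_norm_le
  refine ⟨max R 1, by positivity, fun p h1 => ?_⟩
  by_contra h
  have h2 := hR p (subset_tsupport _ h)
  have := le_max_left R 1
  linarith

/-- The pairing is exactly zero for large `R`: the laboratory stays at `r = 0`, and the shell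
reaches radius `r` at retarded time `(1 - v) r / v`, which leaves the support of `ψ`. -/
theorem leadingAtScri_source {v : ℝ} (hv0 : 0 < v) (hv1 : v < 1) (ρ m : ℝ) (α : S2 → ℝ)
    (a b : Fin 4) : LeadingAtScri 2 (source v ρ m α a b) (fun _ => 0) := by
  intro ψ χ hψ hχ _
  obtain ⟨A, hA0, hA⟩ := exists_bound_of_isTest hψ
  obtain ⟨B, hB0, hB⟩ := exists_bound_of_isTest hχ
  refine tendsto_const_nhds.congr' ?_
  filter_upwards [eventually_gt_atTop (B + v * A / (1 - v))] with R hR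
  have hv : 0 < 1 - v := by linarith
  have hq : 0 < v * A / (1 - v) := by positivity
  have h1 : ∀ t, scriTest 2 ψ χ R (event t 0) = 0 := by
    intro t
    have : χ (‖space (event t 0)‖ - R) = 0 := hB _ (by
      rw [space_event, norm_zero, zero_sub, norm_neg, Real.norm_eq_abs]
      exact lt_of_lt_of_le (by linarith) (le_abs_self R))
    rw [scriTest, this, mul_zero]
  have h2 : ∀ t, 0 < t → ∀ n : S2, scriTest 2 ψ χ R (event t ((v * t) • (n : E3))) = 0 := by
    intro t ht n
    have hn : ‖(v * t) • (n : E3)‖ = v * t := by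
      rw [norm_smul, S2.norm_coe, mul_one, Real.norm_of_nonneg (by positivity)]
    rw [scriTest, space_event, hn, event_zero]
    by_cases h : B < ‖v * t - R‖
    · rw [hB _ h, mul_zero]
    · rw [hA, mul_zero, zero_mul]
      have h3 : A < t - v * t := by
        rw [not_lt, Real.norm_eq_abs] at h
        have h4 := (abs_le.1 h).1
        have h5 : v * A / (1 - v) < v * t := by linarith
        rw [div_lt_iff₀ hv, mul_assoc] at h5
        have := lt_of_mul_lt_mul_left h5 hv0.le
        linarith
      exact h3.trans_le ((le_abs_self _).trans (norm_fst_le (t - v * t, (v * t)⁻¹ • (v * t) • (n : E3))))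
  rw [source_eq]
  simp only [Pi.add_apply, laboratory, shell, h1, integral_zero, mul_zero, add_zero, zero_add]
  symm
  refine integral_eq_zero_of_ae ?_
  filter_upwards [ae_restrict_mem measurableSet_Ioi] with t ht
  simp only [h2 t ht, mul_zero, integral_zero, Pi.zero_apply]

/-! ### The advanced potential -/

/-- The measure `dz / (4π |z|)`. -/
def coulomb : Measure E3 :=
  (volume : Measure E3).withDensity fun z => ENNReal.ofReal (4 * Real.pi * ‖z‖)⁻¹

/-- The null vector from the origin to the future light cone over `z`. -/
def cone (z : E3) : Spacetime := event ‖z‖ z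

@[fun_prop]
lemma continuous_cone : Continuous cone := by unfold cone; fun_prop

lemma add_cone (p : Spacetime) (z : E3) : p + cone z = event (p 0 + ‖z‖) (space p + z) := by
  funext a
  refine Fin.cases rfl (fun i => rfl) a

lemma norm_le_norm_cone (z : E3) : ‖z‖ ≤ ‖cone z‖ := by
  have h := norm_le_pi_norm (cone z) 0
  simpa [cone] using h

lemma locallyIntegrable_coulomb : LocallyIntegrable (fun z : E3 => (4 * Real.pi * ‖z‖)⁻¹) := by
  refine locallyIntegrable_of_norm_le_rpow (C := (4 * Real.pi)⁻¹) (α := 1) (by simp) (by norm_num)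
    (Eventually.of_forall fun z => ?_)
    (Measurable.aestronglyMeasurable (by fun_prop))
  rw [Real.norm_of_nonneg (by positivity), mul_inv, Real.rpow_neg_one]

lemma coulomb_closedBall_lt_top (R : ℝ) : coulomb (Metric.closedBall 0 R) < ⊤ := by
  have h := locallyIntegrable_coulomb.integrableOn_isCompact (isCompact_closedBall (0 : E3) R)
  rw [coulomb, withDensity_apply _ Metric.isClosed_closedBall.measurableSet]
  have := h.lintegral_lt_top
  exact this

lemma advanced_eq (φ : Spacetime → ℝ) (p : Spacetime) :
    advanced φ p = ∫ z, φ (p + cone z) ∂coulomb := by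
  rw [coulomb, integral_withDensity_eq_integral_toReal_smul (by fun_prop)
    (Eventually.of_forall fun _ => ENNReal.ofReal_lt_top), advanced]
  refine integral_congr_ae (Eventually.of_forall fun z => ?_)
  simp only [add_cone]
  rw [ENNReal.toReal_ofReal (by positivity), smul_eq_mul, div_eq_mul_inv, mul_comm]

lemma measure_coulomb_map_lt_top (p : Spacetime) :
    (coulomb.map fun z => - cone z) (Metric.ball p 1) < ⊤ := by
  rw [Measure.map_apply (by fun_prop) Metric.isOpen_ball.measurableSet]
  refine (measure_mono fun z hz => ?_).trans_lt (coulomb_closedBall_lt_top (‖p‖ + 1))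
  rw [mem_preimage, mem_ball_iff_norm] at hz
  rw [mem_closedBall_zero_iff]
  have h1 := norm_le_norm_cone z
  have h2 := norm_sub_norm_le (- cone z) p
  rw [norm_neg] at h2
  linarith

/-- The advanced potential is the convolution of `φ` with the measure `dz / (4π |z|)` carried to the
past light cone. This measure is locally finite because `1 / |z|` is locally integrable, so
smoothness is inherited from `φ`. -/
lemma contDiff_advanced {φ : Spacetime → ℝ} (hφ : IsTest φ) : ContDiff ℝ ∞ (advanced φ) := by
  have : IsLocallyFiniteMeasure (coulomb.map fun z => - cone z) :=
    ⟨fun p => ⟨_, Metric.ball_mem_nhds p one_pos, measure_coulomb_map_lt_top p⟩⟩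
  have h := hφ.2.contDiff_convolution_right (μ := coulomb.map fun z => - cone z) (n := ⊤)
    (ContinuousLinearMap.mul ℝ ℝ) (locallyIntegrable_const (1 : ℝ)) hφ.1
  convert h using 1
  funext p
  simp only [convolution, ContinuousLinearMap.mul_apply', one_mul]
  have hc := hφ.1.continuous
  rw [integral_map (by fun_prop) (Continuous.aestronglyMeasurable (by fun_prop)), advanced_eq]
  simp only [sub_neg_eq_add]

lemma IsTest.pd {φ : Spacetime → ℝ} (hφ : IsTest φ) (a : Fin 4) : IsTest (pd a φ) :=
  ⟨contDiff_pd hφ.1 a, hφ.2.fderiv_apply (𝕜 := ℝ) _⟩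

lemma integrable_comp_cone {φ : Spacetime → ℝ} (hφ : IsTest φ) (p : Spacetime) :
    Integrable (fun z => φ (p + cone z)) coulomb := by
  obtain ⟨R, -, hR⟩ := exists_bound_of_isTest hφ
  obtain ⟨C, hC⟩ := hφ.2.exists_bound_of_continuous hφ.1.continuous
  have hc := hφ.1.continuous
  have h : IntegrableOn (fun z => φ (p + cone z)) (Metric.closedBall 0 (R + ‖p‖)) coulomb :=
    IntegrableOn.of_bound (coulomb_closedBall_lt_top _)
      (Continuous.aestronglyMeasurable (by fun_prop)) C (Eventually.of_forall fun z => hC _)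
  refine (integrableOn_iff_integrable_of_support_subset fun z hz => ?_).1 h
  rw [mem_closedBall_zero_iff]
  by_contra! h1
  refine hz (hR _ ?_)
  have h2 := norm_le_norm_cone z
  have h3 := norm_sub_norm_le (cone z) (-p)
  rw [sub_neg_eq_add, norm_neg, add_comm (cone z)] at h3
  linarith

lemma hasDerivAt_add_single {φ : Spacetime → ℝ} (hφ : ContDiff ℝ ∞ φ) (a : Fin 4)
    (p q : Spacetime) (s : ℝ) :
    HasDerivAt (fun s : ℝ => φ (p + s • (Pi.single a 1 : Spacetime) + q))
      (pd a φ (p + s • (Pi.single a 1 : Spacetime) + q)) s := by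
  have h : HasDerivAt (fun s : ℝ => p + s • (Pi.single a 1 : Spacetime) + q)
      (Pi.single a 1) s := by
    simpa using (((hasDerivAt_id s).smul_const (Pi.single a 1 : Spacetime)).const_add p).add_const q
  exact (hφ.differentiable (by simp)).differentiableAt.hasFDerivAt.comp_hasDerivAt s h

lemma exists_bound_comp_cone {φ : Spacetime → ℝ} (hφ : IsTest φ) (p : Spacetime) (a : Fin 4) :
    ∃ g : E3 → ℝ, Integrable g coulomb ∧ ∀ z, ∀ s ∈ Metric.ball (0 : ℝ) 1,
      ‖φ (p + s • (Pi.single a 1 : Spacetime) + cone z)‖ ≤ g z := by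
  obtain ⟨R, -, hR⟩ := exists_bound_of_isTest hφ
  obtain ⟨C, hC⟩ := hφ.2.exists_bound_of_continuous hφ.1.continuous
  refine ⟨(Metric.closedBall (0 : E3) (R + (‖p‖ + 1))).indicator fun _ => C,
    (integrable_indicator_iff Metric.isClosed_closedBall.measurableSet).2
      (integrableOn_const (coulomb_closedBall_lt_top _).ne), fun z s hs => ?_⟩
  rw [mem_ball_zero_iff] at hs
  by_cases hz : z ∈ Metric.closedBall (0 : E3) (R + (‖p‖ + 1))
  · rw [indicator_of_mem hz]
    exact hC _
  · rw [indicator_of_notMem hz, hR, norm_zero]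
    rw [mem_closedBall_zero_iff, not_le] at hz
    have h2 := norm_le_norm_cone z
    have h3 := norm_sub_norm_le (cone z) (-(p + s • Pi.single a 1))
    rw [sub_neg_eq_add, norm_neg, add_comm (cone z)] at h3
    have h4 := norm_add_le p (s • (Pi.single a 1 : Spacetime))
    have h5 : ‖s • (Pi.single a 1 : Spacetime)‖ = ‖s‖ := by
      rw [norm_smul, Pi.norm_single, norm_one, mul_one]
    linarith

lemma pd_advanced {φ : Spacetime → ℝ} (hφ : IsTest φ) (a : Fin 4) :
    pd a (advanced φ) = advanced (pd a φ) := by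
  funext p
  have hc := hφ.1.continuous
  have hpc := (hφ.pd a).1.continuous
  obtain ⟨g, hg, hb⟩ := exists_bound_comp_cone (hφ.pd a) p a
  have h1 := hasDerivAt_add_single (contDiff_advanced hφ) a p 0 0
  have hm : ∀ s : ℝ, AEStronglyMeasurable
      (fun z => φ (p + s • (Pi.single a 1 : Spacetime) + cone z)) coulomb :=
    fun s => Continuous.aestronglyMeasurable (by fun_prop)
  have hm' : AEStronglyMeasurable
      (fun z => pd a φ (p + (0 : ℝ) • (Pi.single a 1 : Spacetime) + cone z)) coulomb :=
    Continuous.aestronglyMeasurable (by fun_prop)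
  have h2 := (hasDerivAt_integral_of_dominated_loc_of_deriv_le (μ := coulomb)
    (F := fun (s : ℝ) z => φ (p + s • (Pi.single a 1 : Spacetime) + cone z))
    (F' := fun s z => pd a φ (p + s • (Pi.single a 1 : Spacetime) + cone z)) (x₀ := (0 : ℝ))
    (Metric.ball_mem_nhds 0 one_pos) (Eventually.of_forall hm) (integrable_comp_cone hφ _) hm'
    (Eventually.of_forall hb) hg
    (Eventually.of_forall fun z s _ => hasDerivAt_add_single hφ.1 a p (cone z) s)).2
  simp only [← advanced_eq] at h2
  simp only [add_zero] at h1
  have h3 := h1.unique h2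
  simpa using h3

/-- The potential is nonzero only at points from which a future light ray meets the support of `φ`;
there `|t| - |x|` is bounded, whereas it grows on the cone `|x| < w |t|`. -/
lemma admissible_advanced {φ : Spacetime → ℝ} (hφ : IsTest φ) {w : ℝ} (hw : w < 1) :
    Admissible w (advanced φ) := by
  refine ⟨contDiff_advanced hφ, ?_⟩
  obtain ⟨R, hR0, hR⟩ := exists_bound_of_isTest hφ
  -- The bounds below give `|t| - |x| ≤ 3 R`; the further `R` is slack.
  refine ⟨(3 * R + R) / (1 - w), by have : 0 < 1 - w := by linarith
                                    positivity, fun p h1 h2 => ?_⟩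
  rw [advanced_eq]
  refine integral_eq_zero_of_ae (Eventually.of_forall fun z => ?_)
  simp only [Pi.zero_apply]
  by_contra h
  have h3 : ‖p + cone z‖ ≤ R := by
    by_contra! h4
    exact h (hR _ h4)
  have h4 : |p 0 + ‖z‖| ≤ R := by
    have := (norm_le_pi_norm (p + cone z) 0).trans h3
    rwa [add_cone, event_zero, Real.norm_eq_abs] at this
  -- The norm on `Spacetime` is the sup norm, so the Euclidean norm of the spatial part is at most
  -- `√3 R`.
  have h5 : ‖space p + z‖ ≤ 2 * R := by
    have h6 : ∀ i : Fin 3, |(space p + z) i| ≤ R := fun i => by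
      have := (norm_le_pi_norm (p + cone z) i.succ).trans h3
      rwa [add_cone, event_succ, Real.norm_eq_abs] at this
    rw [EuclideanSpace.norm_eq, Real.sqrt_le_iff]
    refine ⟨by positivity, ?_⟩
    calc ∑ i, ‖(space p + z) i‖ ^ 2 ≤ ∑ i : Fin 3, R ^ 2 :=
          Finset.sum_le_sum fun i _ => by
            rw [Real.norm_eq_abs]
            exact pow_le_pow_left₀ (abs_nonneg _) (h6 i) 2
      _ ≤ _ := by simp; nlinarith
  have h6 : |‖space p‖ - ‖z‖| ≤ 2 * R := by
    have := abs_norm_sub_norm_le (space p) (-z)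
    rw [norm_neg, sub_neg_eq_add] at this
    exact this.trans h5
  have hw' : 0 < 1 - w := by linarith
  rw [div_lt_iff₀ hw'] at h1
  obtain ⟨h7, h8⟩ := abs_le.1 h4
  obtain ⟨h9, h10⟩ := abs_le.1 h6
  have h11 := norm_nonneg z
  have h12 := norm_nonneg (space p)
  rcases abs_cases (p 0) with ⟨h13, h14⟩ | ⟨h13, h14⟩
  · rw [h13] at h1 h2
    nlinarith
  · rw [h13] at h1 h2
    nlinarith

/-- The wave operator on functions. -/
def dalembert (φ : Spacetime → ℝ) (p : Spacetime) : ℝ := ∑ a, eta a a * pd a (pd a φ) p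

lemma dalembert_eq (φ : Spacetime → ℝ) (p : Spacetime) :
    dalembert φ p = ∑ i : Fin 3, pd i.succ (pd i.succ φ) p - pd 0 (pd 0 φ) p :=
  sum_eta_smul fun a => pd a (pd a φ) p

lemma IsTest.add {E : Type*} [NormedAddCommGroup E] [NormedSpace ℝ E] {φ ψ : E → ℝ}
    (hφ : IsTest φ) (hψ : IsTest ψ) : IsTest (fun p => φ p + ψ p) :=
  ⟨hφ.1.add hψ.1, hφ.2.add hψ.2⟩

lemma IsTest.mul_left {E : Type*} [NormedAddCommGroup E] [NormedSpace ℝ E] {f φ : E → ℝ}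
    (hφ : IsTest φ) (hf : ContDiff ℝ ∞ f) : IsTest (fun p => f p * φ p) :=
  ⟨hf.mul hφ.1, hφ.2.mul_left⟩

lemma IsTest.sum {E : Type*} [NormedAddCommGroup E] [NormedSpace ℝ E] {ι : Type*} {s : Finset ι}
    {φ : ι → E → ℝ} (hφ : ∀ i, IsTest (φ i)) : IsTest (fun p => ∑ i ∈ s, φ i p) := by
  classical
  induction s using Finset.induction_on with
  | empty => exact ⟨by simpa using contDiff_const, (by
      simp only [Finset.sum_empty]
      exact (HasCompactSupport.zero : HasCompactSupport (0 : E → ℝ)))⟩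
  | insert i s hi ih =>
    simp only [Finset.sum_insert hi]
    exact (hφ i).add ih

lemma IsTest.dalembert {φ : Spacetime → ℝ} (hφ : IsTest φ) : IsTest (dalembert φ) :=
  IsTest.sum fun a => ((hφ.pd a).pd a).mul_left contDiff_const

lemma advanced_polar {φ : Spacetime → ℝ} (hφ : IsTest φ) (p : Spacetime) :
    advanced φ p = (4 * Real.pi)⁻¹ *
      ∫ r in Ioi (0 : ℝ), ∫ n : S2, r * φ (event (p 0 + r) (space p + r • (n : E3))) ∂area := by
  have hi := integrable_comp_cone hφ p
  rw [coulomb, integrable_withDensity_iff_integrable_smul' (by fun_prop)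
    (Eventually.of_forall fun _ => ENNReal.ofReal_lt_top)] at hi
  have hi' : Integrable fun z : E3 => φ (event (p 0 + ‖z‖) (space p + z)) / (4 * Real.pi * ‖z‖) := by
    refine hi.congr (Eventually.of_forall fun z => ?_)
    simp only [add_cone]
    rw [ENNReal.toReal_ofReal (by positivity), smul_eq_mul, div_eq_mul_inv, mul_comm]
  rw [advanced, integral_polar hi', ← integral_const_mul]
  refine setIntegral_congr_fun measurableSet_Ioi fun r hr => ?_
  have hr : 0 < r := hr
  beta_reduce
  rw [← integral_const_mul]
  congr 1
  funext n
  rw [norm_smul, S2.norm_coe, mul_one, Real.norm_of_nonneg hr.le]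
  have := Real.pi_pos
  field_simp

/-- The advanced potential is a solution operator of `-□`. -/
theorem advanced_dalembert {φ : Spacetime → ℝ} (hφ : IsTest φ) (p : Spacetime) :
    advanced (dalembert φ) p = - φ p := by
  obtain ⟨R, hR0, hR⟩ := exists_bound_of_isTest hφ
  have hc := hφ.1
  have hz : ∀ ψ : Spacetime → ℝ, IsTest ψ → ∃ A, 0 < A ∧ ∀ r, A < r → ∀ n : S2,
      ψ (event (p 0 + r) (space p + r • (n : E3))) = 0 := by
    intro ψ hψ
    obtain ⟨R, hR0, hR⟩ := exists_bound_of_isTest hψ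
    refine ⟨R + |p 0|, by positivity, fun r hr n => hR _ ?_⟩
    have h1 := norm_le_pi_norm (event (p 0 + r) (space p + r • (n : E3))) 0
    refine lt_of_lt_of_le ?_ h1
    rw [event_zero, Real.norm_eq_abs]
    have h2 := neg_abs_le (p 0)
    exact lt_of_lt_of_le (by linarith) (le_abs_self _)
  obtain ⟨A₀, hA₀0, hA₀⟩ := hz _ hφ
  choose A₁ hA₁0 hA₁ using fun a => hz _ (hφ.pd a)
  choose A₂ hA₂0 hA₂ using fun a b => hz _ ((hφ.pd a).pd b)
  obtain ⟨B, hB0, hB1, hB2⟩ : ∃ B, A₀ ≤ B ∧ (∀ a, A₁ a ≤ B) ∧ ∀ a b, A₂ a b ≤ B := by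
    have h1 : ∀ a, 0 ≤ ∑ b, A₂ a b := fun a => Finset.sum_nonneg fun b _ => (hA₂0 a b).le
    have h2 : 0 ≤ ∑ a, ∑ b, A₂ a b := Finset.sum_nonneg fun a _ => h1 a
    have h3 : 0 ≤ ∑ a, A₁ a := Finset.sum_nonneg fun a _ => (hA₁0 a).le
    refine ⟨A₀ + ∑ a, A₁ a + ∑ a, ∑ b, A₂ a b, by linarith, fun a => ?_, fun a b => ?_⟩
    · have := Finset.single_le_sum (fun a _ => (hA₁0 a).le) (Finset.mem_univ a)
      linarith
    · have h4 := Finset.single_le_sum (fun b _ => (hA₂0 a b).le) (Finset.mem_univ b)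
      have h5 := Finset.single_le_sum (fun a _ => h1 a) (Finset.mem_univ a)
      linarith
  have hcont : ∀ ψ : Spacetime → ℝ, ContDiff ℝ ∞ ψ → Continuous fun q : ℝ × S2 =>
      ψ (event (p 0 + q.1) (space p + q.1 • (q.2 : E3))) :=
    fun ψ hψ => hψ.continuous.comp (by fun_prop)
  have hcont' : ∀ ψ : Spacetime → ℝ, ContDiff ℝ ∞ ψ → ∀ r : ℝ, Continuous fun n : S2 =>
      ψ (event (p 0 + r) (space p + r • (n : E3))) :=
    fun ψ hψ r => hψ.continuous.comp (by fun_prop)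
  have hd : ∀ ψ : Spacetime → ℝ, ContDiff ℝ ∞ ψ → ∀ (r : ℝ) (n : S2),
      HasDerivAt (fun r => ψ (event (p 0 + r) (space p + r • (n : E3))))
        (pd 0 ψ (event (p 0 + r) (space p + r • (n : E3))) + ∑ i : Fin 3, (n : E3) i *
          pd i.succ ψ (event (p 0 + r) (space p + r • (n : E3)))) r := by
    intro ψ hψ r n
    simpa using hasDerivAt_comp_event_line hψ (p 0) (space p) (n : E3) 1 r
  -- Along each ray of the future light cone, `G = r (∂_r φ - ∂_t φ) + φ` has derivative `F`. Its
  -- value at the vertex is `φ p`, which the integral over the sphere multiplies by `4π`.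
  have hS := integral_shell_eq (A := B)
    (F := fun q => 2 * ∑ i : Fin 3, (q.2 : E3) i *
        pd i.succ φ (event (p 0 + q.1) (space p + q.1 • (q.2 : E3)))
      + q.1 * (∑ i : Fin 3, (q.2 : E3) i * ∑ k : Fin 3, (q.2 : E3) k *
        pd k.succ (pd i.succ φ) (event (p 0 + q.1) (space p + q.1 • (q.2 : E3)))
      - pd 0 (pd 0 φ) (event (p 0 + q.1) (space p + q.1 • (q.2 : E3)))))
    (G := fun q => q.1 * (∑ i : Fin 3, (q.2 : E3) i *
        pd i.succ φ (event (p 0 + q.1) (space p + q.1 • (q.2 : E3)))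
        - pd 0 φ (event (p 0 + q.1) (space p + q.1 • (q.2 : E3))))
      + φ (event (p 0 + q.1) (space p + q.1 • (q.2 : E3))))
    (by
      have h1 := fun i : Fin 3 => hcont _ (contDiff_pd hc i.succ)
      have h2 := fun i k : Fin 3 => hcont _ (contDiff_pd (contDiff_pd hc i.succ) k.succ)
      have h3 := hcont _ (contDiff_pd (contDiff_pd hc 0) 0)
      refine (continuous_const.mul (continuous_finsetSum _ fun i _ =>
        Continuous.mul (by fun_prop) (h1 i))).add (continuous_fst.mul ((continuous_finsetSum _
        fun i _ => Continuous.mul (by fun_prop) (continuous_finsetSum _ fun k _ =>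
        Continuous.mul (by fun_prop) (h2 i k))).sub h3)))
    (by
      have h1 := fun i : Fin 3 => hcont _ (contDiff_pd hc i.succ)
      exact (continuous_fst.mul ((continuous_finsetSum _ fun i _ =>
        Continuous.mul (by fun_prop) (h1 i)).sub (hcont _ (contDiff_pd hc 0)))).add (hcont _ hc))
    (fun t ht n => by
      simp [hA₀ t (hB0.trans_lt ht), hA₁ _ t ((hB1 _).trans_lt ht)])
    (fun t _ n => by
      have h1 := HasDerivAt.fun_sum (u := Finset.univ) fun (i : Fin 3) _ =>
        (hd _ (contDiff_pd hc i.succ) t n).const_mul ((n : E3) i)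
      have h2 := ((hasDerivAt_id t).mul (h1.sub (hd _ (contDiff_pd hc 0) t n))).add (hd φ hc t n)
      refine h2.congr_deriv ?_
      simp only [pd_comm hc 0 (Fin.succ _), id, Fin.sum_univ_three, Pi.sub_apply]
      ring)
    (fun t ht n => by
      simp [hA₁ _ t ((hB1 _).trans_lt ht), hA₂ _ _ t ((hB2 _ _).trans_lt ht)])
  have hE : ∀ r : ℝ, 0 < r → ∫ n : S2, r * dalembert φ (event (p 0 + r) (space p + r • (n : E3))) ∂area
      = ∫ n : S2, (2 * ∑ i : Fin 3, (n : E3) i *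
        pd i.succ φ (event (p 0 + r) (space p + r • (n : E3)))
      + r * (∑ i : Fin 3, (n : E3) i * ∑ k : Fin 3, (n : E3) k *
        pd k.succ (pd i.succ φ) (event (p 0 + r) (space p + r • (n : E3)))
      - pd 0 (pd 0 φ) (event (p 0 + r) (space p + r • (n : E3))))) ∂area := by
    intro r _
    have h1 := fun i : Fin 3 => hcont' _ (contDiff_pd hc i.succ) r
    have h2 := fun i k : Fin 3 => hcont' _ (contDiff_pd (contDiff_pd hc i.succ) k.succ) r
    have h3 := hcont' _ (contDiff_pd (contDiff_pd hc 0) 0) r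
    have h4 := hcont' _ hφ.dalembert.1 r
    have hs : ∀ i : Fin 3, SmoothS2 fun n => pd i.succ φ (event (p 0 + r) (space p + r • (n : E3))) :=
      fun i => SmoothS2.comp_event (contDiff_pd hc i.succ) _ _ _
    -- The divergence theorem on the sphere replaces the tangential part of `r Δφ` by `2 ∂_r φ`, so
    -- that `r □φ` and `F` have equal integrals.
    have h5 : ∫ n : S2, ∑ i : Fin 3,
        (grad (fun n => pd i.succ φ (event (p 0 + r) (space p + r • (n : E3)))) n i
          - 2 * ((n : E3) i * pd i.succ φ (event (p 0 + r) (space p + r • (n : E3))))) ∂area = 0 := by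
      have h6 : ∀ i : Fin 3, Integrable (fun n : S2 =>
          (grad (fun n => pd i.succ φ (event (p 0 + r) (space p + r • (n : E3)))) n i
          - 2 * ((n : E3) i * pd i.succ φ (event (p 0 + r) (space p + r • (n : E3)))))) area :=
        fun i => integrable_area (((hs i).grad i).continuous.sub
          (continuous_const.mul (Continuous.mul (by fun_prop) (h1 i))))
      rw [integral_finsetSum _ fun i _ => h6 i]
      refine Finset.sum_eq_zero fun i _ => ?_
      have h7 : Integrable (fun n : S2 => 2 * ((n : E3) i *
          pd i.succ φ (event (p 0 + r) (space p + r • (n : E3))))) area :=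
        integrable_area (continuous_const.mul (Continuous.mul (by fun_prop) (h1 i)))
      rw [integral_sub (integrable_area ((hs i).grad i).continuous) h7, integral_grad (hs i),
        integral_const_mul, sub_self]
    rw [← sub_eq_zero, ← integral_sub, ← h5]
    · congr 1
      funext n
      simp only [grad_comp_event (contDiff_pd hc (Fin.succ _)), sum_proj_mul, dalembert_eq]
      simp only [Fin.sum_univ_three]
      ring
    · exact integrable_area (continuous_const.mul h4)
    · refine integrable_area ((continuous_const.mul (continuous_finsetSum _ fun i _ =>
        Continuous.mul (by fun_prop) (h1 i))).add (continuous_const.mul ((continuous_finsetSum _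
        fun i _ => Continuous.mul (by fun_prop) (continuous_finsetSum _ fun k _ =>
        Continuous.mul (by fun_prop) (h2 i k))).sub h3)))
  rw [advanced_polar hφ.dalembert, setIntegral_congr_fun measurableSet_Ioi fun r hr => hE r hr]
  refine (congrArg _ hS).trans ?_
  have := Real.pi_pos
  simp [area_real_univ]
  field_simp

/-! ### The retarded field of a moving particle -/

lemma measurePreserving_event :
    MeasurePreserving (fun q : ℝ × E3 => event q.1 q.2) (volume.prod volume) volume := by
  have h1 : MeasurePreserving (fun q : ℝ × E3 => (q.1, WithLp.ofLp q.2)) (volume.prod volume)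
      (volume.prod volume) :=
    (MeasurePreserving.id _).prod (PiLp.volume_preserving_ofLp (Fin 3))
  have h2 := (volume_preserving_piFinSuccAbove (fun _ : Fin 4 => ℝ) 0).symm
  have h3 : (fun q : ℝ × E3 => event q.1 q.2) =
      (MeasurableEquiv.piFinSuccAbove (fun _ : Fin 4 => ℝ) 0).symm ∘
        fun q : ℝ × E3 => (q.1, WithLp.ofLp q.2) := by
    funext q a
    refine Fin.cases ?_ (fun i => ?_) a
    · rfl
    · rfl
  rw [h3]
  exact h2.comp h1

lemma measurableEmbedding_event : MeasurableEmbedding (fun q : ℝ × E3 => event q.1 q.2) :=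
  eventL.toHomeomorph.measurableEmbedding

lemma lintegral_spacetime {f : Spacetime → ENNReal} (hf : Measurable f) :
    ∫⁻ p, f p = ∫⁻ x : E3, ∫⁻ t : ℝ, f (event t x) := by
  rw [← measurePreserving_event.lintegral_comp hf, lintegral_prod_symm _ (by
    exact (hf.comp measurableEmbedding_event.measurable).aemeasurable)]

/-- The denominator of the Liénard–Wiechert field at `p` of a particle that leaves the origin with
velocity `v m`. -/
def delay (v : ℝ) (p : Spacetime) (m : E3) : ℝ :=
  Real.sqrt ((p 0 - v * inner ℝ (space p) m) ^ 2 - (1 - v ^ 2) * (p 0 ^ 2 - ‖space p‖ ^ 2))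

lemma inner_lt_of_ne {v : ℝ} (hv0 : 0 ≤ v) (hv1 : v < 1) (m : S2) {z : E3} (hz : z ≠ 0) :
    0 < ‖z‖ - v * inner ℝ z (m : E3) := by
  have h := (le_abs_self _).trans (abs_real_inner_le_norm z (m : E3))
  rw [S2.norm_coe, mul_one] at h
  have h1 := norm_pos_iff.2 hz
  have h2 := mul_le_mul_of_nonneg_left h hv0
  nlinarith

/-- On the future light cone of a point of the world line the radicand of `delay` is a perfect
square. -/
lemma delay_cone {v : ℝ} (hv0 : 0 ≤ v) (hv1 : v < 1) (m : S2) (z : E3) (t : ℝ) :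
    delay v (event (t + ‖z‖) ((v * t) • (m : E3) + z)) m = ‖z‖ - v * inner ℝ z (m : E3) := by
  have h : 0 ≤ ‖z‖ - v * inner ℝ z (m : E3) := by
    rcases eq_or_ne z 0 with rfl | hz
    · simp
    · exact (inner_lt_of_ne hv0 hv1 m hz).le
  have h1 : ‖(v * t) • (m : E3) + z‖ ^ 2 = (v * t) ^ 2 + 2 * (v * t) * inner ℝ z (m : E3) + ‖z‖ ^ 2 := by
    rw [norm_add_sq_real, norm_smul, S2.norm_coe, mul_one, Real.norm_eq_abs, sq_abs,
      real_inner_smul_left, real_inner_comm]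
    ring
  have h2 : inner ℝ ((v * t) • (m : E3) + z) (m : E3) = v * t + inner ℝ z (m : E3) := by
    rw [inner_add_left, real_inner_smul_left, real_inner_self_eq_norm_sq, S2.norm_coe]
    ring
  rw [delay, space_event, event_zero, h1, h2, Real.sqrt_eq_iff_eq_sq _ h]
  · ring
  · have : (‖z‖ - v * inner ℝ z (m : E3)) ^ 2 ≥ 0 := sq_nonneg _
    convert this using 1
    ring

lemma measurable_delay (v : ℝ) : Measurable fun q : Spacetime × S2 => delay v q.1 (q.2 : E3) := by
  unfold delay
  have : Continuous fun q : Spacetime × S2 => Real.sqrt ((q.1 0 - v * inner ℝ (space q.1) (q.2 : E3)) ^ 2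
    - (1 - v ^ 2) * (q.1 0 ^ 2 - ‖space q.1‖ ^ 2)) := by fun_prop
  exact this.measurable

lemma hasDerivAt_norm_sub {v : ℝ} (m : S2) (x : E3) (t : ℝ) (h : x - (v * t) • (m : E3) ≠ 0) :
    HasDerivAt (fun t => t + ‖x - (v * t) • (m : E3)‖)
      (1 - v * inner ℝ (x - (v * t) • (m : E3)) (m : E3) / ‖x - (v * t) • (m : E3)‖) t := by
  have h1 : HasDerivAt (fun t => x - (v * t) • (m : E3)) (-(v • (m : E3))) t := by
    have := (((hasDerivAt_id t).const_mul v).smul_const (m : E3)).const_sub x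
    simpa using this
  have h2 := (h1.norm_sq).sqrt (by simpa using h)
  simp only [Real.sqrt_sq (norm_nonneg _)] at h2
  refine ((hasDerivAt_id t).add h2).congr_deriv ?_
  rw [inner_neg_right, real_inner_smul_right]
  have := norm_ne_zero_iff.2 h
  field_simp
  ring

/-- The arrival time at `x` of the signal emitted at time `t` is a bijection of `(0, ∞)` to
`(|x|, ∞)`. -/
lemma image_arrival {v : ℝ} (hv0 : 0 ≤ v) (hv1 : v < 1) (m : S2) (x : E3) :
    StrictMono (fun t => t + ‖x - (v * t) • (m : E3)‖) ∧
    (fun t => t + ‖x - (v * t) • (m : E3)‖) '' Ioi 0 = Ioi ‖x‖ := by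
  have hd : ∀ s t : ℝ, s < t →
      s + ‖x - (v * s) • (m : E3)‖ + (1 - v) * (t - s) ≤ t + ‖x - (v * t) • (m : E3)‖ := by
    intro s t hst
    have h1 := norm_sub_norm_le (x - (v * s) • (m : E3)) (x - (v * t) • (m : E3))
    have h2 : x - (v * s) • (m : E3) - (x - (v * t) • (m : E3)) = (v * (t - s)) • (m : E3) := by
      rw [mul_sub, sub_smul]; abel
    rw [h2, norm_smul, S2.norm_coe, mul_one, Real.norm_of_nonneg (by nlinarith)] at h1
    linarith
  have hm : StrictMono (fun t => t + ‖x - (v * t) • (m : E3)‖) := by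
    intro s t hst
    have := hd s t hst
    have : 0 < (1 - v) * (t - s) := mul_pos (by linarith) (by linarith)
    simp only
    linarith
  refine ⟨hm, Subset.antisymm ?_ ?_⟩
  · rintro _ ⟨t, ht, rfl⟩
    have := hm (mem_Ioi.1 ht)
    simpa using this
  · intro s hs
    have hc : Continuous (fun t => t + ‖x - (v * t) • (m : E3)‖) := by fun_prop
    have hs : ‖x‖ < s := hs
    have hT : 0 < (s - ‖x‖) / (1 - v) := div_pos (by linarith) (by linarith)
    have h1 := hd 0 _ hT
    rw [sub_zero, mul_div_cancel₀ _ (by linarith : (1 : ℝ) - v ≠ 0)] at h1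
    obtain ⟨t, ht, rfl⟩ := intermediate_value_Icc hT.le hc.continuousOn
      (show s ∈ Icc _ _ from ⟨by simpa using hs.le, by simpa using h1⟩)
    refine ⟨t, lt_of_le_of_ne ht.1 ?_, rfl⟩
    rintro rfl
    simp at hs

/-- Points on the track of the particle are discarded; elsewhere the distance to it is
differentiable in time. -/
lemma volume_line (m : S2) : (volume : Measure E3) (Submodule.span ℝ {(m : E3)} : Set E3) = 0 := by
  refine Measure.addHaar_submodule _ _ fun h => ?_
  have h1 := finrank_span_singleton (K := ℝ) (S2.coe_ne_zero m)
  rw [h, finrank_top] at h1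
  simp at h1

/-- The change of variables from emission to arrival, for a particle with velocity `v m`. -/
theorem lintegral_retarded {v : ℝ} (hv0 : 0 ≤ v) (hv1 : v < 1) (m : S2)
    {f : Spacetime → ENNReal} (hf : Measurable f) :
    ∫⁻ t in Ioi (0 : ℝ), ∫⁻ z, f (event t ((v * t) • (m : E3)) + cone z) ∂coulomb =
      ∫⁻ p, f p * {p | ‖space p‖ < p 0}.indicator
        (fun p => ENNReal.ofReal (4 * Real.pi * delay v p m)⁻¹) p := by
  have hdm : Measurable fun p => delay v p (m : E3) :=
    (measurable_delay v).comp (measurable_id.prodMk measurable_const)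
  have hset : MeasurableSet {p : Spacetime | ‖space p‖ < p 0} :=
    (isOpen_lt (f := fun p => ‖space p‖) (g := fun p : Spacetime => p 0) (by fun_prop)
      (by fun_prop)).measurableSet
  have h1 : ∀ t : ℝ, ∫⁻ z, f (event t ((v * t) • (m : E3)) + cone z) ∂coulomb =
      ∫⁻ x : E3, ENNReal.ofReal (4 * Real.pi * ‖x - (v * t) • (m : E3)‖)⁻¹ *
        f (event (t + ‖x - (v * t) • (m : E3)‖) x) := by
    intro t
    have hfz : Measurable fun z => f (event t ((v * t) • (m : E3)) + cone z) :=
      hf.comp (Continuous.measurable (by fun_prop))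
    rw [coulomb, lintegral_withDensity_eq_lintegral_mul _ (by fun_prop) hfz, ← lintegral_sub_right_eq_self _ ((v * t) • (m : E3))]
    refine lintegral_congr fun x => ?_
    simp only [Pi.mul_apply, add_cone, event_zero, space_event, add_sub_cancel]
  have hmeas : Measurable fun q : ℝ × E3 =>
      ENNReal.ofReal (4 * Real.pi * ‖q.2 - (v * q.1) • (m : E3)‖)⁻¹ *
        f (event (q.1 + ‖q.2 - (v * q.1) • (m : E3)‖) q.2) := by
    refine Measurable.mul (by fun_prop) (hf.comp ?_)
    exact Continuous.measurable (by fun_prop)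
  simp only [h1]
  rw [lintegral_lintegral_swap hmeas.aemeasurable, lintegral_spacetime (by
    refine hf.mul (Measurable.indicator (by fun_prop) hset))]
  refine lintegral_congr_ae ?_
  have hline : ∀ᵐ x : E3, x ∉ (Submodule.span ℝ {(m : E3)} : Set E3) :=
    measure_eq_zero_iff_ae_notMem.1 (volume_line m)
  filter_upwards [hline] with x hx
  have hx' : ∀ t : ℝ, x - (v * t) • (m : E3) ≠ 0 := fun t h => hx (by
    rw [sub_eq_zero.1 h]
    exact Submodule.smul_mem _ _ (Submodule.mem_span_singleton_self _))
  obtain ⟨hmono, himage⟩ := image_arrival hv0 hv1 m x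
  -- At a fixed observation point emission time is replaced by arrival time, which by
  -- `image_arrival` ranges bijectively over `(|x|, ∞)`.
  have h2 := lintegral_image_eq_lintegral_abs_deriv_mul measurableSet_Ioi
    (fun t _ => (hasDerivAt_norm_sub m x t (hx' t)).hasDerivWithinAt) hmono.injective.injOn
    (s := Ioi 0) (fun s => f (event s x) * ENNReal.ofReal (4 * Real.pi * delay v (event s x) m)⁻¹)
  rw [himage] at h2
  have h3 : ∫⁻ s : ℝ, f (event s x) * {p | ‖space p‖ < p 0}.indicator
        (fun p => ENNReal.ofReal (4 * Real.pi * delay v p m)⁻¹) (event s x) =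
      ∫⁻ s in Ioi ‖x‖, f (event s x) * ENNReal.ofReal (4 * Real.pi * delay v (event s x) m)⁻¹ := by
    rw [← lintegral_indicator measurableSet_Ioi]
    refine lintegral_congr fun s => ?_
    by_cases hs : ‖x‖ < s <;> simp [indicator, hs]
  rw [h3, h2]
  refine lintegral_congr fun t => ?_
  have hz := hx' t
  set z := x - (v * t) • (m : E3) with hzdef
  have hxz : x = (v * t) • (m : E3) + z := by rw [hzdef]; abel
  have h4 := inner_lt_of_ne hv0 hv1 m hz
  have h5 := norm_pos_iff.2 hz
  have h6 : delay v (event (t + ‖z‖) x) m = ‖z‖ - v * inner ℝ z (m : E3) := by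
    conv_lhs => rw [hxz]
    exact delay_cone hv0 hv1 m z t
  rw [h6, mul_left_comm, ← ENNReal.ofReal_mul (abs_nonneg _), mul_comm]
  congr 2
  -- The Jacobian is `delay / |z|`; it converts the Coulomb factor `1 / |z|` into `1 / delay`.
  have h7 : 1 - v * inner ℝ z (m : E3) / ‖z‖ = (‖z‖ - v * inner ℝ z (m : E3)) / ‖z‖ := by
    field_simp
  rw [h7, abs_of_pos (div_pos h4 h5)]
  have := Real.pi_pos
  field_simp

instance : SFinite coulomb := by unfold coulomb; infer_instance

/-- The field of a particle with velocity `v m` that is emitted at positive times. -/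
def retKernel (v : ℝ) (p : Spacetime) (m : S2) : ℝ :=
  if ‖space p‖ < p 0 then (4 * Real.pi * delay v p m)⁻¹ else 0

/-- The field of a particle at rest that is emitted at the times in `S`. -/
def restKernel (S : Set ℝ) [DecidablePred (· ∈ S)] (p : Spacetime) : ℝ :=
  if p 0 - ‖space p‖ ∈ S then (4 * Real.pi * ‖space p‖)⁻¹ else 0

lemma delay_nonneg (v : ℝ) (p : Spacetime) (m : E3) : 0 ≤ delay v p m := Real.sqrt_nonneg _

lemma retKernel_nonneg (v : ℝ) (p : Spacetime) (m : S2) : 0 ≤ retKernel v p m := by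
  unfold retKernel
  have := delay_nonneg v p m
  split_ifs <;> positivity

lemma restKernel_nonneg (S : Set ℝ) [DecidablePred (· ∈ S)] (p : Spacetime) :
    0 ≤ restKernel S p := by
  unfold restKernel
  split_ifs <;> positivity

lemma measurable_retKernel (v : ℝ) : Measurable fun q : S2 × Spacetime => retKernel v q.2 q.1 := by
  have h : Measurable fun q : S2 × Spacetime => delay v q.2 (q.1 : E3) :=
    (measurable_delay v).comp measurable_swap
  refine Measurable.ite ?_ (by fun_prop) measurable_const
  exact (isOpen_lt (f := fun q : S2 × Spacetime => ‖space q.2‖)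
    (g := fun q : S2 × Spacetime => q.2 0) (by fun_prop) (by fun_prop)).measurableSet

lemma measurable_restKernel {S : Set ℝ} [DecidablePred (· ∈ S)] (hS : MeasurableSet S) :
    Measurable (restKernel S) := by
  have h : Continuous fun p : Spacetime => p 0 - ‖space p‖ := by fun_prop
  exact Measurable.ite (hS.preimage h.measurable) (by fun_prop) measurable_const

lemma lintegral_rest {S : Set ℝ} [DecidablePred (· ∈ S)] (hS : MeasurableSet S)
    {f : Spacetime → ENNReal} (hf : Measurable f) :
    ∫⁻ t in S, ∫⁻ z, f (event t 0 + cone z) ∂coulomb =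
      ∫⁻ p, f p * ENNReal.ofReal (restKernel S p) := by
  have hm : Measurable fun q : ℝ × E3 => f (event q.1 0 + cone q.2) :=
    hf.comp (Continuous.measurable (by fun_prop))
  have hfr : Measurable fun p => f p * ENNReal.ofReal (restKernel S p) :=
    hf.mul (measurable_restKernel hS).ennreal_ofReal
  rw [lintegral_lintegral_swap hm.aemeasurable, lintegral_spacetime hfr, coulomb,
    lintegral_withDensity_eq_lintegral_mul _ (by fun_prop) (Measurable.lintegral_prod_left' hm)]
  refine lintegral_congr fun x => ?_
  simp only [Pi.mul_apply, add_cone, event_zero, space_event, zero_add]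
  have hfx : Measurable fun t => f (event (t + ‖x‖) x) :=
    hf.comp (Continuous.measurable (by fun_prop))
  rw [← lintegral_const_mul _ hfx,
    ← lintegral_indicator hS, ← lintegral_sub_right_eq_self _ ‖x‖]
  refine lintegral_congr fun t => ?_
  by_cases h : t - ‖x‖ ∈ S <;> simp [restKernel, h, mul_comm]

/-- Stated for measures, the change of variables yields both the integrability and the value of the
integrals for signed integrands. -/
lemma measurePreserving_retarded {v : ℝ} (hv0 : 0 ≤ v) (hv1 : v < 1) :
    MeasurePreserving (fun q : (ℝ × S2) × E3 =>
        (q.1.2, event q.1.1 ((v * q.1.1) • (q.1.2 : E3)) + cone q.2))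
      (((volume.restrict (Ioi (0 : ℝ))).prod area).prod coulomb)
      ((area.prod volume).withDensity fun q => ENNReal.ofReal (retKernel v q.2 q.1)) := by
  have hΨ : Measurable fun q : (ℝ × S2) × E3 =>
        (q.1.2, event q.1.1 ((v * q.1.1) • (q.1.2 : E3)) + cone q.2) :=
    Continuous.measurable (by fun_prop)
  refine ⟨hΨ, Measure.ext_of_lintegral _ fun F hF => ?_⟩
  have hFΨ : Measurable fun q : (ℝ × S2) × E3 =>
      F (q.1.2, event q.1.1 ((v * q.1.1) • (q.1.2 : E3)) + cone q.2) := hF.comp hΨ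
  rw [lintegral_map hF hΨ, lintegral_withDensity_eq_lintegral_mul _
    (measurable_retKernel v).ennreal_ofReal hF, lintegral_prod _ hFΨ.aemeasurable,
    lintegral_prod_symm _ (by exact (Measurable.lintegral_prod_right' hFΨ).aemeasurable),
    lintegral_prod _ (by exact ((measurable_retKernel v).ennreal_ofReal.mul hF).aemeasurable)]
  refine lintegral_congr fun m => ?_
  refine (lintegral_retarded hv0 hv1 m (f := fun p => F (m, p))
    (hF.comp (measurable_const.prodMk measurable_id))).trans (lintegral_congr fun p => ?_)
  by_cases h : ‖space p‖ < p 0 <;> simp [retKernel, h, mul_comm]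

lemma measurePreserving_rest {S : Set ℝ} [DecidablePred (· ∈ S)] (hS : MeasurableSet S) :
    MeasurePreserving (fun q : ℝ × E3 => event q.1 0 + cone q.2)
      ((volume.restrict S).prod coulomb)
      (volume.withDensity fun p => ENNReal.ofReal (restKernel S p)) := by
  have hΨ : Measurable fun q : ℝ × E3 => event q.1 0 + cone q.2 :=
    Continuous.measurable (by fun_prop)
  refine ⟨hΨ, Measure.ext_of_lintegral _ fun F hF => ?_⟩
  have hFΨ : Measurable fun q : ℝ × E3 => F (event q.1 0 + cone q.2) := hF.comp hΨ
  rw [lintegral_map hF hΨ, lintegral_withDensity_eq_lintegral_mul _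
    (measurable_restKernel hS).ennreal_ofReal hF, lintegral_prod _ hFΨ.aemeasurable]
  exact (lintegral_rest hS hF).trans (lintegral_congr fun p => by simp [mul_comm])

/-- Bounded measurable functions of bounded support. -/
def IsBoundedSupported (φ : Spacetime → ℝ) : Prop :=
  Measurable φ ∧ (∃ C, ∀ p, |φ p| ≤ C) ∧ ∃ R, 0 < R ∧ ∀ p, R < ‖p‖ → φ p = 0

lemma IsTest.isBoundedSupported {φ : Spacetime → ℝ} (hφ : IsTest φ) : IsBoundedSupported φ :=
  ⟨hφ.1.continuous.measurable, hφ.2.exists_bound_of_continuous hφ.1.continuous,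
    exists_bound_of_isTest hφ⟩

/-- Indicators are admitted beside test functions so that local integrability of the fields follows
from the same integrability statements. -/
lemma isBoundedSupported_indicator {K : Set Spacetime} (hK : IsCompact K) :
    IsBoundedSupported (K.indicator fun _ => 1) := by
  obtain ⟨R, hR⟩ := hK.isBounded.exists_norm_le
  refine ⟨measurable_const.indicator hK.measurableSet, ⟨1, fun p => ?_⟩, max R 1, by positivity,
    fun p hp => indicator_of_notMem (fun h => ?_) _⟩
  · by_cases h : p ∈ K <;> simp [h]
  · have := hR p h
    have := le_max_left R 1
    linarith

/-- Emission time and delay are both nonnegative, so a bound on their sum, the arrival time,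
confines both. -/
lemma integrable_retarded_source (v : ℝ) {φ : Spacetime → ℝ} (hφ : IsBoundedSupported φ)
    {τ : S2 → ℝ} (hτ : Continuous τ) :
    Integrable (fun q : (ℝ × S2) × E3 =>
        τ q.1.2 * φ (event q.1.1 ((v * q.1.1) • (q.1.2 : E3)) + cone q.2))
      (((volume.restrict (Ioi (0 : ℝ))).prod area).prod coulomb) := by
  obtain ⟨hm, ⟨C, hC⟩, R, hR0, hR⟩ := hφ
  obtain ⟨L, hL⟩ := (isCompact_univ (X := S2)).exists_bound_of_continuousOn hτ.continuousOn
  have hΨ : Measurable fun q : (ℝ × S2) × E3 =>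
      τ q.1.2 * φ (event q.1.1 ((v * q.1.1) • (q.1.2 : E3)) + cone q.2) :=
    (Continuous.measurable (by fun_prop)).mul (hm.comp (Continuous.measurable (by fun_prop)))
  have h : IntegrableOn (fun q : (ℝ × S2) × E3 =>
      τ q.1.2 * φ (event q.1.1 ((v * q.1.1) • (q.1.2 : E3)) + cone q.2))
      ((Iic R ×ˢ univ) ×ˢ Metric.closedBall 0 R)
      (((volume.restrict (Ioi (0 : ℝ))).prod area).prod coulomb) := by
    refine IntegrableOn.of_bound (C := L * C) ?_ hΨ.aestronglyMeasurable
      (Eventually.of_forall fun q => ?_)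
    · rw [Measure.prod_prod, Measure.prod_prod, Measure.restrict_apply measurableSet_Iic]
      refine ENNReal.mul_lt_top (ENNReal.mul_lt_top ?_ (measure_lt_top _ _))
        (coulomb_closedBall_lt_top R)
      rw [inter_comm, Ioi_inter_Iic]
      simp
    · rw [norm_mul]
      exact mul_le_mul (hL _ trivial) (hC _) (norm_nonneg _) ((norm_nonneg _).trans (hL q.1.2 trivial))
  have h0 : ∀ᵐ q ∂(((volume.restrict (Ioi (0 : ℝ))).prod area).prod coulomb), 0 < q.1.1 := by
    have h1 : ∀ᵐ t ∂(volume.restrict (Ioi (0 : ℝ))), 0 < t := ae_restrict_mem measurableSet_Ioi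
    exact Measure.quasiMeasurePreserving_fst.ae (Measure.quasiMeasurePreserving_fst.ae h1)
  refine (h.integrable_indicator ((measurableSet_Iic.prod MeasurableSet.univ).prod
    Metric.isClosed_closedBall.measurableSet)).congr ?_
  filter_upwards [h0] with q hq
  rw [indicator_apply_eq_self]
  intro hq'
  rw [hR _ ?_, mul_zero]
  by_contra! hle
  have h1 := (norm_le_pi_norm (event q.1.1 ((v * q.1.1) • (q.1.2 : E3)) + cone q.2) 0).trans hle
  rw [add_cone, event_zero, event_zero, Real.norm_eq_abs,
    abs_of_nonneg (by have := norm_nonneg q.2; linarith)] at h1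
  have := norm_nonneg q.2
  exact hq' ⟨⟨by simp only [mem_Iic]; linarith, trivial⟩, by simp; linarith⟩

lemma norm_space_le (p : Spacetime) : ‖space p‖ ≤ 2 * ‖p‖ := by
  rw [EuclideanSpace.norm_eq, Real.sqrt_le_iff]
  refine ⟨by positivity, ?_⟩
  calc ∑ i, ‖space p i‖ ^ 2 ≤ ∑ i : Fin 3, ‖p‖ ^ 2 :=
        Finset.sum_le_sum fun i _ => pow_le_pow_left₀ (norm_nonneg _) (norm_le_pi_norm p i.succ) 2
    _ ≤ _ := by
      simp
      nlinarith [sq_nonneg ‖p‖]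

/-- Emission times may be negative here; the position of arrival bounds the delay by `2 R`, and then
the arrival time bounds the emission time. -/
lemma integrable_rest_source {φ : Spacetime → ℝ} (hφ : IsBoundedSupported φ) (S : Set ℝ) :
    Integrable (fun q : ℝ × E3 => φ (event q.1 0 + cone q.2))
      ((volume.restrict S).prod coulomb) := by
  obtain ⟨hm, ⟨C, hC⟩, R, hR0, hR⟩ := hφ
  have hΨ : Measurable fun q : ℝ × E3 => φ (event q.1 0 + cone q.2) :=
    hm.comp (Continuous.measurable (by fun_prop))
  have h : IntegrableOn (fun q : ℝ × E3 => φ (event q.1 0 + cone q.2))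
      (Icc (-(3 * R)) R ×ˢ Metric.closedBall 0 (2 * R)) ((volume.restrict S).prod coulomb) := by
    refine IntegrableOn.of_bound (C := C) ?_ hΨ.aestronglyMeasurable
      (Eventually.of_forall fun q => hC _)
    rw [Measure.prod_prod]
    refine ENNReal.mul_lt_top ((Measure.restrict_apply_le _ _).trans_lt ?_)
      (coulomb_closedBall_lt_top _)
    simp
  refine (h.integrable_indicator (measurableSet_Icc.prod
    Metric.isClosed_closedBall.measurableSet)).congr (Eventually.of_forall fun q => ?_)
  rw [indicator_apply_eq_self]
  intro hq'
  refine hR _ ?_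
  by_contra! hle
  have h1 := (norm_le_pi_norm (event q.1 0 + cone q.2) 0).trans hle
  rw [add_cone, event_zero, event_zero, Real.norm_eq_abs] at h1
  have h3 : ‖q.2‖ ≤ 2 * R := by
    calc ‖q.2‖ = ‖space (event q.1 0 + cone q.2)‖ := by
          rw [add_cone, space_event, space_event, zero_add]
      _ ≤ 2 * ‖event q.1 0 + cone q.2‖ := norm_space_le _
      _ ≤ 2 * R := by linarith
  obtain ⟨h4, h5⟩ := abs_le.1 h1
  have := norm_nonneg q.2
  exact hq' ⟨⟨by linarith, by linarith⟩, by simpa using h3⟩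

/-! ### The retarded field of the source -/

/-- The retarded field of a shell. -/
def shellField (v : ℝ) (τ : S2 → ℝ) (p : Spacetime) : ℝ := ∫ m, τ m * retKernel v p m ∂area

lemma measurable_retarded_integrand {φ : Spacetime → ℝ} (hφ : Measurable φ)
    {τ : S2 → ℝ} (hτ : Continuous τ) :
    Measurable fun q : S2 × Spacetime => τ q.1 * φ q.2 :=
  (hτ.measurable.comp measurable_fst).mul (hφ.comp measurable_snd)

lemma integrable_retarded {v : ℝ} (hv0 : 0 ≤ v) (hv1 : v < 1) {φ : Spacetime → ℝ}
    (hφ : IsBoundedSupported φ) {τ : S2 → ℝ} (hτ : Continuous τ) :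
    Integrable (fun q : S2 × Spacetime => retKernel v q.2 q.1 * (τ q.1 * φ q.2))
      (area.prod volume) := by
  have h := (measurePreserving_retarded hv0 hv1).integrable_comp (g := fun q => τ q.1 * φ q.2)
    (measurable_retarded_integrand hφ.1 hτ).aestronglyMeasurable
  have h1 := h.1 (integrable_retarded_source v hφ hτ)
  rw [integrable_withDensity_iff_integrable_smul' (measurable_retKernel v).ennreal_ofReal
    (Eventually.of_forall fun _ => ENNReal.ofReal_lt_top)] at h1
  simpa only [ENNReal.toReal_ofReal (retKernel_nonneg _ _ _), smul_eq_mul] using h1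

lemma integral_retarded {v : ℝ} (hv0 : 0 ≤ v) (hv1 : v < 1) {φ : Spacetime → ℝ}
    (hφ : IsBoundedSupported φ) {τ : S2 → ℝ} (hτ : Continuous τ) :
    ∫ t in Ioi (0 : ℝ), ∫ n : S2, τ n * advanced φ (event t ((v * t) • (n : E3))) ∂area =
      ∫ q : S2 × Spacetime, retKernel v q.2 q.1 * (τ q.1 * φ q.2) ∂(area.prod volume) := by
  have hm := measurable_retarded_integrand hφ.1 hτ
  have hp := measurePreserving_retarded hv0 hv1
  have h1 := integral_map (μ := ((volume.restrict (Ioi (0 : ℝ))).prod area).prod coulomb)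
    hp.measurable.aemeasurable (f := fun q => τ q.1 * φ q.2)
    hm.aestronglyMeasurable
  rw [hp.map_eq, integral_withDensity_eq_integral_toReal_smul
    (measurable_retKernel v).ennreal_ofReal
    (Eventually.of_forall fun _ => ENNReal.ofReal_lt_top)] at h1
  simp only [ENNReal.toReal_ofReal (retKernel_nonneg _ _ _), smul_eq_mul] at h1
  have h2 := integrable_retarded_source v hφ hτ
  rw [h1, integral_prod _ h2, integral_prod _ h2.integral_prod_left]
  simp only [integral_const_mul, advanced_eq]

lemma integrable_shellField {v : ℝ} (hv0 : 0 ≤ v) (hv1 : v < 1) {φ : Spacetime → ℝ}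
    (hφ : IsBoundedSupported φ) {τ : S2 → ℝ} (hτ : Continuous τ) :
    Integrable (fun p => shellField v τ p * φ p) := by
  refine (integrable_retarded hv0 hv1 hφ hτ).integral_prod_right.congr
    (Eventually.of_forall fun p => ?_)
  simp only [shellField, ← integral_mul_const]
  exact integral_congr_ae (Eventually.of_forall fun m => by ring)

lemma integral_shellField {v : ℝ} (hv0 : 0 ≤ v) (hv1 : v < 1) {φ : Spacetime → ℝ}
    (hφ : IsBoundedSupported φ) {τ : S2 → ℝ} (hτ : Continuous τ) :
    ∫ p, shellField v τ p * φ p =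
      ∫ t in Ioi (0 : ℝ), ∫ n : S2, τ n * advanced φ (event t ((v * t) • (n : E3))) ∂area := by
  rw [integral_retarded hv0 hv1 hφ hτ, integral_prod_symm _ (integrable_retarded hv0 hv1 hφ hτ)]
  refine integral_congr_ae (Eventually.of_forall fun p => ?_)
  simp only [shellField, ← integral_mul_const]
  exact integral_congr_ae (Eventually.of_forall fun m => by ring)

lemma integrable_restKernel {S : Set ℝ} [DecidablePred (· ∈ S)] (hS : MeasurableSet S)
    {φ : Spacetime → ℝ} (hφ : IsBoundedSupported φ) :
    Integrable (fun p => restKernel S p * φ p) := by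
  have h1 := ((measurePreserving_rest hS).integrable_comp (g := φ)
    hφ.1.aestronglyMeasurable).1 (integrable_rest_source hφ S)
  rw [integrable_withDensity_iff_integrable_smul' (measurable_restKernel hS).ennreal_ofReal
    (Eventually.of_forall fun _ => ENNReal.ofReal_lt_top)] at h1
  simpa only [ENNReal.toReal_ofReal (restKernel_nonneg _ _), smul_eq_mul] using h1

lemma integral_restKernel {S : Set ℝ} [DecidablePred (· ∈ S)] (hS : MeasurableSet S)
    {φ : Spacetime → ℝ} (hφ : IsBoundedSupported φ) :
    ∫ p, restKernel S p * φ p = ∫ t in S, advanced φ (event t 0) := by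
  have hp := measurePreserving_rest hS
  have h1 := integral_map (μ := (volume.restrict S).prod coulomb) hp.measurable.aemeasurable (f := φ)
    hφ.1.aestronglyMeasurable
  rw [hp.map_eq, integral_withDensity_eq_integral_toReal_smul
    (measurable_restKernel hS).ennreal_ofReal
    (Eventually.of_forall fun _ => ENNReal.ofReal_lt_top)] at h1
  simp only [ENNReal.toReal_ofReal (restKernel_nonneg _ _), smul_eq_mul] at h1
  rw [h1, integral_prod _ (integrable_rest_source hφ S)]
  simp only [advanced_eq]

lemma measurable_shellField (v : ℝ) {τ : S2 → ℝ} (hτ : Continuous τ) :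
    Measurable (shellField v τ) := by
  have h : StronglyMeasurable fun q : S2 × Spacetime => τ q.1 * retKernel v q.2 q.1 :=
    ((hτ.measurable.comp measurable_fst).mul (measurable_retKernel v)).stronglyMeasurable
  exact h.integral_prod_left'.measurable

lemma locallyIntegrable_of_boundedSupported {f : Spacetime → ℝ}
    (h : ∀ φ, IsBoundedSupported φ → Integrable fun p => f p * φ p) : LocallyIntegrable f := by
  rw [locallyIntegrable_iff]
  intro K hK
  rw [← integrable_indicator_iff hK.measurableSet]
  refine (h _ (isBoundedSupported_indicator hK)).congr (Eventually.of_forall fun p => ?_)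
  by_cases hp : p ∈ K <;> simp [hp]

/-- The trace-reversed metric perturbation. -/
def field (v ρ m : ℝ) (α : S2 → ℝ) (a b : Fin 4) (p : Spacetime) : ℝ :=
  16 * Real.pi * (rest a b * ((m + shellEnergy v ρ) * restKernel (Iio 0) p
    + m * restKernel (Ioi 0) p) + shellField v (fun n => shellStress v ρ α n a b) p)

lemma integrable_field {v : ℝ} (hv0 : 0 ≤ v) (hv1 : v < 1) (ρ m : ℝ) {α : S2 → ℝ}
    (hα : SmoothS2 α) (a b : Fin 4) {φ : Spacetime → ℝ} (hφ : IsBoundedSupported φ) :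
    Integrable (fun p => field v ρ m α a b p * φ p) := by
  have hc := (isFreeShell_shellStress v ρ hα).continuous a b
  refine (((((integrable_restKernel (S := Iio 0) measurableSet_Iio hφ).const_mul (m + shellEnergy v ρ)).add
    ((integrable_restKernel (S := Ioi 0) measurableSet_Ioi hφ).const_mul m)).const_mul (rest a b)).add
    (integrable_shellField hv0 hv1 hφ hc)).const_mul (16 * Real.pi) |>.congr
    (Eventually.of_forall fun p => ?_)
  simp only [field, Pi.add_apply]
  ring

lemma integral_field {v : ℝ} (hv0 : 0 ≤ v) (hv1 : v < 1) (ρ m : ℝ) {α : S2 → ℝ}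
    (hα : SmoothS2 α) (a b : Fin 4) {φ : Spacetime → ℝ} (hφ : IsBoundedSupported φ) :
    ∫ p, field v ρ m α a b p * φ p = 16 * Real.pi * source v ρ m α a b (advanced φ) := by
  have hc := (isFreeShell_shellStress v ρ hα).continuous a b
  have h1 := (integrable_restKernel (S := Iio 0) measurableSet_Iio hφ).const_mul (m + shellEnergy v ρ)
  have h2 := (integrable_restKernel (S := Ioi 0) measurableSet_Ioi hφ).const_mul m
  have h3 := integrable_shellField hv0 hv1 hφ hc
  have h4 : (fun p => field v ρ m α a b p * φ p) = fun p => 16 * Real.pi * (rest a b *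
      ((m + shellEnergy v ρ) * (restKernel (Iio 0) p * φ p) + m * (restKernel (Ioi 0) p * φ p))
      + shellField v (fun n => shellStress v ρ α n a b) p * φ p) := by
    funext p
    simp only [field]
    ring
  have h5 : Integrable fun p => rest a b *
      ((m + shellEnergy v ρ) * (restKernel (Iio 0) p * φ p) + m * (restKernel (Ioi 0) p * φ p)) :=
    (h1.add h2).const_mul _
  rw [h4, integral_const_mul, integral_add h5 h3, integral_const_mul,
    integral_add h1 h2, integral_const_mul, integral_const_mul, integral_restKernel (S := Iio 0) measurableSet_Iio hφ,
    integral_restKernel (S := Ioi 0) measurableSet_Ioi hφ, integral_shellField hv0 hv1 hφ hc, source_eq]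
  rfl

theorem isRetardedSolution_field {v : ℝ} (hv0 : 0 ≤ v) (hv1 : v < 1) (ρ m : ℝ) {α : S2 → ℝ}
    (hα : SmoothS2 α) : IsRetardedSolution (source v ρ m α) (field v ρ m α) := fun a b =>
  ⟨locallyIntegrable_of_boundedSupported fun _ => integrable_field hv0 hv1 ρ m hα a b,
    fun _ hφ => integral_field hv0 hv1 ρ m hα a b hφ.isBoundedSupported⟩

theorem divT_field {v : ℝ} (hv0 : 0 < v) (hv1 : v < 1) (ρ m : ℝ) {α : S2 → ℝ}
    (hα : SmoothS2 α) (a : Fin 4) {φ : Spacetime → ℝ} (hφ : IsTest φ) :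
    divT (fun a b => ofFun (field v ρ m α a b)) a φ = 0 := by
  -- The cone must contain the shell and lie strictly inside the light cone; any `w` between `v` and
  -- `1` would do.
  have h := divT_source hv0 (show v < (1 + v) / 2 by linarith) hα ρ m
    (admissible_advanced hφ (by linarith)) a
  rw [divT_apply] at h ⊢
  have h1 : ∀ c, ofFun (field v ρ m α a c) (pd c φ) =
      16 * Real.pi * source v ρ m α a c (pd c (advanced φ)) := fun c => by
    rw [pd_advanced hφ, ofFun, integral_field hv0.le hv1 ρ m hα a c (hφ.pd c).isBoundedSupported]
  simp only [h1, ← Finset.mul_sum]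
  rw [← mul_sub, h, mul_zero]

lemma source_neg (v ρ m : ℝ) (α : S2 → ℝ) (a b : Fin 4) (φ : Spacetime → ℝ) :
    source v ρ m α a b (fun p => - φ p) = - source v ρ m α a b φ := by
  simp only [source, Pi.add_apply, laboratory, shell, mul_neg, integral_neg]
  ring

/-- In Lorenz gauge only the wave operator is left; transposed to the test function it is undone by
`advanced_dalembert`. -/
theorem einsteinOp_field {v : ℝ} (hv0 : 0 < v) (hv1 : v < 1) (ρ m : ℝ) {α : S2 → ℝ}
    (hα : SmoothS2 α) (a b : Fin 4) {φ : Spacetime → ℝ} (hφ : IsTest φ) :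
    einsteinOp (fun a b => ofFun (field v ρ m α a b)) a b φ =
      -16 * Real.pi * source v ρ m α a b φ := by
  have h1 : ∀ c d, dD c (divT (fun a b => ofFun (field v ρ m α a b)) d) φ = 0 := fun c d => by
    rw [dD_apply, divT_field hv0 hv1 ρ m hα d (hφ.pd c), neg_zero]
  have h2 : box (ofFun (field v ρ m α a b)) φ = -16 * Real.pi * source v ρ m α a b φ := by
    have h4 : ∀ c, Integrable fun p => eta c c * (field v ρ m α a b p * pd c (pd c φ) p) :=
      fun c => (integrable_field hv0.le hv1 ρ m hα a b
        ((hφ.pd c).pd c).isBoundedSupported).const_mul _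
    have h3 : box (ofFun (field v ρ m α a b)) φ = ofFun (field v ρ m α a b) (dalembert φ) := by
      simp only [box, Finset.sum_apply, Pi.smul_apply, dD_apply, neg_neg, ofFun, smul_eq_mul,
        ← integral_const_mul]
      rw [← integral_finsetSum _ fun c _ => h4 c]
      refine integral_congr_ae (Eventually.of_forall fun p => ?_)
      simp only [dalembert, Finset.mul_sum]
      exact Finset.sum_congr rfl fun c _ => by ring
    have h5 : advanced (dalembert φ) = fun p => - φ p := funext (advanced_dalembert hφ)
    rw [h3, ofFun, integral_field hv0.le hv1 ρ m hα a b hφ.dalembert.isBoundedSupported, h5,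
      source_neg]
    ring
  simp only [einsteinOp, Pi.add_apply, Pi.sub_apply, Pi.smul_apply, Finset.sum_apply, h1, h2]
  simp

/-! ### Continuity and radiative order of the field -/

lemma continuousOn_integral_area {X : Type*} [TopologicalSpace X] [FirstCountableTopology X]
    [LocallyCompactSpace X] {V : Set X} (hV : IsLocallyClosed V) {f : X → S2 → ℝ} (hf : ContinuousOn (fun q : X × S2 => f q.1 q.2) (V ×ˢ univ)) :
    ContinuousOn (fun x => ∫ m, f x m ∂area) V := by
  rw [continuousOn_iff_continuous_domRestrict]
  have := hV.locallyCompactSpace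
  refine continuous_integral_area (F := fun q : V × S2 => f q.1 q.2) ?_
  exact hf.comp_continuous (f := fun q : V × S2 => ((q.1 : X), q.2)) (by fun_prop)
    fun q => ⟨q.1.2, trivial⟩

/-- With `s = x · m` the radicand is `(v t - s)² + (1 - v²)(r² - s²)`, which vanishes only at the
particle itself, on `r = v t`. -/
lemma delay_pos {v : ℝ} (hv0 : 0 ≤ v) (hv1 : v < 1) {p : Spacetime} (h0 : ‖space p‖ < p 0)
    (h : ‖space p‖ ≠ v * p 0) (m : S2) : 0 < delay v p m := by
  have h1 := abs_real_inner_le_norm (space p) (m : E3)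
  rw [S2.norm_coe, mul_one] at h1
  have h2 := norm_nonneg (space p)
  rw [delay, Real.sqrt_pos]
  generalize inner ℝ (space p) (m : E3) = s at *
  generalize ‖space p‖ = r at *
  generalize p 0 = t at *
  have h3 : s ^ 2 ≤ r ^ 2 := sq_le_sq' (abs_le.1 h1).1 (abs_le.1 h1).2
  have h4 : (t - v * s) ^ 2 - (1 - v ^ 2) * (t ^ 2 - r ^ 2) =
      (v * t - s) ^ 2 + (1 - v ^ 2) * (r ^ 2 - s ^ 2) := by ring
  have h5 : 0 < 1 - v ^ 2 := by nlinarith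
  rw [h4]
  rcases h3.lt_or_eq with h6 | h6
  · have := mul_pos h5 (sub_pos.2 h6)
    positivity
  · rw [h6, sub_self, mul_zero, add_zero, sq_pos_iff, sub_ne_zero]
    rintro rfl
    refine h ?_
    have : 0 ≤ v * t := mul_nonneg hv0 (by linarith)
    nlinarith [sq_nonneg (r + v * t)]

lemma continuousAt_restKernel {S : Set ℝ} [DecidablePred (· ∈ S)] {p : Spacetime}
    (h0 : space p ≠ 0) (h : p 0 - ‖space p‖ ∈ interior S ∪ interior Sᶜ) :
    ContinuousAt (restKernel S) p := by
  have hc : ContinuousAt (fun p : Spacetime => p 0 - ‖space p‖) p :=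
    Continuous.continuousAt (by fun_prop)
  rcases h with h | h
  · have h1 : restKernel S =ᶠ[𝓝 p] fun p => (4 * Real.pi * ‖space p‖)⁻¹ := by
      filter_upwards [hc.eventually (isOpen_interior.mem_nhds h)] with q hq
      exact if_pos (interior_subset hq)
    refine ContinuousAt.congr ?_ h1.symm
    refine ContinuousAt.inv₀ (Continuous.continuousAt (by fun_prop)) ?_
    have := Real.pi_pos
    have := norm_pos_iff.2 h0
    positivity
  · have h1 : restKernel S =ᶠ[𝓝 p] fun p => 0 := by
      filter_upwards [hc.eventually (isOpen_interior.mem_nhds h)] with q hq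
      exact if_neg (interior_subset hq)
    exact continuousAt_const.congr h1.symm

lemma continuousAt_shellField {v : ℝ} (hv0 : 0 ≤ v) (hv1 : v < 1) {τ : S2 → ℝ}
    (hτ : Continuous τ) {p : Spacetime} (h0 : p 0 ≠ ‖space p‖) (h : ‖space p‖ ≠ v * p 0) :
    ContinuousAt (shellField v τ) p := by
  rcases h0.lt_or_gt with h0 | h0
  · have ho : IsOpen {p : Spacetime | p 0 < ‖space p‖} :=
      isOpen_lt (f := fun p : Spacetime => p 0) (g := fun p : Spacetime => ‖space p‖)
        (by fun_prop) (by fun_prop)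
    have h1 : shellField v τ =ᶠ[𝓝 p] fun p => 0 := by
      filter_upwards [ho.mem_nhds h0] with q hq
      have hq' : ¬ ‖space q‖ < q 0 := not_lt.2 (le_of_lt hq)
      simp [shellField, retKernel, hq']
    exact continuousAt_const.congr h1.symm
  · have ho : IsOpen {p : Spacetime | ‖space p‖ < p 0 ∧ ‖space p‖ ≠ v * p 0} :=
      (isOpen_lt (f := fun p : Spacetime => ‖space p‖) (g := fun p : Spacetime => p 0)
        (by fun_prop) (by fun_prop)).inter
        (isOpen_ne_fun (f := fun p : Spacetime => ‖space p‖) (g := fun p : Spacetime => v * p 0)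
        (by fun_prop) (by fun_prop))
    refine ContinuousOn.continuousAt (continuousOn_integral_area ho.isLocallyClosed ?_) (ho.mem_nhds ⟨h0, h⟩)
    have h1 : ContinuousOn (fun q : Spacetime × S2 => τ q.2 * (4 * Real.pi * delay v q.1 q.2)⁻¹)
        ({p : Spacetime | ‖space p‖ < p 0 ∧ ‖space p‖ ≠ v * p 0} ×ˢ univ) := by
      refine ContinuousOn.mul (hτ.comp continuous_snd).continuousOn (ContinuousOn.inv₀ ?_ ?_)
      · unfold delay
        exact Continuous.continuousOn (by fun_prop)
      · rintro q ⟨hq, -⟩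
        have := delay_pos hv0 hv1 hq.1 hq.2 q.2
        have := Real.pi_pos
        positivity
    refine h1.congr ?_
    rintro q ⟨hq, -⟩
    simp only [retKernel, if_pos hq.1]

theorem continuousOn_field {v : ℝ} (hv0 : 0 ≤ v) (hv1 : v < 1) (ρ m : ℝ) {α : S2 → ℝ}
    (hα : SmoothS2 α) (a b : Fin 4) : ContinuousOn (field v ρ m α a b)
      {p | space p ≠ 0 ∧ p 0 ≠ ‖space p‖ ∧ ‖space p‖ ≠ v * p 0} := by
  rintro p ⟨h1, h2, h3⟩
  have h4 := sub_ne_zero.2 h2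
  refine ContinuousAt.continuousWithinAt (ContinuousAt.mul continuousAt_const
    (ContinuousAt.add (ContinuousAt.mul continuousAt_const (ContinuousAt.add
    (ContinuousAt.mul continuousAt_const (continuousAt_restKernel h1 ?_))
    (ContinuousAt.mul continuousAt_const (continuousAt_restKernel h1 ?_))))
    (continuousAt_shellField hv0 hv1 ((isFreeShell_shellStress v ρ hα).continuous a b) h2 h3)))
  · rw [compl_Iio, interior_Iio, interior_Ici]
    exact h4.lt_or_gt
  · rw [compl_Ioi, interior_Ioi, interior_Iic]
    exact h4.lt_or_gt.symm

/-- The square of `delay v p m / r` at `p = event (r + ε r) (r n)`, where `μ` is the inner product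
of `n` and `m`. -/
def delaySq (v ε μ : ℝ) : ℝ := (ε + 1 - v * μ) ^ 2 - (1 - v ^ 2) * (ε ^ 2 + 2 * ε)

/-! ### The field of the shell near null infinity. -/

lemma delaySq_zero (v μ : ℝ) : delaySq v 0 μ = (1 - v * μ) ^ 2 := by
  unfold delaySq
  ring

/-- At `ε = 0` the value is at least `(1 - v)²`. The threshold on `ε` makes the linear term at most
half of that, and the quadratic term helps. -/
lemma le_delaySq {v : ℝ} (hv0 : 0 ≤ v) (hv1 : v < 1) {ε μ : ℝ} (hμ : |μ| ≤ 1)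
    (hε : |ε| ≤ (1 - v) ^ 2 / 8) : ((1 - v) / 2) ^ 2 ≤ delaySq v ε μ := by
  obtain ⟨h1, h2⟩ := abs_le.1 hμ
  have h3 : (1 - v) ^ 2 ≤ (1 - v * μ) ^ 2 := by
    refine pow_le_pow_left₀ (by linarith) ?_ 2
    nlinarith
  have h4 : |v * (v - μ)| ≤ 2 := by
    rw [abs_le]
    constructor <;> nlinarith
  have h5 : |ε * (v * (v - μ))| ≤ (1 - v) ^ 2 / 8 * 2 := by
    rw [abs_mul]
    exact mul_le_mul hε h4 (abs_nonneg _) (by positivity)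
  have h6 := (abs_le.1 h5).1
  have h7 : delaySq v ε μ = (v * ε) ^ 2 + 2 * (ε * (v * (v - μ))) + (1 - v * μ) ^ 2 := by
    unfold delaySq
    ring
  rw [h7]
  nlinarith [sq_nonneg (v * ε)]

lemma delay_scri (v : ℝ) {u r : ℝ} (hr : 0 < r) (n m : S2) :
    delay v (event (u + r) (r • (n : E3))) m =
      r * Real.sqrt (delaySq v (u / r) (inner ℝ (n : E3) (m : E3))) := by
  rw [← Real.sqrt_sq hr.le, ← Real.sqrt_mul (sq_nonneg _), delay, Real.sqrt_sq hr.le]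
  congr 1
  rw [event_zero, space_event, real_inner_smul_left, norm_smul, S2.norm_coe, mul_one,
    Real.norm_of_nonneg hr.le, delaySq]
  field_simp
  ring

/-- The retarded field of a shell, times `r`, at `u = ε r > 0`. -/
def shellScri (v : ℝ) (τ : S2 → ℝ) (ε : ℝ) (n : S2) : ℝ :=
  ∫ m, τ m * (4 * Real.pi * Real.sqrt (delaySq v ε (inner ℝ (n : E3) (m : E3))))⁻¹ ∂area

/-- The field of the shell is homogeneous of degree `-1` about the launch event, so `r` times it
depends on the direction, the sign of `u` and `u / r`; the limit `r → ∞` becomes continuity at `u /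
r = 0`. -/
lemma shellField_scri {v : ℝ} {τ : S2 → ℝ} {u r : ℝ} (hr : 0 < r) (n : S2) :
    r * shellField v τ (event (u + r) (r • (n : E3))) =
      if 0 < u then shellScri v τ (u / r) n else 0 := by
  have hn : ‖r • (n : E3)‖ = r := by
    rw [norm_smul, S2.norm_coe, mul_one, Real.norm_of_nonneg hr.le]
  simp only [shellField, retKernel, event_zero, space_event, hn, lt_add_iff_pos_left]
  split_ifs with h
  · rw [← integral_const_mul, shellScri]
    refine integral_congr_ae (Eventually.of_forall fun m => ?_)
    simp only [delay_scri v hr]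
    field_simp
  · simp

lemma field_scri {v ρ m : ℝ} {α : S2 → ℝ} {u r : ℝ} (hr : 0 < r) (n : S2) (a b : Fin 4) :
    r * field v ρ m α a b (event (u + r) (r • (n : E3))) =
      4 * rest a b * ((if u < 0 then m + shellEnergy v ρ else 0) + if 0 < u then m else 0)
        + if 0 < u then 16 * Real.pi * shellScri v (fun n => shellStress v ρ α n a b) (u / r) n
          else 0 := by
  have hn : ‖r • (n : E3)‖ = r := by
    rw [norm_smul, S2.norm_coe, mul_one, Real.norm_of_nonneg hr.le]
  have h := shellField_scri (v := v) (τ := fun n => shellStress v ρ α n a b) (u := u) hr n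
  have h1 : ∀ x y z : ℝ, r * (16 * Real.pi * (x * y + z)) =
    16 * Real.pi * (x * (r * y) + r * z) := fun x y z => by ring
  have := Real.pi_pos
  rw [field, h1, h]
  simp only [restKernel, event_zero, space_event, hn, add_sub_cancel_right, mem_Iio, mem_Ioi]
  split_ifs <;> field_simp <;> ring

lemma continuousOn_shellScri {v : ℝ} (hv0 : 0 ≤ v) (hv1 : v < 1) {τ : S2 → ℝ}
    (hτ : Continuous τ) : ContinuousOn (fun q : ℝ × S2 => shellScri v τ q.1 q.2)
      ({ε | |ε| ≤ (1 - v) ^ 2 / 8} ×ˢ univ) := by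
  have hV : IsClosed ({ε : ℝ | |ε| ≤ (1 - v) ^ 2 / 8} ×ˢ (univ : Set S2)) :=
    (isClosed_le (by fun_prop) continuous_const).prod isClosed_univ
  refine continuousOn_integral_area hV.isLocallyClosed (f := fun (q : ℝ × S2) m => τ m * (4 * Real.pi *
    Real.sqrt (delaySq v q.1 (inner ℝ (q.2 : E3) (m : E3))))⁻¹) ?_
  refine ContinuousOn.mul (hτ.comp continuous_snd).continuousOn (ContinuousOn.inv₀ ?_ ?_)
  · unfold delaySq
    exact Continuous.continuousOn (by fun_prop)
  · rintro q ⟨⟨hq, -⟩, -⟩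
    have h := le_delaySq hv0 hv1 (abs_inner_sphere_le_one q.1.2 q.2) hq
    have : 0 < 1 - v := by linarith
    have h1 : 0 < delaySq v q.1.1 (inner ℝ (q.1.2 : E3) (q.2 : E3)) := lt_of_lt_of_le (by positivity) h
    have := Real.pi_pos
    have := Real.sqrt_pos.2 h1
    positivity

lemma shellScri_zero {v : ℝ} (hv0 : 0 < v) (hv1 : v < 1) (τ : S2 → Fin 4 → Fin 4 → ℝ) (n : S2)
    (a b : Fin 4) :
    16 * Real.pi * shellScri v (fun n => τ n a b) 0 n = radiative v τ n a b := by
  rw [shellScri, radiative, ← integral_const_mul, ← integral_const_mul]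
  refine integral_congr_ae (Eventually.of_forall fun m => ?_)
  have h := one_sub_mul_inner_pos hv0 hv1 n m
  have := Real.pi_pos
  simp only [delaySq_zero, Real.sqrt_sq h.le]
  field_simp
  ring

lemma radiative_shellStress {v : ℝ} (hv0 : 0 < v) (hv1 : v < 1) (ρ : ℝ) {α : S2 → ℝ}
    (hα : SmoothS2 α) (n : S2) (a b : Fin 4) : radiative v (shellStress v ρ α) n a b =
      ρ * radiative v (dust v) n a b + radiative v (lStress v α) n a b := by
  have hd : Continuous fun m : S2 => (1 - v * inner ℝ (n : E3) (m : E3))⁻¹ :=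
    Continuous.inv₀ (by fun_prop) fun m => (one_sub_mul_inner_pos hv0 hv1 n m).ne'
  have h1 : Integrable (fun m => dust v m a b / (1 - v * inner ℝ (n : E3) (m : E3))) area :=
    integrable_area (((isFreeShell_dust v).continuous a b).mul hd)
  have h2 : Integrable (fun m => lStress v α m a b / (1 - v * inner ℝ (n : E3) (m : E3))) area :=
    integrable_area (((isFreeShell_lStress v hα).continuous a b).mul hd)
  have h3 := integral_add (h1.const_mul ρ) h2
  rw [integral_const_mul] at h3
  simp only [radiative, shellStress, add_div, mul_div_assoc]
  rw [h3]
  ring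

theorem tendsto_field_early {v ρ m : ℝ} {α : S2 → ℝ} {u : ℝ} (hu : u < 0) (n : S2) (a b : Fin 4) :
    Tendsto (fun r : ℝ => r * field v ρ m α a b (event (u + r) (r • (n : E3)))) atTop
      (𝓝 (4 * (m + shellEnergy v ρ) * rest a b)) := by
  refine tendsto_const_nhds.congr' ?_
  filter_upwards [eventually_gt_atTop 0] with r hr
  rw [field_scri hr, if_pos hu, if_neg hu.not_gt, if_neg hu.not_gt]
  ring

lemma tendsto_shellScri {v : ℝ} (hv0 : 0 < v) (hv1 : v < 1) {τ : S2 → Fin 4 → Fin 4 → ℝ}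
    {a b : Fin 4} (hτ : Continuous fun n => τ n a b) (u : ℝ) (n : S2) :
    Tendsto (fun r => 16 * Real.pi * shellScri v (fun n => τ n a b) (u / r) n) atTop
      (𝓝 (radiative v τ n a b)) := by
  rw [← shellScri_zero hv0 hv1]
  refine Tendsto.const_mul _ ?_
  have h1 := continuousOn_shellScri hv0.le hv1 hτ
  have h2 : ContinuousAt (fun ε => shellScri v (fun n => τ n a b) ε n) 0 := by
    have h3 : ContinuousOn (fun ε => shellScri v (fun n => τ n a b) ε n)
        {ε | |ε| ≤ (1 - v) ^ 2 / 8} :=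
      h1.comp (f := fun ε : ℝ => (ε, n)) (by fun_prop) fun ε hε => ⟨hε, trivial⟩
    have h4 : 0 < 1 - v := by linarith
    refine h3.continuousAt (mem_of_superset (Metric.closedBall_mem_nhds 0
      (show 0 < (1 - v) ^ 2 / 8 by positivity)) fun ε hε => ?_)
    simpa using hε
  exact h2.tendsto.comp (tendsto_const_nhds.div_atTop tendsto_id)

theorem tendsto_field_late {v : ℝ} (hv0 : 0 < v) (hv1 : v < 1) (ρ m : ℝ) {α : S2 → ℝ}
    (hα : SmoothS2 α) {u : ℝ} (hu : 0 < u) (n : S2) (a b : Fin 4) :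
    Tendsto (fun r : ℝ => r * field v ρ m α a b (event (u + r) (r • (n : E3)))) atTop
      (𝓝 (4 * m * rest a b + ρ * radiative v (dust v) n a b
        + radiative v (lStress v α) n a b)) := by
  rw [add_assoc, ← radiative_shellStress hv0 hv1 ρ hα]
  refine (tendsto_const_nhds.add (tendsto_shellScri hv0 hv1
    ((isFreeShell_shellStress v ρ hα).continuous a b) u n)).congr' ?_
  filter_upwards [eventually_gt_atTop 0] with r hr
  rw [field_scri hr, if_neg hu.not_gt, if_pos hu, if_pos hu]
  ring

/-! ### Wave packets near null infinity -/

/-- The function `r^j ψ(t - r, x / r) χ(r - R)`. -/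
def packet (j : ℤ) (ψ : ℝ × E3 → ℝ) (χ : ℝ → ℝ) (R : ℝ) (p : Spacetime) : ℝ :=
  ‖space p‖ ^ j * ψ (p 0 - ‖space p‖, ‖space p‖⁻¹ • space p) * χ (‖space p‖ - R)

/-- The derivative with respect to retarded time. -/
def dU (ψ : ℝ × E3 → ℝ) (q : ℝ × E3) : ℝ := fderiv ℝ ψ q (1, 0)

/-- The covector `∂_a u`, in terms of the direction. -/
def gradU (y : E3) : Fin 4 → ℝ := Fin.cons 1 fun i => - y i

/-- The covector `∂_a r`, in terms of the direction. -/
def gradR (y : E3) : Fin 4 → ℝ := Fin.cons 0 fun i => y i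

/-- The part of `∂_a (r^j ψ(u, n))` of order `r^(j-1)`. -/
def dAngle (j : ℤ) (a : Fin 4) (ψ : ℝ × E3 → ℝ) (q : ℝ × E3) : ℝ :=
  (Fin.cons 0 (fun i : Fin 3 => j * q.2 i * ψ q
    + fderiv ℝ ψ q (0, EuclideanSpace.single i 1 - q.2 i • q.2)) : Fin 4 → ℝ) a

lemma contDiff_gradU (a : Fin 4) : ContDiff ℝ ∞ fun q : ℝ × E3 => gradU q.2 a := by
  refine Fin.cases ?_ (fun i => ?_) a
  · exact contDiff_const
  · simp only [gradU, Fin.cons_succ]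
    fun_prop

lemma contDiff_gradR (a : Fin 4) : ContDiff ℝ ∞ fun q : ℝ × E3 => gradR q.2 a := by
  refine Fin.cases ?_ (fun i => ?_) a
  · exact contDiff_const
  · simp only [gradR, Fin.cons_succ]
    fun_prop

lemma IsTest.dU {ψ : ℝ × E3 → ℝ} (hψ : IsTest ψ) : IsTest (dU ψ) :=
  ⟨(hψ.1.fderiv_right (m := ∞) (by simp)).clm_apply contDiff_const, hψ.2.fderiv_apply (𝕜 := ℝ) _⟩

lemma IsTest.deriv {χ : ℝ → ℝ} (hχ : IsTest χ) : IsTest (deriv χ) :=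
  ⟨(contDiff_infty_iff_deriv.1 hχ.1).2, hχ.2.deriv⟩

lemma isTest_zero {E : Type*} [NormedAddCommGroup E] [NormedSpace ℝ E] :
    IsTest (fun _ : E => (0 : ℝ)) := ⟨contDiff_const, HasCompactSupport.zero⟩

lemma IsTest.dAngle {ψ : ℝ × E3 → ℝ} (hψ : IsTest ψ) (j : ℤ) (a : Fin 4) :
    IsTest (dAngle j a ψ) := by
  refine Fin.cases ?_ (fun i => ?_) a
  · exact isTest_zero
  · refine IsTest.add (hψ.mul_left (f := fun q => j * q.2 i) (by fun_prop)) ⟨?_, ?_⟩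
    · exact (hψ.1.fderiv_right (m := ∞) (by simp)).clm_apply (by fun_prop)
    · refine (hψ.2.fderiv (𝕜 := ℝ)).mono fun q hq => ?_
      contrapose! hq
      simp only [Function.mem_support, not_not] at hq ⊢
      rw [hq, zero_apply]

lemma packet_eq_zero {χ : ℝ → ℝ} {B : ℝ} (hB : ∀ s, B < ‖s‖ → χ s = 0) (j : ℤ) (ψ : ℝ × E3 → ℝ)
    {R : ℝ} {p : Spacetime} (hp : ‖space p‖ < R - B) : packet j ψ χ R p = 0 := by
  rw [packet, hB _ ?_, mul_zero]
  rw [Real.norm_eq_abs]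
  exact lt_of_lt_of_le (by linarith) (neg_le_abs _)

lemma contDiff_packet {ψ : ℝ × E3 → ℝ} (hψ : ContDiff ℝ ∞ ψ) {χ : ℝ → ℝ} (hχ : ContDiff ℝ ∞ χ)
    {B R : ℝ} (hB : ∀ s, B < ‖s‖ → χ s = 0) (hR : B < R) (j : ℤ) :
    ContDiff ℝ ∞ (packet j ψ χ R) := by
  rw [contDiff_iff_contDiffAt]
  intro p
  -- For `R > B` the cutoff vanishes near `r = 0`, where polar coordinates are singular.
  rcases eq_or_ne (space p) 0 with hp | hp
  · have ho : IsOpen {p : Spacetime | ‖space p‖ < R - B} :=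
      isOpen_lt (f := fun p : Spacetime => ‖space p‖) (by fun_prop) continuous_const
    have hp' : p ∈ {p : Spacetime | ‖space p‖ < R - B} := by
      rw [mem_ofPred_eq, hp, norm_zero]
      linarith
    refine (contDiffAt_const (c := (0 : ℝ))).congr_of_eventuallyEq ?_
    filter_upwards [ho.mem_nhds hp'] with q hq
    exact packet_eq_zero hB j ψ hq
  · have hr : ContDiffAt ℝ ∞ (fun p : Spacetime => ‖space p‖) p :=
      (contDiff_space.contDiffAt (x := p)).norm ℝ hp
    have hr0 := norm_ne_zero_iff.2 hp
    have ht : ContDiffAt ℝ ∞ (fun p : Spacetime => p 0) p :=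
      (contDiff_apply ℝ ℝ (0 : Fin 4)).contDiffAt
    have hz : ContDiffAt ℝ ∞ (fun p : Spacetime => ‖space p‖ ^ j) p := by
      rcases j with j | j
      · simpa using hr.pow j
      · simp only [zpow_negSucc]
        exact (hr.pow (j + 1)).inv (pow_ne_zero _ hr0)
    exact (hz.mul (hψ.contDiffAt.comp p ((ht.sub hr).prodMk
      ((hr.inv hr0).smul contDiff_space.contDiffAt)))).mul
      (hχ.contDiffAt.comp p (hr.sub contDiffAt_const))

lemma isTest_packet {ψ : ℝ × E3 → ℝ} (hψ : IsTest ψ) {χ : ℝ → ℝ} (hχ : IsTest χ)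
    {B R : ℝ} (hB : ∀ s, B < ‖s‖ → χ s = 0) (hR : B < R) (j : ℤ) : IsTest (packet j ψ χ R) := by
  obtain ⟨A, hA0, hA⟩ := exists_bound_of_isTest hψ
  refine ⟨contDiff_packet hψ.1 hχ.1 hB hR j, HasCompactSupport.intro
    (isCompact_closedBall (0 : Spacetime) (A + 2 * (B + R))) fun p hp => ?_⟩
  by_contra h
  have h1 : ‖‖space p‖ - R‖ ≤ B := by
    by_contra! h1
    exact h (by rw [packet, hB _ h1, mul_zero])
  have h2 : ‖(p 0 - ‖space p‖, ‖space p‖⁻¹ • space p)‖ ≤ A := by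
    by_contra! h2
    exact h (by rw [packet, hA _ h2, mul_zero, zero_mul])
  have h3 := (norm_fst_le (p 0 - ‖space p‖, ‖space p‖⁻¹ • space p)).trans h2
  rw [Real.norm_eq_abs] at h1 h3
  have h4 := abs_le.1 h1
  have h5 := abs_le.1 h3
  have h6 := norm_nonneg (space p)
  refine hp ?_
  rw [mem_closedBall_zero_iff, pi_norm_le_iff_of_nonneg (by linarith)]
  refine Fin.cases ?_ (fun i => ?_)
  · rw [Real.norm_eq_abs, abs_le]
    constructor <;> linarith
  · have := PiLp.norm_apply_le (space p) i
    exact this.trans (by linarith)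

lemma hasDerivAt_packet_time {ψ : ℝ × E3 → ℝ} (hψ : ContDiff ℝ ∞ ψ) (χ : ℝ → ℝ) (R : ℝ) (j : ℤ)
    (t : ℝ) (x : E3) : HasDerivAt (fun s => packet j ψ χ R (event s x))
      (packet j (dU ψ) χ R (event t x)) t := by
  have h1 : HasDerivAt (fun s : ℝ => (s - ‖x‖, ‖x‖⁻¹ • x)) ((1 : ℝ), (0 : E3)) t :=
    ((hasDerivAt_id t).sub_const _).prodMk (hasDerivAt_const _ _)
  have h2 := ((hψ.differentiable (by simp)).differentiableAt.hasFDerivAt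
    (x := (t - ‖x‖, ‖x‖⁻¹ • x))).comp_hasDerivAt t h1
  exact (h2.const_mul (‖x‖ ^ j)).mul_const (χ (‖x‖ - R))

lemma hasDerivAt_packet_space {ψ : ℝ × E3 → ℝ} (hψ : ContDiff ℝ ∞ ψ) {χ : ℝ → ℝ}
    (hχ : ContDiff ℝ ∞ χ) (R : ℝ) (j : ℤ) (t : ℝ) {x : E3} (hx : x ≠ 0) (i : Fin 3) :
    HasDerivAt (fun s : ℝ => packet j ψ χ R (event t (x + s • EuclideanSpace.single i 1)))
      (packet j (fun q => gradU q.2 i.succ * dU ψ q) χ R (event t x)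
        + packet j (fun q => gradR q.2 i.succ * ψ q) (deriv χ) R (event t x)
        + packet (j - 1) (dAngle j i.succ ψ) χ R (event t x)) 0 := by
  have hr0 := norm_ne_zero_iff.2 hx
  have hx0 : x + (0 : ℝ) • EuclideanSpace.single i (1 : ℝ) = x := by simp
  have h1 : HasDerivAt (fun s : ℝ => x + s • EuclideanSpace.single i (1 : ℝ))
      (EuclideanSpace.single i (1 : ℝ)) 0 := by
    simpa using ((hasDerivAt_id (0 : ℝ)).smul_const (EuclideanSpace.single i (1 : ℝ))).const_add x
  set y : E3 := ‖x‖⁻¹ • x with hy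
  have hr : HasDerivAt (fun s : ℝ => ‖x + s • EuclideanSpace.single i (1 : ℝ)‖) (y i) 0 := by
    have h2 := (h1.norm_sq).sqrt (by simpa using hx)
    simp only [Real.sqrt_sq (norm_nonneg _), hx0] at h2
    refine h2.congr_deriv ?_
    simp only [EuclideanSpace.inner_single_right, hy, PiLp.smul_apply, smul_eq_mul]
    simp
    field_simp
  have hy' : HasDerivAt (fun s : ℝ => ‖x + s • EuclideanSpace.single i (1 : ℝ)‖⁻¹ •
      (x + s • EuclideanSpace.single i (1 : ℝ))) (‖x‖⁻¹ • (EuclideanSpace.single i 1 - y i • y)) 0 := by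
    have h2 : HasDerivAt (fun s : ℝ => ‖x + s • EuclideanSpace.single i (1 : ℝ)‖⁻¹)
        (-y i / ‖x‖ ^ 2) 0 := (hr.inv (by simpa using hx)).congr_deriv (by rw [hx0])
    refine (h2.smul h1).congr_deriv ?_
    rw [hx0, hy, smul_sub, smul_smul, smul_smul, sub_eq_add_neg, ← neg_smul]
    congr 2
    field_simp
  have hu := (hr.const_sub t).prodMk hy'
  have hψ' := (hψ.differentiable (by simp)).differentiableAt.hasFDerivAt.comp_hasDerivAt 0 hu
  have hχ' := ((hχ.differentiable (by simp)).differentiableAt.hasDerivAt).comp 0 (hr.sub_const R)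
  have hz := (hasDerivAt_zpow j ‖x + (0 : ℝ) • EuclideanSpace.single i (1 : ℝ)‖
    (Or.inl (by rwa [hx0]))).comp 0 hr
  have := (hz.mul hψ').mul hχ'
  refine this.congr_deriv ?_
  have hl : ∀ (a c : ℝ) (w : E3) (q : ℝ × E3),
      fderiv ℝ ψ q (a, c • w) = a * fderiv ℝ ψ q (1, 0) + c * fderiv ℝ ψ q (0, w) := by
    intro a c w q
    rw [← smul_eq_mul, ← smul_eq_mul, ← map_smul, ← map_smul, ← map_add]
    simp
  simp only [Pi.mul_apply, Function.comp_apply, hx0, ← hy, hl, packet, event_zero, space_event, dAngle, gradU,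
    gradR, Fin.cons_succ, dU, zpow_sub_one₀ hr0]
  ring

/-- The chain rule in `u`, `r` and the direction: the term along `∂_a u` keeps the order in `r`, the
radial cutoff contributes `χ'`, and everything else is one order lower. -/
lemma pd_packet {ψ : ℝ × E3 → ℝ} (hψ : ContDiff ℝ ∞ ψ) {χ : ℝ → ℝ} (hχ : ContDiff ℝ ∞ χ)
    {B R : ℝ} (hB : ∀ s, B < ‖s‖ → χ s = 0) (hR : B < R) (j : ℤ) (a : Fin 4) (p : Spacetime) :
    pd a (packet j ψ χ R) p = packet j (fun q => gradU q.2 a * dU ψ q) χ R p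
      + packet j (fun q => gradR q.2 a * ψ q) (deriv χ) R p
      + packet (j - 1) (dAngle j a ψ) χ R p := by
  have hd : DifferentiableAt ℝ (packet j ψ χ R) p :=
    ((contDiff_packet hψ hχ hB hR j).differentiable (by simp)).differentiableAt
  refine Fin.cases ?_ (fun i => ?_) a
  · have h1 : HasDerivAt (fun s => event s (space p)) (Pi.single 0 1) (p 0) := by
      rw [hasDerivAt_pi]
      refine Fin.cases ?_ (fun i => ?_)
      · simpa using hasDerivAt_id' (p 0)
      · simpa [Fin.succ_ne_zero] using hasDerivAt_const (p 0) (space p i)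
    have hd' : DifferentiableAt ℝ (packet j ψ χ R) (event (p 0) (space p)) := by
      rwa [event_space]
    have h2 := hd'.hasFDerivAt.comp_hasDerivAt (p 0) h1
    rw [event_space] at h2
    have h3 := h2.unique (hasDerivAt_packet_time hψ χ R j (p 0) (space p))
    rw [event_space] at h3
    rw [pd, h3]
    simp [packet, gradU, gradR, dAngle]
  · rcases eq_or_ne (space p) 0 with hp | hp
    · have ho : IsOpen {p : Spacetime | ‖space p‖ < R - B} :=
        isOpen_lt (f := fun p : Spacetime => ‖space p‖) (by fun_prop) continuous_const
      have hp' : ‖space p‖ < R - B := by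
        rw [hp, norm_zero]
        linarith
      have h1 : packet j ψ χ R =ᶠ[𝓝 p] fun _ => 0 := by
        filter_upwards [ho.mem_nhds hp'] with q hq
        exact packet_eq_zero hB j ψ hq
      have hB' : ∀ s, B < ‖s‖ → deriv χ s = 0 := by
        intro s hs
        have h2 : χ =ᶠ[𝓝 s] fun _ => 0 := by
          filter_upwards [(isOpen_lt (f := fun _ : ℝ => B) (g := fun s : ℝ => ‖s‖)
            continuous_const continuous_norm).mem_nhds hs] with t ht
          exact hB t ht
        rw [h2.deriv_eq, deriv_const]
      rw [packet_eq_zero hB _ _ hp', packet_eq_zero hB' _ _ hp', packet_eq_zero hB _ _ hp', pd,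
        h1.fderiv_eq]
      simp
    · have h1 : HasDerivAt (fun s : ℝ => event (p 0) (space p + s • EuclideanSpace.single i 1))
          (Pi.single i.succ 1) 0 := by
        rw [hasDerivAt_pi]
        refine Fin.cases ?_ (fun k => ?_)
        · simpa using hasDerivAt_const (0 : ℝ) (p 0)
        · have h2 := ((hasDerivAt_id' (0 : ℝ)).mul_const
            ((EuclideanSpace.single i (1 : ℝ) : E3) k)).const_add (space p k)
          refine h2.congr_deriv ?_
          simp [Pi.single_apply]
      have h0 : event (p 0) (space p + (0 : ℝ) • EuclideanSpace.single i 1) = p := by simp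
      have hd' : DifferentiableAt ℝ (packet j ψ χ R)
          (event (p 0) (space p + (0 : ℝ) • EuclideanSpace.single i 1)) := by
        rwa [h0]
      have h2 := hd'.hasFDerivAt.comp_hasDerivAt (0 : ℝ) h1
      rw [h0] at h2
      have h3 := h2.unique (hasDerivAt_packet_space hψ hχ R j (p 0) hp i)
      rw [event_space] at h3
      rw [pd, h3]

/-! ### Limits at null infinity -/

/-- The function `f` falls off as `1/r` at null infinity, with coefficient `g`. -/
structure HasRadiativeOrder (f : Spacetime → ℝ) (g : ℝ → S2 → ℝ) : Prop where
  measurable : Measurable f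
  integrable : ∀ φ, IsBoundedSupported φ → Integrable fun p => f p * φ p
  bounded : ∀ U : ℝ, ∃ C R₀ : ℝ, ∀ r, R₀ ≤ r → ∀ u, |u| ≤ U → ∀ n : S2,
    |r * f (event (u + r) (r • (n : E3)))| ≤ C
  tendsto : ∀ u, u ≠ 0 → ∀ n : S2,
    Tendsto (fun r => r * f (event (u + r) (r • (n : E3)))) atTop (𝓝 (g u n))

/-- The average of `r f` over a sphere and over retarded time, with weight `ψ`. -/
def scriAverage (f : Spacetime → ℝ) (ψ : ℝ × E3 → ℝ) (r : ℝ) : ℝ :=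
  ∫ q : S2 × ℝ, r * f (event (q.2 + r) (r • (q.1 : E3))) * ψ (q.2, (q.1 : E3)) ∂(area.prod volume)

lemma IsTest.integrable_scri {ψ : ℝ × E3 → ℝ} (hψ : IsTest ψ) :
    Integrable (fun q : S2 × ℝ => ψ (q.2, (q.1 : E3))) (area.prod volume) := by
  obtain ⟨A, hA0, hA⟩ := exists_bound_of_isTest hψ
  refine Continuous.integrable_of_hasCompactSupport (hψ.1.continuous.comp (by fun_prop))
    (HasCompactSupport.intro (isCompact_univ.prod (isCompact_Icc (a := -A) (b := A)))
      fun q hq => hA _ ?_)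
  by_contra! h
  have h1 := (norm_fst_le (q.2, (q.1 : E3))).trans h
  exact hq ⟨trivial, abs_le.1 h1⟩

lemma IsTest.exists_bound_fst {ψ : ℝ × E3 → ℝ} (hψ : IsTest ψ) :
    ∃ A : ℝ, ∀ q : ℝ × E3, A < |q.1| → ψ q = 0 := by
  obtain ⟨A, hA0, hA⟩ := exists_bound_of_isTest hψ
  exact ⟨A, fun q hq => hA _ (hq.trans_le (norm_fst_le q))⟩

lemma measurable_scri {f : Spacetime → ℝ} (hf : Measurable f) {ψ : ℝ × E3 → ℝ} (hψ : IsTest ψ) :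
    Measurable fun q : ℝ × (S2 × ℝ) => q.1 * f (event (q.2.2 + q.1) (q.1 • (q.2.1 : E3))) *
      ψ (q.2.2, (q.2.1 : E3)) :=
  (measurable_fst.mul (hf.comp (Continuous.measurable (by fun_prop)))).mul
    (hψ.1.continuous.measurable.comp (Continuous.measurable (by fun_prop)))

lemma HasRadiativeOrder.exists_bound {f : Spacetime → ℝ} {g : ℝ → S2 → ℝ}
    (hf : HasRadiativeOrder f g) {ψ : ℝ × E3 → ℝ} (hψ : IsTest ψ) : ∃ C R₀ : ℝ, 0 ≤ C ∧
      ∀ r, R₀ ≤ r → ∀ q : S2 × ℝ, ‖r * f (event (q.2 + r) (r • (q.1 : E3))) * ψ (q.2, (q.1 : E3))‖ ≤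
        C * ‖ψ (q.2, (q.1 : E3))‖ := by
  obtain ⟨A, hA⟩ := hψ.exists_bound_fst
  obtain ⟨C, R₀, hC⟩ := hf.bounded A
  refine ⟨|C|, R₀, abs_nonneg _, fun r hr q => ?_⟩
  by_cases h : A < |q.2|
  · rw [hA _ h]
    simp
  · rw [norm_mul]
    exact mul_le_mul_of_nonneg_right ((hC r hr _ (not_lt.1 h) _).trans (le_abs_self C))
      (norm_nonneg _)

lemma HasRadiativeOrder.tendsto_scriAverage {f : Spacetime → ℝ} {g : ℝ → S2 → ℝ}
    (hf : HasRadiativeOrder f g) {ψ : ℝ × E3 → ℝ} (hψ : IsTest ψ) :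
    Tendsto (scriAverage f ψ) atTop
      (𝓝 (∫ q : S2 × ℝ, g q.2 q.1 * ψ (q.2, (q.1 : E3)) ∂(area.prod volume))) := by
  obtain ⟨C, R₀, -, hC⟩ := hf.exists_bound hψ
  refine tendsto_integral_filter_of_dominated_convergence
    (fun q => C * ‖ψ (q.2, (q.1 : E3))‖) (Eventually.of_forall fun r => ?_) ?_
    (hψ.integrable_scri.norm.const_mul C) ?_
  · exact ((measurable_scri hf.measurable hψ).comp
      (measurable_const.prodMk measurable_id)).aestronglyMeasurable
  · filter_upwards [eventually_ge_atTop R₀] with r hr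
    exact Eventually.of_forall (hC r hr)
  · have h0 : ∀ᵐ q ∂(area.prod (volume : Measure ℝ)), q.2 ≠ 0 :=
      Measure.quasiMeasurePreserving_snd.ae (compl_mem_ae_iff.2 (measure_singleton 0))
    filter_upwards [h0] with q hq
    exact (hf.tendsto q.2 hq q.1).mul_const _

lemma integral_spacetime {F : Spacetime → ℝ} (hF : Integrable F) : ∫ p, F p =
    ∫ r in Ioi (0 : ℝ), ∫ n : S2, r ^ 2 * (∫ u : ℝ, F (event (u + r) (r • (n : E3)))) ∂area := by
  have h1 : Integrable (fun q : ℝ × E3 => F (event q.1 q.2)) (volume.prod volume) :=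
    measurePreserving_event.integrable_comp_of_integrable hF
  have h2 : Integrable fun x : E3 => ∫ t : ℝ, F (event t x) := h1.integral_prod_right
  rw [← measurePreserving_event.integral_comp measurableEmbedding_event, integral_prod_symm _ h1,
    integral_polar h2]
  refine setIntegral_congr_fun measurableSet_Ioi fun r hr => ?_
  beta_reduce
  congr 1
  funext n
  rw [integral_add_right_eq_self (fun t => F (event t (r • (n : E3)))) r]

/-- The weight `r ^ (j + 1)` combines `r ^ j`, the volume factor `r²`, and the `1 / r` that
compensates the factor `r` in `scriAverage`. -/
lemma HasRadiativeOrder.integral_packet {f : Spacetime → ℝ} {g : ℝ → S2 → ℝ}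
    (hf : HasRadiativeOrder f g) {ψ : ℝ × E3 → ℝ} (hψ : IsTest ψ) {χ : ℝ → ℝ} (hχ : IsTest χ)
    (j : ℤ) : ∀ᶠ R in atTop, ofFun f (packet j ψ χ R) =
      ∫ s, (s + R) ^ (j + 1) * χ s * scriAverage f ψ (s + R) := by
  obtain ⟨B, hB0, hB⟩ := exists_bound_of_isTest hχ
  obtain ⟨C, R₀, -, hC⟩ := hf.exists_bound hψ
  filter_upwards [eventually_gt_atTop (B + max R₀ 0)] with R hR
  have hBR : B < R := by
    have := le_max_right R₀ 0
    linarith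
  have hi := hf.integrable _ (isTest_packet hψ hχ hB hBR j).isBoundedSupported
  have hz : ∀ r, r - R < -B → χ (r - R) = 0 := fun r hr => hB _ (by
    rw [Real.norm_eq_abs]
    exact lt_of_lt_of_le (by linarith) (neg_le_abs _))
  rw [ofFun, integral_spacetime hi,
    ← integral_sub_right_eq_self (fun s => (s + R) ^ (j + 1) * χ s * scriAverage f ψ (s + R)) R]
  simp only [sub_add_cancel]
  rw [← setIntegral_eq_integral_of_forall_compl_eq_zero (s := Ioi 0)
    (f := fun r => r ^ (j + 1) * χ (r - R) * scriAverage f ψ r) (fun r hr => by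
    have hr : r ≤ 0 := not_lt.1 hr
    rw [hz _ (by linarith), mul_zero, zero_mul])]
  refine setIntegral_congr_fun measurableSet_Ioi fun r hr => ?_
  have hr : 0 < r := hr
  beta_reduce
  by_cases h : r - R < -B
  · rw [hz _ h, mul_zero, zero_mul]
    refine integral_eq_zero_of_ae (Eventually.of_forall fun n => ?_)
    have hn : ‖r • (n : E3)‖ = r := by
      rw [norm_smul, S2.norm_coe, mul_one, Real.norm_of_nonneg hr.le]
    simp [packet, hn, hz _ h]
  · have hrR : R₀ ≤ r := by
      have := le_max_left R₀ 0
      linarith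
    have hi2 : Integrable (fun q : S2 × ℝ => r * f (event (q.2 + r) (r • (q.1 : E3))) *
        ψ (q.2, (q.1 : E3))) (area.prod volume) :=
      (hψ.integrable_scri.norm.const_mul C).mono' ((measurable_scri hf.measurable hψ).comp
        (measurable_const.prodMk measurable_id)).aestronglyMeasurable (Eventually.of_forall (hC r hrR))
    rw [scriAverage, integral_prod _ hi2, ← integral_const_mul]
    refine integral_congr_ae (Eventually.of_forall fun n => ?_)
    have hn : ‖r • (n : E3)‖ = r := by
      rw [norm_smul, S2.norm_coe, mul_one, Real.norm_of_nonneg hr.le]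
    beta_reduce
    rw [← integral_const_mul, ← integral_const_mul]
    refine integral_congr_ae (Eventually.of_forall fun u => ?_)
    simp only [packet, event_zero, space_event, hn, add_sub_cancel_right, smul_smul,
      inv_mul_cancel₀ hr.ne', one_smul, zpow_add₀ hr.ne', zpow_one]
    ring

/-- Dominated convergence; the weight is identically `1` for `j = -1` and tends to zero for smaller
`j`. -/
theorem HasRadiativeOrder.tendsto_packet {f : Spacetime → ℝ} {g : ℝ → S2 → ℝ}
    (hf : HasRadiativeOrder f g) {ψ : ℝ × E3 → ℝ} (hψ : IsTest ψ) {χ : ℝ → ℝ} (hχ : IsTest χ)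
    {j : ℤ} (hj : j ≤ -1) : Tendsto (fun R => ofFun f (packet j ψ χ R)) atTop
      (𝓝 (if j = -1 then (∫ s, χ s) *
        ∫ q : S2 × ℝ, g q.2 q.1 * ψ (q.2, (q.1 : E3)) ∂(area.prod volume) else 0)) := by
  obtain ⟨B, hB0, hB⟩ := exists_bound_of_isTest hχ
  obtain ⟨C, R₀, hC0, hC⟩ := hf.exists_bound hψ
  set L := ∫ q : S2 × ℝ, g q.2 q.1 * ψ (q.2, (q.1 : E3)) ∂(area.prod volume) with hL
  set N := ∫ q : S2 × ℝ, ‖ψ (q.2, (q.1 : E3))‖ ∂(area.prod volume) with hN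
  have hN0 : 0 ≤ N := integral_nonneg fun _ => norm_nonneg _
  have hm : Measurable (scriAverage f ψ) :=
    (measurable_scri hf.measurable hψ).stronglyMeasurable.integral_prod_right'.measurable
  have hb : ∀ r, R₀ ≤ r → ‖scriAverage f ψ r‖ ≤ C * N := fun r hr => by
    rw [hN, ← integral_const_mul]
    exact norm_integral_le_of_norm_le (hψ.integrable_scri.norm.const_mul C)
      (Eventually.of_forall (hC r hr))
  have key : Tendsto (fun R => ∫ s, (s + R) ^ (j + 1) * χ s * scriAverage f ψ (s + R)) atTop
      (𝓝 (∫ s, (if j = -1 then 1 else 0) * χ s * L)) := by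
    refine tendsto_integral_filter_of_dominated_convergence (fun s => C * N * ‖χ s‖)
      (Eventually.of_forall fun R => ?_) ?_
      ((hχ.1.continuous.integrable_of_hasCompactSupport hχ.2).norm.const_mul _)
      (Eventually.of_forall fun s => ?_)
    · refine Measurable.aestronglyMeasurable ?_
      refine (Measurable.mul ?_ hχ.1.continuous.measurable).mul
        (hm.comp (measurable_id.add_const R))
      exact (measurable_id.add_const R).pow_const _
    · filter_upwards [eventually_gt_atTop (B + max R₀ 1)] with R hR
      refine Eventually.of_forall fun s => ?_
      by_cases h : B < ‖s‖
      · simp [hB s h]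
      · have h1 := (abs_le.1 (not_lt.1 h)).1
        have h2 := le_max_left R₀ 1
        have h3 := le_max_right R₀ 1
        have h4 : (s + R) ^ (j + 1) ≤ 1 := zpow_le_one_of_nonpos₀ (by linarith) (by omega)
        rw [norm_mul, norm_mul, mul_comm (C * N)]
        refine mul_le_mul ?_ (hb _ (by linarith)) (norm_nonneg _) (norm_nonneg _)
        rw [Real.norm_of_nonneg (zpow_nonneg (by linarith) _)]
        exact mul_le_of_le_one_left (norm_nonneg _) h4
    · have h1 : Tendsto (fun R => s + R) atTop atTop := tendsto_atTop_add_const_left _ s tendsto_id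
      refine Tendsto.mul (Tendsto.mul_const _ ?_) ((hf.tendsto_scriAverage hψ).comp h1)
      split_ifs with h
      · simp [h]
      · exact (tendsto_zpow_atTop_zero (by omega)).comp h1
  refine (key.congr' ?_).trans (le_of_eq ?_)
  · filter_upwards [hf.integral_packet hψ hχ j] with R hR using hR.symm
  · congr 1
    split_ifs <;> simp [integral_mul_const]

/-! ### Distributions that fall off as `1/r` -/

/-- The distribution `F` and its coefficient `L` of `1/r` at null infinity; packets of lower order
do not contribute. -/
structure HasScriLimit (F : Dist) (L : (ℝ × E3 → ℝ) → ℝ) : Prop where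
  add : ∀ φ ψ, IsTest φ → IsTest ψ → F (fun p => φ p + ψ p) = F φ + F ψ
  tendsto : ∀ ψ χ, IsTest ψ → IsTest χ → ∀ j : ℤ, j ≤ -1 →
    Tendsto (fun R => F (packet j ψ χ R)) atTop (𝓝 (if j = -1 then (∫ s, χ s) * L ψ else 0))

lemma HasScriLimit.congr {F : Dist} {L L' : (ℝ × E3 → ℝ) → ℝ} (h : HasScriLimit F L)
    (hL : ∀ ψ, IsTest ψ → L ψ = L' ψ) : HasScriLimit F L' :=
  ⟨h.add, fun ψ χ hψ hχ j hj => by rw [← hL ψ hψ]; exact h.tendsto ψ χ hψ hχ j hj⟩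

lemma HasScriLimit.add_dist {F G : Dist} {L M : (ℝ × E3 → ℝ) → ℝ} (hF : HasScriLimit F L)
    (hG : HasScriLimit G M) : HasScriLimit (F + G) (fun ψ => L ψ + M ψ) := by
  refine ⟨fun φ ψ hφ hψ => ?_, fun ψ χ hψ hχ j hj => ?_⟩
  · simp only [Pi.add_apply, hF.add φ ψ hφ hψ, hG.add φ ψ hφ hψ]
    ring
  · refine ((hF.tendsto ψ χ hψ hχ j hj).add (hG.tendsto ψ χ hψ hχ j hj)).trans (le_of_eq ?_)
    split_ifs <;> simp [mul_add]

lemma HasScriLimit.smul {F : Dist} {L : (ℝ × E3 → ℝ) → ℝ} (hF : HasScriLimit F L) (c : ℝ) :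
    HasScriLimit (c • F) (fun ψ => c * L ψ) := by
  refine ⟨fun φ ψ hφ hψ => ?_, fun ψ χ hψ hχ j hj => ?_⟩
  · simp only [Pi.smul_apply, smul_eq_mul, hF.add φ ψ hφ hψ]
    ring
  · refine ((hF.tendsto ψ χ hψ hχ j hj).const_mul c).trans (le_of_eq ?_)
    split_ifs <;> simp [mul_left_comm]

lemma pd_add {φ ψ : Spacetime → ℝ} (hφ : IsTest φ) (hψ : IsTest ψ) (a : Fin 4) :
    pd a (fun p => φ p + ψ p) = fun p => pd a φ p + pd a ψ p := by
  funext p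
  rw [pd, fderiv_fun_add (hφ.1.differentiable (by simp)).differentiableAt
    (hψ.1.differentiable (by simp)).differentiableAt]
  rfl

/-- At order `1/r` a derivative acts as `∂_a u ∂_u`. Cutoffs of arbitrary integral and packets of
lower order belong to `HasScriLimit` because both arise from `pd_packet`, so that derivatives can be
iterated. -/
lemma HasScriLimit.dD {F : Dist} {L : (ℝ × E3 → ℝ) → ℝ} (hF : HasScriLimit F L) (a : Fin 4) :
    HasScriLimit (dD a F) (fun ψ => - L (fun q => gradU q.2 a * dU ψ q)) := by
  refine ⟨fun φ ψ hφ hψ => ?_, fun ψ χ hψ hχ j hj => ?_⟩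
  · rw [dD_apply, pd_add hφ hψ, hF.add _ _ (hφ.pd a) (hψ.pd a), dD_apply, dD_apply]
    ring
  · obtain ⟨B, hB0, hB⟩ := exists_bound_of_isTest hχ
    obtain ⟨B', hB0', hB'⟩ := exists_bound_of_isTest hχ.deriv
    have h1 := hψ.dU.mul_left (contDiff_gradU a)
    have h2 := hψ.mul_left (contDiff_gradR a)
    have h3 := hψ.dAngle j a
    have hlim := ((hF.tendsto _ χ h1 hχ j hj).add (hF.tendsto _ _ h2 hχ.deriv j hj)).add
      (hF.tendsto _ χ h3 hχ (j - 1) (by omega))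
    refine (hlim.neg.congr' ?_).trans (le_of_eq ?_)
    · filter_upwards [eventually_gt_atTop B, eventually_gt_atTop B'] with R hR hR'
      have hp : pd a (packet j ψ χ R) = fun p => packet j (fun q => gradU q.2 a * ShellMemory.dU ψ q) χ R p
          + packet j (fun q => gradR q.2 a * ψ q) (deriv χ) R p
          + packet (j - 1) (ShellMemory.dAngle j a ψ) χ R p :=
        funext (pd_packet hψ.1 hχ.1 hB hR j a)
      rw [dD_apply, hp, hF.add _ _ ((isTest_packet h1 hχ hB hR j).add
        (isTest_packet h2 hχ.deriv hB' hR' j)) (isTest_packet h3 hχ hB hR _),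
        hF.add _ _ (isTest_packet h1 hχ hB hR j) (isTest_packet h2 hχ.deriv hB' hR' j)]
    -- The term with the differentiated cutoff drops out since `χ'` has integral zero.
    · have h4 : ∫ s, deriv χ s = 0 :=
        integral_eq_zero_of_hasDerivAt_of_integrable
          (fun s => ((hχ.1.differentiable (by simp)).differentiableAt.hasDerivAt))
          (hχ.deriv.1.continuous.integrable_of_hasCompactSupport hχ.deriv.2)
          (hχ.1.continuous.integrable_of_hasCompactSupport hχ.2)
      rw [h4, if_neg (show ¬ j - 1 = -1 by omega)]
      split_ifs <;> simp

/-! ### Coefficients that are step functions of retarded time -/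

/-- The integral of `ψ` against a function with the values `G false` for `u ≤ 0` and `G true` for
`u > 0`. -/
def stepAverage (G : Bool → S2 → ℝ) (ψ : ℝ × E3 → ℝ) : ℝ :=
  ∫ q : S2 × ℝ, G (decide (0 < q.2)) q.1 * ψ (q.2, (q.1 : E3)) ∂(area.prod volume)

lemma measurable_step {G : Bool → S2 → ℝ} (hG : ∀ s, Continuous (G s)) :
    Measurable fun q : S2 × ℝ => G (decide (0 < q.2)) q.1 := by
  have h : (fun q : S2 × ℝ => G (decide (0 < q.2)) q.1) =
      fun q => if 0 < q.2 then G true q.1 else G false q.1 := by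
    funext q
    split_ifs with h <;> simp [h]
  rw [h]
  exact Measurable.ite (measurableSet_lt measurable_const measurable_snd)
    ((hG _).measurable.comp measurable_fst) ((hG _).measurable.comp measurable_fst)

lemma exists_bound_step {G : Bool → S2 → ℝ} (hG : ∀ s, Continuous (G s)) :
    ∃ C, ∀ s n, ‖G s n‖ ≤ C := by
  obtain ⟨C, hC⟩ := (isCompact_univ (X := S2)).exists_bound_of_continuousOn (hG true).continuousOn
  obtain ⟨D, hD⟩ := (isCompact_univ (X := S2)).exists_bound_of_continuousOn (hG false).continuousOn
  refine ⟨max C D, fun s n => ?_⟩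
  cases s
  · exact (hD n trivial).trans (le_max_right _ _)
  · exact (hC n trivial).trans (le_max_left _ _)

lemma integrable_step {G : Bool → S2 → ℝ} (hG : ∀ s, Continuous (G s)) {ψ : ℝ × E3 → ℝ}
    (hψ : IsTest ψ) : Integrable (fun q : S2 × ℝ =>
      G (decide (0 < q.2)) q.1 * ψ (q.2, (q.1 : E3))) (area.prod volume) := by
  obtain ⟨C, hC⟩ := exists_bound_step hG
  refine (hψ.integrable_scri.norm.const_mul C).mono' ?_ (Eventually.of_forall fun q => ?_)
  · exact ((measurable_step hG).mul (hψ.1.continuous.measurable.comp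
      (Continuous.measurable (by fun_prop)))).aestronglyMeasurable
  · rw [norm_mul]
    exact mul_le_mul_of_nonneg_right (hC _ _) (norm_nonneg _)

lemma stepAverage_add {G H : Bool → S2 → ℝ} (hG : ∀ s, Continuous (G s))
    (hH : ∀ s, Continuous (H s)) {ψ : ℝ × E3 → ℝ} (hψ : IsTest ψ) :
    stepAverage G ψ + stepAverage H ψ = stepAverage (fun s n => G s n + H s n) ψ := by
  simp only [stepAverage]
  rw [← integral_add (integrable_step hG hψ) (integrable_step hH hψ)]
  exact integral_congr_ae (Eventually.of_forall fun q => by ring)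

lemma stepAverage_smul (c : ℝ) (G : Bool → S2 → ℝ) (ψ : ℝ × E3 → ℝ) :
    c * stepAverage G ψ = stepAverage (fun s n => c * G s n) ψ := by
  simp only [stepAverage, ← integral_const_mul, mul_assoc]

lemma isTest_iterate_dU {ψ : ℝ × E3 → ℝ} (hψ : IsTest ψ) (k : ℕ) : IsTest (dU^[k] ψ) := by
  induction k with
  | zero => exact hψ
  | succ k ih =>
    rw [Function.iterate_succ_apply']
    exact ih.dU

lemma hasDerivAt_dU {ψ : ℝ × E3 → ℝ} (hψ : IsTest ψ) (u : ℝ) (y : E3) :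
    HasDerivAt (fun s => ψ (s, y)) (dU ψ (u, y)) u :=
  (hψ.1.differentiable (by simp)).differentiableAt.hasFDerivAt.comp_hasDerivAt u
    ((hasDerivAt_id u).prodMk (hasDerivAt_const u y))

lemma dU_mul {c : E3 → ℝ} (hc : ContDiff ℝ ∞ fun q : ℝ × E3 => c q.2) {ψ : ℝ × E3 → ℝ}
    (hψ : IsTest ψ) : dU (fun q => c q.2 * ψ q) = fun q => c q.2 * dU ψ q :=
  funext fun q => (hasDerivAt_dU (hψ.mul_left hc) q.1 q.2).unique
    ((hasDerivAt_dU hψ q.1 q.2).const_mul (c q.2))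

lemma iterate_dU_mul {c : E3 → ℝ} (hc : ContDiff ℝ ∞ fun q : ℝ × E3 => c q.2) {ψ : ℝ × E3 → ℝ}
    (hψ : IsTest ψ) (k : ℕ) : dU^[k] (fun q => c q.2 * ψ q) = fun q => c q.2 * dU^[k] ψ q := by
  induction k with
  | zero => rfl
  | succ k ih =>
    rw [Function.iterate_succ_apply', ih, dU_mul hc (isTest_iterate_dU hψ k),
      Function.iterate_succ_apply']

/-- The coefficient of `1/r` is the `k`-th derivative, up to sign, of the step function `G`. -/
def HasStep (k : ℕ) (F : Dist) (G : Bool → S2 → ℝ) : Prop :=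
  (∀ s, Continuous (G s)) ∧ HasScriLimit F fun ψ => stepAverage G (dU^[k] ψ)

lemma HasStep.add {k : ℕ} {F F' : Dist} {G G' : Bool → S2 → ℝ} (h : HasStep k F G)
    (h' : HasStep k F' G') : HasStep k (F + F') (fun s n => G s n + G' s n) :=
  ⟨fun s => (h.1 s).add (h'.1 s), (h.2.add_dist h'.2).congr fun _ hψ =>
    stepAverage_add h.1 h'.1 (isTest_iterate_dU hψ k)⟩

lemma HasStep.smul {k : ℕ} {F : Dist} {G : Bool → S2 → ℝ} (h : HasStep k F G) (c : ℝ) :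
    HasStep k (c • F) (fun s n => c * G s n) :=
  ⟨fun s => continuous_const.mul (h.1 s), (h.2.smul c).congr fun _ _ => stepAverage_smul _ _ _⟩

lemma HasStep.sub {k : ℕ} {F F' : Dist} {G G' : Bool → S2 → ℝ} (h : HasStep k F G)
    (h' : HasStep k F' G') : HasStep k (F - F') (fun s n => G s n - G' s n) := by
  have := h.add (h'.smul (-1))
  simpa [sub_eq_add_neg] using this

lemma HasStep.sum {k : ℕ} {ι : Type*} (s : Finset ι) {F : ι → Dist} {G : ι → Bool → S2 → ℝ}
    (h : ∀ i, HasStep k (F i) (G i)) : HasStep k (∑ i ∈ s, F i) (fun t n => ∑ i ∈ s, G i t n) := by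
  classical
  induction s using Finset.induction_on with
  | empty =>
    simp only [Finset.sum_empty]
    refine ⟨fun _ => continuous_const, fun _ _ _ _ => by simp, fun ψ χ _ _ j _ => ?_⟩
    simp [stepAverage]
  | insert i s hi ih =>
    simp only [Finset.sum_insert hi]
    exact (h i).add ih

lemma HasStep.dD {k : ℕ} {F : Dist} {G : Bool → S2 → ℝ} (h : HasStep k F G) (a : Fin 4) :
    HasStep (k + 1) (dD a F) (fun s n => - (gradU (n : E3) a * G s n)) := by
  have hc : Continuous fun n : S2 => gradU (n : E3) a :=
    (contDiff_gradU a).continuous.comp (f := fun n : S2 => ((0 : ℝ), (n : E3))) (by fun_prop)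
  refine ⟨fun s => (hc.mul (h.1 s)).neg, (h.2.dD a).congr fun ψ hψ => ?_⟩
  have h1 := iterate_dU_mul (c := fun y => gradU y a) (contDiff_gradU a) hψ.dU k
  rw [h1, stepAverage, stepAverage, ← integral_neg]
  refine integral_congr_ae (Eventually.of_forall fun q => ?_)
  simp only [Function.iterate_succ_apply]
  ring

lemma HasRadiativeOrder.hasStep {f : Spacetime → ℝ} {G : Bool → S2 → ℝ}
    (hf : HasRadiativeOrder f (fun u n => G (decide (0 < u)) n)) (hG : ∀ s, Continuous (G s)) :
    HasStep 0 (ofFun f) G := by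
  refine ⟨hG, fun φ ψ hφ hψ => ?_, fun ψ χ hψ hχ j hj => hf.tendsto_packet hψ hχ hj⟩
  simp only [ofFun, mul_add]
  exact integral_add (hf.integrable _ hφ.isBoundedSupported) (hf.integrable _ hψ.isBoundedSupported)

lemma HasStep.traceRev {k : ℕ} {T : Tensor2} {G : Fin 4 → Fin 4 → Bool → S2 → ℝ}
    (h : ∀ a b, HasStep k (T a b) (G a b)) (a b : Fin 4) :
    HasStep k (traceRev T a b) (fun s n => ShellMemory.traceRev (fun a b => G a b s n) a b) :=
  (h a b).sub ((HasStep.sum _ fun c => (h c c).smul (eta c c)).smul (eta a b / 2))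

/-! ### The curvature -/

/-- The symbol of the Riemann tensor. -/
def riemannSymbol (k : Fin 4 → ℝ) (h : Fin 4 → Fin 4 → ℝ) (a b c d : Fin 4) : ℝ :=
  1 / 2 * (k b * k c * h a d + k a * k d * h b c - k a * k c * h b d - k b * k d * h a c)

/-- The symbol of the Ricci tensor. -/
def ricciSymbol (k : Fin 4 → ℝ) (h : Fin 4 → Fin 4 → ℝ) (a c : Fin 4) : ℝ :=
  ∑ b, eta b b * riemannSymbol k h a b c b

/-- The symbol of the scalar curvature. -/
def scalarSymbol (k : Fin 4 → ℝ) (h : Fin 4 → Fin 4 → ℝ) : ℝ := ∑ a, eta a a * ricciSymbol k h a a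

/-- The symbol of the Weyl tensor. -/
def weylSymbol (k : Fin 4 → ℝ) (h : Fin 4 → Fin 4 → ℝ) (a b c d : Fin 4) : ℝ :=
  riemannSymbol k h a b c d
    - 1 / 2 * (eta a c * ricciSymbol k h d b - eta a d * ricciSymbol k h c b
        - eta b c * ricciSymbol k h d a + eta b d * ricciSymbol k h c a)
    + (eta a c * eta d b - eta a d * eta c b) / 6 * scalarSymbol k h

lemma HasStep.congr {k : ℕ} {F : Dist} {G G' : Bool → S2 → ℝ} (h : HasStep k F G)
    (hG : ∀ s n, G s n = G' s n) : HasStep k F G' := by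
  obtain rfl : G = G' := funext fun s => funext (hG s)
  exact h

/-- Each derivative contributes minus the covector `∂_a u`; with two derivatives the signs cancel.
-/
lemma HasStep.riemann {T : Tensor2} {G : Fin 4 → Fin 4 → Bool → S2 → ℝ}
    (h : ∀ a b, HasStep 0 (T a b) (G a b)) (a b c d : Fin 4) : HasStep 2 (riemann T a b c d)
      (fun s n => riemannSymbol (gradU (n : E3)) (fun a b => G a b s n) a b c d) := by
  have h2 := fun e f g i => ((h g i).dD f).dD e
  refine HasStep.congr (((((h2 b c a d).add (h2 a d b c)).sub (h2 a c b d)).sub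
    (h2 b d a c)).smul (1 / 2)) fun s n => ?_
  simp only [riemannSymbol]
  ring

lemma HasStep.ricci {T : Tensor2} {G : Fin 4 → Fin 4 → Bool → S2 → ℝ}
    (h : ∀ a b, HasStep 0 (T a b) (G a b)) (a c : Fin 4) : HasStep 2 (ricci T a c)
      (fun s n => ricciSymbol (gradU (n : E3)) (fun a b => G a b s n) a c) :=
  HasStep.sum _ fun b => (HasStep.riemann h a b c b).smul (eta b b)

lemma HasStep.scalarCurv {T : Tensor2} {G : Fin 4 → Fin 4 → Bool → S2 → ℝ}
    (h : ∀ a b, HasStep 0 (T a b) (G a b)) : HasStep 2 (scalarCurv T)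
      (fun s n => scalarSymbol (gradU (n : E3)) (fun a b => G a b s n)) :=
  HasStep.sum _ fun a => (HasStep.ricci h a a).smul (eta a a)

lemma HasStep.weyl {T : Tensor2} {G : Fin 4 → Fin 4 → Bool → S2 → ℝ}
    (h : ∀ a b, HasStep 0 (T a b) (G a b)) (a b c d : Fin 4) : HasStep 2 (weyl T a b c d)
      (fun s n => weylSymbol (gradU (n : E3)) (fun a b => G a b s n) a b c d) :=
  ((HasStep.riemann h a b c d).sub ((((((HasStep.ricci h d b).smul _).sub
    ((HasStep.ricci h c b).smul _)).sub ((HasStep.ricci h d a).smul _)).add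
    ((HasStep.ricci h c a).smul _)).smul (1 / 2))).add ((HasStep.scalarCurv h).smul _)

/-! ### The Weyl tensor of a field in Lorenz gauge -/

@[simp] lemma gradU_zero (y : E3) : gradU y 0 = 1 := rfl

@[simp] lemma gradU_succ (y : E3) (i : Fin 3) : gradU y i.succ = - y i := rfl

lemma sum_eta_mul (H : Fin 4 → ℝ) : ∑ c, eta c c * H c = ∑ k : Fin 3, H k.succ - H 0 :=
  sum_eta_smul H

lemma traceRev_symm {J : Fin 4 → Fin 4 → ℝ} (hJ : ∀ a b, J a b = J b a) (a b : Fin 4) :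
    traceRev J a b = traceRev J b a := by
  have : eta a b = eta b a := by
    unfold eta
    by_cases h : a = b
    · rw [h]
    · rw [if_neg h, if_neg (Ne.symm h)]
  rw [traceRev, traceRev, hJ a b, this]

lemma trace_traceRev (J : Fin 4 → Fin 4 → ℝ) :
    ∑ c, eta c c * traceRev J c c = - ∑ c, eta c c * J c c := by
  simp only [traceRev, sum_eta_mul, eta_zero_zero, eta_succ_succ, if_true,
    smul_eq_mul, Fin.sum_univ_three]
  ring

/-- The hypothesis is the Lorenz gauge at leading order, `k^b J_{ab} = 0` with `k_a = ∂_a u`. Trace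
reversal leaves a multiple of `k_a`. -/
lemma traceRev_null {n : S2} {J : Fin 4 → Fin 4 → ℝ}
    (hn : ∀ a, J a 0 + ∑ i : Fin 3, (n : E3) i * J a i.succ = 0) (a : Fin 4) :
    traceRev J a 0 + ∑ i : Fin 3, (n : E3) i * traceRev J a i.succ =
      (∑ c, eta c c * J c c) / 2 * gradU (n : E3) a := by
  have h1 : eta a 0 + ∑ i : Fin 3, (n : E3) i * eta a i.succ = - gradU (n : E3) a := by
    refine Fin.cases ?_ (fun i => ?_) a
    · simp [eta_zero_zero, eta_zero_succ]
    · simp [eta_succ_zero, eta_succ_succ]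
  have h2 := hn a
  simp only [traceRev, smul_eq_mul, Fin.sum_univ_three] at *
  linear_combination h2 - (∑ c, eta c c * J c c) / 2 * h1

/-- In Lorenz gauge the linearised Ricci tensor is a multiple of the wave operator, whose symbol
vanishes on the null covector `∂_a u`. -/
lemma ricciSymbol_traceRev {n : S2} {J : Fin 4 → Fin 4 → ℝ} (hJ : ∀ a b, J a b = J b a)
    (hn : ∀ a, J a 0 + ∑ i : Fin 3, (n : E3) i * J a i.succ = 0) (a c : Fin 4) :
    ricciSymbol (gradU (n : E3)) (traceRev J) a c = 0 := by
  have h1 := traceRev_null hn a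
  have h2 := traceRev_null hn c
  have h3 := trace_traceRev J
  have hs := traceRev_symm hJ
  have h5 := n.sum_sq
  simp only [hs c] at h2
  generalize ∑ c, eta c c * J c c = j at *
  simp only [ricciSymbol, riemannSymbol, sum_eta_mul, gradU_zero, gradU_succ,
    Fin.sum_univ_three] at *
  linear_combination -1 / 2 * gradU (n : E3) c * h1 - 1 / 2 * gradU (n : E3) a * h2
    - 1 / 2 * gradU (n : E3) a * gradU (n : E3) c * h3 + 1 / 2 * traceRev J a c * h5

lemma sum_proj_proj (n : S2) (H : Fin 3 → Fin 3 → ℝ) (i j : Fin 3) :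
    ∑ k, ∑ l, proj n i k * proj n j l * H k l = H i j - (n : E3) j * ∑ l, (n : E3) l * H i l
      - (n : E3) i * ∑ k, (n : E3) k * H k j
      + (n : E3) i * (n : E3) j * ∑ k, (n : E3) k * ∑ l, (n : E3) l * H k l := by
  simp only [proj]
  fin_cases i <;> fin_cases j <;> simp [Fin.sum_univ_three] <;> ring

/-- Without Ricci part the Weyl symbol is the Riemann symbol. The gauge condition expresses the
radial components of the perturbation by its time components and its trace, and what remains is the
angular projection. -/
lemma weylSymbol_traceRev {n : S2} {J : Fin 4 → Fin 4 → ℝ} (hJ : ∀ a b, J a b = J b a)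
    (hn : ∀ a, J a 0 + ∑ i : Fin 3, (n : E3) i * J a i.succ = 0) (μ ν : Fin 4) :
    weylSymbol (gradU (n : E3)) (traceRev J) 0 ν 0 μ = -(1 / 2 * angular (traceRev J) n μ ν) := by
  have hs := traceRev_symm hJ
  have h0 : weylSymbol (gradU (n : E3)) (traceRev J) 0 ν 0 μ =
      riemannSymbol (gradU (n : E3)) (traceRev J) 0 ν 0 μ := by
    simp [weylSymbol, scalarSymbol, ricciSymbol_traceRev hJ hn]
  rw [h0, riemannSymbol]
  refine Fin.cases ?_ (fun i => ?_) μ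
  · rw [angular_zero_left, gradU_zero]
    ring
  refine Fin.cases ?_ (fun j => ?_) ν
  · rw [angular_zero_right, gradU_zero]
    ring
  have h1 := traceRev_null hn
  rw [angular_succ_succ, sum_proj_proj n (fun k l => traceRev J k.succ l.succ)]
  have h2 : ∀ k : Fin 3, ∑ l : Fin 3, (n : E3) l * traceRev J k.succ l.succ =
      -(traceRev J 0 k.succ + (∑ c, eta c c * J c c) / 2 * (n : E3) k) := fun k => by
    have := h1 k.succ
    rw [gradU_succ, hs k.succ 0] at this
    linarith
  have h3 : ∑ k : Fin 3, (n : E3) k * traceRev J 0 k.succ =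
      (∑ c, eta c c * J c c) / 2 - traceRev J 0 0 := by
    have := h1 0
    rw [gradU_zero] at this
    linarith
  have h4 : ∑ k : Fin 3, (n : E3) k * traceRev J k.succ j.succ =
      -(traceRev J 0 j.succ + (∑ c, eta c c * J c c) / 2 * (n : E3) j) :=
    (Finset.sum_congr rfl fun k _ => by rw [hs k.succ j.succ]).trans (h2 j)
  have h6 : ∑ k : Fin 3, (n : E3) k *
      -(traceRev J 0 k.succ + (∑ c, eta c c * J c c) / 2 * (n : E3) k) =
      traceRev J 0 0 - ∑ c, eta c c * J c c := by
    have h5 := n.sum_sq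
    generalize ∑ c, eta c c * J c c = t at *
    simp only [Fin.sum_univ_three] at *
    linear_combination -h3 + t / 2 * h5
  simp only [h2, h4, h6, gradU_zero, gradU_succ, hs j.succ 0, hs j.succ i.succ]
  ring

/-! ### The memory of the field -/

/-- The radiative order of the field, for `u < 0` and for `u > 0`. -/
def fieldStep (v ρ m : ℝ) (α : S2 → ℝ) (a b : Fin 4) (s : Bool) (n : S2) : ℝ :=
  if s then 4 * m * rest a b + ρ * radiative v (dust v) n a b + radiative v (lStress v α) n a b
  else 4 * (m + shellEnergy v ρ) * rest a b

lemma continuous_radiative {v : ℝ} (hv0 : 0 < v) (hv1 : v < 1) {τ : S2 → Fin 4 → Fin 4 → ℝ}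
    {a b : Fin 4} (hτ : Continuous fun n => τ n a b) :
    Continuous fun n => radiative v τ n a b := by
  have h1 := continuousOn_shellScri hv0.le hv1 hτ
  have h2 : Continuous fun n => shellScri v (fun n => τ n a b) 0 n :=
    h1.comp_continuous (f := fun n : S2 => ((0 : ℝ), n)) (by fun_prop) fun n => ⟨by
      rw [mem_ofPred_eq, abs_zero]
      positivity, trivial⟩
  simp only [← shellScri_zero hv0 hv1]
  exact continuous_const.mul h2

lemma continuous_fieldStep {v : ℝ} (hv0 : 0 < v) (hv1 : v < 1) (ρ m : ℝ) {α : S2 → ℝ}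
    (hα : SmoothS2 α) (a b : Fin 4) (s : Bool) : Continuous (fieldStep v ρ m α a b s) := by
  cases s
  · exact continuous_const
  · have h1 := continuous_radiative hv0 hv1 ((isFreeShell_dust v).continuous a b)
    have h2 := continuous_radiative hv0 hv1 ((isFreeShell_lStress v hα).continuous a b)
    exact (continuous_const.add (continuous_const.mul h1)).add h2

lemma measurable_field (v ρ m : ℝ) {α : S2 → ℝ} (hα : SmoothS2 α) (a b : Fin 4) :
    Measurable (field v ρ m α a b) :=
  measurable_const.mul ((measurable_const.mul ((measurable_const.mul
    (measurable_restKernel measurableSet_Iio)).add (measurable_const.mul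
    (measurable_restKernel measurableSet_Ioi)))).add
    (measurable_shellField v ((isFreeShell_shellStress v ρ hα).continuous a b)))

theorem hasRadiativeOrder_field {v : ℝ} (hv0 : 0 < v) (hv1 : v < 1) (ρ m : ℝ) {α : S2 → ℝ}
    (hα : SmoothS2 α) (a b : Fin 4) : HasRadiativeOrder (field v ρ m α a b)
      (fun u n => fieldStep v ρ m α a b (decide (0 < u)) n) := by
  refine ⟨measurable_field v ρ m hα a b, fun φ hφ => integrable_field hv0.le hv1 ρ m hα a b hφ,
    fun U => ?_, fun u hu n => ?_⟩
  · have hτ := (isFreeShell_shellStress v ρ hα).continuous a b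
    have hv : 0 < (1 - v) ^ 2 / 8 := by
      have : 0 < 1 - v := by linarith
      positivity
    have hK : IsCompact ({ε : ℝ | |ε| ≤ (1 - v) ^ 2 / 8} ×ˢ (univ : Set S2)) := by
      have h1 : {ε : ℝ | |ε| ≤ (1 - v) ^ 2 / 8} = Icc (-((1 - v) ^ 2 / 8)) ((1 - v) ^ 2 / 8) := by
        ext ε
        simp only [mem_ofPred_eq, mem_Icc, abs_le]
      rw [h1]
      exact isCompact_Icc.prod isCompact_univ
    obtain ⟨C, hC⟩ := hK.exists_bound_of_continuousOn (continuousOn_shellScri hv0.le hv1 hτ)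
    set E := |m + shellEnergy v ρ| + |m|
    -- Beyond this radius `|u / r|` is below the threshold of `le_delaySq`, so `shellScri` is
    -- bounded by compactness.
    refine ⟨|4 * rest a b| * E + 16 * Real.pi * C, max 1 (|U| / ((1 - v) ^ 2 / 8)),
      fun r hr u hu n => ?_⟩
    have hr0 : 0 < r := lt_of_lt_of_le one_pos ((le_max_left _ _).trans hr)
    have hε : |u / r| ≤ (1 - v) ^ 2 / 8 := by
      have h1 := (le_max_right _ _).trans hr
      rw [div_le_iff₀ hv] at h1
      rw [abs_div, abs_of_pos hr0, div_le_iff₀ hr0]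
      linarith [le_abs_self U]
    have h1 := hC (u / r, n) ⟨hε, trivial⟩
    have hC0 : 0 ≤ C := (norm_nonneg _).trans h1
    have hpi := Real.pi_pos
    rw [field_scri hr0]
    refine (abs_add_le _ _).trans (add_le_add ?_ ?_)
    · rw [abs_mul]
      refine mul_le_mul_of_nonneg_left ((abs_add_le _ _).trans (add_le_add ?_ ?_)) (abs_nonneg _)
      · split_ifs <;> simp
      · split_ifs <;> simp
    · split_ifs
      · rw [abs_mul, abs_of_pos (by positivity : 0 < 16 * Real.pi)]
        exact mul_le_mul_of_nonneg_left h1 (by positivity)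
      · rw [abs_zero]
        positivity
  · rcases hu.lt_or_gt with hu | hu
    · simpa [fieldStep, hu.not_gt] using tendsto_field_early (m := m) hu n a b
    · simpa [fieldStep, hu] using tendsto_field_late hv0 hv1 ρ m hα hu n a b

lemma rest_symm (a b : Fin 4) : rest a b = rest b a := by simp only [rest, and_comm]

/-- The null contraction of the field is the total energy, the same before and after the launch. The
null condition therefore holds for the jump, though not for the two values separately. -/
lemma fieldStep_null {v : ℝ} (hv0 : 0 < v) (hv1 : v < 1) (ρ m : ℝ) {α : S2 → ℝ}
    (hα : SmoothS2 α) (n : S2) (a : Fin 4) (s : Bool) : fieldStep v ρ m α a 0 s n +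
      ∑ i : Fin 3, (n : E3) i * fieldStep v ρ m α a i.succ s n =
        4 * (m + shellEnergy v ρ) * (if a = 0 then 1 else 0) := by
  have h0 : rest a 0 = if a = 0 then 1 else 0 := by simp [rest]
  have h1 : ∀ i : Fin 3, rest a i.succ = 0 := fun i => by simp [rest, Fin.succ_ne_zero]
  have h2 := radiative_dust_null hv0 hv1 n a
  have h3 : radiative v (lStress v α) n a 0 +
      ∑ i : Fin 3, (n : E3) i * radiative v (lStress v α) n a i.succ = 0 := by
    refine Fin.cases ?_ (fun j => ?_) a
    · rw [radiative_lStress_zero_zero, zero_add]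
      simp only [radiative_lStress_zero_succ hv0 hv1 hα]
      simp only [mul_left_comm _ (2 * gam v), ← Finset.mul_sum, rot_tangent, mul_zero]
    · have := sum_mul_radiative_lStress hv0 hv1 hα n j
      simp only [radiative_symm v (lStress_symm v α) n j.succ]
      rw [this, add_neg_cancel]
  have hE : shellEnergy v ρ = ρ * shellEnergy v 1 := by simp [shellEnergy]; ring
  cases s
  · simp [fieldStep, h0, h1]
  · simp only [fieldStep, if_true, h0, h1, hE, Fin.sum_univ_three] at *
    linear_combination ρ * h2 + h3

lemma fieldStep_symm (v ρ m : ℝ) (α : S2 → ℝ) (a b : Fin 4) (s : Bool) (n : S2) :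
    fieldStep v ρ m α a b s n = fieldStep v ρ m α b a s n := by
  simp only [fieldStep, rest_symm a b, radiative_symm v (dust_symm v) n a b,
    radiative_symm v (lStress_symm v α) n a b]

lemma traceRev_sub (H J : Fin 4 → Fin 4 → ℝ) :
    (traceRev fun a b => H a b - J a b) = fun a b => traceRev H a b - traceRev J a b := by
  funext a b
  simp only [traceRev, smul_eq_mul, mul_sub, Finset.sum_sub_distrib]
  ring

lemma angular_sub (H J : Fin 4 → Fin 4 → ℝ) (n : S2) :
    angular (fun a b => H a b - J a b) n = angular H n - angular J n := by
  funext a b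
  refine Fin.cases ?_ (fun i => ?_) a
  · simp [angular_zero_left]
  refine Fin.cases ?_ (fun j => ?_) b
  · simp [angular_zero_right]
  simp only [Pi.sub_apply, angular_succ_succ, mul_sub, Finset.sum_sub_distrib]

lemma weylSymbol_sub (k : Fin 4 → ℝ) (H J : Fin 4 → Fin 4 → ℝ) (a b c d : Fin 4) :
    weylSymbol k (fun a b => H a b - J a b) a b c d =
      weylSymbol k H a b c d - weylSymbol k J a b c d := by
  have h1 : ∀ a b c d, riemannSymbol k (fun a b => H a b - J a b) a b c d =
      riemannSymbol k H a b c d - riemannSymbol k J a b c d := fun a b c d => by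
    simp only [riemannSymbol]
    ring
  have h2 : ∀ a c, ricciSymbol k (fun a b => H a b - J a b) a c =
      ricciSymbol k H a c - ricciSymbol k J a c := fun a c => by
    simp only [ricciSymbol, h1, mul_sub, Finset.sum_sub_distrib]
  have h3 : scalarSymbol k (fun a b => H a b - J a b) = scalarSymbol k H - scalarSymbol k J := by
    simp only [scalarSymbol, h2, mul_sub, Finset.sum_sub_distrib]
  simp only [weylSymbol, h1, h2, h3]
  ring

theorem weylSymbol_fieldStep {v : ℝ} (hv0 : 0 < v) (hv1 : v < 1) (ρ m : ℝ) {α : S2 → ℝ}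
    (hα : SmoothS2 α) (n : S2) (μ ν : Fin 4) :
    weylSymbol (gradU (n : E3)) (traceRev fun a b => fieldStep v ρ m α a b true n) 0 ν 0 μ
      - weylSymbol (gradU (n : E3)) (traceRev fun a b => fieldStep v ρ m α a b false n) 0 ν 0 μ =
      - memoryTensor v α n μ ν := by
  rw [← weylSymbol_sub, ← traceRev_sub, weylSymbol_traceRev, traceRev_sub, angular_sub,
    memoryTensor_eq hv0 hv1 hα ρ m n]
  · rfl
  · intro a b
    rw [fieldStep_symm v ρ m α a b, fieldStep_symm v ρ m α a b]
  · intro a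
    have h1 := fieldStep_null hv0 hv1 ρ m hα n a true
    have h2 := fieldStep_null hv0 hv1 ρ m hα n a false
    simp only [Fin.sum_univ_three] at *
    linear_combination h1 - h2

lemma iteratedDeriv_two_dU {ψ : ℝ × E3 → ℝ} (hψ : IsTest ψ) (u : ℝ) (y : E3) :
    iteratedDeriv 2 (fun s => ψ (s, y)) u = dU (dU ψ) (u, y) := by
  have h1 : deriv (fun s => ψ (s, y)) = fun s => dU ψ (s, y) :=
    funext fun s => (hasDerivAt_dU hψ s y).deriv
  rw [iteratedDeriv_succ, iteratedDeriv_one, h1, (hasDerivAt_dU hψ.dU u y).deriv]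

lemma continuous_memoryTensor {v : ℝ} (hv0 : 0 < v) (hv1 : v < 1) {α : S2 → ℝ}
    (hα : SmoothS2 α) (a b : Fin 4) : Continuous fun n => memoryTensor v α n a b := by
  refine Fin.cases ?_ (fun i => ?_) a
  · simp only [memoryTensor_zero_left]
    exact continuous_const
  refine Fin.cases ?_ (fun j => ?_) b
  · simp only [memoryTensor_zero_right]
    exact continuous_const
  simp only [memoryTensor, angular_succ_succ, proj]
  refine continuous_const.mul (continuous_finsetSum _ fun k _ => continuous_finsetSum _ fun l _ =>
    Continuous.mul (by fun_prop)
      (continuous_radiative hv0 hv1 ((isFreeShell_lStress v hα).continuous _ _)))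

/-- A function independent of retarded time does not contribute to a second derivative. -/
lemma stepAverage_dU {G : Bool → S2 → ℝ} (hG : ∀ s, Continuous (G s)) {ψ : ℝ × E3 → ℝ}
    (hψ : IsTest ψ) : stepAverage G (dU ψ) =
      ∫ u : ℝ, ∫ n : S2, (if 0 < u then G true n - G false n else 0) * dU ψ (u, (n : E3)) ∂area := by
  have h0 : stepAverage (fun _ => G false) (dU ψ) = 0 := by
    rw [stepAverage, integral_prod _ (integrable_step (fun _ => hG false) hψ.dU)]
    refine integral_eq_zero_of_ae (Eventually.of_forall fun n => ?_)
    have hi : ∀ {φ : ℝ × E3 → ℝ}, IsTest φ → Integrable fun u : ℝ => φ (u, (n : E3)) := fun hφ => by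
      obtain ⟨A, hA⟩ := hφ.exists_bound_fst
      refine Continuous.integrable_of_hasCompactSupport (hφ.1.continuous.comp (by fun_prop))
        (HasCompactSupport.intro (isCompact_Icc (a := -A) (b := A)) fun u hu => hA _ ?_)
      by_contra! h
      exact hu (abs_le.1 h)
    simp only [integral_const_mul, Pi.zero_apply]
    rw [integral_eq_zero_of_hasDerivAt_of_integrable (fun u => hasDerivAt_dU hψ u n) (hi hψ.dU)
      (hi hψ), mul_zero]
  have hG' : ∀ s, Continuous ((fun (s : Bool) n => G s n + -1 * G false n) s) := fun s =>
    (hG s).add (continuous_const.mul (hG false))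
  have h1 := stepAverage_add hG (H := fun _ n => -1 * G false n)
    (fun _ => continuous_const.mul (hG false)) hψ.dU
  rw [← stepAverage_smul, h0, mul_zero, add_zero] at h1
  rw [h1, stepAverage, integral_prod_symm _ (by exact integrable_step hG' hψ.dU)]
  refine integral_congr_ae (Eventually.of_forall fun u => ?_)
  refine integral_congr_ae (Eventually.of_forall fun n => ?_)
  by_cases h : 0 < u <;> simp [h, sub_eq_add_neg]

theorem hasMemoryTensor_field {v : ℝ} (hv0 : 0 < v) (hv1 : v < 1) (ρ m : ℝ) {α : S2 → ℝ}
    (hα : SmoothS2 α) : HasMemoryTensor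
      (traceRev (fun a b => ofFun (field v ρ m α a b))) (memoryTensor v α) := by
  -- The twice integrated Weyl coefficient is the step function with the memory as its jump.
  refine ⟨fun u n a b => if 0 < u then memoryTensor v α n a b else 0, fun μ ν => ⟨fun b => ?_, ?_,
    fun n => ⟨?_, ?_⟩⟩⟩
  · have hG : ∀ s, Continuous
        ((fun (s : Bool) (n : S2) => if s then memoryTensor v α n μ ν else 0) s) := fun s => by
      cases s
      · exact continuous_const
      · simpa using continuous_memoryTensor hv0 hv1 hα μ ν
    obtain ⟨C, hC⟩ := exists_bound_step hG
    have hm := (measurable_step hG).comp (measurable_swap (α := ℝ) (β := S2))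
    refine (IntegrableOn.of_bound (C := C) ?_ hm.aestronglyMeasurable
      (Eventually.of_forall fun q => hC _ _)).congr_fun (fun q _ => ?_)
      (measurableSet_Icc.prod MeasurableSet.univ)
    · rw [Measure.prod_prod]
      exact ENNReal.mul_lt_top (by simp) (measure_lt_top _ _)
    · simp
  · intro ψ χ hψ hχ h1
    have hs := HasStep.weyl (HasStep.traceRev fun a b =>
      (hasRadiativeOrder_field hv0 hv1 ρ m hα a b).hasStep
        (continuous_fieldStep hv0 hv1 ρ m hα a b)) 0 ν 0 μ
    -- A test at order `1/r` is a packet with `j = 1 - 2`.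
    have h2 := hs.2.tendsto ψ χ hψ hχ (-1) le_rfl
    rw [if_pos rfl, h1, one_mul, Function.iterate_succ_apply, Function.iterate_one,
      stepAverage_dU hs.1 hψ.dU] at h2
    refine h2.trans (le_of_eq (congrArg _ ?_))
    beta_reduce
    rw [← integral_neg]
    refine integral_congr_ae (Eventually.of_forall fun u => ?_)
    beta_reduce
    rw [← integral_neg]
    refine integral_congr_ae (Eventually.of_forall fun n => ?_)
    beta_reduce
    rw [weylSymbol_fieldStep hv0 hv1 ρ m hα, iteratedDeriv_two_dU hψ]
    split_ifs <;> simp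
  · refine tendsto_const_nhds.congr' ?_
    filter_upwards [eventually_le_atBot 0] with u hu
    rw [if_neg (not_lt.2 hu)]
  · refine tendsto_const_nhds.congr' ?_
    filter_upwards [eventually_gt_atTop 0] with u hu
    rw [if_pos hu]

end ShellMemory

end

/-! ### The theorem. -/

open ShellMemory in
theorem mainTheorem12 (v : ℝ) (hv0 : 0 < v) (hv1 : v < 1) (α : S2 → ℝ) (hα : SmoothS2 α) :
    -- the stress term is of magnetic parity and conserved by itself
    IsVectorType (lStress v α) ∧
    Conserved (shell v (lStress v α)) ∧
    -- the dominant energy condition holds for large density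
    (∃ ρ₀ : ℝ, 0 < ρ₀ ∧ ∀ ρ : ℝ, ρ₀ ≤ ρ → ∀ m : ℝ, 0 ≤ m → DominantEnergy (source v ρ m α)) ∧
    -- the contribution of the stress term to the radiative order is of magnetic parity
    IsVectorType (radiative v (lStress v α)) ∧
    ∀ ρ : ℝ, 0 < ρ → ∀ m : ℝ, 0 ≤ m →
      -- conservation, and no flux of stress-energy to null infinity
      Conserved (source v ρ m α) ∧
      (∀ a b, LeadingAtScri 2 (source v ρ m α a b) (fun _ => 0)) ∧
      ∃ hb : Fin 4 → Fin 4 → Spacetime → ℝ,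
        -- the retarded solution
        IsRetardedSolution (source v ρ m α) hb ∧
        (∀ a b, ContinuousOn (hb a b)
          {p | space p ≠ 0 ∧ p 0 ≠ ‖space p‖ ∧ ‖space p‖ ≠ v * p 0}) ∧
        -- it satisfies the Lorenz gauge condition and the linearized Einstein equation
        (∀ a φ, IsTest φ → divT (fun a b => ofFun (hb a b)) a φ = 0) ∧
        (∀ a b φ, IsTest φ → einsteinOp (fun a b => ofFun (hb a b)) a b φ =
          -16 * Real.pi * source v ρ m α a b φ) ∧
        -- its radiative order at early and at late retarded times
        (∀ u : ℝ, u < 0 → ∀ (n : S2) (a b : Fin 4),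
          Tendsto (fun r : ℝ => r * hb a b (event (u + r) (r • (n : E3)))) atTop
            (𝓝 (4 * (m + shellEnergy v ρ) * rest a b))) ∧
        (∀ u : ℝ, 0 < u → ∀ (n : S2) (a b : Fin 4),
          Tendsto (fun r : ℝ => r * hb a b (event (u + r) (r • (n : E3)))) atTop
            (𝓝 (4 * m * rest a b + ρ * radiative v (dust v) n a b
              + radiative v (lStress v α) n a b))) ∧
        -- its memory tensor
        ∃ Δ : S2 → Fin 4 → Fin 4 → ℝ,
          HasMemoryTensor (traceRev (fun a b => ofFun (hb a b))) Δ ∧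
          (∀ n, Δ n = (1 / 2 : ℝ) •
            (angular (traceRev (fun a b => 4 * m * rest a b + ρ * radiative v (dust v) n a b
                + radiative v (lStress v α) n a b)) n
              - angular (traceRev (fun a b => 4 * (m + shellEnergy v ρ) * rest a b)) n)) ∧
          IsVectorType Δ ∧
          (¬ OnlyLowMultipoles α → ∃ n a b, Δ n a b ≠ 0) := by
  refine ⟨isVectorType_lStress v hα, conserved_shell_lStress hv0 hα, dominantEnergy_source hv0 hv1 hα,
    isVectorType_radiative_lStress hv0 hv1 hα, fun ρ _ m _ => ⟨conserved_source hv0 hα ρ m,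
    leadingAtScri_source hv0 hv1 ρ m α, field v ρ m α,
    isRetardedSolution_field hv0.le hv1 ρ m hα, continuousOn_field hv0.le hv1 ρ m hα,
    fun a _ hφ => divT_field hv0 hv1 ρ m hα a hφ,
    fun a b _ hφ => einsteinOp_field hv0 hv1 ρ m hα a b hφ,
    fun _ hu n a b => tendsto_field_early hu n a b,
    fun _ hu n a b => tendsto_field_late hv0 hv1 ρ m hα hu n a b,
    memoryTensor v α, hasMemoryTensor_field hv0 hv1 ρ m hα,
    memoryTensor_eq hv0 hv1 hα ρ m, isVectorType_memoryTensor hv0 hv1 hα, fun h => ?_⟩⟩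
  -- Vanishing memory forces `memoryPotential`, and then `α`, to have only `ℓ ≤ 1`.
  contrapose! h
  exact onlyLowMultipoles_of_memoryPotential hv0 hv1 hα (onlyLowMultipoles_memoryPotential hv0 hv1 hα h)
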